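/- **Conventions.** All objects are smooth. A *quaternionic vector bundle* of rank $4k$ is a real vector bundle $E\to M$ with a reduction of its frame bundle to ${\rm Sp}(1)\cdot{\rm GL}(k,\mathbb{H})$, acting on $\mathbb{H}^k$ by $q\mapsto aqA^{-1}$. Its *admissible linear complex structures* are the endomorphisms of the fibres which, in an admissible frame, are multiplication by an imaginary quaternion of length one; they form a sphere bundle $\pi:Z\to M$, whose fibres carry the complex structure $A\mapsto J\circ A$ on $T_J(Z_x)\subseteq{\rm End}(E_x)$. An *almost co-CR quaternionic structure* on $M$ is a pair $(E,\rho)$ with $E$ a quaternionic vector bundle over $M$ and $\rho:E\to TM$ a surjective morphism of vector bundles whose kernel contains no nonzero subspace preserved by some admissible linear complex structure. Let $\nabla$ be a connection on $E$ compatible with the structural group. It is *torsion free* if $\rho(\nabla_{\rho s_1}s_2-\nabla_{\rho s_2}s_1)=[\rho s_1,\rho s_2]$ for any local sections $s_1,s_2$ of $E$, and it *satisfies the first Bianchi identity* if it is torsion free and its curvature form $R$ satisfies $$R(\rho e_1,\rho e_2)e_3+R(\rho e_2,\rho e_3)e_1+R(\rho e_3,\rho e_1)e_2=0$$ for any $e_1,e_2,e_3$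 in the same fibre of $E$. Let $\mathcal{C}=(\ker d\pi)^{0,1}\oplus\mathcal{B}$ be the complex distribution on $Z$ in which $\mathcal{B}_J$ is the horizontal lift, with respect to $\nabla$, of $\rho(\ker(J+{\rm i}))$, where $\ker(J+{\rm i})\subseteq E\otimes\mathbb{C}$. A smooth map $\varphi$ between manifolds endowed with such data $(E_j,\rho_j,\nabla_j)$, $j=1,2$, is *twistorial* if it is covered by a smooth map $\Phi:Z_1\to Z_2$ with $d\Phi(\mathcal{C}_1)\subseteq\mathcal{C}_2$. A *quaternionic structure* on a manifold $N$, $\dim N=4k\geq8$, is a quaternionic vector bundle structure on $TN$ for which there is a torsion free compatible connection $D$ on $TN$ such that the corresponding $\mathcal{C}$ (for $E=TN$, $\rho={\rm Id}$, $\nabla=D$) is integrable, that is, its sections are closed under the bracket. **Proposition.** Let $(M,E,\rho)$ be an almost co-CR quaternionic manifold with ${\rm rank}\,E>4$, and let $\nabla$ be a compatible connection on $E$ which satisfies the first Bianchi identity. Then each point of $M$ has an open neighbourhood $U$ such that the total space of $\ker\rho|_U$ (an embedded submanifold of the total space of $E$) carries a quaternionic structure, with a connection $D$ as above, such that the projection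 $\ker\rho|_U\to M$ is a twistorial map, with respect to $(T(\ker\rho|_U),{\rm Id},D)$ and $(E,\rho,\nabla)$. -/

import Mathlib

open Bundle Set
open scoped Manifold ContDiff Quaternion Matrix

noncomputable section

namespace CoCR

/-! ### The quaternionic linear group -/

/-- The standard quaternionic vector space `ℍ^k` (row vectors). -/
abbrev HVec (k : ℕ) : Type := Fin k → ℍ[ℝ]

/-- The group `Sp(1)·GL(k,ℍ)`, that is, the real linear automorphisms of `ℍ^k` of the form
`q ↦ a q A⁻¹`, with `a` a unit quaternion and `A ∈ GL(k,ℍ)`. -/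
def quaternionicGroup (k : ℕ) : Set (HVec k ≃L[ℝ] HVec k) :=
  {g | ∃ (a : ℍ[ℝ]) (A : (Matrix (Fin k) (Fin k) ℍ[ℝ])ˣ), ‖a‖ = 1 ∧
    ∀ q : HVec k, g q = a • (q ᵥ* (↑A⁻¹ : Matrix (Fin k) (Fin k) ℍ[ℝ]))}

section Bundles

/- `M` is a manifold with local model the finite-dimensional space `B`, and `E` is a vector bundle
over `M` with typical fibre `F`. -/
variable {B : Type*} [NormedAddCommGroup B] [NormedSpace ℝ B]
  {M : Type*} [TopologicalSpace M] [ChartedSpace B M]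
  {F : Type*} [NormedAddCommGroup F] [NormedSpace ℝ F]
  {E : M → Type*} [TopologicalSpace (TotalSpace F E)]
  [∀ x, AddCommGroup (E x)] [∀ x, Module ℝ (E x)] [∀ x, TopologicalSpace (E x)]
  [∀ x, IsTopologicalAddGroup (E x)] [∀ x, ContinuousSMul ℝ (E x)]
  [FiberBundle F E] [VectorBundle ℝ F E]

variable (B F) in
/-- The local section `s` of `E` is smooth on the set `U`. -/
def IsSmoothSectionOn (s : ∀ x : M, E x) (U : Set M) : Prop :=
  ContMDiffOn 𝓘(ℝ, B) (𝓘(ℝ, B).prod 𝓘(ℝ, F)) ∞ (fun x => (⟨x, s x⟩ : TotalSpace F E)) U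

variable (B F E) in
/-- A quaternionic vector bundle structure on `E`, of rank `4k`: a reduction of the frame bundle
of `E` to the group `Sp(1)·GL(k,ℍ)`. -/
structure QuaternionicStructure (k : ℕ) where
  /-- the admissible frames at `x` -/
  frames : ∀ x : M, Set (HVec k ≃L[ℝ] E x)
  /-- the group acts simply transitively on the admissible frames at `x` -/
  mem_frames_iff : ∀ x, ∀ u ∈ frames x, ∀ v : HVec k ≃L[ℝ] E x,
    v ∈ frames x ↔ ∃ g ∈ quaternionicGroup k, v = g.trans u
  /-- there are smooth admissible frames near every point -/
  exists_local : ∀ x₀ : M, ∃ U : Set M, IsOpen U ∧ x₀ ∈ U ∧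
    ∃ u : ∀ x : M, HVec k ≃L[ℝ] E x,
      (∀ q, IsSmoothSectionOn B F (fun x => u x q) U) ∧ ∀ x ∈ U, u x ∈ frames x

namespace QuaternionicStructure

variable {k : ℕ} (Q : QuaternionicStructure B F E k)

/-- The admissible linear complex structures on the fibre `E x`: those which, in an admissible
frame, are the multiplication by an imaginary quaternion of length one. -/
def admissible (x : M) : Set (E x →L[ℝ] E x) :=
  {J | ∃ u ∈ Q.frames x, ∃ i : ℍ[ℝ], i.re = 0 ∧ ‖i‖ = 1 ∧ ∀ q : HVec k, J (u q) = u (i • q)}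

/-- The total space of the bundle `Z` of admissible linear complex structures on `E`, as a subset
(an embedded submanifold) of the total space of the vector bundle `End E`. -/
def twistorBundle : Set (TotalSpace (F →L[ℝ] F) (fun x : M => E x →L[ℝ] E x)) :=
  {w | w.2 ∈ Q.admissible w.1}

/-- The tangent space at `J` to the fibre `Z x`, as a subspace of `End (E x)`. It consists of the
elements of the rank three space spanned by `Z x` which anticommute with `J` (that is, which are
orthogonal to `J`). -/
def verticalTangent (x : M) (J : E x →L[ℝ] E x) : Set (E x →L[ℝ] E x) :=
  {A | A ∈ Submodule.span ℝ (Q.admissible x) ∧ A ∘L J = -(J ∘L A)}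

/-- The element `A₁ + i A₂` of the complexification of the tangent space at `J` to the fibre `Z x`
is of type `(0,1)`, with respect to the complex structure `A ↦ J ∘ A`; that is,
`J ∘ (A₁ + i A₂) = -i (A₁ + i A₂)`. -/
def IsVertical01 (x : M) (J A₁ A₂ : E x →L[ℝ] E x) : Prop :=
  A₁ ∈ Q.verticalTangent x J ∧ A₂ ∈ Q.verticalTangent x J ∧ J ∘L A₁ = A₂ ∧ J ∘L A₂ = -A₁

/-- `(E, ρ)` is an almost co-CR quaternionic structure: `ρ : E → TM` is a smooth surjective
morphism of vector bundles whose kernel contains no nonzero subspace preserved by some admissible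
linear complex structure. -/
structure IsAlmostCoCR (ρ : ∀ x : M, E x →L[ℝ] TangentSpace 𝓘(ℝ, B) x) [IsManifold 𝓘(ℝ, B) 1 M] :
    Prop where
  smooth : ContMDiff (𝓘(ℝ, B).prod 𝓘(ℝ, F)) (𝓘(ℝ, B).prod 𝓘(ℝ, B)) ∞
    (fun p : TotalSpace F E => (⟨p.1, ρ p.1 p.2⟩ : TangentBundle 𝓘(ℝ, B) M))
  surjective : ∀ x, Function.Surjective (ρ x)
  ker_inter : ∀ x, ∀ J ∈ Q.admissible x, ∀ W : Submodule ℝ (E x),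
    (∀ v ∈ W, ρ x v = 0) → (∀ v ∈ W, J v ∈ W) → W = ⊥

/-- The connection `∇` on `E` is compatible with the structural group: in any local admissible
frame its connection form takes values in the Lie algebra of `Sp(1)·GL(k,ℍ)`, that is, in the
space of the maps `q ↦ a q + q C`, with `a` an imaginary quaternion and `C` a `k×k` quaternionic
matrix. -/
def IsCompatible (nabla : CovariantDerivative 𝓘(ℝ, B) F E) : Prop :=
  ∀ U : Set M, IsOpen U → ∀ u : ∀ x : M, HVec k ≃L[ℝ] E x,
    (∀ q, IsSmoothSectionOn B F (fun x => u x q) U) → (∀ x ∈ U, u x ∈ Q.frames x) →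
    ∀ x ∈ U, ∀ X : TangentSpace 𝓘(ℝ, B) x,
      ∃ (a : ℍ[ℝ]) (C : Matrix (Fin k) (Fin k) ℍ[ℝ]), a.re = 0 ∧
        ∀ q : HVec k, nabla (fun y => u y q) x X = u x (a • q + q ᵥ* C)

end QuaternionicStructure

/-! ### Torsion and curvature -/

/-- The connection `∇` on `E` is torsion free with respect to `ρ`: for any local sections `s₁, s₂`
of `E`, we have `ρ (∇_{ρ s₁} s₂ - ∇_{ρ s₂} s₁) - [ρ s₁, ρ s₂] = 0`. -/
def IsTorsionFree (ρ : ∀ x : M, E x →L[ℝ] TangentSpace 𝓘(ℝ, B) x)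
    (nabla : CovariantDerivative 𝓘(ℝ, B) F E) : Prop :=
  ∀ U : Set M, IsOpen U → ∀ s₁ s₂ : (∀ x : M, E x),
    IsSmoothSectionOn B F s₁ U → IsSmoothSectionOn B F s₂ U → ∀ x ∈ U,
      ρ x (nabla s₂ x (ρ x (s₁ x)) - nabla s₁ x (ρ x (s₂ x)))
        - VectorField.mlieBracket 𝓘(ℝ, B) (fun y => ρ y (s₁ y)) (fun y => ρ y (s₂ y)) x = 0

/-- The curvature `R(X,Y)s = ∇_X ∇_Y s - ∇_Y ∇_X s - ∇_{[X,Y]} s`. -/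
def curvature (nabla : CovariantDerivative 𝓘(ℝ, B) F E)
    (X Y : ∀ x : M, TangentSpace 𝓘(ℝ, B) x) (s : ∀ x : M, E x) (x : M) : E x :=
  nabla (fun y => nabla s y (Y y)) x (X x) - nabla (fun y => nabla s y (X y)) x (Y x)
    - nabla s x (VectorField.mlieBracket 𝓘(ℝ, B) X Y x)

/-- The connection `∇` satisfies the first Bianchi identity (with respect to `ρ`): it is torsion
free and `R(ρ e₁, ρ e₂) e₃ + R(ρ e₂, ρ e₃) e₁ + R(ρ e₃, ρ e₁) e₂ = 0`, for any `e₁, e₂, e₃` in the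
same fibre of `E`. (Each `eᵢ` is the value at a point of a smooth local section `sᵢ`.) -/
structure SatisfiesFirstBianchi (ρ : ∀ x : M, E x →L[ℝ] TangentSpace 𝓘(ℝ, B) x)
    (nabla : CovariantDerivative 𝓘(ℝ, B) F E) : Prop where
  torsionFree : IsTorsionFree ρ nabla
  bianchi : ∀ U : Set M, IsOpen U → ∀ s₁ s₂ s₃ : (∀ x : M, E x),
    IsSmoothSectionOn B F s₁ U → IsSmoothSectionOn B F s₂ U → IsSmoothSectionOn B F s₃ U →
    ∀ x ∈ U,
      curvature nabla (fun y => ρ y (s₁ y)) (fun y => ρ y (s₂ y)) s₃ x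
        + curvature nabla (fun y => ρ y (s₂ y)) (fun y => ρ y (s₃ y)) s₁ x
        + curvature nabla (fun y => ρ y (s₃ y)) (fun y => ρ y (s₁ y)) s₂ x = 0

/-! ### The complex distribution on the bundle of admissible linear complex structures -/

variable (B F E) in
/-- The model with corners of the manifold `End E`. -/
abbrev endModel : ModelWithCorners ℝ (B × (F →L[ℝ] F)) (ModelProd B (F →L[ℝ] F)) :=
  𝓘(ℝ, B).prod 𝓘(ℝ, F →L[ℝ] F)

variable (F E) in
/-- The total space of the vector bundle `End E`. -/
abbrev EndTotal : Type _ := TotalSpace (F →L[ℝ] F) (fun x : M => E x →L[ℝ] E x)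

/-- The differential at `w` of the projection `End E → M`. -/
def dproj (w : EndTotal F E) (ξ : TangentSpace (endModel B F) w) : TangentSpace 𝓘(ℝ, B) w.proj :=
  mfderiv (endModel B F) 𝓘(ℝ, B) (fun w' : EndTotal F E => w'.proj) w ξ

/-- The section `y ↦ σ_f(y)` of `E` which is constant, equal to `f`, in the preferred
trivialization of `E` around `x₀` (it is smooth near `x₀`). -/
def constSection (x₀ : M) (f : F) (y : M) : E y :=
  (trivializationAt F E x₀).symmL ℝ y f

/-- The differential at `w` of the map which associates to an element of `End E` its matrix with
respect to the preferred trivialization of `E` around the base point of `w`. -/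
def dmatrix (w : EndTotal F E) (ξ : TangentSpace (endModel B F) w) : F →L[ℝ] F :=
  mfderiv (endModel B F) 𝓘(ℝ, F →L[ℝ] F)
    (fun w' : EndTotal F E =>
      ContinuousLinearMap.inCoordinates F E F E w.proj w'.proj w.proj w'.proj w'.2) w ξ

/-- The connection map `K : T(End E) → End E` of the connection induced by `∇` on `End E`:
if `w = (x, J)`, `ξ ∈ T_w(End E)` and `v ∈ E x` then `connectionMap ∇ w ξ v = (K ξ) v`.
Thus, if `ξ` is the velocity of a curve `(x(t), J(t))` then `K ξ` is the covariant derivative of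
`J(t)` along the curve; in a trivialization it is given by `dJ(ξ) + [Γ(X), J]`, where `X` is the
projection of `ξ` and `Γ` is the local connection form. The vector `ξ` is horizontal if and only if
`K ξ = 0`, whilst on vertical vectors `K` is the canonical identification of the tangent space to
the fibre with `End (E x)`. -/
def connectionMap (nabla : CovariantDerivative 𝓘(ℝ, B) F E) (w : EndTotal F E)
    (ξ : TangentSpace (endModel B F) w) (v : E w.proj) : E w.proj :=
  constSection w.proj
      (dmatrix w ξ ((trivializationAt F E w.proj).continuousLinearMapAt ℝ w.proj v)) w.proj
    + nabla (constSection w.proj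
        ((trivializationAt F E w.proj).continuousLinearMapAt ℝ w.proj (w.2 v))) w.proj (dproj w ξ)
    - w.2 (nabla (constSection w.proj
        ((trivializationAt F E w.proj).continuousLinearMapAt ℝ w.proj v)) w.proj (dproj w ξ))

namespace QuaternionicStructure

variable {k : ℕ} (Q : QuaternionicStructure B F E k)

/-- The complex distribution `𝒞 = (ker dπ)^{0,1} ⊕ 𝓑` on `Z`, where `𝓑_J` is the horizontal lift
of `ρ(ker(J + i))`. Here `(ξ, η)` stands for the complex tangent vector `ξ + i η` at `w = (x, J)`.
The vertical part of `ξ + i η` has to be of type `(0,1)`, and its projection to `T_xM ⊗ ℂ` has to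
be equal to `ρ(e₁ + i e₂)` for some `e₁ + i e₂ ∈ E_x ⊗ ℂ` with `J(e₁ + i e₂) = -i(e₁ + i e₂)`.
(For a compatible `∇`, such `ξ` and `η` are tangent to `Z`.) -/
def distribution (ρ : ∀ x : M, E x →L[ℝ] TangentSpace 𝓘(ℝ, B) x)
    (nabla : CovariantDerivative 𝓘(ℝ, B) F E) (w : EndTotal F E)
    (ξ η : TangentSpace (endModel B F) w) : Prop :=
  (∃ A₁ A₂ : E w.proj →L[ℝ] E w.proj, Q.IsVertical01 w.proj w.2 A₁ A₂ ∧
    (∀ v, connectionMap nabla w ξ v = A₁ v) ∧ ∀ v, connectionMap nabla w η v = A₂ v) ∧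
  ∃ e₁ e₂ : E w.proj, w.2 e₁ = e₂ ∧ w.2 e₂ = -e₁ ∧
    dproj w ξ = ρ w.proj e₁ ∧ dproj w η = ρ w.proj e₂

/-- The complex distribution `𝒞` on `Z` is integrable: its (local) sections are closed under the
bracket `[X₁ + i X₂, Y₁ + i Y₂] = ([X₁,Y₁] - [X₂,Y₂]) + i ([X₁,Y₂] + [X₂,Y₁])`. Local sections over
`Z` are written as the restrictions to `Z` of smooth local vector fields on `End E`; as the fields
are tangent to `Z`, the bracket along `Z` does not depend on the extensions. -/
def IsIntegrable [IsManifold 𝓘(ℝ, B) 1 M] [ContMDiffVectorBundle 1 F E 𝓘(ℝ, B)]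
    (ρ : ∀ x : M, E x →L[ℝ] TangentSpace 𝓘(ℝ, B) x)
    (nabla : CovariantDerivative 𝓘(ℝ, B) F E) : Prop :=
  ∀ O : Set (EndTotal F E), IsOpen O →
    ∀ X₁ X₂ Y₁ Y₂ : (∀ w : EndTotal F E, TangentSpace (endModel B F) w),
      (∀ V ∈ ({X₁, X₂, Y₁, Y₂} : Set (∀ w : EndTotal F E, TangentSpace (endModel B F) w)),
        ContMDiffOn (endModel B F) (endModel B F).tangent ∞
          (fun w => (⟨w, V w⟩ : TangentBundle (endModel B F) (EndTotal F E))) O) →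
      (∀ w ∈ O ∩ Q.twistorBundle, Q.distribution ρ nabla w (X₁ w) (X₂ w)) →
      (∀ w ∈ O ∩ Q.twistorBundle, Q.distribution ρ nabla w (Y₁ w) (Y₂ w)) →
      ∀ w ∈ O ∩ Q.twistorBundle, Q.distribution ρ nabla w
        (VectorField.mlieBracket (endModel B F) X₁ Y₁ w
          - VectorField.mlieBracket (endModel B F) X₂ Y₂ w)
        (VectorField.mlieBracket (endModel B F) X₁ Y₂ w
          + VectorField.mlieBracket (endModel B F) X₂ Y₁ w)

end QuaternionicStructure

/-- The total space of the restriction to `U` of `ker ρ`, as a subset of the total space of `E`. -/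
def kerOver (ρ : ∀ x : M, E x →L[ℝ] TangentSpace 𝓘(ℝ, B) x) (U : Set M) :
    Set (TotalSpace F E) :=
  {p | p.proj ∈ U ∧ ρ p.proj p.2 = 0}

end Bundles

/-! ### Twistorial maps -/

section Twistorial

variable {B₁ : Type*} [NormedAddCommGroup B₁] [NormedSpace ℝ B₁]
  {M₁ : Type*} [TopologicalSpace M₁] [ChartedSpace B₁ M₁]
  {F₁ : Type*} [NormedAddCommGroup F₁] [NormedSpace ℝ F₁]
  {E₁ : M₁ → Type*} [TopologicalSpace (TotalSpace F₁ E₁)]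
  [∀ x, AddCommGroup (E₁ x)] [∀ x, Module ℝ (E₁ x)] [∀ x, TopologicalSpace (E₁ x)]
  [∀ x, IsTopologicalAddGroup (E₁ x)] [∀ x, ContinuousSMul ℝ (E₁ x)]
  [FiberBundle F₁ E₁] [VectorBundle ℝ F₁ E₁]
  {B₂ : Type*} [NormedAddCommGroup B₂] [NormedSpace ℝ B₂]
  {M₂ : Type*} [TopologicalSpace M₂] [ChartedSpace B₂ M₂]
  {F₂ : Type*} [NormedAddCommGroup F₂] [NormedSpace ℝ F₂]
  {E₂ : M₂ → Type*} [TopologicalSpace (TotalSpace F₂ E₂)]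
  [∀ x, AddCommGroup (E₂ x)] [∀ x, Module ℝ (E₂ x)] [∀ x, TopologicalSpace (E₂ x)]
  [∀ x, IsTopologicalAddGroup (E₂ x)] [∀ x, ContinuousSMul ℝ (E₂ x)]
  [FiberBundle F₂ E₂] [VectorBundle ℝ F₂ E₂]

/-- The map `φ : M₁ → M₂` is twistorial, with respect to the almost co-CR quaternionic structures
`(E₁, ρ₁, ∇₁)` and `(E₂, ρ₂, ∇₂)`: it is smooth and there exists a smooth map `Φ : Z₁ → Z₂`
covering `φ` such that `dΦ(𝒞₁) ⊆ 𝒞₂`. (The smooth map `Φ` is given through a map `End E₁ → End E₂`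
smooth at the points of the submanifold `Z₁`; as `𝒞₁` is tangent to `Z₁`, only the restriction of
this map to `Z₁` matters.) -/
def IsTwistorial {k₁ k₂ : ℕ}
    (Q₁ : QuaternionicStructure B₁ F₁ E₁ k₁)
    (ρ₁ : ∀ x : M₁, E₁ x →L[ℝ] TangentSpace 𝓘(ℝ, B₁) x)
    (nabla₁ : CovariantDerivative 𝓘(ℝ, B₁) F₁ E₁)
    (Q₂ : QuaternionicStructure B₂ F₂ E₂ k₂)
    (ρ₂ : ∀ x : M₂, E₂ x →L[ℝ] TangentSpace 𝓘(ℝ, B₂) x)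
    (nabla₂ : CovariantDerivative 𝓘(ℝ, B₂) F₂ E₂) (φ : M₁ → M₂) : Prop :=
  ContMDiff 𝓘(ℝ, B₁) 𝓘(ℝ, B₂) ∞ φ ∧
  ∃ Φ : EndTotal F₁ E₁ → EndTotal F₂ E₂,
    (∀ w ∈ Q₁.twistorBundle, ContMDiffAt (endModel B₁ F₁) (endModel B₂ F₂) ∞ Φ w) ∧
    (∀ w ∈ Q₁.twistorBundle, Φ w ∈ Q₂.twistorBundle ∧ (Φ w).proj = φ w.proj) ∧
    ∀ w ∈ Q₁.twistorBundle, ∀ ξ η : TangentSpace (endModel B₁ F₁) w,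
      Q₁.distribution ρ₁ nabla₁ w ξ η →
      Q₂.distribution ρ₂ nabla₂ (Φ w)
        (mfderiv (endModel B₁ F₁) (endModel B₂ F₂) Φ w ξ)
        (mfderiv (endModel B₁ F₁) (endModel B₂ F₂) Φ w η)

end Twistorial

/-! ### Quaternionic manifolds -/

section Manifolds

variable {B : Type*} [NormedAddCommGroup B] [NormedSpace ℝ B]
  {N : Type*} [TopologicalSpace N] [ChartedSpace B N] [IsManifold 𝓘(ℝ, B) ∞ N]

variable (B N) in
/-- The identity of the tangent bundle. -/
abbrev idTangent (x : N) : TangentSpace 𝓘(ℝ, B) x →L[ℝ] TangentSpace 𝓘(ℝ, B) x :=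
  ContinuousLinearMap.id ℝ (TangentSpace 𝓘(ℝ, B) x)

variable (B N) in
/-- An almost quaternionic structure on `N`, where `dim N = 4k`. -/
abbrev AlmostQuaternionicStructure (k : ℕ) : Type _ :=
  QuaternionicStructure B B (fun x : N => TangentSpace 𝓘(ℝ, B) x) k

/-- The almost quaternionic structure `Q` on `N` is quaternionic, as shown by the compatible
connection `D`: the smooth connection `D` is compatible with `Q`, is torsion free, and the induced
complex distribution on the bundle of admissible linear complex structures is integrable. -/
structure IsQuaternionic {k : ℕ} (Q : AlmostQuaternionicStructure B N k)
    (D : CovariantDerivative 𝓘(ℝ, B) B (fun x : N => TangentSpace 𝓘(ℝ, B) x)) : Prop where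
  smooth : CovariantDerivative.ContMDiffCovariantDerivative D ∞
  compatible : Q.IsCompatible D
  torsionFree : IsTorsionFree (idTangent B N) D
  integrable : Q.IsIntegrable (idTangent B N) D

end Manifolds

end CoCR

end

/-! The aim is an isomorphism between the tangent bundle of `N = ker ρ|_U` and the pull-back of `E`
by the projection `ϖ : N → M`, under which `dϖ` becomes `ρ` and the pulled-back connection becomes
torsion free. The frames and the connection of `E` then give the quaternionic structure on `N`, and
the projection is twistorial almost by construction.

Two consequences of the hypotheses make such an isomorphism possible. As `ρ` is onto, torsion
freeness shows that `ker ρ` is parallel (`IsLocalBianchi.map_conn_of_mem_ker`), and the Bianchi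
identity with its third vector in `ker ρ` shows that `ker ρ` is flat
(`IsLocalBianchi.curvature_of_mem_ker`). Hence radial parallel transport gives parallel frames of
`ker ρ` (`IsLocalBianchi.transport_parallel`). Further, let `α : TM → E` be a local section of `ρ`,
seen as an `E`-valued one-form. Torsion freeness says that the exterior covariant derivative `d^∇ α`
takes values in `ker ρ` (`IsLocalBianchi.map_extCovDeriv`), and the Bianchi identity on the image of
`α` says that `d^∇ d^∇ α = 0` (`IsLocalBianchi.extCovDeriv_extCovDeriv`). So `d^∇ α` is a closed
two-form with values in a flat bundle, and the Poincaré lemma (`exists_primitive`) allows `α` to be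
corrected to a closed section.

Together, the corrected `α` and the parallel frame of `ker ρ` form a field `g` of isomorphisms of
the typical fibre `F`, such that `ρ ∘ g` is a constant map `τ : F → B` and `g` is closed
(`IsLocalBianchi.exists_closed_frame`). In adapted coordinates `N` is the open subset `τ ⁻¹' O` of
`F`, and `g` identifies `TN = N × F` with the pull-back of `E`. Closedness of `g` is exactly the
symmetry of the Christoffel form of the pulled-back connection, while compatibility is inherited
(`isQuaternionicFrame_inducedConn`).

For a torsion free compatible connection the one obstruction to integrability of the distribution is
a curvature term. It defines an alternating form with values in the imaginary quaternions which
satisfies a cyclic identity, and such a form is zero for `k ≥ 2` (`imaginary_form_eq_zero`,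
`curvature_type`, `IsQuaternionicFrame.frameDistribution_lieBracket`). Finally, conjugation by the
isomorphism maps one twistor bundle to the other and intertwines the projections and the connection
maps (`dproj_kernelEndMap`, `connectionMap_kernelEndMap`). -/

noncomputable section

set_option linter.unusedSectionVars false

namespace CoCR

/-! ### Smooth families of continuous curves -/

section Families

open Topology Filter

variable {B G : Type*} [NormedAddCommGroup B] [NormedSpace ℝ B] [FiniteDimensional ℝ B]
  [NormedAddCommGroup G] [NormedSpace ℝ G]

/-- The family of curves `t ↦ f (x, t)`, `t ∈ [0, 1]`, parametrized by `x`. -/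
def curveFamily (f : B × ℝ → G) (hf : Continuous f) (x : B) : C(unitInterval, G) :=
  ⟨fun t => f (x, t), by fun_prop⟩

@[simp]
lemma curveFamily_apply (f : B × ℝ → G) (hf : Continuous f) (x : B) (t : unitInterval) :
    curveFamily f hf x t = f (x, t) := rfl

/-- The derivative of a family of curves with respect to the parameter. -/
def curveFamilyDeriv (f : B × ℝ → G) (hf : Continuous (fderiv ℝ f)) (x : B) :
    B →L[ℝ] C(unitInterval, G) :=
  LinearMap.toContinuousLinearMap
    { toFun := fun h => ⟨fun t => fderiv ℝ f (x, t) (h, 0), by fun_prop⟩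
      map_add' := fun a b => by
        ext t
        exact map_add ((fderiv ℝ f (x, t)).comp (ContinuousLinearMap.inl ℝ B ℝ)) a b
      map_smul' := fun c a => by
        ext t
        exact map_smul ((fderiv ℝ f (x, t)).comp (ContinuousLinearMap.inl ℝ B ℝ)) c a }

@[simp]
lemma curveFamilyDeriv_apply (f : B × ℝ → G) (hf : Continuous (fderiv ℝ f)) (x h : B)
    (t : unitInterval) : curveFamilyDeriv f hf x h t = fderiv ℝ f (x, t) (h, 0) := rfl

/-- As `[0, 1]` is compact, the curried map into the sup-normed space of curves is continuous; this
is where uniformity in `t` comes from. -/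
lemma exists_ball_norm_sub_lt (f : B × unitInterval → G) (hf : Continuous f) (x : B) {ε : ℝ}
    (hε : 0 < ε) : ∃ δ > 0, ∀ y ∈ Metric.ball x δ, ∀ t, ‖f (y, t) - f (x, t)‖ < ε := by
  let D : C(B, C(unitInterval, G)) := ContinuousMap.curry ⟨f, hf⟩
  have hD : ∀ᶠ y in 𝓝 x, ‖D y - D x‖ < ε := by
    have : Tendsto (fun y => ‖D y - D x‖) (𝓝 x) (𝓝 0) := by
      have h : Continuous fun y => ‖D y - D x‖ := by fun_prop
      simpa using h.tendsto x
    exact this.eventually (gt_mem_nhds hε)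
  obtain ⟨δ, hδ, hball⟩ := Metric.eventually_nhds_iff_ball.1 hD
  exact ⟨δ, hδ, fun y hy t => ((D y - D x).norm_coe_le_norm t).trans_lt (hball y hy)⟩

/-- For each `t`, the mean value inequality on a ball where the partial derivative varies by less
than `ε` bounds the remainder; the radius does not depend on `t`, so the bound holds in the sup
norm. -/
lemma hasFDerivAt_curveFamily (f : B × ℝ → G) (hf : ContDiff ℝ 1 f) (x : B) :
    HasFDerivAt (curveFamily f hf.continuous)
      (curveFamilyDeriv f (hf.continuous_fderiv one_ne_zero) x) x := by
  have hc := hf.continuous_fderiv one_ne_zero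
  refine HasFDerivAt.of_isLittleO (Asymptotics.isLittleO_iff.2 fun ε hε => ?_)
  obtain ⟨δ, hδ, hball⟩ := exists_ball_norm_sub_lt
    (fun p : B × unitInterval => fderiv ℝ f (p.1, (p.2 : ℝ))) (by fun_prop) x hε
  filter_upwards [Metric.ball_mem_nhds x hδ] with y hy
  refine (ContinuousMap.norm_le _ (by positivity)).2 fun t => ?_
  have key := Convex.norm_image_sub_le_of_norm_hasFDerivWithin_le' (𝕜 := ℝ)
    (f := fun z => f (z, (t : ℝ)))
    (f' := fun z => (fderiv ℝ f (z, (t : ℝ))).comp (ContinuousLinearMap.inl ℝ B ℝ))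
    (φ := (fderiv ℝ f (x, (t : ℝ))).comp (ContinuousLinearMap.inl ℝ B ℝ)) (C := ε)
    (s := Metric.ball x δ) (x := x) (y := y) ?_ ?_ (convex_ball x δ) (Metric.mem_ball_self hδ) hy
  · have h : curveFamilyDeriv f hc x (y - x) t
        = (fderiv ℝ f (x, (t : ℝ))).comp (ContinuousLinearMap.inl ℝ B ℝ) (y - x) := rfl
    simpa only [ContinuousMap.sub_apply, curveFamily_apply, h] using key
  · intro z hz
    have h1 : HasFDerivAt (fun z : B => (z, (t : ℝ))) (ContinuousLinearMap.inl ℝ B ℝ) z :=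
      hasFDerivAt_prodMk_left z (t : ℝ)
    exact (((hf.differentiable one_ne_zero) (z, (t : ℝ))).hasFDerivAt.comp z h1).hasFDerivWithinAt
  · intro z hz
    rw [← ContinuousLinearMap.sub_comp]
    refine (ContinuousLinearMap.opNorm_comp_le _ _).trans ?_
    have h1 : ‖fderiv ℝ f (z, (t : ℝ)) - fderiv ℝ f (x, (t : ℝ))‖ ≤ ε :=
      (hball z hz t).le
    have h2 := ContinuousLinearMap.norm_inl_le_one ℝ B ℝ
    calc _ ≤ ε * 1 := by gcongr
      _ = ε := mul_one ε

/-- Each directional derivative of a curve family is the curve family of a partial derivative of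
`f`, so the induction closes because `f` is quantified after `n`. Finite dimension of `B` reduces
smoothness of the derivative to its values on fixed vectors. -/
lemma contDiff_curveFamily_nat (n : ℕ) : ∀ (f : B × ℝ → G) (hf : ContDiff ℝ ∞ f),
    ContDiff ℝ n (curveFamily f hf.continuous) := by
  induction n with
  | zero =>
    intro f hf
    refine contDiff_zero.2 ?_
    exact continuous_iff_continuousAt.2 fun x =>
      (hasFDerivAt_curveFamily f (hf.of_le (by simp)) x).continuousAt
  | succ n ih =>
    intro f hf
    have h1 : ContDiff ℝ 1 f := hf.of_le (by simp)
    push_cast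
    refine contDiff_succ_iff_fderiv_apply.2
      ⟨fun x => (hasFDerivAt_curveFamily f h1 x).differentiableAt, by simp, fun y => ?_⟩
    have h2 : ContDiff ℝ ∞ (fun p : B × ℝ => fderiv ℝ f p (y, 0)) :=
      (hf.fderiv_right (m := ∞) (by simp)).clm_apply contDiff_const
    convert ih _ h2 using 2 with x
    rw [(hasFDerivAt_curveFamily f h1 x).fderiv]
    rfl

lemma contDiff_curveFamily (f : B × ℝ → G) (hf : ContDiff ℝ ∞ f) :
    ContDiff ℝ ∞ (curveFamily f hf.continuous) :=
  contDiff_infty.2 fun n => contDiff_curveFamily_nat n f hf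

end Families

/-! ### Integration of curves -/

section Volterra

open intervalIntegral MeasureTheory

variable {G : Type*} [NormedAddCommGroup G] [NormedSpace ℝ G] [CompleteSpace G]

/-- The integral of a continuous curve over `[0, t]`. -/
def curveIntegral (y : C(unitInterval, G)) (t : ℝ) : G :=
  ∫ s in (0 : ℝ)..t, IccExtend zero_le_one y s

lemma continuous_iccExtend (y : C(unitInterval, G)) :
    Continuous (IccExtend (zero_le_one (α := ℝ)) y) := y.continuous.Icc_extend'

/-- The extension of `y` by constants is continuous on `ℝ`, so the derivative is two-sided also at
`0` and at `1`. -/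
lemma hasDerivAt_curveIntegral (y : C(unitInterval, G)) (t : ℝ) :
    HasDerivAt (curveIntegral y) (IccExtend zero_le_one y t) t :=
  integral_hasDerivAt_right ((continuous_iccExtend y).intervalIntegrable _ _)
    (continuous_iccExtend y).aestronglyMeasurable.stronglyMeasurableAtFilter
    (continuous_iccExtend y).continuousAt

lemma norm_curveIntegral_le (y : C(unitInterval, G)) (t : unitInterval) :
    ‖curveIntegral y t‖ ≤ ‖y‖ := by
  have h := norm_integral_le_of_norm_le_const (a := (0 : ℝ)) (b := t) (C := ‖y‖)
    (f := IccExtend zero_le_one y) fun s _ => y.norm_coe_le_norm _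
  refine h.trans ?_
  have : |(t : ℝ) - 0| ≤ 1 := by
    rw [sub_zero, abs_of_nonneg t.2.1]
    exact t.2.2
  exact mul_le_of_le_one_right (norm_nonneg _) this

variable (G) in
/-- The Volterra operator `y ↦ (t ↦ ∫₀ᵗ y)`. -/
def volterra : C(unitInterval, G) →L[ℝ] C(unitInterval, G) :=
  LinearMap.mkContinuous
    { toFun := fun y => ⟨fun t => curveIntegral y t, by
        have : Continuous (curveIntegral y) :=
          continuous_iff_continuousAt.2 fun t => (hasDerivAt_curveIntegral y t).continuousAt
        fun_prop⟩
      map_add' := fun y z => by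
        ext t
        exact integral_add ((continuous_iccExtend y).intervalIntegrable _ _)
          ((continuous_iccExtend z).intervalIntegrable _ _)
      map_smul' := fun c y => by
        ext t
        exact integral_smul c _ } 1 fun y => by
    rw [one_mul]
    exact (ContinuousMap.norm_le _ (norm_nonneg _)).2 (norm_curveIntegral_le y)

@[simp]
lemma volterra_apply (y : C(unitInterval, G)) (t : unitInterval) :
    volterra G y t = curveIntegral y t := rfl

/-- The integral over `[0, 1]`, as a continuous linear map. -/
def integralCLM : C(unitInterval, G) →L[ℝ] G :=
  (ContinuousMap.evalCLM ℝ (1 : unitInterval)).comp (volterra G)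

lemma integralCLM_apply (y : C(unitInterval, G)) :
    integralCLM y = ∫ s in (0 : ℝ)..1, IccExtend zero_le_one y s := rfl

lemma integralCLM_curveFamily {B : Type*} [NormedAddCommGroup B] [NormedSpace ℝ B]
    [FiniteDimensional ℝ B] (f : B × ℝ → G) (hf : Continuous f) (x : B) :
    integralCLM (curveFamily f hf x) = ∫ s in (0 : ℝ)..1, f (x, s) := by
  rw [integralCLM_apply]
  refine integral_congr fun s hs => ?_
  rw [uIcc_of_le zero_le_one] at hs
  exact IccExtend_of_mem _ _ hs

end Volterra

end CoCR

end

noncomputable section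

set_option linter.unusedSectionVars false

namespace CoCR
/-! ### Radial parallel transport -/

section Radial

open Topology Filter intervalIntegral MeasureTheory

variable {B R : Type*} [NormedAddCommGroup B] [NormedSpace ℝ B] [FiniteDimensional ℝ B]
  [NormedRing R] [NormedAlgebra ℝ R] [CompleteSpace R]

/-- A smooth family of operators through the identity can be inverted smoothly. -/
lemma exists_smooth_solution {W : Type*} [NormedAddCommGroup W] [NormedSpace ℝ W] [CompleteSpace W]
    (T : B → W →L[ℝ] W) (hT : ContDiff ℝ ∞ T) (hT0 : T 0 = 1) (w : W) :
    ∃ δ > 0, ∃ y : B → W, ContDiffOn ℝ ∞ y (Metric.ball 0 δ) ∧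
      ∀ x ∈ Metric.ball (0 : B) δ, T x (y x) = w ∧ ∀ z, T x z = w → z = y x := by
  obtain ⟨δ, hδ, hunit⟩ : ∃ δ > 0, ∀ x ∈ Metric.ball (0 : B) δ, IsUnit (T x) := by
    have : ∀ᶠ x in 𝓝 (0 : B), IsUnit (T x) := by
      refine hT.continuous.continuousAt.eventually_mem
        (Units.isOpen (R := W →L[ℝ] W).mem_nhds ?_)
      simp [hT0]
    exact Metric.eventually_nhds_iff_ball.1 this
  refine ⟨δ, hδ, fun x => Ring.inverse (T x) w, ?_, fun x hx => ⟨?_, fun z hz => ?_⟩⟩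
  · intro x hx
    obtain ⟨u, hu⟩ := hunit x hx
    have h1 : ContDiffAt ℝ ∞ (Ring.inverse (M₀ := W →L[ℝ] W)) (T x) := by
      rw [← hu]
      exact contDiffAt_ringInverse ℝ u
    have h2 : ContDiffAt ℝ ∞ (fun x => Ring.inverse (T x)) x := h1.comp x hT.contDiffAt
    exact (h2.clm_apply contDiffAt_const).contDiffWithinAt
  · exact DFunLike.congr_fun (Ring.mul_inverse_cancel _ (hunit x hx)) w
  · rw [← hz]
    exact (DFunLike.congr_fun (Ring.inverse_mul_cancel _ (hunit x hx)) z).symm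

/-- The family of curves `t ↦ a_{tx}(x)` associated to the one-form `a`. -/
def radialFamily (a : B → B →L[ℝ] R) (ha : ContDiff ℝ ∞ a) : B → C(unitInterval, R) :=
  curveFamily (fun p : B × ℝ => a (p.2 • p.1) p.1)
    ((ha.continuous.comp (by fun_prop)).clm_apply continuous_fst)

lemma contDiff_radialFamily (a : B → B →L[ℝ] R) (ha : ContDiff ℝ ∞ a) :
    ContDiff ℝ ∞ (radialFamily a ha) :=
  contDiff_curveFamily _ ((ha.comp (contDiff_snd.smul contDiff_fst)).clm_apply contDiff_fst)

/-- This is the integrated form of a linear differential equation with parameter `x`: `V` stands for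
integration and `A x` for the coefficients. Because `A 0 = 0`, the operator is the identity at `x =
0`, and smooth dependence on `x` follows from smoothness of inversion. -/
lemma exists_smooth_solution_one_add {X Y W : Type*} [NormedAddCommGroup X] [NormedSpace ℝ X]
    [NormedAddCommGroup Y] [NormedSpace ℝ Y] [NormedAddCommGroup W] [NormedSpace ℝ W]
    [CompleteSpace W] (S : X →L[ℝ] W →L[ℝ] Y) (V : Y →L[ℝ] W) (A : B → X) (hA : ContDiff ℝ ∞ A)
    (hA0 : A 0 = 0) (w : W) :
    ∃ δ > 0, ∃ y : B → W, ContDiffOn ℝ ∞ y (Metric.ball 0 δ) ∧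
      ∀ x ∈ Metric.ball (0 : B) δ, y x + V (S (A x) (y x)) = w ∧
        ∀ z, z + V (S (A x) z) = w → z = y x :=
  exists_smooth_solution (fun x => (1 : W →L[ℝ] W) + V.comp (S (A x)))
    (contDiff_const.add (contDiff_const.clm_comp (S.contDiff.comp hA))) (by simp [hA0]) w

/-- Along the ray through `x`, transport solves `y' = -a_{tx}(x) y`, `y(0) = 1`, that is, `y + ∫ a y
= 1` in the Banach space of curves. `P x` is the value of the solution at time one; uniqueness makes
it consistent along each ray. -/
lemma exists_radialTransport (a : B → B →L[ℝ] R) (ha : ContDiff ℝ ∞ a) :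
    ∃ δ > 0, ∃ P : B → R, ContDiffOn ℝ ∞ P (Metric.ball 0 δ) ∧ P 0 = 1 ∧
      ∀ x ∈ Metric.ball (0 : B) δ, ∀ t ∈ Icc (0 : ℝ) 1,
        fderiv ℝ P (t • x) x = -(a (t • x) x * P (t • x)) := by
  set A := radialFamily a ha with hA
  have hA0 : A 0 = 0 := by
    ext t
    simp [hA, radialFamily]
  obtain ⟨δ, hδ, y, hysmooth, hyprop⟩ :=
    exists_smooth_solution_one_add (ContinuousLinearMap.mul ℝ C(unitInterval, R)) (volterra R) A
      (contDiff_radialFamily a ha) hA0 1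
  have hyeq : ∀ x ∈ Metric.ball (0 : B) δ, ∀ t, y x t + curveIntegral (A x * y x) t = 1 :=
    fun x hx t => DFunLike.congr_fun (hyprop x hx).1 t
  have huniq : ∀ x ∈ Metric.ball (0 : B) δ, ∀ z : C(unitInterval, R),
      (∀ t : unitInterval, z t + curveIntegral (A x * z) t = 1) → z = y x :=
    fun x hx z hz => (hyprop x hx).2 z (ContinuousMap.ext hz)
  set P : B → R := fun x => y x 1 with hP
  have hscale : ∀ x ∈ Metric.ball (0 : B) δ, ∀ t : unitInterval, y x t = P ((t : ℝ) • x) := by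
    intro x hx t
    have htx : (t : ℝ) • x ∈ Metric.ball (0 : B) δ := by
      simp only [mem_ball_zero_iff] at hx ⊢
      rw [norm_smul, Real.norm_of_nonneg t.2.1]
      exact (mul_le_of_le_one_left (norm_nonneg _) t.2.2).trans_lt hx
    -- The slowed-down curve `s ↦ y_x(ts)` solves the equation with parameter `t • x`, by the
    -- substitution `u ↦ tu` in the integral. By uniqueness it is the solution there, and `s = 1`
    -- gives the claim.
    set z : C(unitInterval, R) := ⟨fun s => y x (t * s), by fun_prop⟩ with hz
    have hzy : z = y ((t : ℝ) • x) := by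
      refine huniq _ htx z ?_
      intro s
      have h1 := hyeq x hx (t * s)
      have h2 : curveIntegral (A ((t : ℝ) • x) * z) s = curveIntegral (A x * y x) (t * s : ℝ) := by
        unfold curveIntegral
        have h3 := intervalIntegral.smul_integral_comp_mul_left
          (f := IccExtend zero_le_one (A x * y x)) (a := 0) (b := s) (t : ℝ)
        rw [mul_zero] at h3
        rw [← h3, ← intervalIntegral.integral_smul]
        refine integral_congr fun u hu => ?_
        rw [uIcc_of_le s.2.1] at hu
        have hu1 : u ∈ Icc (0 : ℝ) 1 := ⟨hu.1, hu.2.trans s.2.2⟩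
        have hu2 : (t : ℝ) * u ∈ Icc (0 : ℝ) 1 := (t * ⟨u, hu1⟩ : unitInterval).2
        rw [IccExtend_of_mem _ _ hu1, IccExtend_of_mem _ _ hu2]
        have h4 : (t * ⟨u, hu1⟩ : unitInterval) = ⟨(t : ℝ) * u, hu2⟩ := rfl
        simp only [ContinuousMap.mul_apply, hA, radialFamily, curveFamily_apply, hz,
          ContinuousMap.coe_mk, h4, map_smul, smul_mul_assoc, smul_smul]
        rw [mul_comm u (t : ℝ)]
      rw [h2]
      exact h1
    have := DFunLike.congr_fun hzy 1
    simpa [hz, hP] using this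
  have hPsmooth : ContDiffOn ℝ ∞ P (Metric.ball 0 δ) :=
    (ContinuousMap.evalCLM ℝ (1 : unitInterval) : C(unitInterval, R) →L[ℝ] R).contDiff.comp_contDiffOn
      hysmooth
  refine ⟨δ, hδ, P, hPsmooth, ?_, ?_⟩
  · have h0 : (0 : B) ∈ Metric.ball (0 : B) δ := Metric.mem_ball_self hδ
    simpa [hA0, curveIntegral, hP, IccExtend, Function.comp_def] using hyeq 0 h0 1
  · intro x hx τ hτ
    have hτx : τ • x ∈ Metric.ball (0 : B) δ := by
      simp only [mem_ball_zero_iff] at hx ⊢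
      rw [norm_smul, Real.norm_of_nonneg hτ.1]
      exact (mul_le_of_le_one_left (norm_nonneg _) hτ.2).trans_lt hx
    have hPd : DifferentiableAt ℝ P (τ • x) :=
      (hPsmooth.contDiffAt (Metric.isOpen_ball.mem_nhds hτx)).differentiableAt (by simp)
    have h1 : HasDerivAt (fun t : ℝ => P (t • x)) (fderiv ℝ P (τ • x) x) τ := by
      have h2 : HasDerivAt (fun t : ℝ => t • x) x τ := by
        simpa using (hasDerivAt_id τ).smul_const x
      exact hPd.hasFDerivAt.comp_hasDerivAt τ h2
    have h4 : HasDerivAt (fun t : ℝ => 1 - curveIntegral (A x * y x) t)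
        (-(a (τ • x) x * P (τ • x))) τ := by
      have h5 := (hasDerivAt_curveIntegral (A x * y x) τ).const_sub 1
      have h6 : IccExtend zero_le_one (A x * y x) τ = a (τ • x) x * P (τ • x) := by
        rw [IccExtend_of_mem _ _ hτ, ContinuousMap.mul_apply, hscale x hx ⟨τ, hτ⟩]
        simp [hA, radialFamily]
      rwa [h6] at h5
    -- The integral equation is known only for `t ∈ [0, 1]`, so derivatives are compared within this
    -- interval; they are unique there, even at its end points.
    have h7 : EqOn (fun t : ℝ => P (t • x)) (fun t : ℝ => 1 - curveIntegral (A x * y x) t)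
        (Icc 0 1) := by
      intro t ht
      have h8 := hyeq x hx ⟨t, ht⟩
      have h9 := hscale x hx ⟨t, ht⟩
      simp only at h9 ⊢
      rw [← h9, ← h8]
      abel
    have h10 := (h4.hasDerivWithinAt (s := Icc 0 1)).congr_of_mem h7 hτ
    exact (uniqueDiffOn_Icc zero_lt_one τ hτ).eq_deriv _ h1.hasDerivWithinAt h10

/-- A solution of a linear ordinary differential equation which vanishes at `0` is zero. -/
lemma eq_zero_of_linear_ode {G : Type*} [NormedAddCommGroup G] [NormedSpace ℝ G]
    (u : ℝ → G) (c : ℝ → G →L[ℝ] G) (hc : ContinuousOn c (Icc 0 1))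
    (hu : ∀ t ∈ Icc (0 : ℝ) 1, HasDerivAt u (c t (u t)) t) (h0 : u 0 = 0) : u 1 = 0 := by
  obtain ⟨K, hK⟩ := isCompact_Icc.exists_bound_of_continuousOn hc
  have h1 : ∀ t ∈ Ico (0 : ℝ) 1, ‖c t (u t)‖ ≤ K * ‖u t‖ + 0 := fun t ht => by
    rw [add_zero]
    exact ((c t).le_opNorm _).trans
      (mul_le_mul_of_nonneg_right (hK t (Ico_subset_Icc_self ht)) (norm_nonneg _))
  have h2 := norm_le_gronwallBound_of_norm_deriv_right_le (f := u) (f' := fun t => c t (u t))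
    (δ := 0) (K := K) (ε := 0) (a := 0) (b := 1)
    (fun t ht => (hu t ht).continuousAt.continuousWithinAt)
    (fun t ht => (hu t (Ico_subset_Icc_self ht)).hasDerivWithinAt) (by simp [h0]) h1 1
    (right_mem_Icc.2 zero_le_one)
  simpa [gronwallBound_ε0_δ0] using h2

end Radial

end CoCR

end

noncomputable section

set_option synthInstance.maxHeartbeats 200000
set_option linter.unusedSectionVars false

namespace CoCR
/-! ### The Poincaré lemma for two-forms -/

section Poincare

open Topology Filter intervalIntegral MeasureTheory

variable {B G : Type*} [NormedAddCommGroup B] [NormedSpace ℝ B] [FiniteDimensional ℝ B]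
  [NormedAddCommGroup G] [NormedSpace ℝ G]

/-- A smooth map on a neighbourhood of a point agrees near that point with a smooth map defined
everywhere. -/
lemma exists_contDiff_eqOn_ball {f : B → G} {O : Set B} (hO : IsOpen O) {b : B} (hb : b ∈ O)
    (hf : ContDiffOn ℝ ∞ f O) :
    ∃ δ > 0, ∃ h : B → G, Metric.ball b δ ⊆ O ∧ ContDiff ℝ ∞ h ∧
      EqOn f h (Metric.ball b δ) := by
  obtain ⟨ε, hε, hεO⟩ := Metric.isOpen_iff.1 hO b hb
  -- The bump equals one on the ball of radius `ε / 4` and is supported in the closed ball of radius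
  -- `ε / 2`, inside the ball of radius `ε` on which `f` is smooth.
  let χ : ContDiffBump b := ⟨ε / 4, ε / 2, by positivity, by linarith⟩
  refine ⟨ε / 4, by positivity, fun x => χ x • f x, ?_, ?_, ?_⟩
  · exact (Metric.ball_subset_ball (by linarith)).trans hεO
  · refine contDiff_iff_contDiffAt.2 fun x => ?_
    by_cases hx : x ∈ Metric.ball b ε
    · exact χ.contDiff.contDiffAt.smul (hf.contDiffAt (hO.mem_nhds (hεO hx)))
    · have h1 : x ∉ tsupport χ := by
        rw [χ.tsupport_eq]
        intro h
        exact hx (Metric.closedBall_subset_ball (half_lt_self hε) h)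
      have h2 : (fun x => χ x • f x) =ᶠ[𝓝 x] fun _ => 0 := by
        filter_upwards [(isClosed_tsupport χ).isOpen_compl.mem_nhds h1] with y hy
        simp [image_eq_zero_of_notMem_tsupport hy]
      exact contDiffAt_const.congr_of_eventuallyEq h2
  · intro x hx
    simp [χ.one_of_mem_closedBall (Metric.ball_subset_closedBall hx)]

lemma hasFDerivAt_clm_apply_const {X : Type*} [NormedAddCommGroup X] [NormedSpace ℝ X]
    {f : B → X →L[ℝ] G} {f' : B →L[ℝ] X →L[ℝ] G} {x : B} (h : HasFDerivAt f f' x) (v : X) :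
    HasFDerivAt (fun y => f y v) (f'.flip v) x := by
  simpa using h.clm_apply (hasFDerivAt_const v x)

lemma hasDerivAt_clm_apply_const {X : Type*} [NormedAddCommGroup X] [NormedSpace ℝ X]
    {f : ℝ → X →L[ℝ] G} {f' : X →L[ℝ] G} {x : ℝ} (h : HasDerivAt f f' x) (v : X) :
    HasDerivAt (fun y => f y v) (f' v) x := by
  simpa using h.clm_apply (hasDerivAt_const x v)

lemma hasFDerivAt_comp_smul_const {Ω : B → G} (t : ℝ) {x : B}
    (h : DifferentiableAt ℝ Ω (t • x)) :
    HasFDerivAt (fun z : B => Ω (t • z)) (t • fderiv ℝ Ω (t • x)) x := by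
  have h2 : HasFDerivAt (fun z : B => t • z) (t • ContinuousLinearMap.id ℝ B) x :=
    (hasFDerivAt_id x).const_smul t
  refine (HasFDerivAt.comp x h.hasFDerivAt h2).congr_fderiv ?_
  ext v
  simp

lemma hasDerivAt_comp_smul_const {Ω : B → G} (t : ℝ) {x : B}
    (h : DifferentiableAt ℝ Ω (t • x)) :
    HasDerivAt (fun t : ℝ => Ω (t • x)) (fderiv ℝ Ω (t • x) x) t := by
  have h2 : HasDerivAt (fun t : ℝ => t • x) x t := by
    simpa using (hasDerivAt_id t).smul_const x
  exact HasFDerivAt.comp_hasDerivAt t h.hasFDerivAt h2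

lemma continuous_comp_smul_const {H : Type*} [TopologicalSpace H] {h : B → H} (hh : Continuous h)
    (x : B) : Continuous fun t : ℝ => h (t • x) :=
  hh.comp (by fun_prop)

lemma fderiv_antisymm {η : B → B →L[ℝ] B →L[ℝ] G} {x : B} (hη : DifferentiableAt ℝ η x)
    (h : ∀ᶠ y in 𝓝 x, ∀ X Y, η y X Y = -η y Y X) (W X Y : B) :
    fderiv ℝ η x W X Y = -fderiv ℝ η x W Y X := by
  have h1 : ∀ X Y, HasFDerivAt (fun y => η y X Y) (((fderiv ℝ η x).flip X).flip Y) x :=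
    fun X Y => hasFDerivAt_clm_apply_const (hasFDerivAt_clm_apply_const hη.hasFDerivAt X) Y
  have h2 : (fun y => η y X Y) =ᶠ[𝓝 x] fun y => -η y Y X := by
    filter_upwards [h] with y hy using hy X Y
  have h3 := ((h1 X Y).unique ((h1 Y X).neg.congr_of_eventuallyEq h2))
  exact DFunLike.congr_fun h3 W

/-- A closed two-form is exact near a point. -/
lemma exists_primitive [CompleteSpace G] {O : Set B} (hO : IsOpen O) (h0 : (0 : B) ∈ O)
    (η : B → B →L[ℝ] B →L[ℝ] G) (hη : ContDiffOn ℝ ∞ η O)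
    (hanti : ∀ x ∈ O, ∀ X Y, η x X Y = -η x Y X)
    (hclosed : ∀ x ∈ O, ∀ W X Y,
      fderiv ℝ η x W X Y + fderiv ℝ η x X Y W + fderiv ℝ η x Y W X = 0) :
    ∃ δ > 0, ∃ b : B → B →L[ℝ] G, Metric.ball 0 δ ⊆ O ∧ ContDiff ℝ ∞ b ∧
      ∀ x ∈ Metric.ball (0 : B) δ, ∀ X Y, fderiv ℝ b x X Y - fderiv ℝ b x Y X = η x X Y := by
  obtain ⟨δ, hδ, Ω, hsub, hΩ, heq⟩ := exists_contDiff_eqOn_ball hO h0 hη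
  have hev : ∀ x ∈ Metric.ball (0 : B) δ, η =ᶠ[𝓝 x] Ω := fun x hx => by
    filter_upwards [Metric.isOpen_ball.mem_nhds hx] with y hy using heq hy
  have hfd : ∀ x ∈ Metric.ball (0 : B) δ, fderiv ℝ η x = fderiv ℝ Ω x := fun x hx =>
    (hev x hx).fderiv_eq
  -- The radial homotopy formula: the primitive is `b_x(Y) = ∫₀¹ t Ω_{tx}(x, Y) dt`.
  set f : B × ℝ → B →L[ℝ] G := fun p => p.2 • Ω (p.2 • p.1) p.1 with hf
  have hfs : ContDiff ℝ ∞ f :=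
    contDiff_snd.smul ((hΩ.comp (contDiff_snd.smul contDiff_fst)).clm_apply contDiff_fst)
  have hf1 : ContDiff ℝ 1 f := hfs.of_le (by simp)
  have hΩd : ∀ x, DifferentiableAt ℝ Ω x := fun x => hΩ.differentiable (by simp) x
  refine ⟨δ, hδ, fun x => integralCLM (curveFamily f hfs.continuous x), hsub,
    (integralCLM (G := B →L[ℝ] G)).contDiff.comp (contDiff_curveFamily f hfs), fun x hx X Y => ?_⟩
  have hder : ∀ (t : ℝ) (X Y : B), fderiv ℝ f (x, t) (X, 0) Y =
      t ^ 2 • fderiv ℝ Ω (t • x) X x Y + t • Ω (t • x) X Y := by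
    intro t X Y
    have h1 : HasFDerivAt (fun z : B => f (z, t))
        ((fderiv ℝ f (x, t)).comp (ContinuousLinearMap.inl ℝ B ℝ)) x :=
      HasFDerivAt.comp (f := fun z : B => (z, t)) x
        ((hf1.differentiable one_ne_zero) (x, t)).hasFDerivAt (hasFDerivAt_prodMk_left x t)
    have h3 := hasFDerivAt_comp_smul_const (G := B →L[ℝ] B →L[ℝ] G) t (hΩd (t • x))
    have h4 := (h3.clm_apply (hasFDerivAt_id x)).const_smul t
    have h5 := DFunLike.congr_fun (DFunLike.congr_fun (h1.unique h4) X) Y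
    simp only [ContinuousLinearMap.comp_apply, ContinuousLinearMap.inl_apply] at h5
    rw [h5]
    simp [smul_smul, pow_two, add_comm]
  have hbd : ∀ X Y : B, fderiv ℝ (fun x => integralCLM (curveFamily f hfs.continuous x)) x X Y =
      ∫ t in (0 : ℝ)..1, (t ^ 2 • fderiv ℝ Ω (t • x) X x Y + t • Ω (t • x) X Y) := by
    intro X Y
    have h1 := integralCLM.hasFDerivAt.comp x (hasFDerivAt_curveFamily f hf1 x)
    have h2 : fderiv ℝ (fun x => integralCLM (curveFamily f hfs.continuous x)) x = _ := h1.fderiv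
    have hc : Continuous fun p : B × ℝ => fderiv ℝ f p (X, 0) :=
      (hf1.continuous_fderiv one_ne_zero).clm_apply continuous_const
    have h3 : fderiv ℝ (fun x => integralCLM (curveFamily f hfs.continuous x)) x X =
        integralCLM (curveFamily (fun p : B × ℝ => fderiv ℝ f p (X, 0)) hc x) := by
      rw [h2]
      rfl
    rw [h3, integralCLM_curveFamily, ContinuousLinearMap.intervalIntegral_apply]
    · exact integral_congr fun t _ => hder t X Y
    · exact (hc.comp (by fun_prop)).intervalIntegrable _ _
  have hΩc : Continuous (fderiv ℝ Ω) := hΩ.continuous_fderiv (by simp)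
  have hΩc' : Continuous Ω := hΩ.continuous
  have hint : ∀ X Y : B, IntervalIntegrable
      (fun t : ℝ => t ^ 2 • fderiv ℝ Ω (t • x) X x Y + t • Ω (t • x) X Y) volume 0 1 := by
    intro X Y
    refine Continuous.intervalIntegrable ?_ _ _
    have h2 : Continuous fun t : ℝ => fderiv ℝ Ω (t • x) X x Y :=
      (((continuous_comp_smul_const hΩc x).clm_apply continuous_const).clm_apply
        continuous_const).clm_apply continuous_const
    have h3 : Continuous fun t : ℝ => Ω (t • x) X Y :=
      ((continuous_comp_smul_const hΩc' x).clm_apply continuous_const).clm_apply continuous_const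
    exact ((continuous_pow 2).smul h2).add (continuous_id.smul h3)
  rw [hbd, hbd, ← integral_sub (hint X Y) (hint Y X)]
  -- Closedness on the triple `(X, x, Y)`, combined with antisymmetry, turns the integrand of `db(X,
  -- Y)` into the derivative of `t² Ω_{tx}(X, Y)`, whose integral over `[0, 1]` is `Ω_x(X, Y)`.
  have hprim : ∀ t ∈ uIcc (0 : ℝ) 1, HasDerivAt (fun t : ℝ => t ^ 2 • Ω (t • x) X Y)
      (t ^ 2 • fderiv ℝ Ω (t • x) X x Y + t • Ω (t • x) X Y
        - (t ^ 2 • fderiv ℝ Ω (t • x) Y x X + t • Ω (t • x) Y X)) t := by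
    intro t ht
    rw [uIcc_of_le zero_le_one] at ht
    have htx : t • x ∈ Metric.ball (0 : B) δ := by
      simp only [mem_ball_zero_iff] at hx ⊢
      rw [norm_smul, Real.norm_of_nonneg ht.1]
      exact (mul_le_of_le_one_left (norm_nonneg _) ht.2).trans_lt hx
    have h3 := hasDerivAt_comp_smul_const (G := B →L[ℝ] B →L[ℝ] G) t (hΩd (t • x))
    have h4 : HasDerivAt (fun t : ℝ => Ω (t • x) X Y) (fderiv ℝ Ω (t • x) x X Y) t :=
      hasDerivAt_clm_apply_const (hasDerivAt_clm_apply_const h3 X) Y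
    have h5 := (hasDerivAt_pow 2 t).smul h4
    have hanti' : ∀ᶠ y in 𝓝 (t • x), ∀ X Y, Ω y X Y = -Ω y Y X := by
      filter_upwards [Metric.isOpen_ball.mem_nhds htx] with y hy X Y
      rw [← heq hy]
      exact hanti y (hsub hy) X Y
    have h6 := fderiv_antisymm (hΩd (t • x)) hanti'
    have h7 := hclosed (t • x) (hsub htx) X x Y
    rw [hfd _ htx, h6 Y X x, h6 x Y X] at h7
    have h8 := hanti'.self_of_nhds Y X
    have h9 : fderiv ℝ Ω (t • x) x X Y
        = fderiv ℝ Ω (t • x) X x Y - fderiv ℝ Ω (t • x) Y x X := by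
      rw [← sub_eq_zero, ← neg_eq_zero, ← h7]
      abel
    refine h5.congr_deriv ?_
    rw [h9, h8]
    simp
    module
  rw [integral_eq_sub_of_hasDerivAt hprim ((hint X Y).sub (hint Y X))]
  simp [heq hx]

end Poincare

end CoCR

end

noncomputable section

set_option synthInstance.maxHeartbeats 200000
set_option linter.unusedSectionVars false

namespace CoCR
/-! ### Co-CR quaternionic structures in coordinates -/

section Coordinates

open Topology Filter

variable {B F : Type*} [NormedAddCommGroup B] [NormedSpace ℝ B] [FiniteDimensional ℝ B]
  [NormedAddCommGroup F] [NormedSpace ℝ F] [FiniteDimensional ℝ F]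

lemma minSmoothness_two_le_infty : minSmoothness ℝ 2 ≤ (∞ : ℕ∞ω) := by
  rw [minSmoothness_of_isRCLikeNormedField]
  exact WithTop.coe_le_coe.2 (le_top : (2 : ℕ∞) ≤ ⊤)

/-- The curvature of the connection `d + Γ`. -/
def localCurvature (Γ : B → B →L[ℝ] F →L[ℝ] F) (b X Y : B) : F →L[ℝ] F :=
  fderiv ℝ Γ b X Y - fderiv ℝ Γ b Y X + (Γ b X).comp (Γ b Y) - (Γ b Y).comp (Γ b X)

lemma localCurvature_apply (Γ : B → B →L[ℝ] F →L[ℝ] F) (b X Y : B) (f : F) :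
    localCurvature Γ b X Y f = fderiv ℝ Γ b X Y f - fderiv ℝ Γ b Y X f + Γ b X (Γ b Y f)
      - Γ b Y (Γ b X f) := rfl

/-- A connection `d + Γ` which satisfies the first Bianchi identity with respect to the surjective
morphism `r`, on the set `O`. -/
structure IsLocalBianchi (O : Set B) (Γ : B → B →L[ℝ] F →L[ℝ] F) (r : B → F →L[ℝ] B) :
    Prop where
  contDiffOn_conn : ContDiffOn ℝ ∞ Γ O
  contDiffOn_map : ContDiffOn ℝ ∞ r O
  surjective : ∀ b ∈ O, Function.Surjective (r b)
  torsion : ∀ b ∈ O, ∀ f₁ f₂, r b (Γ b (r b f₁) f₂ - Γ b (r b f₂) f₁) =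
    fderiv ℝ r b (r b f₁) f₂ - fderiv ℝ r b (r b f₂) f₁
  bianchi : ∀ b ∈ O, ∀ f₁ f₂ f₃, localCurvature Γ b (r b f₁) (r b f₂) f₃
    + localCurvature Γ b (r b f₂) (r b f₃) f₁ + localCurvature Γ b (r b f₃) (r b f₁) f₂ = 0

namespace IsLocalBianchi

variable {O : Set B} {Γ : B → B →L[ℝ] F →L[ℝ] F} {r : B → F →L[ℝ] B}

lemma mono (h : IsLocalBianchi O Γ r) {O' : Set B} (hO' : O' ⊆ O) : IsLocalBianchi O' Γ r where
  contDiffOn_conn := h.contDiffOn_conn.mono hO'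
  contDiffOn_map := h.contDiffOn_map.mono hO'
  surjective := fun b hb => h.surjective b (hO' hb)
  torsion := fun b hb => h.torsion b (hO' hb)
  bianchi := fun b hb => h.bianchi b (hO' hb)

/-- The kernel of `r` is parallel. -/
lemma map_conn_of_mem_ker (h : IsLocalBianchi O Γ r) {b : B} (hb : b ∈ O) {f : F}
    (hf : r b f = 0) (X : B) : r b (Γ b X f) = fderiv ℝ r b X f := by
  -- Surjectivity lets the direction `X` be the image of a vector of `F`; in the torsion identity
  -- for that vector and `f`, both terms containing `r b f` vanish.
  obtain ⟨f', rfl⟩ := h.surjective b hb X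
  simpa [hf] using h.torsion b hb f' f

/-- The kernel of `r` is flat. -/
lemma curvature_of_mem_ker (h : IsLocalBianchi O Γ r) {b : B} (hb : b ∈ O) {f : F}
    (hf : r b f = 0) (X Y : B) : localCurvature Γ b X Y f = 0 := by
  obtain ⟨f₁, rfl⟩ := h.surjective b hb X
  obtain ⟨f₂, rfl⟩ := h.surjective b hb Y
  -- Two of the three terms in the cyclic sum have `r b f = 0` as an argument of the curvature.
  simpa [hf, localCurvature_apply] using h.bianchi b hb f₁ f₂ f

/-- The section is `s ∘ (r_b ∘ s)⁻¹`, which makes sense near `0` because `r_0 ∘ s = 1`. -/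
lemma exists_section (h : IsLocalBianchi O Γ r) (hO : IsOpen O) (h0 : (0 : B) ∈ O)
    {s : B →L[ℝ] F} (hs : ∀ X, r 0 (s X) = X) :
    ∃ δ > 0, ∃ α : B → B →L[ℝ] F, Metric.ball 0 δ ⊆ O ∧
      ContDiffOn ℝ ∞ α (Metric.ball 0 δ) ∧ α 0 = s ∧
      ∀ b ∈ Metric.ball (0 : B) δ, ∀ X, r b (α b X) = X := by
  have hc : ContinuousOn (fun b => (r b).comp s) O :=
    (h.contDiffOn_map.clm_comp contDiffOn_const).continuousOn
  have h1 : (r 0).comp s = 1 := by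
    ext X
    simp [hs]
  have h2 : ∀ᶠ b in 𝓝 (0 : B), b ∈ O ∧ IsUnit ((r b).comp s) := by
    refine Filter.Eventually.and (hO.mem_nhds h0) ((hc.continuousAt (hO.mem_nhds h0)).eventually_mem
      (Units.isOpen (R := B →L[ℝ] B).mem_nhds ?_))
    simp [h1]
  obtain ⟨δ, hδ, hball⟩ := Metric.eventually_nhds_iff_ball.1 h2
  refine ⟨δ, hδ, fun b => s.comp (Ring.inverse ((r b).comp s)), fun b hb => (hball b hb).1, ?_,
    ?_, ?_⟩
  · intro b hb
    obtain ⟨u, hu⟩ := (hball b hb).2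
    have h3 : ContDiffAt ℝ ∞ (Ring.inverse (M₀ := B →L[ℝ] B)) ((r b).comp s) := by
      rw [← hu]
      exact contDiffAt_ringInverse ℝ u
    have h4 : ContDiffAt ℝ ∞ (fun b => (r b).comp s) b :=
      ((h.contDiffOn_map.clm_comp contDiffOn_const).contDiffAt
        (hO.mem_nhds (hball b hb).1))
    exact ((contDiffAt_const (c := s)).clm_comp (h3.comp b h4)).contDiffWithinAt
  · simp only [h1, Ring.inverse_one]
    rfl
  · intro b hb X
    exact DFunLike.congr_fun (Ring.mul_inverse_cancel _ (hball b hb).2) X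

/-- Radial parallel transport preserves the kernel of `r`. -/
lemma map_transport_eq_zero {δ : ℝ} (h : IsLocalBianchi (Metric.ball 0 δ) Γ r)
    {α : B → B →L[ℝ] F} (hα : ContDiffOn ℝ ∞ α (Metric.ball 0 δ))
    (hrα : ∀ b ∈ Metric.ball (0 : B) δ, ∀ X, r b (α b X) = X)
    {P : B → F →L[ℝ] F} (hP : ContDiffOn ℝ ∞ P (Metric.ball 0 δ)) (hP0 : P 0 = 1)
    (hrad : ∀ b ∈ Metric.ball (0 : B) δ, ∀ t ∈ Icc (0 : ℝ) 1,
      fderiv ℝ P (t • b) b = -(Γ (t • b) b).comp (P (t • b)))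
    {k : F} (hk : r 0 k = 0) {b : B} (hb : b ∈ Metric.ball (0 : B) δ) : r b (P b k) = 0 := by
  have htb : ∀ t ∈ Icc (0 : ℝ) 1, t • b ∈ Metric.ball (0 : B) δ := fun t ht => by
    simp only [mem_ball_zero_iff] at hb ⊢
    rw [norm_smul, Real.norm_of_nonneg ht.1]
    exact (mul_le_of_le_one_left (norm_nonneg _) ht.2).trans_lt hb
  have hsm : ContinuousOn (fun t : ℝ => t • b) (Icc 0 1) := by fun_prop
  -- The derivative of `r (P k)` along the ray is `∂r - r ∘ Γ` applied to `P k`. That operator kills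
  -- `ker r`, so it factors through `r` by means of the section `α`; this gives a linear equation
  -- for `r (P k)` itself, with initial value zero.
  have key := eq_zero_of_linear_ode (fun t => r (t • b) (P (t • b) k))
    (fun t => (fderiv ℝ r (t • b) b - (r (t • b)).comp (Γ (t • b) b)).comp (α (t • b)))
    ?_ ?_ (by simp [hP0, hk])
  · simpa using key
  · have h1 : ContinuousOn (fderiv ℝ r) (Metric.ball 0 δ) :=
      h.contDiffOn_map.continuousOn_fderiv_of_isOpen Metric.isOpen_ball (by simp)
    exact (((h1.comp hsm htb).clm_apply continuousOn_const).sub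
      ((h.contDiffOn_map.continuousOn.comp hsm htb).clm_comp
        ((h.contDiffOn_conn.continuousOn.comp hsm htb).clm_apply continuousOn_const))).clm_comp
      (hα.continuousOn.comp hsm htb)
  · intro t ht
    have hnh := Metric.isOpen_ball.mem_nhds (htb t ht)
    have h1 := hasDerivAt_comp_smul_const (G := F →L[ℝ] B) t
      ((h.contDiffOn_map.contDiffAt hnh).differentiableAt (by simp))
    have h2 := hasDerivAt_comp_smul_const (G := F →L[ℝ] F) t
      ((hP.contDiffAt hnh).differentiableAt (by simp))
    refine (h1.clm_apply (hasDerivAt_clm_apply_const h2 k)).congr_deriv ?_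
    rw [hrad b hb t ht]
    set f := P (t • b) k with hf
    have h3 : r (t • b) (f - α (t • b) (r (t • b) f)) = 0 := by
      rw [map_sub, hrα _ (htb t ht), sub_self]
    have h4 := h.map_conn_of_mem_ker (htb t ht) h3 b
    simp only [map_sub] at h4
    simp only [neg_apply, map_neg,
      ContinuousLinearMap.comp_apply, sub_apply]
    rw [sub_eq_sub_iff_add_eq_add] at h4
    rw [← sub_eq_add_neg, sub_eq_sub_iff_add_eq_add, ← h4]
    abel

/-- Radial parallel transport is parallel on the kernel of `r`. -/
lemma transport_parallel {δ : ℝ} (h : IsLocalBianchi (Metric.ball 0 δ) Γ r)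
    {P : B → F →L[ℝ] F} (hP : ContDiffOn ℝ ∞ P (Metric.ball 0 δ))
    (hrad : ∀ b ∈ Metric.ball (0 : B) δ, ∀ t ∈ Icc (0 : ℝ) 1,
      fderiv ℝ P (t • b) b = -(Γ (t • b) b).comp (P (t • b)))
    {k : F} (hk : ∀ b ∈ Metric.ball (0 : B) δ, r b (P b k) = 0)
    {b : B} (hb : b ∈ Metric.ball (0 : B) δ) (X : B) :
    fderiv ℝ P b X k + Γ b X (P b k) = 0 := by
  have htb : ∀ t ∈ Icc (0 : ℝ) 1, t • b ∈ Metric.ball (0 : B) δ := fun t ht => by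
    simp only [mem_ball_zero_iff] at hb ⊢
    rw [norm_smul, Real.norm_of_nonneg ht.1]
    exact (mul_le_of_le_one_left (norm_nonneg _) ht.2).trans_lt hb
  have hsm : ContinuousOn (fun t : ℝ => t • b) (Icc 0 1) := by fun_prop
  have hP' : ContDiffOn ℝ ∞ (fderiv ℝ P) (Metric.ball 0 δ) :=
    hP.fderiv_of_isOpen Metric.isOpen_ball (by simp)
  have hDP : ∀ z ∈ Metric.ball (0 : B) δ, HasFDerivAt P (fderiv ℝ P z) z := fun z hz =>
    ((hP.contDiffAt (Metric.isOpen_ball.mem_nhds hz)).differentiableAt (by simp)).hasFDerivAt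
  have hDDP : ∀ z ∈ Metric.ball (0 : B) δ,
      HasFDerivAt (fderiv ℝ P) (fderiv ℝ (fderiv ℝ P) z) z := fun z hz =>
    ((hP'.contDiffAt (Metric.isOpen_ball.mem_nhds hz)).differentiableAt (by simp)).hasFDerivAt
  have hDΓ : ∀ z ∈ Metric.ball (0 : B) δ, HasFDerivAt Γ (fderiv ℝ Γ z) z := fun z hz =>
    ((h.contDiffOn_conn.contDiffAt (Metric.isOpen_ball.mem_nhds hz)).differentiableAt
      (by simp)).hasFDerivAt
  -- the derivative of the radial equation in the direction `X`
  have hrad' : ∀ z ∈ Metric.ball (0 : B) δ, fderiv ℝ (fderiv ℝ P) z X z k + fderiv ℝ P z X k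
      + fderiv ℝ Γ z X z (P z k) + Γ z X (P z k) + Γ z z (fderiv ℝ P z X k) = 0 := by
    intro z hz
    have h1 := hasFDerivAt_clm_apply_const
      (((hDDP z hz).clm_apply (hasFDerivAt_id z)).add
        (((hDΓ z hz).clm_apply (hasFDerivAt_id z)).clm_comp (hDP z hz))) k
    have h2 : (fun z => (fderiv ℝ P z z + (Γ z z).comp (P z)) k) =ᶠ[𝓝 z] fun _ => 0 := by
      filter_upwards [Metric.isOpen_ball.mem_nhds hz] with w hw
      have := hrad w hw 1 (right_mem_Icc.2 zero_le_one)
      rw [one_smul] at this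
      rw [this]
      exact DFunLike.congr_fun (neg_add_cancel ((Γ w w).comp (P w))) k
    have h3 := DFunLike.congr_fun (h1.unique ((hasFDerivAt_const 0 z).congr_of_eventuallyEq h2)) X
    simp at h3
    rw [← h3]
    abel
  -- `Q` is the covariant derivative of the transported vector in the fixed direction `X`; it has to
  -- vanish.
  set Q : B → F := fun z => fderiv ℝ P z X k + Γ z X (P z k) with hQ
  have hDQ : ∀ z ∈ Metric.ball (0 : B) δ, ∀ Y, HasFDerivAt Q (fderiv ℝ Q z) z ∧
      fderiv ℝ Q z Y = fderiv ℝ (fderiv ℝ P) z Y X k + fderiv ℝ Γ z Y X (P z k)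
        + Γ z X (fderiv ℝ P z Y k) := by
    intro z hz Y
    have h1 := (hasFDerivAt_clm_apply_const
      (hasFDerivAt_clm_apply_const (G := F →L[ℝ] F) (hDDP z hz) X) k).add
      ((hasFDerivAt_clm_apply_const (G := F →L[ℝ] F) (hDΓ z hz) X).clm_apply
        (hasFDerivAt_clm_apply_const (hDP z hz) k))
    have h2 : HasFDerivAt Q _ z := h1
    refine ⟨h2.differentiableAt.hasFDerivAt, ?_⟩
    rw [h2.fderiv]
    simp
    abel
  -- Flatness allows the radial and the `X` covariant derivatives to be interchanged. The radial
  -- derivative of `P k` is zero, and the bracket of a constant field with the radial field is that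
  -- constant field, whence `∇_z Q = -Q`.
  have hQrad : ∀ z ∈ Metric.ball (0 : B) δ, fderiv ℝ Q z z = -Q z - Γ z z (Q z) := by
    intro z hz
    have h1 := h.curvature_of_mem_ker hz (hk z hz) z X
    rw [localCurvature_apply] at h1
    have h2 := hrad' z hz
    have h3 : fderiv ℝ (fderiv ℝ P) z z X = fderiv ℝ (fderiv ℝ P) z X z :=
      ((hP.contDiffAt (Metric.isOpen_ball.mem_nhds hz)).isSymmSndFDerivAt
        minSmoothness_two_le_infty).eq z X
    have h4 := hrad z hz 1 (right_mem_Icc.2 zero_le_one)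
    rw [one_smul] at h4
    rw [(hDQ z hz z).2, h3, h4]
    simp only [hQ, map_add, neg_apply, map_neg, ContinuousLinearMap.comp_apply]
    rw [← sub_eq_zero]
    calc _ = (fderiv ℝ (fderiv ℝ P) z X z k + fderiv ℝ P z X k
      + fderiv ℝ Γ z X z (P z k) + Γ z X (P z k) + Γ z z (fderiv ℝ P z X k))
      + (fderiv ℝ Γ z z X (P z k) - fderiv ℝ Γ z X z (P z k) + Γ z z (Γ z X (P z k))
      - Γ z X (Γ z z (P z k))) := by abel
      _ = 0 := by rw [h1, h2, add_zero]
  -- The factor `t` absorbs the term `-Q` and makes the initial value zero.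
  have key := eq_zero_of_linear_ode (fun t => t • Q (t • b)) (fun t => -Γ (t • b) b) ?_ ?_
    (by simp)
  · simpa using key
  · exact ((h.contDiffOn_conn.continuousOn.comp hsm htb).clm_apply continuousOn_const).neg
  · intro t ht
    have h1 := hasDerivAt_comp_smul_const t (hDQ _ (htb t ht) 0).1.differentiableAt
    refine ((hasDerivAt_id t).smul h1).congr_deriv ?_
    have h2 := hQrad _ (htb t ht)
    simp only [map_smul, smul_apply] at h2
    simp only [id, h2, one_smul, map_smul]
    rw [neg_apply]
    module

end IsLocalBianchi

end Coordinates

end CoCR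

end

noncomputable section

set_option synthInstance.maxHeartbeats 200000
set_option linter.unusedSectionVars false

namespace CoCR
-- Exterior covariant derivatives and closed frames.
section Coordinates

open Topology Filter

variable {B F : Type*} [NormedAddCommGroup B] [NormedSpace ℝ B] [FiniteDimensional ℝ B]
  [NormedAddCommGroup F] [NormedSpace ℝ F] [FiniteDimensional ℝ F]

lemma _root_.ContDiffOn.hasFDerivAt_of_isOpen {X Y : Type*} [NormedAddCommGroup X] [NormedSpace ℝ X]
    [NormedAddCommGroup Y] [NormedSpace ℝ Y] {f : X → Y} {O : Set X} (hf : ContDiffOn ℝ ∞ f O)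
    (hO : IsOpen O) {x : X} (hx : x ∈ O) : HasFDerivAt f (fderiv ℝ f x) x :=
  ((hf.contDiffAt (hO.mem_nhds hx)).differentiableAt (by simp)).hasFDerivAt

lemma hasFDerivAt_clm_apply₂_const {X Y Z : Type*} [NormedAddCommGroup X] [NormedSpace ℝ X]
    [NormedAddCommGroup Y] [NormedSpace ℝ Y] [NormedAddCommGroup Z] [NormedSpace ℝ Z]
    {f : B → X →L[ℝ] Y →L[ℝ] Z} {f' : B →L[ℝ] X →L[ℝ] Y →L[ℝ] Z} {b : B}
    (h : HasFDerivAt f f' b) (x : X) (y : Y) :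
    HasFDerivAt (fun b => f b x y) ((f'.flip x).flip y) b :=
  hasFDerivAt_clm_apply_const (hasFDerivAt_clm_apply_const h x) y

lemma fderiv_translate {Y : Type*} [NormedAddCommGroup Y] [NormedSpace ℝ Y] (f : B → Y) (a b : B) :
    fderiv ℝ (fun x => f (x + a)) b = fderiv ℝ f (b + a) :=
  fderiv_comp_add_right a

/-- The covariant derivative `(X, Y) ↦ (∇_X α)(Y)` of the section `α` of `Hom(TM, E)`, where `TM`
is endowed with the trivial connection. -/
def localCovDeriv (Γ : B → B →L[ℝ] F →L[ℝ] F) (α : B → B →L[ℝ] F) (b : B) :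
    B →L[ℝ] B →L[ℝ] F :=
  fderiv ℝ α b + ((ContinuousLinearMap.compL ℝ B F F).flip (α b)).comp (Γ b)

@[simp]
lemma localCovDeriv_apply (Γ : B → B →L[ℝ] F →L[ℝ] F) (α : B → B →L[ℝ] F) (b X Y : B) :
    localCovDeriv Γ α b X Y = fderiv ℝ α b X Y + Γ b X (α b Y) := rfl

lemma contDiffOn_localCovDeriv {O : Set B} (hO : IsOpen O) {Γ : B → B →L[ℝ] F →L[ℝ] F}
    {α : B → B →L[ℝ] F} (hΓ : ContDiffOn ℝ ∞ Γ O) (hα : ContDiffOn ℝ ∞ α O) :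
    ContDiffOn ℝ ∞ (localCovDeriv Γ α) O :=
  contDiffOn_clm_apply.2 fun X => contDiffOn_clm_apply.2 fun Y =>
    (((hα.fderiv_of_isOpen hO (by simp)).clm_apply contDiffOn_const).clm_apply
      contDiffOn_const).add
      ((hΓ.clm_apply contDiffOn_const).clm_apply (hα.clm_apply contDiffOn_const))

/-- The exterior covariant derivative of the section `α` of `Hom(TM, E)`. -/
def localExtCovDeriv (Γ : B → B →L[ℝ] F →L[ℝ] F) (α : B → B →L[ℝ] F) (b : B) :
    B →L[ℝ] B →L[ℝ] F :=
  localCovDeriv Γ α b - (localCovDeriv Γ α b).flip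

@[simp]
lemma localExtCovDeriv_apply (Γ : B → B →L[ℝ] F →L[ℝ] F) (α : B → B →L[ℝ] F) (b X Y : B) :
    localExtCovDeriv Γ α b X Y =
      fderiv ℝ α b X Y + Γ b X (α b Y) - (fderiv ℝ α b Y X + Γ b Y (α b X)) := rfl

lemma contDiffOn_localExtCovDeriv {O : Set B} (hO : IsOpen O) {Γ : B → B →L[ℝ] F →L[ℝ] F}
    {α : B → B →L[ℝ] F} (hΓ : ContDiffOn ℝ ∞ Γ O) (hα : ContDiffOn ℝ ∞ α O) :
    ContDiffOn ℝ ∞ (localExtCovDeriv Γ α) O :=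
  have h := contDiffOn_localCovDeriv hO hΓ hα
  contDiffOn_clm_apply.2 fun _ => contDiffOn_clm_apply.2 fun _ =>
    ((h.clm_apply contDiffOn_const).clm_apply contDiffOn_const).sub
      ((h.clm_apply contDiffOn_const).clm_apply contDiffOn_const)

namespace IsLocalBianchi

variable {O : Set B} {Γ : B → B →L[ℝ] F →L[ℝ] F} {r : B → F →L[ℝ] B}

/-- Differentiating `r (α Y) = Y` expresses `r (∂α)` through `∂r`; torsion freeness on the vectors
`α X`, `α Y` cancels the result against the connection terms. -/
lemma map_extCovDeriv (h : IsLocalBianchi O Γ r) (hO : IsOpen O) {α : B → B →L[ℝ] F}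
    (hα : ContDiffOn ℝ ∞ α O) (hrα : ∀ b ∈ O, ∀ X, r b (α b X) = X) {b : B} (hb : b ∈ O)
    (X Y : B) : r b (localExtCovDeriv Γ α b X Y) = 0 := by
  have h1 : ∀ X Y, fderiv ℝ r b X (α b Y) + r b (fderiv ℝ α b X Y) = 0 := by
    intro X Y
    have h2 := (h.contDiffOn_map.hasFDerivAt_of_isOpen hO hb).clm_apply
      (hasFDerivAt_clm_apply_const (hα.hasFDerivAt_of_isOpen hO hb) Y)
    have h3 : (fun b => r b (α b Y)) =ᶠ[𝓝 b] fun _ => Y := by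
      filter_upwards [hO.mem_nhds hb] with z hz using hrα z hz Y
    have h4 := DFunLike.congr_fun
      (h2.unique ((hasFDerivAt_const Y b).congr_of_eventuallyEq h3)) X
    simp at h4
    rw [← h4]
    abel
  have h5 := h.torsion b hb (α b X) (α b Y)
  rw [hrα b hb, hrα b hb] at h5
  simp only [map_sub] at h5
  rw [localExtCovDeriv_apply]
  simp only [map_sub, map_add]
  rw [eq_neg_of_add_eq_zero_right (h1 X Y), eq_neg_of_add_eq_zero_right (h1 Y X)]
  rw [sub_eq_iff_eq_add] at h5
  rw [h5]
  abel

lemma fderiv_extCovDeriv (h : IsLocalBianchi O Γ r) (hO : IsOpen O) {α : B → B →L[ℝ] F}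
    (hα : ContDiffOn ℝ ∞ α O) {b : B} (hb : b ∈ O) (W X Y : B) :
    fderiv ℝ (localExtCovDeriv Γ α) b W X Y =
      fderiv ℝ (fderiv ℝ α) b W X Y + fderiv ℝ Γ b W X (α b Y) + Γ b X (fderiv ℝ α b W Y)
      - (fderiv ℝ (fderiv ℝ α) b W Y X + fderiv ℝ Γ b W Y (α b X)
        + Γ b Y (fderiv ℝ α b W X)) := by
  have h1 := hasFDerivAt_clm_apply₂_const
    ((contDiffOn_localExtCovDeriv hO h.contDiffOn_conn hα).hasFDerivAt_of_isOpen hO hb) X Y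
  have hα' : ContDiffOn ℝ ∞ (fderiv ℝ α) O := hα.fderiv_of_isOpen hO (by simp)
  have hΓ := h.contDiffOn_conn.hasFDerivAt_of_isOpen hO hb
  have h2 : ∀ X Y, HasFDerivAt (fun b => fderiv ℝ α b X Y + Γ b X (α b Y))
      (((fderiv ℝ (fderiv ℝ α) b).flip X).flip Y + ((Γ b X).comp ((fderiv ℝ α b).flip Y)
        + ((fderiv ℝ Γ b).flip X).flip (α b Y))) b := fun X Y =>
    (hasFDerivAt_clm_apply₂_const (hα'.hasFDerivAt_of_isOpen hO hb) X Y).add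
      ((hasFDerivAt_clm_apply_const (G := F →L[ℝ] F) hΓ X).clm_apply
        (hasFDerivAt_clm_apply_const (hα.hasFDerivAt_of_isOpen hO hb) Y))
  have h3 := DFunLike.congr_fun (h1.unique ((h2 X Y).sub (h2 Y X))) W
  refine Eq.trans h3 ?_
  simp
  abel

/-- The second Bianchi-type identity for the exterior covariant derivative. -/
lemma extCovDeriv_extCovDeriv (h : IsLocalBianchi O Γ r) (hO : IsOpen O) {α : B → B →L[ℝ] F}
    (hα : ContDiffOn ℝ ∞ α O) (hrα : ∀ b ∈ O, ∀ X, r b (α b X) = X) {b : B} (hb : b ∈ O)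
    (W X Y : B) :
    (fderiv ℝ (localExtCovDeriv Γ α) b W X Y + Γ b W (localExtCovDeriv Γ α b X Y))
    + (fderiv ℝ (localExtCovDeriv Γ α) b X Y W + Γ b X (localExtCovDeriv Γ α b Y W))
    + (fderiv ℝ (localExtCovDeriv Γ α) b Y W X + Γ b Y (localExtCovDeriv Γ α b W X)) = 0 := by
  -- The second exterior covariant derivative is the curvature wedged with `α`, which is the cyclic
  -- Bianchi sum on the image of `α`; second derivatives of `α` cancel by symmetry.
  have h1 := h.bianchi b hb (α b W) (α b X) (α b Y)
  simp only [hrα b hb, localCurvature_apply] at h1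
  have hsymm : ∀ X Y, fderiv ℝ (fderiv ℝ α) b X Y = fderiv ℝ (fderiv ℝ α) b Y X := fun X Y =>
    ((hα.contDiffAt (hO.mem_nhds hb)).isSymmSndFDerivAt minSmoothness_two_le_infty).eq X Y
  simp only [h.fderiv_extCovDeriv hO hα hb, localExtCovDeriv_apply, map_add, map_sub]
  rw [hsymm X W, hsymm Y X, hsymm Y W]
  rw [← h1]
  abel

/-- There is a closed isomorphism of the form `α ∘ τ + P ∘ (1 - s ∘ τ)`. -/
theorem exists_closed_frame_zero (h : IsLocalBianchi O Γ r) (hO : IsOpen O) (h0 : (0 : B) ∈ O) :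
    ∃ δ > 0, ∃ (s : B →L[ℝ] F) (g : B → F →L[ℝ] F), Metric.ball 0 δ ⊆ O ∧
      ContDiffOn ℝ ∞ g (Metric.ball 0 δ) ∧ (∀ X, r 0 (s X) = X) ∧
      ∀ b ∈ Metric.ball (0 : B) δ, IsUnit (g b) ∧ (∀ f, r b (g b f) = r 0 f) ∧
        ∀ X Y, fderiv ℝ g b (r 0 X) Y + Γ b (r 0 X) (g b Y)
          = fderiv ℝ g b (r 0 Y) X + Γ b (r 0 Y) (g b X) := by
  obtain ⟨s', hs'⟩ := (r 0 : F →ₗ[ℝ] B).exists_rightInverse_of_surjective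
    (LinearMap.range_eq_top.2 (h.surjective 0 h0))
  set s : B →L[ℝ] F := LinearMap.toContinuousLinearMap s' with hsdef
  have hs : ∀ X, r 0 (s X) = X := fun X => DFunLike.congr_fun hs' X
  obtain ⟨δ₁, hδ₁, α, hsub₁, hα, hα0, hrα⟩ := h.exists_section hO h0 hs
  -- Radial transport needs a one-form on the whole of `B`, hence a smooth form which agrees with
  -- `Γ` near `0`.
  obtain ⟨δ₂, hδ₂, Γ', hsub₂, hΓ', heq⟩ := exists_contDiff_eqOn_ball hO h0 h.contDiffOn_conn
  obtain ⟨δ₃, hδ₃, P, hP, hP0, hrad⟩ := exists_radialTransport (R := F →L[ℝ] F) Γ' hΓ'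
  set τ := r 0 with hτ
  -- The projection onto `ker τ` along the image of `s`.
  set κ : F →L[ℝ] F := ContinuousLinearMap.id ℝ F - s.comp τ with hκ
  have hκapp : ∀ f, κ f = f - s (τ f) := fun f => rfl
  have hτκ : ∀ f, τ (κ f) = 0 := fun f => by rw [hκapp, map_sub, hs, sub_self]
  have hκker : ∀ f, τ f = 0 → κ f = f := fun f hf => by rw [hκapp, hf, map_zero, sub_zero]
  set G : B → F →L[ℝ] F := fun b => (α b).comp τ + (P b).comp κ with hG
  have hGapp : ∀ b f, G b f = α b (τ f) + P b (κ f) := fun b f => rfl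
  have hG0 : G 0 = 1 := by
    ext f
    rw [hGapp, hα0, hP0, hκapp]
    simp
  -- shrink the neighbourhood
  obtain ⟨δ, hδ, hball⟩ : ∃ δ > 0, ∀ b ∈ Metric.ball (0 : B) δ,
      (b ∈ Metric.ball (0 : B) δ₁ ∧ b ∈ Metric.ball (0 : B) δ₂ ∧ b ∈ Metric.ball (0 : B) δ₃)
        ∧ IsUnit (G b) := by
    refine Metric.eventually_nhds_iff_ball.1 (Filter.Eventually.and ?_ ?_)
    · filter_upwards [Metric.ball_mem_nhds (0 : B) hδ₁, Metric.ball_mem_nhds (0 : B) hδ₂,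
        Metric.ball_mem_nhds (0 : B) hδ₃] with b h1 h2 h3 using ⟨h1, h2, h3⟩
    · have hGc : ContinuousAt G 0 :=
        ((hα.continuousOn.continuousAt (Metric.ball_mem_nhds _ hδ₁)).clm_comp
          continuousAt_const).add
          ((hP.continuousOn.continuousAt (Metric.ball_mem_nhds _ hδ₃)).clm_comp continuousAt_const)
      refine hGc.eventually_mem ((Units.isOpen (R := F →L[ℝ] F)).mem_nhds ?_)
      rw [hG0]
      exact isUnit_one
  set D := Metric.ball (0 : B) δ with hD
  have hDo : IsOpen D := Metric.isOpen_ball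
  have hD0 : (0 : B) ∈ D := Metric.mem_ball_self hδ
  have hDO : D ⊆ O := fun b hb => hsub₁ (hball b hb).1.1
  replace hα : ContDiffOn ℝ ∞ α D := hα.mono fun b hb => (hball b hb).1.1
  replace hP : ContDiffOn ℝ ∞ P D := hP.mono fun b hb => (hball b hb).1.2.2
  replace hrα : ∀ b ∈ D, ∀ X, r b (α b X) = X := fun b hb => hrα b (hball b hb).1.1
  have hunit : ∀ b ∈ D, IsUnit (G b) := fun b hb => (hball b hb).2
  replace h : IsLocalBianchi D Γ r := h.mono hDO
  replace hrad : ∀ b ∈ D, ∀ t ∈ Icc (0 : ℝ) 1,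
      fderiv ℝ P (t • b) b = -(Γ (t • b) b).comp (P (t • b)) := by
    intro b hb t ht
    have htb : t • b ∈ D := by
      simp only [hD, mem_ball_zero_iff] at hb ⊢
      rw [norm_smul, Real.norm_of_nonneg ht.1]
      exact (mul_le_of_le_one_left (norm_nonneg _) ht.2).trans_lt hb
    rw [heq (hball _ htb).1.2.1]
    exact hrad b (hball b hb).1.2.2 t ht
  have hPker : ∀ k, τ k = 0 → ∀ b ∈ D, r b (P b k) = 0 := fun k hk b hb =>
    h.map_transport_eq_zero hα hrα hP hP0 hrad hk hb
  have hPpar : ∀ k, τ k = 0 → ∀ b ∈ D, ∀ X, fderiv ℝ P b X k + Γ b X (P b k) = 0 :=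
    fun k hk b hb X => h.transport_parallel hP hrad (hPker k hk) hb X
  have hrG : ∀ b ∈ D, ∀ f, r b (G b f) = τ f := fun b hb f => by
    rw [hGapp, map_add, hrα b hb, hPker _ (hτκ f) b hb, add_zero]
  have hGs : ContDiffOn ℝ ∞ G D :=
    (hα.clm_comp contDiffOn_const).add (hP.clm_comp contDiffOn_const)
  have hGinj : ∀ b ∈ D, ∀ f, G b f = 0 → f = 0 := by
    intro b hb f hf
    have := DFunLike.congr_fun (Ring.inverse_mul_cancel _ (hunit b hb)) f
    have h2 : Ring.inverse (G b) (G b f) = f := this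
    rw [← h2, hf, map_zero]
  set Ω := localExtCovDeriv Γ α with hΩ
  have hΩs : ContDiffOn ℝ ∞ Ω D := contDiffOn_localExtCovDeriv hDo h.contDiffOn_conn hα
  have hinvs : ContDiffOn ℝ ∞ (fun b => Ring.inverse (G b)) D := by
    intro b hb
    obtain ⟨u, hu⟩ := hunit b hb
    have h3 : ContDiffAt ℝ ∞ (Ring.inverse (M₀ := F →L[ℝ] F)) (G b) := by
      rw [← hu]
      exact contDiffAt_ringInverse ℝ u
    exact (h3.comp b (hGs.contDiffAt (hDo.mem_nhds hb))).contDiffWithinAt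
  -- The components of `d^∇ α` in the frame `G`. As `d^∇ α` lies in `ker r`, they lie in `ker τ`,
  -- where `G` coincides with `P`.
  set η : B → B →L[ℝ] B →L[ℝ] F := fun b =>
    (ContinuousLinearMap.compL ℝ B F F (Ring.inverse (G b))).comp (Ω b) with hη
  have hηs : ContDiffOn ℝ ∞ η D :=
    contDiffOn_clm_apply.2 fun _ => contDiffOn_clm_apply.2 fun _ =>
      hinvs.clm_apply ((hΩs.clm_apply contDiffOn_const).clm_apply contDiffOn_const)
  have hGη : ∀ b ∈ D, ∀ X Y, G b (η b X Y) = Ω b X Y := fun b hb X Y =>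
    DFunLike.congr_fun (Ring.mul_inverse_cancel _ (hunit b hb)) (Ω b X Y)
  have hτη : ∀ b ∈ D, ∀ X Y, τ (η b X Y) = 0 := fun b hb X Y => by
    rw [← hrG b hb, hGη b hb, h.map_extCovDeriv hDo hα hrα hb]
  have hPη : ∀ b ∈ D, ∀ X Y, P b (η b X Y) = Ω b X Y := fun b hb X Y => by
    rw [← hGη b hb, hGapp, hτη b hb, hκker _ (hτη b hb X Y), map_zero, zero_add]
  have hanti : ∀ b ∈ D, ∀ X Y, η b X Y = -η b Y X := by
    intro b hb X Y
    have h1 : Ω b X Y = -Ω b Y X := by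
      simp only [hΩ, localExtCovDeriv_apply]
      abel
    change Ring.inverse (G b) (Ω b X Y) = -Ring.inverse (G b) (Ω b Y X)
    rw [h1, map_neg]
  -- In a parallel frame the ordinary derivative of the components is the covariant derivative, so
  -- `d^∇ d^∇ α = 0` means that `η` is closed.
  have hDη : ∀ b ∈ D, ∀ W X Y, G b (fderiv ℝ η b W X Y)
      = fderiv ℝ Ω b W X Y + Γ b W (Ω b X Y) := by
    intro b hb W X Y
    have hη' := hasFDerivAt_clm_apply₂_const (hηs.hasFDerivAt_of_isOpen hDo hb) X Y
    have h1 := (hP.hasFDerivAt_of_isOpen hDo hb).clm_apply hη'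
    have h2 : (fun b => P b (η b X Y)) =ᶠ[𝓝 b] fun b => Ω b X Y := by
      filter_upwards [hDo.mem_nhds hb] with z hz using hPη z hz X Y
    have h3 := DFunLike.congr_fun (h1.unique ((hasFDerivAt_clm_apply₂_const
      (hΩs.hasFDerivAt_of_isOpen hDo hb) X Y).congr_of_eventuallyEq h2)) W
    have h4 : τ (fderiv ℝ η b W X Y) = 0 := by
      have h5 : HasFDerivAt (fun b => τ (η b X Y)) _ b := τ.hasFDerivAt.comp b hη'
      have h6 : (fun b => τ (η b X Y)) =ᶠ[𝓝 b] fun b => 0 := by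
        filter_upwards [hDo.mem_nhds hb] with z hz using hτη z hz X Y
      exact DFunLike.congr_fun
        (h5.unique ((hasFDerivAt_const 0 b).congr_of_eventuallyEq h6)) W
    have h7 : P b (fderiv ℝ η b W X Y) + fderiv ℝ P b W (η b X Y) = fderiv ℝ Ω b W X Y := h3
    have h8 := hPpar _ (hτη b hb X Y) b hb W
    rw [hPη b hb] at h8
    rw [hGapp, h4, hκker _ h4, map_zero, zero_add, ← h7, add_assoc, h8, add_zero]
  obtain ⟨ε, hε, β, hsubε, hβ, hβη⟩ := exists_primitive hDo hD0 η hηs hanti (by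
    intro b hb W X Y
    refine hGinj b hb _ ?_
    rw [map_add, map_add, hDη b hb, hDη b hb, hDη b hb]
    exact h.extCovDeriv_extCovDeriv hDo hα hrα hb W X Y)
  -- the correction of the section `α`
  set β' : B → B →L[ℝ] F := fun b => κ.comp (β b) with hβ'
  have hβ's : ContDiff ℝ ∞ β' := contDiff_const.clm_comp hβ
  have hDβ' : ∀ b, ∀ X Y, fderiv ℝ β' b X Y = κ (fderiv ℝ β b X Y) := by
    intro b X Y
    have h1 : HasFDerivAt β' _ b :=
      (hasFDerivAt_const κ b).clm_comp (hβ.differentiable (by simp) b).hasFDerivAt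
    rw [h1.fderiv]
    simp
  have hτβ' : ∀ b X, τ (β' b X) = 0 := fun b X => hτκ _
  -- Expanded, `g = (α - P ∘ β') ∘ τ + P ∘ κ`: the section `α` is corrected by a form with values in
  -- `ker r`, so `r ∘ g` is still `τ`.
  set g : B → F →L[ℝ] F := fun b => (G b).comp (ContinuousLinearMap.id ℝ F - (β' b).comp τ) with hg
  have hgapp : ∀ b f, g b f = G b (f - β' b (τ f)) := fun b f => rfl
  have hgs : ContDiffOn ℝ ∞ g D :=
    hGs.clm_comp (contDiffOn_const.sub (hβ's.contDiffOn.clm_comp contDiffOn_const))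
  refine ⟨ε, hε, s, g, hsubε.trans hDO, hgs.mono hsubε, hs, fun b hbε => ?_⟩
  have hb := hsubε hbε
  refine ⟨?_, fun f => ?_, ?_⟩
  -- Since `τ ∘ β' = 0`, the endomorphism `β' ∘ τ` has square zero, and `1 + β' ∘ τ` is the inverse.
  · have h1 : IsUnit (ContinuousLinearMap.id ℝ F - (β' b).comp τ) := by
      refine ⟨⟨ContinuousLinearMap.id ℝ F - (β' b).comp τ,
        ContinuousLinearMap.id ℝ F + (β' b).comp τ, ?_, ?_⟩, rfl⟩ <;>
      · ext f
        simp [hτβ']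
    exact (hunit b hb).mul h1
  · rw [hgapp, hrG b hb, map_sub, hτβ', sub_zero]
  -- The part of `g` in `ker τ` is parallel and does not contribute. Antisymmetrizing the rest gives
  -- `d^∇ α - G (dβ')`, which vanishes because `dβ' = η`.
  · have hDg : ∀ X f, fderiv ℝ g b X f + Γ b X (g b f) =
        localCovDeriv Γ α b X (τ f) - G b (fderiv ℝ β' b X (τ f)) := by
      intro X f
      have h1 := hasFDerivAt_clm_apply_const (hgs.hasFDerivAt_of_isOpen hDo hb) f
      have hβd := (hβ's.differentiable (by simp) b).hasFDerivAt
      have h2 := (hGs.hasFDerivAt_of_isOpen hDo hb).clm_apply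
        ((hasFDerivAt_const f b).sub (hasFDerivAt_clm_apply_const hβd (τ f)))
      have h3 : fderiv ℝ g b X f = _ := DFunLike.congr_fun (h1.unique h2) X
      have h4 : ∀ f, fderiv ℝ G b X f = fderiv ℝ α b X (τ f) + fderiv ℝ P b X (κ f) := by
        intro f
        have h5 := hasFDerivAt_clm_apply_const (hGs.hasFDerivAt_of_isOpen hDo hb) f
        have h6 := (hasFDerivAt_clm_apply_const (hα.hasFDerivAt_of_isOpen hDo hb) (τ f)).add
          (hasFDerivAt_clm_apply_const (hP.hasFDerivAt_of_isOpen hDo hb) (κ f))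
        exact DFunLike.congr_fun (h5.unique h6) X
      have h7 : fderiv ℝ g b X f = -G b (fderiv ℝ β' b X (τ f))
          + fderiv ℝ G b X (f - β' b (τ f)) := by
        rw [h3]
        simp
      have h8 := hPpar _ (hτκ (f - β' b (τ f))) b hb X
      rw [h7, h4, hgapp, hGapp b (f - β' b (τ f)), map_add, map_sub τ, hτβ', sub_zero,
        localCovDeriv_apply]
      rw [eq_neg_of_add_eq_zero_left h8]
      abel
    intro X Y
    rw [hDg, hDg, ← sub_eq_zero]
    have h1 : Ω b (τ X) (τ Y) = localCovDeriv Γ α b (τ X) (τ Y)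
        - localCovDeriv Γ α b (τ Y) (τ X) := rfl
    have h2 : G b (fderiv ℝ β' b (τ X) (τ Y)) - G b (fderiv ℝ β' b (τ Y) (τ X))
        = Ω b (τ X) (τ Y) := by
      rw [← map_sub, hDβ', hDβ', ← map_sub, hβη b hbε, hκker _ (hτη b hb _ _), hGη b hb]
    rw [← sub_eq_zero.2 (h2.trans h1).symm]
    abel

lemma translate (h : IsLocalBianchi O Γ r) (b₀ : B) :
    IsLocalBianchi ((fun b => b + b₀) ⁻¹' O) (fun b => Γ (b + b₀)) (fun b => r (b + b₀)) where
  contDiffOn_conn := h.contDiffOn_conn.comp (by fun_prop) fun _ hb => hb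
  contDiffOn_map := h.contDiffOn_map.comp (by fun_prop) fun _ hb => hb
  surjective := fun b hb => h.surjective _ hb
  torsion := fun b hb f₁ f₂ => by
    simpa only [fderiv_comp_add_right] using h.torsion _ hb f₁ f₂
  bianchi := fun b hb f₁ f₂ f₃ => by
    have h1 : fderiv ℝ (fun b => Γ (b + b₀)) b = fderiv ℝ Γ (b + b₀) :=
      fderiv_translate Γ b₀ b
    simpa only [localCurvature, h1] using h.bianchi _ hb f₁ f₂ f₃

/-- Near any point, there is an isomorphism `g` from the trivial bundle with fibre `F` to itself
which is closed with respect to the connection `d + Γ`, pulled back to `F`, and such that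
`r ∘ g` is constant. -/
theorem exists_closed_frame (h : IsLocalBianchi O Γ r) (hO : IsOpen O) {b₀ : B} (h0 : b₀ ∈ O) :
    ∃ (O' : Set B) (s : B →L[ℝ] F) (g : B → F →L[ℝ] F), IsOpen O' ∧ b₀ ∈ O' ∧ O' ⊆ O ∧
      ContDiffOn ℝ ∞ g O' ∧ (∀ X, r b₀ (s X) = X) ∧
      ∀ b ∈ O', IsUnit (g b) ∧ (∀ f, r b (g b f) = r b₀ f) ∧
        ∀ X Y, fderiv ℝ g b (r b₀ X) Y + Γ b (r b₀ X) (g b Y)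
          = fderiv ℝ g b (r b₀ Y) X + Γ b (r b₀ Y) (g b X) := by
  obtain ⟨δ, hδ, s, g, hsub, hg, hs, hprop⟩ := (h.translate b₀).exists_closed_frame_zero
    (hO.preimage (by fun_prop)) (by simpa using h0)
  simp only [zero_add] at hs hprop
  have hmem : ∀ b ∈ Metric.ball b₀ δ, b - b₀ ∈ Metric.ball (0 : B) δ := fun b hb => by
    simpa [dist_eq_norm] using hb
  refine ⟨Metric.ball b₀ δ, s, fun b => g (b - b₀), Metric.isOpen_ball, Metric.mem_ball_self hδ,
    fun b hb => by simpa using hsub (hmem b hb), hg.comp (by fun_prop) hmem, hs, fun b hb => ?_⟩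
  have h1 := hprop _ (hmem b hb)
  simp only [sub_add_cancel] at h1
  simpa only [fderiv_comp_sub] using h1

end IsLocalBianchi

end Coordinates

end CoCR

end

noncomputable section

set_option linter.unusedSectionVars false

namespace CoCR
/-! ### The Lie algebra of `Sp(1)·GL(k,ℍ)` -/

section QuaternionAlgebra

variable {k : ℕ}

/-- The left multiplication by a quaternion, on `ℍ^k`. -/
def lmul (q : ℍ[ℝ]) : HVec k →L[ℝ] HVec k :=
  LinearMap.toContinuousLinearMap
    { toFun := fun x => q • x
      map_add' := fun x y => smul_add q x y
      map_smul' := fun c x => smul_comm q c x }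

@[simp]
lemma lmul_apply (q : ℍ[ℝ]) (x : HVec k) : lmul q x = q • x := rfl

variable (k) in
/-- The left multiplication by quaternions, as a linear map. -/
def lmulₗ : ℍ[ℝ] →ₗ[ℝ] (HVec k →L[ℝ] HVec k) where
  toFun := lmul
  map_add' p q := by
    ext x : 1
    exact add_smul p q x
  map_smul' c q := by
    ext x : 1
    exact smul_assoc c q x

variable (k) in
/-- The space of left multiplications by imaginary quaternions. -/
def imMul : Submodule ℝ (HVec k →L[ℝ] HVec k) where
  carrier := {T | ∃ q : ℍ[ℝ], q.re = 0 ∧ T = lmul q}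
  add_mem' := by
    rintro _ _ ⟨p, hp, rfl⟩ ⟨q, hq, rfl⟩
    exact ⟨p + q, by simp [hp, hq], (map_add (lmulₗ k) p q).symm⟩
  zero_mem' := ⟨0, rfl, (map_zero (lmulₗ k)).symm⟩
  smul_mem' := by
    rintro c _ ⟨q, hq, rfl⟩
    exact ⟨c • q, by simp [hq], (map_smul (lmulₗ k) c q).symm⟩

lemma mem_imMul {T : HVec k →L[ℝ] HVec k} : T ∈ imMul k ↔ ∃ q : ℍ[ℝ], q.re = 0 ∧ T = lmul q :=
  Iff.rfl

variable (k) in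
/-- The normalizer of the space of left multiplications by imaginary quaternions; this is the Lie
algebra of `Sp(1)·GL(k,ℍ)`. -/
def imNormalizer : Submodule ℝ (HVec k →L[ℝ] HVec k) where
  carrier := {T | ∀ i ∈ imMul k, T.comp i - i.comp T ∈ imMul k}
  add_mem' := by
    intro S T hS hT i hi
    have := add_mem (hS i hi) (hT i hi)
    convert this using 1
    ext x : 1
    simp
    abel
  zero_mem' := by
    intro i _
    have : (0 : HVec k →L[ℝ] HVec k).comp i - i.comp (0 : HVec k →L[ℝ] HVec k) = 0 := by simp
    rw [this]
    exact zero_mem _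
  smul_mem' := by
    intro c T hT i hi
    have := Submodule.smul_mem _ c (hT i hi)
    convert this using 1
    ext x : 1
    simp [smul_sub]

/-- The normalizer is closed under the bracket. -/
lemma bracket_mem_imNormalizer {S T : HVec k →L[ℝ] HVec k} (hS : S ∈ imNormalizer k)
    (hT : T ∈ imNormalizer k) : S.comp T - T.comp S ∈ imNormalizer k := by
  intro i hi
  have := sub_mem (hS _ (hT i hi)) (hT _ (hS i hi))
  convert this using 1
  ext x : 1
  simp
  abel

/-- Right multiplication by a matrix commutes with left multiplications, so only the commutator of
two imaginary quaternions remains, and it is imaginary. -/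
lemma mem_imNormalizer_of_form {T : HVec k →L[ℝ] HVec k} {a : ℍ[ℝ]}
    {C : Matrix (Fin k) (Fin k) ℍ[ℝ]} (hT : ∀ q : HVec k, T q = a • q + q ᵥ* C) :
    T ∈ imNormalizer k := by
  rintro _ ⟨i, hi, rfl⟩
  refine ⟨a * i - i * a, by simp [Quaternion.re_mul]; ring, ?_⟩
  ext x : 1
  simp only [sub_apply, ContinuousLinearMap.comp_apply, lmul_apply, hT, smul_add,
    Matrix.smul_vecMul, sub_smul, mul_smul]
  abel

/-- The quaternion with the given components. -/
def quat (a b c d : ℝ) : ℍ[ℝ] := ⟨a, b, c, d⟩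

@[simp]
lemma quat_re (a b c d : ℝ) : (quat a b c d).re = a := rfl

@[simp]
lemma quat_imI (a b c d : ℝ) : (quat a b c d).imI = b := rfl

@[simp]
lemma quat_imJ (a b c d : ℝ) : (quat a b c d).imJ = c := rfl

@[simp]
lemma quat_imK (a b c d : ℝ) : (quat a b c d).imK = d := rfl

/-- The conditions say that `i ↦ d₁`, `j ↦ d₂` is an infinitesimal rotation: `d₁ ⊥ i`, `d₂ ⊥ j`, and
the mixed inner products are opposite. Such a rotation is the commutator with half its axis. -/
lemma imaginary_derivation_inner {d₁ d₂ : ℍ[ℝ]} (h₁ : d₁.re = 0) (h₂ : d₂.re = 0)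
    (h₃ : d₁.imI = 0) (h₄ : d₂.imJ = 0) (h₅ : d₁.imJ + d₂.imI = 0) :
    ∃ a : ℍ[ℝ], a.re = 0 ∧ a * quat 0 1 0 0 - quat 0 1 0 0 * a = d₁ ∧
      a * quat 0 0 1 0 - quat 0 0 1 0 * a = d₂ := by
  refine ⟨quat 0 (d₂.imK / 2) (-d₁.imK / 2) (d₁.imJ / 2), rfl, ?_, ?_⟩
  · ext <;> simp [h₁, h₃] <;> ring
  · ext <;> simp [h₂, h₄] <;> linarith

lemma lmul_injective (hk : 0 < k) : Function.Injective (lmul : ℍ[ℝ] → HVec k →L[ℝ] HVec k) := by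
  intro p q h
  have := congrFun (DFunLike.congr_fun h (fun _ => 1)) ⟨0, hk⟩
  simpa using this

/-- The commutator with `T` acts on imaginary quaternions as a derivation. The relations `i² = j² =
-1` and `ij = l` make it an infinitesimal rotation, so it is the commutator with some `a`; the
difference of `T` and left multiplication by `a` is `ℍ`-linear, and so it is given by a matrix on
the right. -/
lemma exists_form_of_mem_imNormalizer (hk : 0 < k) {T : HVec k →L[ℝ] HVec k}
    (hT : T ∈ imNormalizer k) : ∃ (a : ℍ[ℝ]) (C : Matrix (Fin k) (Fin k) ℍ[ℝ]), a.re = 0 ∧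
      ∀ q : HVec k, T q = a • q + q ᵥ* C := by
  set i : ℍ[ℝ] := quat 0 1 0 0 with hi
  set j : ℍ[ℝ] := quat 0 0 1 0 with hj
  set l : ℍ[ℝ] := quat 0 0 0 1 with hl
  have hij : i * j = l := by ext <;> simp [hi, hj, hl]
  have hii : i * i = -1 := by ext <;> simp [hi]
  have hjj : j * j = -1 := by ext <;> simp [hj]
  obtain ⟨d₁, hd₁, hT₁⟩ := hT (lmul i) ⟨i, rfl, rfl⟩
  obtain ⟨d₂, hd₂, hT₂⟩ := hT (lmul j) ⟨j, rfl, rfl⟩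
  obtain ⟨d₃, hd₃, hT₃⟩ := hT (lmul l) ⟨l, rfl, rfl⟩
  have e₁ : ∀ x, T (i • x) = i • T x + d₁ • x := fun x => by
    have := DFunLike.congr_fun hT₁ x
    simp only [sub_apply, ContinuousLinearMap.comp_apply, lmul_apply] at this
    rw [← this]
    abel
  have e₂ : ∀ x, T (j • x) = j • T x + d₂ • x := fun x => by
    have := DFunLike.congr_fun hT₂ x
    simp only [sub_apply, ContinuousLinearMap.comp_apply, lmul_apply] at this
    rw [← this]
    abel
  have e₃ : ∀ x, T (l • x) = l • T x + d₃ • x := fun x => by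
    have := DFunLike.congr_fun hT₃ x
    simp only [sub_apply, ContinuousLinearMap.comp_apply, lmul_apply] at this
    rw [← this]
    abel
  have hzero : ∀ q : ℍ[ℝ], (∀ x : HVec k, q • x = 0) → q = 0 := fun q hq => by
    refine lmul_injective hk ?_
    ext x : 1
    simp [hq]
  have r₁ : i * d₁ + d₁ * i = 0 := hzero _ fun x => by
    have h := e₁ (i • x)
    rw [← mul_smul, hii, e₁, neg_smul, one_smul, map_neg, smul_add, ← mul_smul i i, hii] at h
    simp only [neg_smul, one_smul, ← mul_smul] at h
    rw [add_smul]
    have h2 : -T x + ((i * d₁) • x + (d₁ * i) • x) = -T x + 0 := by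
      rw [add_zero, ← add_assoc]
      exact h.symm
    exact add_left_cancel h2
  have r₂ : j * d₂ + d₂ * j = 0 := hzero _ fun x => by
    have h := e₂ (j • x)
    rw [← mul_smul, hjj, e₂, neg_smul, one_smul, map_neg, smul_add, ← mul_smul j j, hjj] at h
    simp only [neg_smul, one_smul, ← mul_smul] at h
    rw [add_smul]
    have h2 : -T x + ((j * d₂) • x + (d₂ * j) • x) = -T x + 0 := by
      rw [add_zero, ← add_assoc]
      exact h.symm
    exact add_left_cancel h2
  have r₃ : i * d₂ + d₁ * j - d₃ = 0 := hzero _ fun x => by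
    have h := e₁ (j • x)
    rw [← mul_smul, hij, e₂, e₃, smul_add, ← mul_smul i j, hij] at h
    simp only [← mul_smul] at h
    rw [add_assoc] at h
    rw [sub_smul, add_smul, ← add_left_cancel h, sub_self]
  have s₁ := congrArg QuaternionAlgebra.re r₁
  have s₂ := congrArg QuaternionAlgebra.re r₂
  have s₃ := congrArg QuaternionAlgebra.re r₃
  simp [hi, hj, hd₁, hd₂, hd₃] at s₁ s₂ s₃
  obtain ⟨a, ha, ha₁, ha₂⟩ := imaginary_derivation_inner hd₁ hd₂ (by linarith) (by linarith)
    (by linarith)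
  set S : HVec k →L[ℝ] HVec k := T - lmul a with hS
  have hSapp : ∀ x, S x = T x - a • x := fun x => rfl
  have f₁ : ∀ x, S (i • x) = i • S x := fun x => by
    rw [hSapp, hSapp, e₁, ← ha₁, smul_sub, sub_smul, ← mul_smul, ← mul_smul]
    abel
  have f₂ : ∀ x, S (j • x) = j • S x := fun x => by
    rw [hSapp, hSapp, e₂, ← ha₂, smul_sub, sub_smul, ← mul_smul, ← mul_smul]
    abel
  have f : ∀ (q : ℍ[ℝ]) x, S (q • x) = q • S x := by
    intro q x
    have hq : q = q.re • 1 + q.imI • i + q.imJ • j + q.imK • (i * j) := by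
      ext <;> simp [hi, hj]
    rw [hq]
    simp only [add_smul, map_add, smul_assoc, map_smul, one_smul, mul_smul, f₁, f₂]
  -- Row `m` of the matrix is the image under the `ℍ`-linear part of the `m`-th basis vector.
  refine ⟨a, fun m n => S (Pi.single m 1) n, ha, fun q => ?_⟩
  have hq : q = ∑ m, q m • (Pi.single m 1 : HVec k) := by
    ext1 n
    simp [Finset.sum_apply, Pi.single_apply]
  have h1 : S q = q ᵥ* fun m n => S (Pi.single m 1) n := by
    conv_lhs => rw [hq]
    ext1 n
    simp only [map_sum, f, Finset.sum_apply, Pi.smul_apply, smul_eq_mul]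
    rfl
  rw [← h1, hSapp]
  abel

/-- The elements of `Sp(1)·GL(k,ℍ)` normalize the space of left multiplications. -/
lemma comp_lmul_of_mem_quaternionicGroup {g : HVec k ≃L[ℝ] HVec k} (hg : g ∈ quaternionicGroup k)
    (i : ℍ[ℝ]) (hi : i.re = 0) : ∃ i' : ℍ[ℝ], i'.re = 0 ∧ ‖i'‖ = ‖i‖ ∧
      ∀ q, g (i • q) = i' • g q := by
  obtain ⟨a, A, ha, hgA⟩ := hg
  have ha0 : a ≠ 0 := by
    rintro rfl
    simp at ha
  refine ⟨a * i * a⁻¹, ?_, ?_, fun q => ?_⟩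
  · have h1 : (a * i * a⁻¹).re = (a⁻¹ * (a * i)).re := by
      simp only [Quaternion.re_mul]
      ring
    rw [h1, ← mul_assoc, inv_mul_cancel₀ ha0, one_mul, hi]
  · simp [norm_mul, norm_inv, ha]
  · rw [hgA, hgA, Matrix.smul_vecMul]
    simp only [← mul_smul]
    rw [mul_assoc (a * i), inv_mul_cancel₀ ha0, mul_one]

/-! ### Algebraic consequences of the first Bianchi identity -/

lemma eq_zero_of_mul_re_eq_zero {p : ℍ[ℝ]} (h : ∀ q : ℍ[ℝ], (p * q).re = 0) : p = 0 := by
  have := h (star p)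
  rw [Quaternion.self_mul_star] at this
  exact Quaternion.normSq_eq_zero.1 (by simpa using this)

/-- If `a`, `b` lie in one coordinate line, a third vector in another line isolates `t a b` in the
cyclic identity; this needs `k ≥ 2`. If they lie in different lines, the identity gives `t(p, q) p'
= t(p', q) p`. With `p = 1` it shows that all products `t(1, q) p'` are imaginary, so `t(1, q) = 0`,
and with `p' = 1` everything vanishes. -/
lemma imaginary_form_eq_zero (hk : 2 ≤ k) (t : HVec k →+ HVec k →+ ℍ[ℝ])
    (hre : ∀ a b, (t a b).re = 0) (hanti : ∀ a b, t a b = -t b a)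
    (hcyc : ∀ a b c, t a b • c + t b c • a + t c a • b = 0) (a b : HVec k) : t a b = 0 := by
  have hsame : ∀ (m : Fin k) (p q : ℍ[ℝ]), t (Pi.single m p) (Pi.single m q) = 0 := by
    intro m p q
    obtain ⟨n, hn⟩ : ∃ n : Fin k, n ≠ m := by
      have : Nontrivial (Fin k) := Fin.nontrivial_iff_two_le.2 hk
      exact exists_ne m
    have := congrFun (hcyc (Pi.single m p) (Pi.single m q) (Pi.single n 1)) n
    simpa [hn] using this
  have hdiff : ∀ (m n : Fin k), m ≠ n → ∀ p q : ℍ[ℝ],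
      t (Pi.single m p) (Pi.single n q) = 0 := by
    intro m n hmn p q
    have h1 : ∀ p p', t (Pi.single m p) (Pi.single n q) * p'
        = t (Pi.single m p') (Pi.single n q) * p := by
      intro p p'
      have := congrFun (hcyc (Pi.single m p) (Pi.single n q) (Pi.single m p')) m
      simp [hmn, hanti (Pi.single n q) (Pi.single m p')] at this
      rwa [← sub_eq_add_neg, sub_eq_zero] at this
    have h2 : t (Pi.single m 1) (Pi.single n q) = 0 := by
      refine eq_zero_of_mul_re_eq_zero fun p => ?_
      rw [h1 1 p, mul_one]
      exact hre _ _
    have h3 := h1 p 1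
    rwa [h2, zero_mul, mul_one] at h3
  have hsum : ∀ a : HVec k, a = ∑ m, Pi.single m (a m) := fun a =>
    (Finset.univ_sum_single a).symm
  rw [hsum a, hsum b]
  simp only [map_sum, AddMonoidHom.finsetSum_apply]
  refine Finset.sum_eq_zero fun m _ => Finset.sum_eq_zero fun n _ => ?_
  by_cases hmn : n = m
  · subst hmn
    exact hsame _ _ _
  · exact hdiff _ _ hmn _ _

/-- The `(0,2)`-part, with respect to any admissible complex structure, of a curvature tensor which
satisfies the first Bianchi identity, preserves the complex structure. -/
lemma curvature_type (hk : 2 ≤ k) (R : HVec k →ₗ[ℝ] HVec k →ₗ[ℝ] (HVec k →L[ℝ] HVec k))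
    (hR : ∀ a b, R a b ∈ imNormalizer k) (hanti : ∀ a b, R a b = -R b a)
    (hcyc : ∀ a b c, R a b c + R b c a + R c a b = 0) {j : HVec k →L[ℝ] HVec k}
    (hj : j ∈ imMul k) (hjj : ∀ x, j (j x) = -x) (a b : HVec k) :
    (R a (j b) + R (j a) b).comp j - j.comp (R a (j b) + R (j a) b)
      = j.comp ((R a b - R (j a) (j b)).comp j - j.comp (R a b - R (j a) (j b))) := by
  -- The defect of the desired identity. It is left multiplication by an imaginary quaternion
  -- depending on `a`, `b`, so it suffices to verify the hypotheses of `imaginary_form_eq_zero`.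
  set T : HVec k → HVec k → HVec k →L[ℝ] HVec k := fun a b =>
    ((R a (j b) + R (j a) b).comp j - j.comp (R a (j b) + R (j a) b))
      - j.comp ((R a b - R (j a) (j b)).comp j - j.comp (R a b - R (j a) (j b))) with hT
  have hTapp : ∀ a b x, T a b x = R a (j b) (j x) + R (j a) b (j x)
      - (j (R a (j b) x) + j (R (j a) b x)) - (j (R a b (j x)) - j (R (j a) (j b) (j x))
        + (R a b x - R (j a) (j b) x)) := by
    intro a b x
    simp [hT, hjj]
    abel
  have hTim : ∀ a b, T a b ∈ imMul k := by
    intro a b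
    obtain ⟨q, hq, rfl⟩ := hj
    have h1 := add_mem (hR a (lmul q b)) (hR (lmul q a) b) _ ⟨q, hq, rfl⟩
    have h2 := sub_mem (hR a b) (hR (lmul q a) (lmul q b)) _ ⟨q, hq, rfl⟩
    refine sub_mem h1 ?_
    -- the product of `q` with an imaginary quaternion which anticommutes with `q` is imaginary
    set U := R a b - R (lmul q a) (lmul q b) with hU
    obtain ⟨p, hp, hp'⟩ := h2
    have hk' : 0 < k := by omega
    have hanti' : q * p + p * q = 0 := by
      refine lmul_injective hk' ?_
      ext x : 1
      have h3 := DFunLike.congr_fun hp' (lmul q x)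
      have h4 := DFunLike.congr_fun hp' x
      simp only [sub_apply, ContinuousLinearMap.comp_apply, hjj, map_neg] at h3 h4
      simp only [lmul_apply, add_smul, mul_smul, zero_smul] at h3 h4 ⊢
      rw [← h3, ← h4]
      have h5 : q • q • U x = -U x := hjj (U x)
      rw [smul_sub, h5]
      abel
    refine ⟨q * p, ?_, ?_⟩
    · have h6 := congrArg QuaternionAlgebra.re hanti'
      simp at h6 ⊢
      linarith
    · rw [hp']
      ext x : 1
      simp [mul_smul]
  have hk' : 0 < k := by omega
  -- Evaluation at a vector whose entries are `1` recovers the quaternion from its left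
  -- multiplication.
  set e : HVec k := fun _ => 1 with he
  let t : HVec k →+ HVec k →+ ℍ[ℝ] := AddMonoidHom.mk' (fun a =>
      AddMonoidHom.mk' (fun b => T a b e ⟨0, hk'⟩) (by
        intro b b'
        simp only [hTapp, map_add, add_apply, Pi.add_apply, Pi.sub_apply]
        abel)) (by
      intro a a'
      refine AddMonoidHom.ext fun b => ?_
      simp only [AddMonoidHom.mk'_apply, hTapp, map_add, add_apply, Pi.add_apply, Pi.sub_apply,
        LinearMap.add_apply, AddMonoidHom.add_apply]
      abel)
  have htapp : ∀ a b, t a b = T a b e ⟨0, hk'⟩ := fun a b => rfl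
  have htT : ∀ a b, T a b = lmul (t a b) ∧ (t a b).re = 0 := by
    intro a b
    obtain ⟨q, hq, hq'⟩ := hTim a b
    have : t a b = q := by
      rw [htapp, hq']
      simp [he]
    rw [this]
    exact ⟨hq', hq⟩
  have h0 : t a b = 0 := by
    refine imaginary_form_eq_zero hk t (fun a b => (htT a b).2) (fun a b => ?_) (fun a b c => ?_)
      a b
    · have : T a b = -T b a := by
        ext1 x
        rw [neg_apply, hTapp, hTapp, hanti b (j a), hanti (j b) a, hanti b a, hanti (j b) (j a)]
        simp only [neg_apply, map_neg]
        abel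
      rw [htapp, htapp, this]
      rfl
    · have h1 : ∀ a b c, t a b • c = T a b c := fun a b c => by
        rw [(htT a b).1, lmul_apply]
      rw [h1, h1, h1]
      have hj' : ∀ a b c, j (R a b c) + j (R b c a) + j (R c a b) = 0 := fun a b c => by
        rw [← map_add, ← map_add, hcyc, map_zero]
      -- The cyclic sum of `T` splits into eight Bianchi sums, one for each way of applying `j` to
      -- some of the three arguments.
      calc _ = -(R a b c + R b c a + R c a b)
            + (R (j a) (j b) c + R (j b) c (j a) + R c (j a) (j b))
            + (R (j b) (j c) a + R (j c) a (j b) + R a (j b) (j c))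
            + (R (j c) (j a) b + R (j a) b (j c) + R b (j c) (j a))
            - (j (R a b (j c)) + j (R b (j c) a) + j (R (j c) a b))
            - (j (R b c (j a)) + j (R c (j a) b) + j (R (j a) b c))
            - (j (R c a (j b)) + j (R a (j b) c) + j (R (j b) c a))
            + (j (R (j a) (j b) (j c)) + j (R (j b) (j c) (j a)) + j (R (j c) (j a) (j b))) := by
              simp only [hTapp]
              abel
        _ = 0 := by
          simp only [hcyc, hj']
          simp
  have := (htT a b).1
  rw [h0] at this
  have h1 : T a b = 0 := by
    rw [this]
    exact map_zero (lmulₗ k)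
  exact sub_eq_zero.1 h1

end QuaternionAlgebra

end CoCR

end

noncomputable section

set_option synthInstance.maxHeartbeats 200000
set_option linter.unusedSectionVars false

namespace CoCR
/-! ### Torsion free quaternionic connections in coordinates -/

section TorsionFree

open Topology Filter

variable {F : Type*} [NormedAddCommGroup F] [NormedSpace ℝ F] [FiniteDimensional ℝ F] {k : ℕ}

/-- The difference quotients lie in `S`, which is closed as its ambient space is finite-dimensional.
-/
lemma mem_of_hasDerivAt {G : Type*} [NormedAddCommGroup G] [NormedSpace ℝ G]
    [FiniteDimensional ℝ G] (S : Submodule ℝ G) {f : ℝ → G} {f' : G} {t₀ : ℝ}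
    (hf : HasDerivAt f f' t₀) (hS : ∀ᶠ t in 𝓝 t₀, f t ∈ S) : f' ∈ S := by
  have h1 := hasDerivAt_iff_tendsto_slope.1 hf
  refine S.closed_of_finiteDimensional.mem_of_tendsto h1 ?_
  filter_upwards [nhdsWithin_le_nhds hS] with t ht
  exact S.smul_mem _ (S.sub_mem ht hS.self_of_nhds)

lemma hasDerivAt_linearMap_comp {G G' : Type*} [NormedAddCommGroup G] [NormedSpace ℝ G]
    [FiniteDimensional ℝ G] [NormedAddCommGroup G'] [NormedSpace ℝ G'] (L : G →ₗ[ℝ] G')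
    {f : ℝ → G} {f' : G} {t : ℝ} (hf : HasDerivAt f f' t) :
    HasDerivAt (fun t => L (f t)) (L f') t :=
  L.toContinuousLinearMap.hasFDerivAt.comp_hasDerivAt t hf

lemma hasDerivAt_lmul {q : ℝ → ℍ[ℝ]} {q' : ℍ[ℝ]} {t : ℝ} (hq : HasDerivAt q q' t) :
    HasDerivAt (fun t => (lmul (q t) : HVec k →L[ℝ] HVec k)) (lmul q') t := by
  have := hasDerivAt_linearMap_comp (G := ℍ[ℝ]) (G' := HVec k →L[ℝ] HVec k) (lmulₗ k) hq
  exact this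

/-- The endomorphisms of `F` which, in the frame `h` with inverse `hi`, are left multiplications by
imaginary quaternions. -/
def frameIm (h : HVec k →L[ℝ] F) (hi : F →L[ℝ] HVec k) : Submodule ℝ (F →L[ℝ] F) where
  carrier := {T | hi.comp (T.comp h) ∈ imMul k}
  add_mem' := by
    intro S T hS hT
    simpa only [Set.mem_ofPred_eq, ContinuousLinearMap.add_comp, ContinuousLinearMap.comp_add]
      using add_mem hS hT
  zero_mem' := by
    simp only [Set.mem_ofPred_eq, ContinuousLinearMap.zero_comp, ContinuousLinearMap.comp_zero]
    exact zero_mem _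
  smul_mem' := by
    intro c T hT
    simpa only [Set.mem_ofPred_eq, ContinuousLinearMap.smul_comp, ContinuousLinearMap.comp_smul]
      using Submodule.smul_mem _ c hT

lemma mem_frameIm {h : HVec k →L[ℝ] F} {hi : F →L[ℝ] HVec k} {T : F →L[ℝ] F} :
    T ∈ frameIm h hi ↔ hi.comp (T.comp h) ∈ imMul k := Iff.rfl

lemma mem_frameIm_iff {h : HVec k →L[ℝ] F} {hi : F →L[ℝ] HVec k} (hl : ∀ v, hi (h v) = v)
    (hr : ∀ f, h (hi f) = f) {T : F →L[ℝ] F} :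
    T ∈ frameIm h hi ↔ ∃ q : ℍ[ℝ], q.re = 0 ∧ ∀ v, T (h v) = h (q • v) := by
  rw [mem_frameIm, mem_imMul]
  refine exists_congr fun q => and_congr_right fun _ => ⟨fun H v => ?_, fun H => ?_⟩
  · rw [← hr (T (h v))]
    exact congrArg h (DFunLike.congr_fun H v)
  · ext x : 1
    simp [H, hl]

/-- The part `P + [Γ(X), J]` of the vector `(X, P)` tangent at `(y, J)` to the bundle of
endomorphisms which is vertical with respect to the connection `d + Γ`. -/
def vertPart (Γ : F → F →L[ℝ] F →L[ℝ] F) (w ξ : F × (F →L[ℝ] F)) : F →L[ℝ] F :=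
  ξ.2 + (Γ w.1 ξ.1).comp w.2 - w.2.comp (Γ w.1 ξ.1)

@[simp]
lemma vertPart_apply (Γ : F → F →L[ℝ] F →L[ℝ] F) (w ξ : F × (F →L[ℝ] F)) (v : F) :
    vertPart Γ w ξ v = ξ.2 v + Γ w.1 ξ.1 (w.2 v) - w.2 (Γ w.1 ξ.1 v) := rfl

/-- A torsion free connection `d + Γ` on the trivial bundle `TV`, together with a global frame `h`,
with inverse `hi`, in which the connection form is quaternionic. -/
structure IsQuaternionicFrame (V : Set F) (Γ : F → F →L[ℝ] F →L[ℝ] F) (h : F → HVec k →L[ℝ] F)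
    (hi : F → F →L[ℝ] HVec k) : Prop where
  contDiffOn_conn : ContDiffOn ℝ ∞ Γ V
  symm : ∀ y ∈ V, ∀ X Y, Γ y X Y = Γ y Y X
  contDiffOn_frame : ContDiffOn ℝ ∞ h V
  contDiffOn_inv : ContDiffOn ℝ ∞ hi V
  inv_frame : ∀ y ∈ V, ∀ v, hi y (h y v) = v
  frame_inv : ∀ y ∈ V, ∀ f, h y (hi y f) = f
  connForm_mem : ∀ y ∈ V, ∀ X,
    (hi y).comp (fderiv ℝ h y X + (Γ y X).comp (h y)) ∈ imNormalizer k

/-- The bundle of admissible linear complex structures. -/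
def frameTwistor (V : Set F) (h : F → HVec k →L[ℝ] F) (hi : F → F →L[ℝ] HVec k) :
    Set (F × (F →L[ℝ] F)) :=
  {w | w.1 ∈ V ∧ ∃ q : ℍ[ℝ], q.re = 0 ∧ ‖q‖ = 1 ∧ w.2 = (h w.1).comp ((lmul q).comp (hi w.1))}

/-- The vectors tangent to the bundle of admissible linear complex structures. -/
def frameTangent (Γ : F → F →L[ℝ] F →L[ℝ] F) (h : F → HVec k →L[ℝ] F)
    (hi : F → F →L[ℝ] HVec k) (w : F × (F →L[ℝ] F)) : Set (F × (F →L[ℝ] F)) :=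
  {ξ | vertPart Γ w ξ ∈ frameIm (h w.1) (hi w.1) ∧
    ∀ v, vertPart Γ w ξ (w.2 v) = -w.2 (vertPart Γ w ξ v)}

lemma quaternion_mul_self {q : ℍ[ℝ]} (hre : q.re = 0) (hq : ‖q‖ = 1) : q * q = -1 := by
  have h1 : star q = -q := by
    ext <;> simp [hre]
  have h2 := Quaternion.self_mul_star q
  rw [h1, Quaternion.normSq_eq_norm_mul_self, hq] at h2
  have h3 : -(q * q) = 1 := by
    rw [← mul_neg, h2]
    simp
  rw [← h3, neg_neg]

/-- Anticommuting imaginary quaternions are orthogonal, so this is Pythagoras. -/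
lemma norm_add_smul_of_anticommute {p q : ℍ[ℝ]} (hp : p.re = 0) (hq : q.re = 0) (hn : ‖q‖ = 1)
    (h : q * p + p * q = 0) (t : ℝ) : ‖q + t • p‖ ^ 2 = 1 + t ^ 2 * ‖p‖ ^ 2 := by
  have h1 := congrArg QuaternionAlgebra.re h
  have h2 : ∀ x : ℍ[ℝ], ‖x‖ ^ 2 = x.re ^ 2 + x.imI ^ 2 + x.imJ ^ 2 + x.imK ^ 2 := fun x => by
    rw [sq, ← Quaternion.normSq_eq_norm_mul_self, Quaternion.normSq_def']
  have h3 := h2 q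
  rw [hn] at h3
  simp [hp, hq] at h1
  rw [h2, h2]
  simp [hp, hq] at h3 ⊢
  linear_combination -h3 - t * h1

namespace IsQuaternionicFrame

variable {V : Set F} {Γ : F → F →L[ℝ] F →L[ℝ] F} {h : F → HVec k →L[ℝ] F}
    {hi : F → F →L[ℝ] HVec k}

lemma sq_apply (H : IsQuaternionicFrame V Γ h hi) {w : F × (F →L[ℝ] F)}
    (hw : w ∈ frameTwistor V h hi) (v : F) : w.2 (w.2 v) = -v := by
  obtain ⟨hy, q, hq, hn, hJ⟩ := hw
  rw [hJ]
  simp only [ContinuousLinearMap.comp_apply, lmul_apply, H.inv_frame _ hy]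
  rw [← mul_smul, quaternion_mul_self hq hn, neg_smul, one_smul, map_neg, H.frame_inv _ hy]

lemma fderiv_inv (H : IsQuaternionicFrame V Γ h hi) (hV : IsOpen V) {y : F} (hy : y ∈ V)
    (X : F) (v : HVec k) : fderiv ℝ hi y X (h y v) = -hi y (fderiv ℝ h y X v) := by
  have h1 := (H.contDiffOn_inv.hasFDerivAt_of_isOpen hV hy).clm_apply
    (hasFDerivAt_clm_apply_const (H.contDiffOn_frame.hasFDerivAt_of_isOpen hV hy) v)
  have h2 : (fun y => hi y (h y v)) =ᶠ[𝓝 y] fun _ => v := by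
    filter_upwards [hV.mem_nhds hy] with z hz using H.inv_frame z hz v
  have h3 := DFunLike.congr_fun (h1.unique ((hasFDerivAt_const v y).congr_of_eventuallyEq h2)) X
  simp at h3
  rw [← eq_neg_of_add_eq_zero_right h3]

/-- Realizing vectors by curves allows identities which hold only along the twistor bundle to be
differentiated, with no recourse to its submanifold structure. -/
lemma exists_curve (H : IsQuaternionicFrame V Γ h hi) (hV : IsOpen V) (hk : 0 < k)
    {w ξ : F × (F →L[ℝ] F)}
    (hw : w ∈ frameTwistor V h hi) (hξ : ξ ∈ frameTangent Γ h hi w) :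
    ∃ c : ℝ → F × (F →L[ℝ] F), HasDerivAt c ξ 0 ∧ c 0 = w ∧
      ∀ᶠ t in 𝓝 0, c t ∈ frameTwistor V h hi := by
  have hJJ := H.sq_apply hw
  obtain ⟨y, J⟩ := w
  obtain ⟨x, P⟩ := ξ
  obtain ⟨hy, q, hq, hn, hJ⟩ := hw
  obtain ⟨hA, hAJ⟩ := hξ
  simp only at hy hJ hA hAJ hJJ
  have hJh : ∀ v, J (h y v) = h y (q • v) := fun v => by simp [hJ, H.inv_frame y hy]
  -- the derivative of the quaternion which represents the complex structure
  obtain ⟨p, hp, hpv⟩ : ∃ p : ℍ[ℝ], p.re = 0 ∧ ∀ v, h y (p • v) =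
      vertPart Γ (y, J) (x, P) (h y v) - (fderiv ℝ h y x (q • v) + Γ y x (h y (q • v)))
        + h y (q • hi y (fderiv ℝ h y x v + Γ y x (h y v))) := by
    have h1 := H.connForm_mem y hy x _ ⟨q, hq, rfl⟩
    obtain ⟨p, hp, hpT⟩ := sub_mem (mem_frameIm.1 hA) h1
    refine ⟨p, hp, fun v => ?_⟩
    have h2 := congrArg (h y) (DFunLike.congr_fun hpT v)
    simp only [sub_apply, add_apply, ContinuousLinearMap.comp_apply, lmul_apply, map_sub,
      H.frame_inv y hy] at h2
    rw [← h2]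
    simp only [sub_sub_eq_add_sub]
    abel
  have hanti : q * p + p * q = 0 := by
    refine lmul_injective hk ?_
    ext v : 1
    have hinj : ∀ {a b}, h y a = h y b → a = b := fun {a b} hab => by
      rw [← H.inv_frame y hy a, hab, H.inv_frame y hy]
    refine hinj ?_
    simp only [lmul_apply, add_smul, mul_smul, zero_smul, map_add, map_zero]
    rw [← hJh, hpv, hpv, ← mul_smul q q, quaternion_mul_self hq hn]
    have h3 := hAJ (h y v)
    rw [hJh] at h3
    rw [h3]
    simp only [map_add, map_sub, neg_smul, one_smul, map_neg, ← hJh, H.frame_inv y hy, hJJ, smul_add]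
    abel
  set z : ℝ → F := fun t => y + t • x with hz
  have hzd : HasDerivAt z x 0 := by
    have h1 : HasDerivAt z ((1 : ℝ) • x) 0 :=
      ((hasDerivAt_id (0 : ℝ)).smul_const x).const_add y
    rwa [one_smul] at h1
  -- The path `q + t p` normalized to unit length. As `p` and `q` anticommute, its norm is
  -- stationary at `t = 0`, so the velocity there is still `p`.
  set qt : ℝ → ℍ[ℝ] := fun t => (√(1 + t ^ 2 * ‖p‖ ^ 2))⁻¹ • (q + t • p) with hqt
  have hpos : ∀ t : ℝ, 0 < 1 + t ^ 2 * ‖p‖ ^ 2 := fun t => by positivity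
  have hqd : HasDerivAt qt p 0 := by
    have h1 : HasDerivAt (fun t : ℝ => 1 + t ^ 2 * ‖p‖ ^ 2) 0 0 := by
      simpa using (((hasDerivAt_id (0 : ℝ)).pow 2).mul_const (‖p‖ ^ 2)).const_add 1
    have h2 := (h1.sqrt (hpos 0).ne').inv (Real.sqrt_pos.2 (hpos 0)).ne'
    have h3 : HasDerivAt (fun t : ℝ => q + t • p) ((1 : ℝ) • p) 0 :=
      ((hasDerivAt_id (0 : ℝ)).smul_const p).const_add q
    have h4 : HasDerivAt qt _ 0 := h2.smul h3
    convert h4 using 1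
    simp
  have hq0 : qt 0 = q := by simp [hqt]
  have hz0 : z 0 = y := by simp [hz]
  have hLd : HasDerivAt (fun t => (lmul (qt t) : HVec k →L[ℝ] HVec k)) (lmul p) 0 :=
    hasDerivAt_lmul hqd
  have hhd : HasDerivAt (fun t => h (z t)) (fderiv ℝ h y x) 0 := by
    have := H.contDiffOn_frame.hasFDerivAt_of_isOpen hV hy
    rw [← hz0] at this
    have h1 := this.comp_hasDerivAt 0 hzd
    rw [hz0] at h1
    exact h1
  have hid : HasDerivAt (fun t => hi (z t)) (fderiv ℝ hi y x) 0 := by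
    have := H.contDiffOn_inv.hasFDerivAt_of_isOpen hV hy
    rw [← hz0] at this
    have h1 := this.comp_hasDerivAt 0 hzd
    rw [hz0] at h1
    exact h1
  have hJd := hhd.clm_comp (hLd.clm_comp hid)
  refine ⟨fun t => (z t, (h (z t)).comp ((lmul (qt t)).comp (hi (z t)))), ?_, ?_, ?_⟩
  · refine hzd.prodMk (hJd.congr_deriv ?_)
    ext f
    obtain ⟨v, rfl⟩ : ∃ v, f = h y v := ⟨hi y f, (H.frame_inv y hy f).symm⟩
    simp only [add_apply, ContinuousLinearMap.comp_apply, lmul_apply, hz0, hq0, H.inv_frame y hy,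
      H.fderiv_inv hV hy, map_add, hpv, vertPart_apply, hJh, map_neg, smul_add]
    have h4 : J (Γ y x (h y v)) = h y (q • hi y (Γ y x (h y v))) := by
      rw [← hJh, H.frame_inv y hy]
    rw [h4]
    abel
  · simp only [hz0, hq0, ← hJ]
  · have hzc : ∀ᶠ t in 𝓝 (0 : ℝ), z t ∈ V := by
      refine hzd.continuousAt.eventually_mem ?_
      rw [hz0]
      exact hV.mem_nhds hy
    filter_upwards [hzc] with t ht
    refine ⟨ht, qt t, by simp [hqt, hp, hq], ?_, rfl⟩
    have h5 := norm_add_smul_of_anticommute hp hq hn hanti t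
    rw [hqt, norm_smul, norm_inv, Real.norm_of_nonneg (Real.sqrt_nonneg _), ← h5,
      Real.sqrt_sq (norm_nonneg _)]
    refine inv_mul_cancel₀ fun h6 => ?_
    rw [h6] at h5
    have := hpos t
    rw [← h5] at this
    simp at this

/-- Differentiation of identities along the bundle of admissible linear complex structures. -/
lemma fderiv_mem (H : IsQuaternionicFrame V Γ h hi) (hV : IsOpen V) (hk : 0 < k)
    {w ξ : F × (F →L[ℝ] F)} (hw : w ∈ frameTwistor V h hi) (hξ : ξ ∈ frameTangent Γ h hi w)
    {O : Set (F × (F →L[ℝ] F))} (hO : IsOpen O) (hwO : w ∈ O)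
    {G : Type*} [NormedAddCommGroup G] [NormedSpace ℝ G]
    [FiniteDimensional ℝ G] (S : Submodule ℝ G) {f : F × (F →L[ℝ] F) → G}
    {f' : F × (F →L[ℝ] F) →L[ℝ] G} (hf : HasFDerivAt f f' w)
    (hS : ∀ w ∈ O ∩ frameTwistor V h hi, f w ∈ S) : f' ξ ∈ S := by
  obtain ⟨c, hc, hc0, hcZ⟩ := H.exists_curve hV hk hw hξ
  rw [← hc0] at hf
  refine mem_of_hasDerivAt S (hf.comp_hasDerivAt 0 hc) ?_
  have h1 : ∀ᶠ t in 𝓝 0, c t ∈ O := by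
    refine hc.continuousAt.eventually_mem ?_
    rw [hc0]
    exact hO.mem_nhds hwO
  filter_upwards [h1, hcZ] with t h2 h3 using hS _ ⟨h2, h3⟩

lemma fderiv_eq_zero (H : IsQuaternionicFrame V Γ h hi) (hV : IsOpen V) (hk : 0 < k)
    {w ξ : F × (F →L[ℝ] F)} (hw : w ∈ frameTwistor V h hi) (hξ : ξ ∈ frameTangent Γ h hi w)
    {O : Set (F × (F →L[ℝ] F))} (hO : IsOpen O) (hwO : w ∈ O)
    {G : Type*} [NormedAddCommGroup G] [NormedSpace ℝ G]
    [FiniteDimensional ℝ G] {f : F × (F →L[ℝ] F) → G}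
    {f' : F × (F →L[ℝ] F) →L[ℝ] G} (hf : HasFDerivAt f f' w)
    (hS : ∀ w ∈ O ∩ frameTwistor V h hi, f w = 0) : f' ξ = 0 :=
  (Submodule.mem_bot ℝ).1 (H.fderiv_mem hV hk hw hξ hO hwO ⊥ hf fun w hw =>
    (Submodule.mem_bot ℝ).2 (hS w hw))

end IsQuaternionicFrame

end TorsionFree

end CoCR

end

noncomputable section

set_option synthInstance.maxHeartbeats 200000
set_option linter.unusedSectionVars false

namespace CoCR
-- The curvature of a torsion free quaternionic connection.
section TorsionFree

open Topology Filter

variable {F : Type*} [NormedAddCommGroup F] [NormedSpace ℝ F] [FiniteDimensional ℝ F] {k : ℕ}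

lemma hasFDerivAt_clm_apply_comp_fst {X Y G : Type*} [NormedAddCommGroup X] [NormedSpace ℝ X]
    [NormedAddCommGroup Y] [NormedSpace ℝ Y]
    [NormedAddCommGroup G] [NormedSpace ℝ G] {Γ : X → Y →L[ℝ] G} {W : Type*}
    [NormedAddCommGroup W] [NormedSpace ℝ W] {f : W → X} {g : W → Y} {f' : W →L[ℝ] X}
    {g' : W →L[ℝ] Y} {w : W} {Γ' : X →L[ℝ] Y →L[ℝ] G}
    (hΓ : HasFDerivAt Γ Γ' (f w)) (hf : HasFDerivAt f f' w) (hg : HasFDerivAt g g' w) :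
    HasFDerivAt (fun w => Γ (f w) (g w)) ((Γ (f w)).comp g' + (Γ'.comp f').flip (g w)) w :=
  (hΓ.comp w hf).clm_apply hg

lemma hasFDerivAt_vertPart {Γ : F → F →L[ℝ] F →L[ℝ] F} {w : F × (F →L[ℝ] F)}
    {X : F × (F →L[ℝ] F) → F × (F →L[ℝ] F)}
    {X' : F × (F →L[ℝ] F) →L[ℝ] F × (F →L[ℝ] F)} {Γ' : F →L[ℝ] F →L[ℝ] F →L[ℝ] F}
    (hΓ : HasFDerivAt Γ Γ' w.1) (hX : HasFDerivAt X X' w) :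
    ∃ A' : F × (F →L[ℝ] F) →L[ℝ] F →L[ℝ] F,
      HasFDerivAt (fun w => vertPart Γ w (X w)) A' w ∧ ∀ ξ v, A' ξ v =
        (X' ξ).2 v + (Γ' ξ.1 (X w).1 (w.2 v) + Γ w.1 (X' ξ).1 (w.2 v) + Γ w.1 (X w).1 (ξ.2 v))
        - (ξ.2 (Γ w.1 (X w).1 v) + w.2 (Γ' ξ.1 (X w).1 v) + w.2 (Γ w.1 (X' ξ).1 v)) := by
  have h1 := hasFDerivAt_clm_apply_comp_fst (G := F →L[ℝ] F) hΓ hasFDerivAt_fst hX.fst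
  have h2 : HasFDerivAt (fun w : F × (F →L[ℝ] F) => w.2)
      (ContinuousLinearMap.snd ℝ F (F →L[ℝ] F)) w := hasFDerivAt_snd
  refine ⟨_, (hX.snd.add (h1.clm_comp h2)).sub (h2.clm_comp h1), fun ξ v => ?_⟩
  simp
  abel

/-- The complex distribution on the bundle of admissible linear complex structures. -/
def frameDistribution (Γ : F → F →L[ℝ] F →L[ℝ] F) (h : F → HVec k →L[ℝ] F)
    (hi : F → F →L[ℝ] HVec k) (w ξ η : F × (F →L[ℝ] F)) : Prop :=
  ξ ∈ frameTangent Γ h hi w ∧ η ∈ frameTangent Γ h hi w ∧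
    (∀ v, vertPart Γ w η v = w.2 (vertPart Γ w ξ v)) ∧ η.1 = w.2 ξ.1

namespace IsQuaternionicFrame

variable {V : Set F} {Γ : F → F →L[ℝ] F →L[ℝ] F} {h : F → HVec k →L[ℝ] F}
    {hi : F → F →L[ℝ] HVec k}

/-- The connection form. -/
def connForm (Γ : F → F →L[ℝ] F →L[ℝ] F) (h : F → HVec k →L[ℝ] F) (hi : F → F →L[ℝ] HVec k)
    (X y : F) : HVec k →L[ℝ] HVec k :=
  (hi y).comp (fderiv ℝ h y X + (Γ y X).comp (h y))

lemma contDiffOn_connForm (H : IsQuaternionicFrame V Γ h hi) (hV : IsOpen V) (X : F) :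
    ContDiffOn ℝ ∞ (connForm Γ h hi X) V :=
  H.contDiffOn_inv.clm_comp (((H.contDiffOn_frame.fderiv_of_isOpen hV
    (m := ∞) (by simp)).clm_apply contDiffOn_const).add
    ((H.contDiffOn_conn.clm_apply contDiffOn_const).clm_comp H.contDiffOn_frame))

lemma frame_connForm (H : IsQuaternionicFrame V Γ h hi) {y : F} (hy : y ∈ V) (X : F)
    (v : HVec k) : h y (connForm Γ h hi X y v) = fderiv ℝ h y X v + Γ y X (h y v) :=
  H.frame_inv y hy _

lemma hasDerivAt_line (y X : F) : HasDerivAt (fun t : ℝ => y + t • X) X 0 := by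
  have h1 : HasDerivAt (fun t : ℝ => y + t • X) ((1 : ℝ) • X) 0 :=
    ((hasDerivAt_id (0 : ℝ)).smul_const X).const_add y
  rwa [one_smul] at h1

lemma mem_of_hasFDerivAt {G : Type*} [NormedAddCommGroup G] [NormedSpace ℝ G]
    [FiniteDimensional ℝ G] (S : Submodule ℝ G) {f : F → G} {f' : F →L[ℝ] G} (hV : IsOpen V)
    {y : F} (hy : y ∈ V) (hf : HasFDerivAt f f' y) (hS : ∀ y ∈ V, f y ∈ S) (X : F) :
    f' X ∈ S := by
  have hz := hasDerivAt_line y X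
  have hz0 : y + (0 : ℝ) • X = y := by simp
  rw [← hz0] at hf
  refine mem_of_hasDerivAt S (hf.comp_hasDerivAt 0 hz) ?_
  have h3 : ∀ᶠ t : ℝ in 𝓝 0, y + t • X ∈ V := by
    refine hz.continuousAt.eventually_mem ?_
    rw [hz0]
    exact hV.mem_nhds hy
  filter_upwards [h3] with t ht using hS _ ht

/-- Obtained by differentiating `h ∘ A = dh + Γ ∘ h`, where `A` is the connection form, so that
derivatives of the inverse frame do not occur. -/
lemma fderiv_connForm (H : IsQuaternionicFrame V Γ h hi) (hV : IsOpen V) {y : F} (hy : y ∈ V)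
    (X Y : F) (v : HVec k) : h y (fderiv ℝ (connForm Γ h hi Y) y X v) =
      fderiv ℝ (fderiv ℝ h) y X Y v + fderiv ℝ Γ y X Y (h y v)
        + Γ y Y (fderiv ℝ h y X v) - fderiv ℝ h y X (connForm Γ h hi Y y v) := by
  have hΓd := H.contDiffOn_conn.hasFDerivAt_of_isOpen hV hy
  have hh := H.contDiffOn_frame.hasFDerivAt_of_isOpen hV hy
  have hh' : HasFDerivAt (fderiv ℝ h) (fderiv ℝ (fderiv ℝ h) y) y :=
    (H.contDiffOn_frame.fderiv_of_isOpen hV (m := ∞) (by simp)).hasFDerivAt_of_isOpen hV hy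
  have h1 := hh.clm_apply (hasFDerivAt_clm_apply_const
    ((H.contDiffOn_connForm hV Y).hasFDerivAt_of_isOpen hV hy) v)
  have h2 : (fun z => h z (connForm Γ h hi Y z v)) =ᶠ[𝓝 y]
      fun z => fderiv ℝ h z Y v + Γ z Y (h z v) := by
    filter_upwards [hV.mem_nhds hy] with z hz using H.frame_connForm hz Y v
  have h3 : HasFDerivAt (fun z => fderiv ℝ h z Y v + Γ z Y (h z v)) _ y :=
    (hasFDerivAt_clm_apply₂_const hh' Y v).add
      ((hasFDerivAt_clm_apply_const (G := F →L[ℝ] F) hΓd Y).clm_apply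
        (hasFDerivAt_clm_apply_const hh v))
  have h4 := DFunLike.congr_fun (h1.unique (h3.congr_of_eventuallyEq h2)) X
  simp only [add_apply, ContinuousLinearMap.comp_apply, ContinuousLinearMap.flip_apply] at h4
  rw [eq_sub_iff_add_eq, h4]
  abel

/-- The curvature form takes values in the Lie algebra of `Sp(1)·GL(k,ℍ)`. -/
lemma curvature_mem (H : IsQuaternionicFrame V Γ h hi) (hV : IsOpen V) {y : F} (hy : y ∈ V)
    (X Y : F) : (hi y).comp ((localCurvature Γ y X Y).comp (h y)) ∈ imNormalizer k := by
  have hWd : ∀ X Y, fderiv ℝ (connForm Γ h hi Y) y X ∈ imNormalizer k := fun X Y =>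
    mem_of_hasFDerivAt (G := HVec k →L[ℝ] HVec k) (imNormalizer k) hV hy
      ((H.contDiffOn_connForm hV Y).hasFDerivAt_of_isOpen hV hy)
      (fun z hz => H.connForm_mem z hz Y) X
  -- In the frame the curvature is `dA + [A, A]`. Derivatives of `A` stay in the linear subspace
  -- `imNormalizer k`, and the bracket stays in it because it is a Lie algebra.
  have h1 := add_mem (sub_mem (hWd X Y) (hWd Y X)) (bracket_mem_imNormalizer
    (H.connForm_mem y hy X) (H.connForm_mem y hy Y))
  convert h1 using 1
  ext v : 1
  have hinj : ∀ {a b}, h y a = h y b → a = b := fun {a b} hab => by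
    rw [← H.inv_frame y hy a, hab, H.inv_frame y hy]
  refine hinj ?_
  have hsymm : fderiv ℝ (fderiv ℝ h) y X Y = fderiv ℝ (fderiv ℝ h) y Y X :=
    ((H.contDiffOn_frame.contDiffAt (hV.mem_nhds hy)).isSymmSndFDerivAt
      minSmoothness_two_le_infty).eq X Y
  change h y (hi y (localCurvature Γ y X Y (h y v))) =
    h y (fderiv ℝ (connForm Γ h hi Y) y X v - fderiv ℝ (connForm Γ h hi X) y Y v
      + (connForm Γ h hi X y (connForm Γ h hi Y y v)
        - connForm Γ h hi Y y (connForm Γ h hi X y v)))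
  rw [H.frame_inv y hy, localCurvature_apply]
  simp only [map_add, map_sub, H.fderiv_connForm hV hy, H.frame_connForm hy]
  rw [hsymm]
  abel

lemma localCurvature_add_left (y X X' Y : F) : localCurvature Γ y (X + X') Y
    = localCurvature Γ y X Y + localCurvature Γ y X' Y := by
  ext v
  rw [add_apply]
  simp only [localCurvature_apply, map_add, add_apply]
  abel

lemma localCurvature_smul_left (c : ℝ) (y X Y : F) : localCurvature Γ y (c • X) Y
    = c • localCurvature Γ y X Y := by
  ext v
  rw [smul_apply]
  simp only [localCurvature_apply, map_smul, smul_apply, smul_sub, smul_add]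

lemma localCurvature_antisymm (y X Y : F) : localCurvature Γ y X Y = -localCurvature Γ y Y X := by
  ext v
  rw [neg_apply]
  simp only [localCurvature_apply]
  abel

/-- The curvature form. -/
def curvatureForm (Γ : F → F →L[ℝ] F →L[ℝ] F) (h : HVec k →L[ℝ] F) (hi : F →L[ℝ] HVec k) (y : F) :
    HVec k →ₗ[ℝ] HVec k →ₗ[ℝ] (HVec k →L[ℝ] HVec k) :=
  LinearMap.mk₂ ℝ
    (fun a c => hi.comp ((localCurvature Γ y (h a) (h c)).comp h))
    (fun a a' c => by
      rw [map_add, localCurvature_add_left, ContinuousLinearMap.add_comp,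
        ContinuousLinearMap.comp_add])
    (fun t a c => by
      rw [map_smul, localCurvature_smul_left, ContinuousLinearMap.smul_comp,
        ContinuousLinearMap.comp_smul])
    (fun c a a' => by
      rw [map_add, localCurvature_antisymm, localCurvature_add_left, neg_add,
        ← localCurvature_antisymm, ← localCurvature_antisymm, ContinuousLinearMap.add_comp,
        ContinuousLinearMap.comp_add])
    (fun t c a => by
      rw [map_smul, localCurvature_antisymm, localCurvature_smul_left, ← smul_neg,
        ← localCurvature_antisymm, ContinuousLinearMap.smul_comp, ContinuousLinearMap.comp_smul])

lemma curvatureForm_apply (g : HVec k →L[ℝ] F) (gi : F →L[ℝ] HVec k) (y : F) (a c v : HVec k) :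
    curvatureForm Γ g gi y a c v = gi (localCurvature Γ y (g a) (g c) (g v)) := rfl

lemma fderiv_conn_symm (H : IsQuaternionicFrame V Γ h hi) (hV : IsOpen V) {y : F} (hy : y ∈ V)
    (X Y Z : F) : fderiv ℝ Γ y X Y Z = fderiv ℝ Γ y X Z Y := by
  have h1 : ∀ Y Z, HasFDerivAt (fun b => Γ b Y Z) _ y := fun Y Z =>
    hasFDerivAt_clm_apply₂_const (H.contDiffOn_conn.hasFDerivAt_of_isOpen hV hy) Y Z
  have h2 : (fun b => Γ b Y Z) =ᶠ[𝓝 y] fun b => Γ b Z Y := by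
    filter_upwards [hV.mem_nhds hy] with z hz using H.symm z hz Y Z
  exact DFunLike.congr_fun ((h1 Y Z).unique ((h1 Z Y).congr_of_eventuallyEq h2)) X

/-- The usual first Bianchi identity: torsion freeness is the symmetry of `Γ` and of its
derivatives, which makes all terms cancel in pairs. -/
lemma curvature_cyclic (H : IsQuaternionicFrame V Γ h hi) (hV : IsOpen V) {y : F} (hy : y ∈ V)
    (X Y Z : F) : localCurvature Γ y X Y Z + localCurvature Γ y Y Z X
      + localCurvature Γ y Z X Y = 0 := by
  simp only [localCurvature_apply]
  rw [H.fderiv_conn_symm hV hy X Z Y, H.fderiv_conn_symm hV hy Y X Z,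
    H.fderiv_conn_symm hV hy Z Y X, H.symm y hy Z Y, H.symm y hy Z X, H.symm y hy Y X]
  abel

lemma curvature_type (H : IsQuaternionicFrame V Γ h hi) (hV : IsOpen V) (hk : 2 ≤ k)
    {w : F × (F →L[ℝ] F)} (hw : w ∈ frameTwistor V h hi) (x y v : F) :
    (localCurvature Γ w.1 x (w.2 y) (w.2 v) + localCurvature Γ w.1 (w.2 x) y (w.2 v)
      - (w.2 (localCurvature Γ w.1 x (w.2 y) v) + w.2 (localCurvature Γ w.1 (w.2 x) y v)))
    = w.2 (localCurvature Γ w.1 x y (w.2 v) - localCurvature Γ w.1 (w.2 x) (w.2 y) (w.2 v)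
      - (w.2 (localCurvature Γ w.1 x y v) - w.2 (localCurvature Γ w.1 (w.2 x) (w.2 y) v))) := by
  obtain ⟨b, J⟩ := w
  obtain ⟨hb, q, hq, hn, hJ⟩ := hw
  simp only at hb hJ ⊢
  have hJh : ∀ v, J (h b v) = h b (q • v) := fun v => by simp [hJ, H.inv_frame b hb]
  have key := CoCR.curvature_type hk (curvatureForm Γ (h b) (hi b) b)
    (fun a c => H.curvature_mem hV hb _ _) (fun a c => by
      ext1 v
      rw [neg_apply, curvatureForm_apply, curvatureForm_apply, localCurvature_antisymm, neg_apply,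
        map_neg]) (fun a c d => by
      rw [curvatureForm_apply, curvatureForm_apply, curvatureForm_apply, ← map_add, ← map_add,
        H.curvature_cyclic hV hb, map_zero])
      (j := lmul q) ⟨q, hq, rfl⟩ (fun x => by
      rw [lmul_apply, lmul_apply, ← mul_smul, quaternion_mul_self hq hn, neg_smul, one_smul])
      (hi b x) (hi b y)
  have h3 := congrArg (h b) (DFunLike.congr_fun key (hi b v))
  simp only [sub_apply, add_apply, ContinuousLinearMap.comp_apply, lmul_apply, curvatureForm_apply,
    map_sub, map_add, H.frame_inv b hb, ← hJh] at h3
  simp only [map_sub]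
  exact h3

end IsQuaternionicFrame

end TorsionFree

end CoCR

end

noncomputable section

set_option synthInstance.maxHeartbeats 200000
set_option linter.unusedSectionVars false

namespace CoCR
-- Integrability of the complex distribution.
section TorsionFree

open Topology Filter VectorField

variable {F : Type*} [NormedAddCommGroup F] [NormedSpace ℝ F] [FiniteDimensional ℝ F] {k : ℕ}

namespace IsQuaternionicFrame

variable {V : Set F} {Γ : F → F →L[ℝ] F →L[ℝ] F} {h : F → HVec k →L[ℝ] F}
    {hi : F → F →L[ℝ] HVec k}

/-- The covariant derivative of an endomorphism field, read in the frame, is the derivative of its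
matrix plus a commutator with the connection form; the latter normalizes the imaginary
multiplications. -/
lemma vertPart_mem_frameIm (H : IsQuaternionicFrame V Γ h hi) (hV : IsOpen V) {y : F}
    (hy : y ∈ V) {A A' : F →L[ℝ] F} {x : F} (hA : A ∈ frameIm (h y) (hi y))
    (hd : (hi y).comp (A.comp (fderiv ℝ h y x) + A'.comp (h y))
      + (fderiv ℝ hi y x).comp (A.comp (h y)) ∈ imMul k) :
    vertPart Γ (y, A) (x, A') ∈ frameIm (h y) (hi y) := by
  have h1 := add_mem hd (H.connForm_mem y hy x _ hA)
  rw [mem_frameIm]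
  convert h1 using 1
  ext v : 1
  have h2 : fderiv ℝ hi y x (A (h y v)) = -hi y (fderiv ℝ h y x (hi y (A (h y v)))) := by
    rw [← H.fderiv_inv hV hy, H.frame_inv y hy]
  simp only [sub_apply, add_apply, ContinuousLinearMap.comp_apply, vertPart_apply, h2, map_add,
    map_sub, H.frame_inv y hy]
  abel

/-- The covariant derivative along `ξ` of the vertical part of a vector field tangent to the bundle
of admissible linear complex structures. -/
lemma covDeriv_vertPart (H : IsQuaternionicFrame V Γ h hi) (hV : IsOpen V) (hk : 0 < k)
    {O : Set (F × (F →L[ℝ] F))} (hO : IsOpen O) {X : F × (F →L[ℝ] F) → F × (F →L[ℝ] F)}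
    (hX : ∀ w ∈ O ∩ frameTwistor V h hi, X w ∈ frameTangent Γ h hi w)
    {w : F × (F →L[ℝ] F)} (hwO : w ∈ O) (hw : w ∈ frameTwistor V h hi)
    {A' : F × (F →L[ℝ] F) →L[ℝ] F →L[ℝ] F}
    (hA' : HasFDerivAt (fun w => vertPart Γ w (X w)) A' w)
    {ξ : F × (F →L[ℝ] F)} (hξ : ξ ∈ frameTangent Γ h hi w) :
    vertPart Γ (w.1, vertPart Γ w (X w)) (ξ.1, A' ξ) ∈ frameIm (h w.1) (hi w.1) ∧
    ∀ v, vertPart Γ (w.1, vertPart Γ w (X w)) (ξ.1, A' ξ) (w.2 v)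
      + vertPart Γ w (X w) (vertPart Γ w ξ v)
      + vertPart Γ w ξ (vertPart Γ w (X w) v)
      + w.2 (vertPart Γ (w.1, vertPart Γ w (X w)) (ξ.1, A' ξ) v) = 0 := by
  have hy := hw.1
  constructor
  · refine H.vertPart_mem_frameIm hV hy (hX w ⟨hwO, hw⟩).1 ?_
    have h1 : HasFDerivAt (fun w : F × (F →L[ℝ] F) => h w.1)
        ((fderiv ℝ h w.1).comp (ContinuousLinearMap.fst ℝ F (F →L[ℝ] F))) w :=
      (H.contDiffOn_frame.hasFDerivAt_of_isOpen hV hy).comp w hasFDerivAt_fst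
    have h2 : HasFDerivAt (fun w : F × (F →L[ℝ] F) => hi w.1)
        ((fderiv ℝ hi w.1).comp (ContinuousLinearMap.fst ℝ F (F →L[ℝ] F))) w :=
      (H.contDiffOn_inv.hasFDerivAt_of_isOpen hV hy).comp w hasFDerivAt_fst
    have h3 := h2.clm_comp (hA'.clm_comp h1)
    exact H.fderiv_mem hV hk hw hξ hO hwO (G := HVec k →L[ℝ] HVec k) (imMul k) h3
      fun w hw => (hX w hw).1
  · intro v
    have hJ : ∀ v, HasFDerivAt (fun w : F × (F →L[ℝ] F) => w.2 v)
        ((ContinuousLinearMap.snd ℝ F (F →L[ℝ] F)).flip v) w := fun v =>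
      ((ContinuousLinearMap.snd ℝ F (F →L[ℝ] F)).flip v).hasFDerivAt
    -- The second assertion is the derivative along `ξ` of the relation `A J + J A = 0`, rewritten
    -- with covariant derivatives.
    have h1 : HasFDerivAt (fun w => vertPart Γ w (X w) (w.2 v) + w.2 (vertPart Γ w (X w) v)) _ w :=
      (hA'.clm_apply (hJ v)).add
        ((hasFDerivAt_snd (p := w)).clm_apply (hasFDerivAt_clm_apply_const hA' v))
    have h2 := H.fderiv_eq_zero hV hk hw hξ hO hwO h1 fun w hw => by
      rw [(hX w hw).2, neg_add_cancel]
    simp only [add_apply, ContinuousLinearMap.comp_apply, ContinuousLinearMap.flip_apply,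
      ContinuousLinearMap.coe_snd'] at h2
    have h3 := (hX w ⟨hwO, hw⟩).2
    generalize vertPart Γ w (X w) = A at h2 h3 ⊢
    simp only [vertPart_apply, map_add, map_sub, map_neg, h3]
    linear_combination (norm := module) h2

/-- The structure equation: with `A`, `B` the vertical parts of `X`, `Y`, the vertical part of the
bracket is `∇_X B - ∇_Y A - [R(X, Y), J]`. The curvature is the obstruction to horizontal fields
being closed under the bracket. -/
lemma vertPart_lieBracket {w : F × (F →L[ℝ] F)} {X Y : F × (F →L[ℝ] F) → F × (F →L[ℝ] F)}
    {A' B' : F × (F →L[ℝ] F) →L[ℝ] F →L[ℝ] F}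
    (hA' : ∀ ξ v, A' ξ v = (fderiv ℝ X w ξ).2 v + (fderiv ℝ Γ w.1 ξ.1 (X w).1 (w.2 v)
        + Γ w.1 (fderiv ℝ X w ξ).1 (w.2 v) + Γ w.1 (X w).1 (ξ.2 v))
        - (ξ.2 (Γ w.1 (X w).1 v) + w.2 (fderiv ℝ Γ w.1 ξ.1 (X w).1 v)
          + w.2 (Γ w.1 (fderiv ℝ X w ξ).1 v)))
    (hB' : ∀ ξ v, B' ξ v = (fderiv ℝ Y w ξ).2 v + (fderiv ℝ Γ w.1 ξ.1 (Y w).1 (w.2 v)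
        + Γ w.1 (fderiv ℝ Y w ξ).1 (w.2 v) + Γ w.1 (Y w).1 (ξ.2 v))
        - (ξ.2 (Γ w.1 (Y w).1 v) + w.2 (fderiv ℝ Γ w.1 ξ.1 (Y w).1 v)
          + w.2 (Γ w.1 (fderiv ℝ Y w ξ).1 v))) (v : F) :
    vertPart Γ w (lieBracket ℝ X Y w) v =
      vertPart Γ (w.1, vertPart Γ w (Y w)) ((X w).1, B' (X w)) v
      - vertPart Γ (w.1, vertPart Γ w (X w)) ((Y w).1, A' (Y w)) v
      - (localCurvature Γ w.1 (X w).1 (Y w).1 (w.2 v)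
        - w.2 (localCurvature Γ w.1 (X w).1 (Y w).1 v)) := by
  simp only [vertPart_apply, hA', hB', localCurvature_apply, lieBracket, Prod.fst_sub,
    Prod.snd_sub, map_sub, map_add, sub_apply]
  abel

lemma bracket_mem_frameIm (H : IsQuaternionicFrame V Γ h hi) (hV : IsOpen V)
    {w : F × (F →L[ℝ] F)} (hw : w ∈ frameTwistor V h hi) (x y : F) :
    (localCurvature Γ w.1 x y).comp w.2 - w.2.comp (localCurvature Γ w.1 x y)
      ∈ frameIm (h w.1) (hi w.1) := by
  obtain ⟨b, J⟩ := w
  obtain ⟨hb, q, hq, hn, hJ⟩ := hw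
  simp only at hb hJ ⊢
  have h1 := H.curvature_mem hV hb x y (lmul q) ⟨q, hq, rfl⟩
  rw [mem_frameIm]
  convert h1 using 1
  ext v : 1
  simp [hJ, H.inv_frame b hb]

/-- Tangency is preserved because each term of the structure equation is an imaginary multiplication
in the frame, and because the failures of `∇_X B` and `∇_Y A` to anticommute with `J` coincide. The
curvature term anticommutes with `J` by `J² = -1`. -/
lemma frameTangent_lieBracket (H : IsQuaternionicFrame V Γ h hi) (hV : IsOpen V) (hk : 0 < k)
    {O : Set (F × (F →L[ℝ] F))} (hO : IsOpen O) {X Y : F × (F →L[ℝ] F) → F × (F →L[ℝ] F)}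
    (hXs : ContDiffOn ℝ ∞ X O) (hYs : ContDiffOn ℝ ∞ Y O)
    (hX : ∀ w ∈ O ∩ frameTwistor V h hi, X w ∈ frameTangent Γ h hi w)
    (hY : ∀ w ∈ O ∩ frameTwistor V h hi, Y w ∈ frameTangent Γ h hi w)
    {w : F × (F →L[ℝ] F)} (hwO : w ∈ O) (hw : w ∈ frameTwistor V h hi) :
    lieBracket ℝ X Y w ∈ frameTangent Γ h hi w := by
  have hΓ := H.contDiffOn_conn.hasFDerivAt_of_isOpen hV hw.1
  obtain ⟨A', hA', hA⟩ := hasFDerivAt_vertPart hΓ (hXs.hasFDerivAt_of_isOpen hO hwO)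
  obtain ⟨B', hB', hB⟩ := hasFDerivAt_vertPart hΓ (hYs.hasFDerivAt_of_isOpen hO hwO)
  have hXw := hX w ⟨hwO, hw⟩
  have hYw := hY w ⟨hwO, hw⟩
  obtain ⟨m1, n1⟩ := H.covDeriv_vertPart hV hk hO hX hwO hw hA' hYw
  obtain ⟨m2, n2⟩ := H.covDeriv_vertPart hV hk hO hY hwO hw hB' hXw
  have key := fun v => vertPart_lieBracket hA hB v
  refine ⟨?_, fun v => ?_⟩
  · have h1 := sub_mem (sub_mem m2 m1) (H.bracket_mem_frameIm hV hw (X w).1 (Y w).1)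
    convert h1 using 1
    ext v
    exact key v
  · rw [key, key]
    simp only [map_sub, H.sq_apply hw, map_neg]
    linear_combination (norm := module) n2 v - n1 v

/-- The complex distribution on the bundle of admissible linear complex structures of a torsion free
quaternionic connection is integrable. -/
theorem frameDistribution_lieBracket (H : IsQuaternionicFrame V Γ h hi) (hV : IsOpen V)
    (hk : 2 ≤ k) {O : Set (F × (F →L[ℝ] F))} (hO : IsOpen O)
    {X₁ X₂ Y₁ Y₂ : F × (F →L[ℝ] F) → F × (F →L[ℝ] F)}
    (hX₁ : ContDiffOn ℝ ∞ X₁ O) (hX₂ : ContDiffOn ℝ ∞ X₂ O)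
    (hY₁ : ContDiffOn ℝ ∞ Y₁ O) (hY₂ : ContDiffOn ℝ ∞ Y₂ O)
    (hX : ∀ w ∈ O ∩ frameTwistor V h hi, frameDistribution Γ h hi w (X₁ w) (X₂ w))
    (hY : ∀ w ∈ O ∩ frameTwistor V h hi, frameDistribution Γ h hi w (Y₁ w) (Y₂ w))
    {w : F × (F →L[ℝ] F)} (hwO : w ∈ O) (hw : w ∈ frameTwistor V h hi) :
    frameDistribution Γ h hi w (lieBracket ℝ X₁ Y₁ w - lieBracket ℝ X₂ Y₂ w)
      (lieBracket ℝ X₁ Y₂ w + lieBracket ℝ X₂ Y₁ w) := by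
  have hk' : 0 < k := by omega
  have hJJ := H.sq_apply hw
  have hadd : ∀ ξ η v, vertPart Γ w (ξ + η) v = vertPart Γ w ξ v + vertPart Γ w η v := by
    intro ξ η v
    simp only [vertPart_apply, Prod.fst_add, Prod.snd_add, map_add, add_apply]
    abel
  have hsub : ∀ ξ η v, vertPart Γ w (ξ - η) v = vertPart Γ w ξ v - vertPart Γ w η v := by
    intro ξ η v
    simp only [vertPart_apply, Prod.fst_sub, Prod.snd_sub, map_sub, sub_apply]
    abel
  have tX₁ := fun w hw => (hX w hw).1
  have tX₂ := fun w hw => (hX w hw).2.1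
  have tY₁ := fun w hw => (hY w hw).1
  have tY₂ := fun w hw => (hY w hw).2.1
  have b₁₁ := H.frameTangent_lieBracket hV hk' hO hX₁ hY₁ tX₁ tY₁ hwO hw
  have b₁₂ := H.frameTangent_lieBracket hV hk' hO hX₁ hY₂ tX₁ tY₂ hwO hw
  have b₂₁ := H.frameTangent_lieBracket hV hk' hO hX₂ hY₁ tX₂ tY₁ hwO hw
  have b₂₂ := H.frameTangent_lieBracket hV hk' hO hX₂ hY₂ tX₂ tY₂ hwO hw
  have hΓ := H.contDiffOn_conn.hasFDerivAt_of_isOpen hV hw.1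
  have dX₁ := hX₁.hasFDerivAt_of_isOpen hO hwO
  have dX₂ := hX₂.hasFDerivAt_of_isOpen hO hwO
  have dY₁ := hY₁.hasFDerivAt_of_isOpen hO hwO
  have dY₂ := hY₂.hasFDerivAt_of_isOpen hO hwO
  -- the derivatives of the identities which define the distribution
  have hfst : ∀ {X₁ X₂ : F × (F →L[ℝ] F) → F × (F →L[ℝ] F)},
      HasFDerivAt X₁ (fderiv ℝ X₁ w) w → HasFDerivAt X₂ (fderiv ℝ X₂ w) w →
      (∀ w ∈ O ∩ frameTwistor V h hi, frameDistribution Γ h hi w (X₁ w) (X₂ w)) →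
      ∀ ξ ∈ frameTangent Γ h hi w,
        (fderiv ℝ X₂ w ξ).1 = ξ.2 (X₁ w).1 + w.2 (fderiv ℝ X₁ w ξ).1 := by
    intro X₁ X₂ d₁ d₂ hX ξ hξ
    have h1 := H.fderiv_eq_zero hV hk' hw hξ hO hwO
      (d₂.fst.sub ((hasFDerivAt_snd (p := w)).clm_apply d₁.fst)) fun w hw => by
        rw [Pi.sub_apply, (hX w hw).2.2.2, sub_self]
    simp only [sub_apply, add_apply, ContinuousLinearMap.comp_apply,
      ContinuousLinearMap.flip_apply, ContinuousLinearMap.coe_snd',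
      ContinuousLinearMap.coe_fst'] at h1
    linear_combination (norm := module) h1
  have hsnd : ∀ {X₁ X₂ : F × (F →L[ℝ] F) → F × (F →L[ℝ] F)}
      {A₁ A₂ : F × (F →L[ℝ] F) →L[ℝ] F →L[ℝ] F},
      HasFDerivAt (fun w => vertPart Γ w (X₁ w)) A₁ w →
      HasFDerivAt (fun w => vertPart Γ w (X₂ w)) A₂ w →
      (∀ w ∈ O ∩ frameTwistor V h hi, frameDistribution Γ h hi w (X₁ w) (X₂ w)) →
      ∀ ξ ∈ frameTangent Γ h hi w, ∀ v,
        vertPart Γ (w.1, vertPart Γ w (X₂ w)) (ξ.1, A₂ ξ) v =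
          vertPart Γ w ξ (vertPart Γ w (X₁ w) v)
          + w.2 (vertPart Γ (w.1, vertPart Γ w (X₁ w)) (ξ.1, A₁ ξ) v) := by
    intro X₁ X₂ A₁ A₂ d₁ d₂ hX ξ hξ v
    have h1 := H.fderiv_eq_zero hV hk' hw hξ hO hwO
      ((hasFDerivAt_clm_apply_const d₂ v).sub
        ((hasFDerivAt_snd (p := w)).clm_apply (hasFDerivAt_clm_apply_const d₁ v))) fun w hw => by
        rw [Pi.sub_apply, (hX w hw).2.2.1, sub_self]
    simp only [sub_apply, add_apply, ContinuousLinearMap.comp_apply,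
      ContinuousLinearMap.flip_apply, ContinuousLinearMap.coe_snd'] at h1
    have h2 := (hX w ⟨hwO, hw⟩).2.2.1
    generalize vertPart Γ w (X₁ w) = A at h1 h2 ⊢
    generalize vertPart Γ w (X₂ w) = A' at h1 h2 ⊢
    simp only [vertPart_apply, map_add, map_sub, h2]
    linear_combination (norm := module) h1
  obtain ⟨A₁, hA₁, kA₁⟩ := hasFDerivAt_vertPart hΓ dX₁
  obtain ⟨A₂, hA₂, kA₂⟩ := hasFDerivAt_vertPart hΓ dX₂
  obtain ⟨B₁, hB₁, kB₁⟩ := hasFDerivAt_vertPart hΓ dY₁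
  obtain ⟨B₂, hB₂, kB₂⟩ := hasFDerivAt_vertPart hΓ dY₂
  have eX := hX w ⟨hwO, hw⟩
  have eY := hY w ⟨hwO, hw⟩
  refine ⟨⟨?_, fun v => ?_⟩, ⟨?_, fun v => ?_⟩, fun v => ?_, ?_⟩
  · convert sub_mem b₁₁.1 b₂₂.1 using 1
    ext v
    exact hsub _ _ _
  · rw [hsub, hsub, b₁₁.2, b₂₂.2, map_sub]
    abel
  · convert add_mem b₁₂.1 b₂₁.1 using 1
    ext v
    exact hadd _ _ _
  · rw [hadd, hadd, b₁₂.2, b₂₁.2, map_add]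
    abel
  -- Once the covariant derivatives of `X₂`, `Y₂` are expressed through those of `X₁`, `Y₁`, only
  -- curvature terms are left, and they combine to the identity on the type of the curvature.
  · have hcurv := H.curvature_type hV hk hw (X₁ w).1 (Y₁ w).1 v
    have s₁ := hsnd hB₁ hB₂ hY _ eX.1 v
    have s₂ := hsnd hB₁ hB₂ hY _ eX.2.1 v
    have s₃ := hsnd hA₁ hA₂ hX _ eY.1 v
    have s₄ := hsnd hA₁ hA₂ hX _ eY.2.1 v
    rw [hadd, hsub, vertPart_lieBracket kA₁ kB₂, vertPart_lieBracket kA₂ kB₁,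
      vertPart_lieBracket kA₁ kB₁, vertPart_lieBracket kA₂ kB₂]
    rw [s₁, s₂, s₃, s₄]
    rw [eX.2.2.2, eY.2.2.2]
    simp only [map_add, map_sub, hJJ, eX.2.2.1, eY.2.2.1] at hcurv ⊢
    linear_combination (norm := module) -hcurv
  · have f₁ := hfst dY₁ dY₂ hY _ eX.1
    have f₂ := hfst dY₁ dY₂ hY _ eX.2.1
    have f₃ := hfst dX₁ dX₂ hX _ eY.1
    have f₄ := hfst dX₁ dX₂ hX _ eY.2.1
    simp only [lieBracket, Prod.fst_sub, Prod.fst_add, map_sub, f₁, f₂, f₃, f₄, map_add, hJJ]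
    -- The remaining terms are endomorphism components of one field applied to projections of the
    -- other. The relation between the vertical parts trades them for values of `Γ`, which cancel by
    -- its symmetry, that is, by torsion freeness.
    have e₁ := congrArg w.2 (eX.2.2.1 (Y₁ w).1)
    have e₂ := congrArg w.2 (eY.2.2.1 (X₁ w).1)
    simp only [vertPart_apply, eX.2.2.2, eY.2.2.2, map_add, map_sub, hJJ] at e₁ e₂
    rw [H.symm _ hw.1 (Y₁ w).1 (X₁ w).1, H.symm _ hw.1 (w.2 (Y₁ w).1) (X₁ w).1,
      H.symm _ hw.1 (w.2 (Y₁ w).1) (w.2 (X₁ w).1), H.symm _ hw.1 (Y₁ w).1 (w.2 (X₁ w).1)] at e₂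
    linear_combination (norm := module) e₁ - e₂

end IsQuaternionicFrame

end TorsionFree

end CoCR

end

noncomputable section

set_option synthInstance.maxHeartbeats 200000
set_option linter.unusedSectionVars false

namespace CoCR
/-! ### Manifolds with a single chart -/

section SingleChart

open Topology Filter VectorField

variable {G : Type*} [NormedAddCommGroup G] [NormedSpace ℝ G] {H : Type*} [TopologicalSpace H]
  {I : ModelWithCorners ℝ G H} [I.Boundaryless] {X : Type*} [TopologicalSpace X] [ChartedSpace H X]

lemma mfderiv_eq_fderiv_extChartAt {G' : Type*} [NormedAddCommGroup G']
    [NormedSpace ℝ G'] {f : X → G'} {p : X} (hf : MDifferentiableAt I 𝓘(ℝ, G') f p) :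
    (mfderiv I 𝓘(ℝ, G') f p : G →L[ℝ] G') =
      fderiv ℝ (f ∘ (extChartAt I p).symm) (extChartAt I p p) := by
  have h1 : (mfderiv I 𝓘(ℝ, G') f p : G →L[ℝ] G') =
      fderivWithin ℝ (writtenInExtChartAt I 𝓘(ℝ, G') p f) (range I) (extChartAt I p p) :=
    if_pos hf
  rw [h1, I.range_eq_univ, fderivWithin_univ]
  rfl

-- That all preferred charts coincide is the form in which a manifold covered by one chart is used
-- here: tangent spaces are then globally the model space.
variable (I) in
lemma extChartAt_eq_of_chartAt_eq (hX : ∀ p q : X, chartAt H p = chartAt H q) (p q : X) :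
    extChartAt I p = extChartAt I q := by
  simp only [extChartAt, hX p q]

lemma extChartAt_source_eq_univ (hX : ∀ p q : X, chartAt H p = chartAt H q) (p : X) :
    (extChartAt I p).source = univ := by
  rw [eq_univ_iff_forall]
  intro q
  rw [extChartAt_eq_of_chartAt_eq I hX p q]
  exact mem_extChartAt_source q

-- A tangent space is the model space seen through the preferred chart at its base point; when that
-- chart is the same at every point, its differential is the identity.
variable (I) in
lemma hasMFDerivAt_extChartAt_of_chartAt_eq [IsManifold I 1 X]
    (hX : ∀ p q : X, chartAt H p = chartAt H q)
    (p q : X) : HasMFDerivAt I 𝓘(ℝ, G) (extChartAt I p) q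
      (ContinuousLinearMap.id ℝ G : TangentSpace I q →L[ℝ] TangentSpace 𝓘(ℝ, G) (extChartAt I p q)) := by
  have h1 : MDifferentiableAt I 𝓘(ℝ, G) (extChartAt I p) q := by
    rw [extChartAt_eq_of_chartAt_eq I hX p q]
    exact mdifferentiableAt_extChartAt (mem_chart_source H q)
  have h2 : (mfderiv I 𝓘(ℝ, G) (extChartAt I p) q : G →L[ℝ] G) = ContinuousLinearMap.id ℝ G := by
    refine (mfderiv_eq_fderiv_extChartAt h1).trans ?_
    rw [extChartAt_eq_of_chartAt_eq I hX p q]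
    have h3 : (extChartAt I q ∘ (extChartAt I q).symm) =ᶠ[𝓝 (extChartAt I q q)] id := by
      filter_upwards [extChartAt_target_mem_nhds (I := I) q] with z hz
        using (extChartAt I q).right_inv hz
    rw [h3.fderiv_eq, fderiv_id]
  have h3 := h1.hasMFDerivAt
  rwa [show mfderiv I 𝓘(ℝ, G) (extChartAt I p) q = (ContinuousLinearMap.id ℝ G :
    TangentSpace I q →L[ℝ] TangentSpace 𝓘(ℝ, G) (extChartAt I p q)) from h2] at h3

variable (I) in
lemma hasMFDerivAt_extChartAt_symm_of_chartAt_eq [IsManifold I 1 X]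
    (hX : ∀ p q : X, chartAt H p = chartAt H q)
    (p : X) {y : G} (hy : y ∈ (extChartAt I p).target) :
    HasMFDerivAt 𝓘(ℝ, G) I (extChartAt I p).symm y
      (ContinuousLinearMap.id ℝ G : TangentSpace 𝓘(ℝ, G) y →L[ℝ]
        TangentSpace I ((extChartAt I p).symm y)) := by
  have hopen := isOpen_extChartAt_target (I := I) p
  have h1 : MDifferentiableAt 𝓘(ℝ, G) I (extChartAt I p).symm y :=
    (mdifferentiableOn_extChartAt_symm y hy).mdifferentiableAt (hopen.mem_nhds hy)
  refine ⟨h1.continuousAt, ?_⟩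
  have h2 : HasFDerivAt (id : G → G) (ContinuousLinearMap.id ℝ G) y := hasFDerivAt_id y
  refine HasFDerivAt.hasFDerivWithinAt ?_
  refine h2.congr_of_eventuallyEq ?_
  filter_upwards [hopen.mem_nhds hy] with z hz
  change extChartAt I ((extChartAt I p).symm y) ((extChartAt I p).symm z) = z
  rw [extChartAt_eq_of_chartAt_eq I hX _ p]
  exact (extChartAt I p).right_inv hz

lemma mlieBracket_of_chartAt_eq [IsManifold I 1 X] (hX : ∀ p q : X, chartAt H p = chartAt H q)
    (p q : X) (V W : ∀ q : X, TangentSpace I q) :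
    mlieBracket I V W q = lieBracket ℝ (E := G) (fun y => V ((extChartAt I p).symm y))
      (fun y => W ((extChartAt I p).symm y)) (extChartAt I p q) := by
  rw [extChartAt_eq_of_chartAt_eq I hX p q]
  have h1 : ∀ V : ∀ q : X, TangentSpace I q,
      mpullbackWithin 𝓘(ℝ, G) I (extChartAt I q).symm V (range I) =ᶠ[𝓝 (extChartAt I q q)]
      fun y => (V ((extChartAt I q).symm y) : G) := by
    intro V
    filter_upwards [extChartAt_target_mem_nhds (I := I) q] with y hy
    have h2 := (hasMFDerivAt_extChartAt_symm_of_chartAt_eq I hX q hy).mfderiv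
    rw [mpullbackWithin_apply, I.range_eq_univ, mfderivWithin_univ, h2]
    exact DFunLike.congr_fun (ContinuousLinearMap.inverse_id (R := ℝ) (M := G)) _
  rw [← mlieBracketWithin_univ, mlieBracketWithin_apply,
    (hasMFDerivAt_extChartAt_of_chartAt_eq I hX q q).mfderiv]
  refine (DFunLike.congr_fun (ContinuousLinearMap.inverse_id (R := ℝ) (M := G)) _).trans ?_
  have h4 : (extChartAt I q).symm ⁻¹' univ ∩ range I = univ := by
    rw [I.range_eq_univ, preimage_univ, univ_inter]
  rw [h4]
  exact ((h1 V).lieBracketWithin_vectorField_eq_nhds (𝕜 := ℝ) (s := univ) (h1 W)).trans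
    (congrFun lieBracketWithin_univ _)

lemma trivializationAt_tangent_of_chartAt_eq [IsManifold I 1 X]
    (hX : ∀ p q : X, chartAt H p = chartAt H q) (p q : X) (v : TangentSpace I q) :
    (trivializationAt G (TangentSpace I : X → Type _) p ⟨q, v⟩).2 = v := by
  rw [TangentBundle.trivializationAt_apply]
  have h1 : (chartAt H p).extend I = extChartAt I q := by rw [hX p q]; rfl
  have h3 : (extChartAt I q ∘ (extChartAt I q).symm) =ᶠ[𝓝 (extChartAt I q q)] id := by
    filter_upwards [extChartAt_target_mem_nhds (I := I) q] with z hz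
      using (extChartAt I q).right_inv hz
  change fderivWithin ℝ (((chartAt H p).extend I) ∘ (extChartAt I q).symm) (range I)
    (extChartAt I q q) v = v
  rw [h1, I.range_eq_univ, fderivWithin_univ, h3.fderiv_eq, fderiv_id]
  rfl

lemma continuousLinearMapAt_tangent_of_chartAt_eq [IsManifold I 1 X]
    (hX : ∀ p q : X, chartAt H p = chartAt H q) (p q : X) :
    ((trivializationAt G (TangentSpace I : X → Type _) p).continuousLinearMapAt ℝ q : G →L[ℝ] G)
      = ContinuousLinearMap.id ℝ G := by
  have hq : q ∈ (trivializationAt G (TangentSpace I : X → Type _) p).baseSet := by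
    rw [TangentBundle.trivializationAt_baseSet, hX p q]
    exact mem_chart_source H q
  ext v
  refine Eq.trans ?_ (trivializationAt_tangent_of_chartAt_eq hX p q v)
  rw [Trivialization.continuousLinearMapAt_apply, Trivialization.coe_linearMapAt_of_mem _ hq]

lemma symmL_tangent_of_chartAt_eq [IsManifold I 1 X]
    (hX : ∀ p q : X, chartAt H p = chartAt H q) (p q : X) :
    ((trivializationAt G (TangentSpace I : X → Type _) p).symmL ℝ q : G →L[ℝ] G)
      = ContinuousLinearMap.id ℝ G := by
  have hq : q ∈ (trivializationAt G (TangentSpace I : X → Type _) p).baseSet := by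
    rw [TangentBundle.trivializationAt_baseSet, hX p q]
    exact mem_chart_source H q
  ext v
  have h1 := (trivializationAt G (TangentSpace I : X → Type _) p).symmL_continuousLinearMapAt
    (R := ℝ) hq v
  have h2 : (trivializationAt G (TangentSpace I : X → Type _) p).continuousLinearMapAt ℝ q v = v :=
    DFunLike.congr_fun (continuousLinearMapAt_tangent_of_chartAt_eq hX p q) v
  rw [h2] at h1
  exact h1

lemma contMDiffAt_extChartAt_of_chartAt_eq [IsManifold I ∞ X]
    (hX : ∀ p q : X, chartAt H p = chartAt H q) (p q : X) :
    ContMDiffAt I 𝓘(ℝ, G) ∞ (extChartAt I p) q := by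
  rw [extChartAt_eq_of_chartAt_eq I hX p q]
  exact contMDiffAt_extChartAt

/-- Smooth functions, on a manifold with a single chart. -/
lemma contMDiffOn_iff_of_chartAt_eq [IsManifold I ∞ X] {G' : Type*} [NormedAddCommGroup G']
    [NormedSpace ℝ G'] (hX : ∀ p q : X, chartAt H p = chartAt H q) (p : X) {f : X → G'} {O : Set X} :
    ContMDiffOn I 𝓘(ℝ, G') ∞ f O ↔ ContDiffOn ℝ ∞ (fun y => f ((extChartAt I p).symm y))
      ((extChartAt I p).target ∩ (extChartAt I p).symm ⁻¹' O) := by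
  have hs := extChartAt_source_eq_univ (I := I) hX p
  rw [← contMDiffOn_iff_contDiffOn]
  constructor
  · intro h
    exact h.comp ((contMDiffOn_extChartAt_symm p).mono inter_subset_left) fun y hy => hy.2
  · intro h
    have h1 : ContMDiffOn I 𝓘(ℝ, G) ∞ (extChartAt I p) O := fun q _ =>
      (contMDiffAt_extChartAt_of_chartAt_eq hX p q).contMDiffWithinAt
    have h2 : ∀ q, (extChartAt I p).symm (extChartAt I p q) = q := fun q =>
      (extChartAt I p).left_inv (hs ▸ mem_univ q)
    refine (h.comp h1 fun q hq => ⟨(extChartAt I p).map_source (hs ▸ mem_univ q), ?_⟩).congr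
      fun q _ => ?_
    · rw [mem_preimage, h2]
      exact hq
    · simp only [Function.comp_apply, h2]

/-- Smooth vector fields, on a manifold with a single chart. -/
lemma contMDiffOn_tangent_iff_of_chartAt_eq [IsManifold I ∞ X]
    (hX : ∀ p q : X, chartAt H p = chartAt H q) {V : ∀ q : X, TangentSpace I q} {O : Set X} :
    ContMDiffOn I I.tangent ∞ (fun q => (⟨q, V q⟩ : TangentBundle I X)) O ↔
      ContMDiffOn I 𝓘(ℝ, G) ∞ (fun q => (V q : G)) O := by
  refine forall₂_congr fun q _ => ?_
  refine contMDiffWithinAt_section.trans ?_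
  refine contMDiffWithinAt_congr (fun z _ => ?_) ?_ <;>
  exact trivializationAt_tangent_of_chartAt_eq hX _ _ _

end SingleChart

end CoCR

end

noncomputable section

set_option synthInstance.maxHeartbeats 200000
set_option linter.unusedSectionVars false

namespace CoCR
-- Admissible complex structures and changes of frame.
section Admissible

variable {B : Type*} [NormedAddCommGroup B] [NormedSpace ℝ B]
  {M : Type*} [TopologicalSpace M] [ChartedSpace B M]
  {F : Type*} [NormedAddCommGroup F] [NormedSpace ℝ F]
  {E : M → Type*} [TopologicalSpace (TotalSpace F E)]
  [∀ x, AddCommGroup (E x)] [∀ x, Module ℝ (E x)] [∀ x, TopologicalSpace (E x)]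
  [∀ x, IsTopologicalAddGroup (E x)] [∀ x, ContinuousSMul ℝ (E x)]
  [FiberBundle F E] [VectorBundle ℝ F E] {k : ℕ} (Q : QuaternionicStructure B F E k)

namespace QuaternionicStructure

/-- A change of admissible frame conjugates the imaginary quaternion by a unit quaternion, which
preserves real part zero and the norm; so any one admissible frame can be used. -/
lemma mem_admissible_iff {x : M} {u : HVec k ≃L[ℝ] E x} (hu : u ∈ Q.frames x)
    {J : E x →L[ℝ] E x} : J ∈ Q.admissible x ↔
      ∃ i : ℍ[ℝ], i.re = 0 ∧ ‖i‖ = 1 ∧ ∀ q : HVec k, J (u q) = u (i • q) := by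
  refine ⟨?_, fun h => ⟨u, hu, h⟩⟩
  rintro ⟨u', hu', i, hi, hn, hJ⟩
  obtain ⟨g, hg, rfl⟩ := (Q.mem_frames_iff x u hu u').1 hu'
  obtain ⟨i', hi', hn', hgi⟩ := comp_lmul_of_mem_quaternionicGroup hg i hi
  refine ⟨i', hi', hn'.trans hn, fun q => ?_⟩
  obtain ⟨q, rfl⟩ := g.surjective q
  rw [← hgi]
  exact hJ q

/-- Unit imaginary quaternions span all imaginary ones, by scaling. -/
lemma mem_span_admissible_iff {x : M} {u : HVec k ≃L[ℝ] E x} (hu : u ∈ Q.frames x)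
    {A : E x →L[ℝ] E x} : A ∈ Submodule.span ℝ (Q.admissible x) ↔
      ∃ i : ℍ[ℝ], i.re = 0 ∧ ∀ q : HVec k, A (u q) = u (i • q) := by
  constructor
  · intro hA
    induction hA using Submodule.span_induction with
    | mem J hJ =>
      obtain ⟨i, hi, _, h⟩ := (Q.mem_admissible_iff hu).1 hJ
      exact ⟨i, hi, h⟩
    | zero => exact ⟨0, rfl, fun q => by simp⟩
    | add A A' _ _ h h' =>
      obtain ⟨i, hi, h⟩ := h
      obtain ⟨i', hi', h'⟩ := h'
      exact ⟨i + i', by simp [hi, hi'], fun q => by simp [h, h', add_smul]⟩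
    | smul c A _ h =>
      obtain ⟨i, hi, h⟩ := h
      exact ⟨c • i, by simp [hi], fun q => by simp [h]⟩
  · rintro ⟨i, hi, h⟩
    by_cases h0 : i = 0
    · have hA : A = 0 := by
        ext e
        obtain ⟨q, rfl⟩ := u.surjective e
        simp [h, h0]
      rw [hA]
      exact zero_mem _
    · have hn : ‖i‖ ≠ 0 := norm_ne_zero_iff.2 h0
      have h1 : ‖i‖⁻¹ • A ∈ Q.admissible x := by
        refine ⟨u, hu, ‖i‖⁻¹ • i, by simp [hi], ?_, fun q => by simp [h]⟩
        rw [norm_smul, norm_inv, norm_norm, inv_mul_cancel₀ hn]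
      have h2 := Submodule.smul_mem _ ‖i‖ (Submodule.subset_span (R := ℝ) h1)
      rwa [smul_smul, mul_inv_cancel₀ hn, one_smul] at h2

end QuaternionicStructure

end Admissible

section TorsionFree

open Topology Filter VectorField

variable {F : Type*} [NormedAddCommGroup F] [NormedSpace ℝ F] [FiniteDimensional ℝ F] {k : ℕ}

namespace IsQuaternionicFrame

variable {V : Set F} {Γ : F → F →L[ℝ] F →L[ℝ] F} {h : F → HVec k →L[ℝ] F}
    {hi : F → F →L[ℝ] HVec k}

/-- The Lie algebra is the normalizer of the imaginary multiplications, so compatibility means that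
the connection preserves the subbundle `frameIm`. This condition does not depend on the frame. -/
lemma change_frame (H : IsQuaternionicFrame V Γ h hi) (hV : IsOpen V) {V' : Set F} (hV' : IsOpen V')
    (hsub : V' ⊆ V) {h' : F → HVec k →L[ℝ] F} {hi' : F → F →L[ℝ] HVec k}
    (hs : ContDiffOn ℝ ∞ h' V') (his : ContDiffOn ℝ ∞ hi' V')
    (hl : ∀ y ∈ V', ∀ v, hi' y (h' y v) = v) (hr : ∀ y ∈ V', ∀ f, h' y (hi' y f) = f)
    (heq : ∀ y ∈ V', frameIm (h' y) (hi' y) = frameIm (h y) (hi y)) :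
    IsQuaternionicFrame V' Γ h' hi' where
  contDiffOn_conn := H.contDiffOn_conn.mono hsub
  symm y hy := H.symm y (hsub hy)
  contDiffOn_frame := hs
  contDiffOn_inv := his
  inv_frame := hl
  frame_inv := hr
  connForm_mem := by
    intro y hy X i hmem
    -- The endomorphism field with constant matrix `i` in the new frame; its covariant derivative,
    -- read in that frame, is the commutator of the connection form with `i`.
    set S : F → F →L[ℝ] F := fun y => (h' y).comp (i.comp (hi' y)) with hS
    have hSmem : ∀ y ∈ V', S y ∈ frameIm (h y) (hi y) := by
      intro y hy
      rw [← heq y hy, mem_frameIm]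
      convert hmem using 1
      ext v : 1
      simp [hS, hl y hy]
    have hh := hs.hasFDerivAt_of_isOpen hV' hy
    have hhi := his.hasFDerivAt_of_isOpen hV' hy
    have hSd : HasFDerivAt S _ y := hh.clm_comp ((hasFDerivAt_const i y).clm_comp hhi)
    have h1 := vertPart_mem_frameIm (x := X) (A' := fderiv ℝ S y X) H hV (hsub hy) (hSmem y hy) (by
      have h2 := (H.contDiffOn_inv.hasFDerivAt_of_isOpen hV (hsub hy)).clm_comp
        (hSd.differentiableAt.hasFDerivAt.clm_comp
          (H.contDiffOn_frame.hasFDerivAt_of_isOpen hV (hsub hy)))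
      exact mem_of_hasFDerivAt (G := HVec k →L[ℝ] HVec k) (imMul k) hV' hy h2 hSmem X)
    rw [← heq y hy, mem_frameIm] at h1
    convert h1 using 1
    ext v : 1
    have h3 : ∀ v, fderiv ℝ hi' y X (h' y v) = -hi' y (fderiv ℝ h' y X v) := by
      intro v
      have h1 := hhi.clm_apply (hasFDerivAt_clm_apply_const hh v)
      have h2 : (fun y => hi' y (h' y v)) =ᶠ[𝓝 y] fun _ => v := by
        filter_upwards [hV'.mem_nhds hy] with z hz using hl z hz v
      have h3 := DFunLike.congr_fun
        (h1.unique ((hasFDerivAt_const v y).congr_of_eventuallyEq h2)) X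
      simp at h3
      rw [← eq_neg_of_add_eq_zero_right h3]
    have h4 : fderiv ℝ S y X (h' y v) = fderiv ℝ h' y X (i v)
        - h' y (i (hi' y (fderiv ℝ h' y X v))) := by
      rw [hSd.fderiv]
      simp [hl y hy, h3]
      abel
    have h5 : ∀ f, S y f = h' y (i (hi' y f)) := fun f => rfl
    simp only [sub_apply, add_apply, ContinuousLinearMap.comp_apply, vertPart_apply, h4, h5,
      hl y hy, map_add, map_sub]
    abel

end IsQuaternionicFrame

end TorsionFree

/-! ### Tangent and endomorphism bundles of a manifold with a single chart. -/

section SingleChart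

open Topology Filter VectorField

variable {F : Type*} [NormedAddCommGroup F] [NormedSpace ℝ F]
  {N : Type*} [TopologicalSpace N] [ChartedSpace F N] [IsManifold 𝓘(ℝ, F) ∞ N]

lemma trivializationAt_eq_of_chartAt_eq (hN : ∀ p q : N, chartAt F p = chartAt F q) (p q : N) :
    trivializationAt F (TangentSpace 𝓘(ℝ, F) : N → Type _) p =
      trivializationAt F (TangentSpace 𝓘(ℝ, F) : N → Type _) q := by
  rw [TangentBundle.trivializationAt_eq_localTriv, TangentBundle.trivializationAt_eq_localTriv]
  congr 1
  exact Subtype.ext (hN p q)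

/-- The total space of the endomorphism bundle is again covered by one chart, so differentials and
brackets on it are also computed in the model space. -/
lemma chartAt_endTotal_eq (hN : ∀ p q : N, chartAt F p = chartAt F q)
    (w w' : EndTotal F (fun p : N => TangentSpace 𝓘(ℝ, F) p)) :
    chartAt (ModelProd F (F →L[ℝ] F)) w = chartAt (ModelProd F (F →L[ℝ] F)) w' := by
  rw [FiberBundle.chartedSpace_chartAt, FiberBundle.chartedSpace_chartAt, hN w.proj w'.proj]
  congr 2
  rw [hom_trivializationAt, hom_trivializationAt]
  congr 1 <;> exact trivializationAt_eq_of_chartAt_eq hN _ _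

lemma inCoordinates_tangent_of_chartAt_eq (hN : ∀ p q : N, chartAt F p = chartAt F q)
    (p q p' q' : N) (T : TangentSpace 𝓘(ℝ, F) q →L[ℝ] TangentSpace 𝓘(ℝ, F) q') :
    ContinuousLinearMap.inCoordinates F (TangentSpace 𝓘(ℝ, F) : N → Type _) F
      (TangentSpace 𝓘(ℝ, F) : N → Type _) p q p' q' T = T := by
  ext v
  have h1 : (trivializationAt F (TangentSpace 𝓘(ℝ, F) : N → Type _) p).symmL ℝ q v = v :=
    DFunLike.congr_fun (symmL_tangent_of_chartAt_eq hN p q) v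
  have h2 := DFunLike.congr_fun (continuousLinearMapAt_tangent_of_chartAt_eq hN p' q') (T v)
  refine Eq.trans ?_ h2
  rw [ContinuousLinearMap.inCoordinates]
  simp only [ContinuousLinearMap.comp_apply]
  rw [h1]

end SingleChart

end CoCR

end

noncomputable section

set_option synthInstance.maxHeartbeats 200000
set_option linter.unusedSectionVars false

namespace CoCR
-- Connections given by a Christoffel form.
section SingleChart

open Topology Filter VectorField

variable {F : Type*} [NormedAddCommGroup F] [NormedSpace ℝ F]
  {N : Type*} [TopologicalSpace N] [ChartedSpace F N] [IsManifold 𝓘(ℝ, F) ∞ N]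

lemma mdifferentiableAt_tangent_iff_of_chartAt_eq (hN : ∀ p q : N, chartAt F p = chartAt F q)
    {Y : ∀ p : N, TangentSpace 𝓘(ℝ, F) p} {p : N} :
    MDifferentiableAt 𝓘(ℝ, F) (𝓘(ℝ, F).prod 𝓘(ℝ, F))
      (fun q => (⟨q, Y q⟩ : TangentBundle 𝓘(ℝ, F) N)) p ↔
      MDifferentiableAt 𝓘(ℝ, F) 𝓘(ℝ, F) (fun q => (Y q : F)) p := by
  refine (mdifferentiableAt_section _ _).trans ?_
  have : (fun q => (trivializationAt F (TangentSpace 𝓘(ℝ, F) : N → Type _) p ⟨q, Y q⟩).2)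
      = fun q => (Y q : F) := funext fun q => trivializationAt_tangent_of_chartAt_eq hN _ _ _
  rw [this]

lemma differentiableAt_comp_extChartAt_symm {G : Type*} [NormedAddCommGroup G] [NormedSpace ℝ G]
    {f : N → G} {p : N} (hf : MDifferentiableAt 𝓘(ℝ, F) 𝓘(ℝ, G) f p) :
    DifferentiableAt ℝ (f ∘ (extChartAt 𝓘(ℝ, F) p).symm) (extChartAt 𝓘(ℝ, F) p p) := by
  have h1 := hf.differentiableWithinAt_writtenInExtChartAt
  rw [ModelWithCorners.range_eq_univ, differentiableWithinAt_univ] at h1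
  exact h1

lemma fderiv_smul_comp_extChartAt_symm {f : N → ℝ} {Y : N → F} {p : N}
    (hf : MDifferentiableAt 𝓘(ℝ, F) 𝓘(ℝ, ℝ) f p) (hY : MDifferentiableAt 𝓘(ℝ, F) 𝓘(ℝ, F) Y p) :
    fderiv ℝ (fun y => f ((extChartAt 𝓘(ℝ, F) p).symm y) • Y ((extChartAt 𝓘(ℝ, F) p).symm y))
      (extChartAt 𝓘(ℝ, F) p p) =
    f p • fderiv ℝ (Y ∘ (extChartAt 𝓘(ℝ, F) p).symm) (extChartAt 𝓘(ℝ, F) p p)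
      + (fderiv ℝ (f ∘ (extChartAt 𝓘(ℝ, F) p).symm) (extChartAt 𝓘(ℝ, F) p p)).smulRight (Y p) := by
  have h1 := ((differentiableAt_comp_extChartAt_symm hf).hasFDerivAt.smul
    (differentiableAt_comp_extChartAt_symm hY).hasFDerivAt).fderiv
  simp only [Function.comp_apply, extChartAt_to_inv] at h1
  exact h1

/-- The connection `d + Γ` on the tangent bundle of a manifold with a single chart. -/
def chartConnection (hN : ∀ p q : N, chartAt F p = chartAt F q) (Γ : F → F →L[ℝ] F →L[ℝ] F) :
    CovariantDerivative 𝓘(ℝ, F) F (fun p : N => TangentSpace 𝓘(ℝ, F) p) where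
  toFun Y p := (fderiv ℝ (fun y => (Y ((extChartAt 𝓘(ℝ, F) p).symm y) : F)) (extChartAt 𝓘(ℝ, F) p p)
    + (Γ (extChartAt 𝓘(ℝ, F) p p)).flip (Y p) : F →L[ℝ] F)
  isCovariantDerivativeOnUniv :=
    { add := by
        intro Y Y' p hY hY' _
        rw [mdifferentiableAt_tangent_iff_of_chartAt_eq hN] at hY hY'
        have h1 := ((differentiableAt_comp_extChartAt_symm hY).hasFDerivAt.add
          (differentiableAt_comp_extChartAt_symm hY').hasFDerivAt).fderiv
        refine (congrArg₂ (· + ·) h1 (map_add (Γ (extChartAt 𝓘(ℝ, F) p p)).flip (Y p) (Y' p))).trans ?_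
        exact add_add_add_comm _ _ _ _
      leibniz := by
        intro Y f p hY hf _
        rw [mdifferentiableAt_tangent_iff_of_chartAt_eq hN] at hY
        have h1 := fderiv_smul_comp_extChartAt_symm hf hY
        have h2 : (mvfderiv 𝓘(ℝ, F) f p : F →L[ℝ] ℝ) =
          fderiv ℝ (f ∘ (extChartAt 𝓘(ℝ, F) p).symm) (extChartAt 𝓘(ℝ, F) p p) :=
            mfderiv_eq_fderiv_extChartAt hf
        refine (congrArg₂ (· + ·) h1
          (map_smul (Γ (extChartAt 𝓘(ℝ, F) p p)).flip (f p) (Y p))).trans ?_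
        rw [h2]
        have h3 : ∀ (c : ℝ) (S T U : F →L[ℝ] F), c • S + T + c • U = c • (S + U) + T := by
          intro c S T U
          module
        exact h3 _ _ _ _ }

lemma chartConnection_apply (hN : ∀ p q : N, chartAt F p = chartAt F q)
    (Γ : F → F →L[ℝ] F →L[ℝ] F) (p₀ : N) (Y : ∀ p : N, TangentSpace 𝓘(ℝ, F) p) (p : N) :
    (chartConnection hN Γ Y p : F →L[ℝ] F) =
      fderiv ℝ (fun y => (Y ((extChartAt 𝓘(ℝ, F) p₀).symm y) : F)) (extChartAt 𝓘(ℝ, F) p₀ p)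
        + (Γ (extChartAt 𝓘(ℝ, F) p₀ p)).flip (Y p) := by
  rw [extChartAt_eq_of_chartAt_eq 𝓘(ℝ, F) hN p₀ p]
  rfl

end SingleChart

end CoCR

end

noncomputable section

set_option synthInstance.maxHeartbeats 200000
set_option linter.unusedSectionVars false

namespace CoCR
-- Smoothness, torsion and compatibility of such connections.
section SingleChart

open Topology Filter VectorField

variable {F : Type*} [NormedAddCommGroup F] [NormedSpace ℝ F] [FiniteDimensional ℝ F]
  {N : Type*} [TopologicalSpace N] [ChartedSpace F N] [IsManifold 𝓘(ℝ, F) ∞ N]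

lemma isSmoothSectionOn_tangent_iff (hN : ∀ p q : N, chartAt F p = chartAt F q) (p₀ : N)
    {s : ∀ p : N, TangentSpace 𝓘(ℝ, F) p} {U : Set N} :
    IsSmoothSectionOn F F s U ↔
      ContDiffOn ℝ ∞ (fun y => (s ((extChartAt 𝓘(ℝ, F) p₀).symm y) : F))
        ((extChartAt 𝓘(ℝ, F) p₀).target ∩ (extChartAt 𝓘(ℝ, F) p₀).symm ⁻¹' U) :=
  (contMDiffOn_tangent_iff_of_chartAt_eq hN).trans (contMDiffOn_iff_of_chartAt_eq hN p₀)

lemma isOpen_target_inter_preimage {G : Type*} [NormedAddCommGroup G] [NormedSpace ℝ G]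
    {H : Type*} [TopologicalSpace H] {I : ModelWithCorners ℝ G H} [I.Boundaryless] {X : Type*}
    [TopologicalSpace X] [ChartedSpace H X] (p₀ : X) {U : Set X} (hU : IsOpen U) :
    IsOpen ((extChartAt I p₀).target ∩ (extChartAt I p₀).symm ⁻¹' U) :=
  (continuousOn_extChartAt_symm p₀).isOpen_inter_preimage (isOpen_extChartAt_target p₀) hU

/-- The value of a section of the bundle of endomorphisms of the tangent space, as an endomorphism
of the model space. -/
def modelEnd {p : N} (T : TangentSpace 𝓘(ℝ, F) p →L[ℝ] TangentSpace 𝓘(ℝ, F) p) : F →L[ℝ] F := T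

/-- A frame of the tangent space, as a frame of the model space. -/
def modelFrame {k : ℕ} {p : N} (u : HVec k ≃L[ℝ] TangentSpace 𝓘(ℝ, F) p) : HVec k ≃L[ℝ] F := u

lemma contMDiff_chartConnection (hN : ∀ p q : N, chartAt F p = chartAt F q) (p₀ : N)
    {Γ : F → F →L[ℝ] F →L[ℝ] F} (hΓ : ContDiffOn ℝ ∞ Γ (extChartAt 𝓘(ℝ, F) p₀).target) :
    CovariantDerivative.ContMDiffCovariantDerivative (chartConnection hN Γ) ∞ := by
  refine ⟨⟨fun {Y} hY => ?_⟩⟩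
  have hY' : IsSmoothSectionOn F F Y univ := hY.of_le le_rfl
  rw [isSmoothSectionOn_tangent_iff hN p₀, preimage_univ, inter_univ] at hY'
  have hs := isOpen_extChartAt_target (I := 𝓘(ℝ, F)) p₀
  have h1 : ContMDiffOn 𝓘(ℝ, F) 𝓘(ℝ, F →L[ℝ] F) ∞
      (fun p => modelEnd (chartConnection hN Γ Y p)) univ := by
    rw [contMDiffOn_iff_of_chartAt_eq hN p₀, preimage_univ, inter_univ]
    have h2 : ContDiffOn ℝ ∞ (fun y => fderiv ℝ (fun y =>
        (Y ((extChartAt 𝓘(ℝ, F) p₀).symm y) : F)) y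
          + (Γ y).flip (Y ((extChartAt 𝓘(ℝ, F) p₀).symm y))) (extChartAt 𝓘(ℝ, F) p₀).target := by
      refine (hY'.fderiv_of_isOpen hs (by simp)).add ?_
      refine contDiffOn_clm_apply.2 fun X => ?_
      exact (hΓ.clm_apply contDiffOn_const).clm_apply hY'
    refine h2.congr fun y hy => ?_
    refine (chartConnection_apply hN Γ p₀ Y _).trans ?_
    rw [(extChartAt 𝓘(ℝ, F) p₀).right_inv hy]
  intro p _
  rw [contMDiffWithinAt_hom_bundle]
  refine ⟨contMDiffWithinAt_id, ?_⟩
  refine (h1 p (mem_univ p)).congr (fun q _ => ?_) ?_ <;>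
  exact inCoordinates_tangent_of_chartAt_eq hN _ _ _ _ _

lemma isTorsionFree_chartConnection (hN : ∀ p q : N, chartAt F p = chartAt F q) (p₀ : N)
    {Γ : F → F →L[ℝ] F →L[ℝ] F}
    (hΓ : ∀ y ∈ (extChartAt 𝓘(ℝ, F) p₀).target, ∀ X Y, Γ y X Y = Γ y Y X) :
    IsTorsionFree (idTangent F N) (chartConnection hN Γ) := by
  intro U hU s₁ s₂ _ _ p hp
  have hs := extChartAt_source_eq_univ (I := 𝓘(ℝ, F)) hN p₀
  have hpy : extChartAt 𝓘(ℝ, F) p₀ p ∈ (extChartAt 𝓘(ℝ, F) p₀).target :=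
    (extChartAt 𝓘(ℝ, F) p₀).map_source (hs ▸ mem_univ p)
  have hinv : (extChartAt 𝓘(ℝ, F) p₀).symm (extChartAt 𝓘(ℝ, F) p₀ p) = p :=
    (extChartAt 𝓘(ℝ, F) p₀).left_inv (hs ▸ mem_univ p)
  rw [mlieBracket_of_chartAt_eq hN p₀]
  have h1 := fun (Y : ∀ p : N, TangentSpace 𝓘(ℝ, F) p) (X : F) =>
    DFunLike.congr_fun (chartConnection_apply hN Γ p₀ Y p) X
  have h2 : ∀ (s : ∀ p : N, TangentSpace 𝓘(ℝ, F) p),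
    (s ((extChartAt 𝓘(ℝ, F) p₀).symm (extChartAt 𝓘(ℝ, F) p₀ p)) : F) = s p := fun s =>
      congrArg (fun q => (s q : F)) hinv
  have h3 : ∀ a b c f : F, c = f → (a + c) - (b + f) - (a - b) = 0 := by
    intro a b c f h
    rw [h]
    abel
  change (modelEnd (chartConnection hN Γ s₂ p) (s₁ p) - modelEnd (chartConnection hN Γ s₁ p) (s₂ p) : F) -
    (fderiv ℝ (fun y => (s₂ ((extChartAt 𝓘(ℝ, F) p₀).symm y) : F)) (extChartAt 𝓘(ℝ, F) p₀ p)
      (s₁ ((extChartAt 𝓘(ℝ, F) p₀).symm (extChartAt 𝓘(ℝ, F) p₀ p)))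
    - fderiv ℝ (fun y => (s₁ ((extChartAt 𝓘(ℝ, F) p₀).symm y) : F)) (extChartAt 𝓘(ℝ, F) p₀ p)
      (s₂ ((extChartAt 𝓘(ℝ, F) p₀).symm (extChartAt 𝓘(ℝ, F) p₀ p)))) = (0 : F)
  rw [h2 s₁, h2 s₂]
  refine Eq.trans ?_ (h3 (fderiv ℝ (fun y => (s₂ ((extChartAt 𝓘(ℝ, F) p₀).symm y) : F))
    (extChartAt 𝓘(ℝ, F) p₀ p) (s₁ p))
    (fderiv ℝ (fun y => (s₁ ((extChartAt 𝓘(ℝ, F) p₀).symm y) : F))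
    (extChartAt 𝓘(ℝ, F) p₀ p) (s₂ p)) (Γ (extChartAt 𝓘(ℝ, F) p₀ p) (s₁ p) (s₂ p))
    (Γ (extChartAt 𝓘(ℝ, F) p₀ p) (s₂ p) (s₁ p)) (hΓ _ hpy _ _))
  exact congrArg₂ (· - ·) (congrArg₂ (· - ·) (h1 s₂ (s₁ p)) (h1 s₁ (s₂ p))) rfl

variable {k : ℕ}

lemma contDiffOn_inverse {X : Type*} [NormedAddCommGroup X] [NormedSpace ℝ X] {V : Set X}
    (hV : IsOpen V) {h : X → HVec k →L[ℝ] F} {hi : X → F →L[ℝ] HVec k} (hs : ContDiffOn ℝ ∞ h V) (hl : ∀ y ∈ V, ∀ v, hi y (h y v) = v)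
    (hr : ∀ y ∈ V, ∀ f, h y (hi y f) = f) : ContDiffOn ℝ ∞ hi V := by
  have h1 : ∀ y ∈ V, ∃ e : HVec k ≃L[ℝ] F, (e : HVec k →L[ℝ] F) = h y ∧
      (e.symm : F →L[ℝ] HVec k) = hi y := fun y hy =>
    ⟨ContinuousLinearEquiv.equivOfInverse (h y) (hi y) (hl y hy) (hr y hy), rfl, rfl⟩
  have h2 : ContDiffOn ℝ ∞ (fun y => ContinuousLinearMap.inverse (h y)) V := by
    intro y hy
    obtain ⟨e, he, _⟩ := h1 y hy
    have h3 : ContDiffAt ℝ ∞ (ContinuousLinearMap.inverse (R := ℝ) (M := HVec k) (M₂ := F))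
        (h y) := by
      rw [← he]
      exact contDiffAt_map_inverse e
    exact (h3.comp y (hs.contDiffAt (hV.mem_nhds hy))).contDiffWithinAt
  refine h2.congr fun y hy => ?_
  obtain ⟨e, he, he'⟩ := h1 y hy
  rw [← he, ← he', ContinuousLinearMap.inverse_equiv]

/-- Both subspaces are the span of the admissible complex structures, which is intrinsic. -/
lemma frameIm_eq_of_mem_frames {Q' : AlmostQuaternionicStructure F N k} {p : N}
    {u u' : HVec k ≃L[ℝ] TangentSpace 𝓘(ℝ, F) p} (hu : u ∈ Q'.frames p) (hu' : u' ∈ Q'.frames p)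
    {h h' : HVec k →L[ℝ] F} {hi hi' : F →L[ℝ] HVec k} (hl : ∀ v, hi (h v) = v)
    (hr : ∀ f, h (hi f) = f) (hl' : ∀ v, hi' (h' v) = v) (hr' : ∀ f, h' (hi' f) = f)
    (huh : ∀ v, u v = h v) (huh' : ∀ v, u' v = h' v) : frameIm h' hi' = frameIm h hi := by
  ext A
  rw [mem_frameIm_iff hl hr, mem_frameIm_iff hl' hr']
  have h1 := Q'.mem_span_admissible_iff hu (A := A)
  have h2 := Q'.mem_span_admissible_iff hu' (A := A)
  simp only [huh] at h1
  simp only [huh'] at h2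
  exact h2.symm.trans h1

/-- Compatibility refers to every local admissible frame, while `H` concerns only `h`. The passage
is `change_frame`, after which `exists_form_of_mem_imNormalizer` produces the quaternion and the
matrix. -/
lemma isCompatible_chartConnection (hN : ∀ p q : N, chartAt F p = chartAt F q) (p₀ : N)
    (hk : 0 < k) {Q' : AlmostQuaternionicStructure F N k}
    {Γ : F → F →L[ℝ] F →L[ℝ] F} {h : F → HVec k →L[ℝ] F} {hi : F → F →L[ℝ] HVec k}
    (H : IsQuaternionicFrame (extChartAt 𝓘(ℝ, F) p₀).target Γ h hi)
    (hframe : ∀ p, ∃ u ∈ Q'.frames p, ∀ v, u v = h (extChartAt 𝓘(ℝ, F) p₀ p) v) :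
    Q'.IsCompatible (chartConnection hN Γ) := by
  intro U hU u hsm hu p hp X
  have hs := extChartAt_source_eq_univ (I := 𝓘(ℝ, F)) hN p₀
  set ψ := extChartAt 𝓘(ℝ, F) p₀ with hψ
  have hpy : ∀ p, ψ p ∈ ψ.target := fun p => ψ.map_source (hs ▸ mem_univ p)
  have hinv : ∀ p, ψ.symm (ψ p) = p := fun p => ψ.left_inv (hs ▸ mem_univ p)
  set V' := ψ.target ∩ ψ.symm ⁻¹' U with hV'
  have hV'o : IsOpen V' := isOpen_target_inter_preimage p₀ hU
  have hyV' : ψ p ∈ V' := ⟨hpy p, by rw [mem_preimage, hinv]; exact hp⟩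
  set h' : F → HVec k →L[ℝ] F := fun y => (modelFrame (u (ψ.symm y)) : HVec k →L[ℝ] F) with hh'
  set hi' : F → F →L[ℝ] HVec k := fun y => ((modelFrame (u (ψ.symm y))).symm : F →L[ℝ] HVec k) with hhi'
  have hl : ∀ y ∈ V', ∀ v, hi' y (h' y v) = v := fun y _ v => (modelFrame (u (ψ.symm y))).symm_apply_apply v
  have hr : ∀ y ∈ V', ∀ f, h' y (hi' y f) = f := fun y _ f => (modelFrame (u (ψ.symm y))).apply_symm_apply f
  have hs' : ContDiffOn ℝ ∞ h' V' := contDiffOn_clm_apply.2 fun q =>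
    (isSmoothSectionOn_tangent_iff hN p₀).1 (hsm q)
  have H' := H.change_frame (isOpen_extChartAt_target p₀) hV'o inter_subset_left hs'
    (contDiffOn_inverse hV'o hs' hl hr) hl hr fun y hy => by
      obtain ⟨u₀, hu₀, hu₀h⟩ := hframe (ψ.symm y)
      rw [ψ.right_inv hy.1] at hu₀h
      exact frameIm_eq_of_mem_frames hu₀ (hu _ hy.2) (H.inv_frame y hy.1) (H.frame_inv y hy.1)
        (hl y hy) (hr y hy) hu₀h fun v => rfl
  obtain ⟨a, C, ha, haC⟩ := exists_form_of_mem_imNormalizer hk (H'.connForm_mem _ hyV' X)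
  refine ⟨a, C, ha, fun q => ?_⟩
  rw [← haC]
  have h1 := DFunLike.congr_fun (chartConnection_apply hN Γ p₀ (fun y => u y q) p) X
  have h2 : fderiv ℝ (fun y => h' y q) (ψ p) X = fderiv ℝ h' (ψ p) X q := by
    rw [(hasFDerivAt_clm_apply_const (hs'.hasFDerivAt_of_isOpen hV'o hyV') q).fderiv]
    rfl
  have h3 : ∀ f, u p (hi' (ψ p) f) = f := fun f => by
    have h5 : ∀ q, q = p → u p ((modelFrame (u q)).symm f) = f := by
      rintro _ rfl
      exact (u _).apply_symm_apply f
    exact h5 _ (hinv p)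
  have h4 : h' (ψ p) q = u p q := by
    simp only [hh']
    exact congrArg (fun z => (u z q : F)) (hinv p)
  refine Eq.trans ?_ (h3 _).symm
  refine h1.trans ?_
  change fderiv ℝ (fun y => h' y q) (ψ p) X + Γ (ψ p) X (u p q)
    = fderiv ℝ h' (ψ p) X q + Γ (ψ p) X (h' (ψ p) q)
  rw [h2, h4]

end SingleChart

end CoCR

end

noncomputable section

set_option synthInstance.maxHeartbeats 200000
set_option linter.unusedSectionVars false

namespace CoCR
-- The connection map in a single chart.
section SingleChart

open Topology Filter VectorField

variable {F : Type*} [NormedAddCommGroup F] [NormedSpace ℝ F] [FiniteDimensional ℝ F]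
  {N : Type*} [TopologicalSpace N] [ChartedSpace F N] [IsManifold 𝓘(ℝ, F) ∞ N]

lemma extChartAt_endTotal_apply (hN : ∀ p q : N, chartAt F p = chartAt F q) (p₀ : N)
    (w₀ w : EndTotal F (fun p : N => TangentSpace 𝓘(ℝ, F) p)) :
    extChartAt (endModel F F) w₀ w = (extChartAt 𝓘(ℝ, F) p₀ w.proj, modelEnd w.2) := by
  rw [FiberBundle.extChartAt, extChartAt_eq_of_chartAt_eq 𝓘(ℝ, F) hN p₀ w₀.proj]
  refine Prod.ext rfl ?_
  exact inCoordinates_tangent_of_chartAt_eq hN w₀.proj w.proj w₀.proj w.proj w.2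

lemma dmatrix_tangent (hN : ∀ p q : N, chartAt F p = chartAt F q)
    (w : EndTotal F (fun p : N => TangentSpace 𝓘(ℝ, F) p))
    (ξ : TangentSpace (endModel F F) w) :
    dmatrix w ξ = (show F × (F →L[ℝ] F) from ξ).2 := by
  have h1 := hasMFDerivAt_extChartAt_of_chartAt_eq (endModel F F) (chartAt_endTotal_eq hN) w w
  have h2 : HasMFDerivAt (endModel F F) 𝓘(ℝ, F →L[ℝ] F)
      (fun w' => (extChartAt (endModel F F) w w').2) w
      (ContinuousLinearMap.snd ℝ F (F →L[ℝ] F)) :=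
    ((ContinuousLinearMap.snd ℝ F (F →L[ℝ] F)).hasMFDerivAt).comp w h1
  have h3 : (fun w' : EndTotal F (fun p : N => TangentSpace 𝓘(ℝ, F) p) =>
      (extChartAt (endModel F F) w w').2) = fun w' =>
      ContinuousLinearMap.inCoordinates F (TangentSpace 𝓘(ℝ, F) : N → Type _) F
      (TangentSpace 𝓘(ℝ, F) : N → Type _) w.proj w'.proj w.proj w'.proj w'.2 := by
    rw [FiberBundle.extChartAt]
    rfl
  rw [h3] at h2
  exact DFunLike.congr_fun h2.mfderiv ξ

lemma dproj_tangent (hN : ∀ p q : N, chartAt F p = chartAt F q)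
    (w : EndTotal F (fun p : N => TangentSpace 𝓘(ℝ, F) p))
    (ξ : TangentSpace (endModel F F) w) :
    dproj w ξ = (show F × (F →L[ℝ] F) from ξ).1 := by
  have h1 := hasMFDerivAt_extChartAt_of_chartAt_eq (endModel F F) (chartAt_endTotal_eq hN) w w
  have h2 : HasMFDerivAt (endModel F F) 𝓘(ℝ, F)
      (fun w' => (extChartAt (endModel F F) w w').1) w
      (ContinuousLinearMap.fst ℝ F (F →L[ℝ] F)) :=
    ((ContinuousLinearMap.fst ℝ F (F →L[ℝ] F)).hasMFDerivAt).comp w h1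
  have h3 : (fun w' : EndTotal F (fun p : N => TangentSpace 𝓘(ℝ, F) p) =>
      (extChartAt (endModel F F) w w').1) =
      fun w' => extChartAt 𝓘(ℝ, F) w.proj w'.proj := by
    rw [FiberBundle.extChartAt]
    rfl
  have h4 : MDifferentiableAt (endModel F F) 𝓘(ℝ, F)
      (fun w' : EndTotal F (fun p : N => TangentSpace 𝓘(ℝ, F) p) => w'.proj) w :=
    mdifferentiableAt_proj _
  have h5 := (hasMFDerivAt_extChartAt_of_chartAt_eq 𝓘(ℝ, F) hN w.proj w.proj).comp w
    h4.hasMFDerivAt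
  rw [h3] at h2
  exact DFunLike.congr_fun (h5.mfderiv.symm.trans h2.mfderiv) ξ

/-- The constant sections of the definition are constant vectors of the model space, whose covariant
derivative is `Γ` alone. -/
lemma connectionMap_chartConnection (hN : ∀ p q : N, chartAt F p = chartAt F q)
    (Γ : F → F →L[ℝ] F →L[ℝ] F) (w₀ w : EndTotal F (fun p : N => TangentSpace 𝓘(ℝ, F) p))
    (ξ : TangentSpace (endModel F F) w) (v : TangentSpace 𝓘(ℝ, F) w.proj) :
    connectionMap (chartConnection hN Γ) w ξ v =
      vertPart Γ (extChartAt (endModel F F) w₀ w) ξ v := by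
  have h1 : ∀ f q, constSection (E := fun p : N => TangentSpace 𝓘(ℝ, F) p) w.proj f q = f :=
    fun f q => DFunLike.congr_fun (symmL_tangent_of_chartAt_eq hN w.proj q) f
  have h1' : ∀ f : F, constSection (E := fun p : N => TangentSpace 𝓘(ℝ, F) p) w.proj f = fun _ => f :=
    fun f => funext (h1 f)
  have h2 : ∀ v, (trivializationAt F (fun p : N => TangentSpace 𝓘(ℝ, F) p)
      w.proj).continuousLinearMapAt ℝ w.proj v = v := fun v =>
    DFunLike.congr_fun (continuousLinearMapAt_tangent_of_chartAt_eq hN w.proj w.proj) v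
  have h3 : ∀ f X : F, chartConnection hN Γ (fun _ => f) w.proj X
      = Γ (extChartAt 𝓘(ℝ, F) w₀.proj w.proj) X f := by
    intro f X
    refine (DFunLike.congr_fun (chartConnection_apply hN Γ w₀.proj _ w.proj) X).trans ?_
    have h4 : fderiv ℝ (fun _ : F => f) (extChartAt 𝓘(ℝ, F) w₀.proj w.proj) = 0 :=
      (hasFDerivAt_const f _).fderiv
    change (fderiv ℝ (fun _ : F => f) (extChartAt 𝓘(ℝ, F) w₀.proj w.proj)) X + _ = _
    rw [h4]
    exact zero_add _
  rw [connectionMap, h1, h1', h1', h2, h2, dmatrix_tangent hN, dproj_tangent hN]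
  rw [extChartAt_endTotal_apply hN w₀.proj w₀ w]
  refine congrArg₂ (· - ·) (congrArg₂ (· + ·) rfl (h3 _ _)) (congrArg w.2 (h3 _ _))

end SingleChart

end CoCR

end

noncomputable section

set_option synthInstance.maxHeartbeats 200000
set_option linter.unusedSectionVars false

namespace CoCR
-- The complex distribution in a single chart.
section SingleChart

open Topology Filter VectorField

variable {F : Type*} [NormedAddCommGroup F] [NormedSpace ℝ F] [FiniteDimensional ℝ F]
  {N : Type*} [TopologicalSpace N] [ChartedSpace F N] [IsManifold 𝓘(ℝ, F) ∞ N]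
  {k : ℕ} {Q' : AlmostQuaternionicStructure F N k} {p₀ : N}
  {Γ : F → F →L[ℝ] F →L[ℝ] F} {h : F → HVec k →L[ℝ] F} {hi : F → F →L[ℝ] HVec k}

/-- An endomorphism of the model space, as an endomorphism of a tangent space. -/
def tangentEnd (p : N) (T : F →L[ℝ] F) : TangentSpace 𝓘(ℝ, F) p →L[ℝ] TangentSpace 𝓘(ℝ, F) p := T

lemma mem_twistorBundle_iff_of_chartAt_eq (hN : ∀ p q : N, chartAt F p = chartAt F q)
    (H : IsQuaternionicFrame (extChartAt 𝓘(ℝ, F) p₀).target Γ h hi)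
    (hframe : ∀ p, ∃ u ∈ Q'.frames p, ∀ v, u v = h (extChartAt 𝓘(ℝ, F) p₀ p) v)
    (w₀ w : EndTotal F (fun p : N => TangentSpace 𝓘(ℝ, F) p)) :
    w ∈ Q'.twistorBundle ↔
      extChartAt (endModel F F) w₀ w ∈ frameTwistor (extChartAt 𝓘(ℝ, F) p₀).target h hi := by
  rw [extChartAt_endTotal_apply hN p₀]
  have hy : extChartAt 𝓘(ℝ, F) p₀ w.proj ∈ (extChartAt 𝓘(ℝ, F) p₀).target :=
    (extChartAt 𝓘(ℝ, F) p₀).map_source (extChartAt_source_eq_univ (I := 𝓘(ℝ, F)) hN p₀ ▸ mem_univ _)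
  obtain ⟨u, hu, huh⟩ := hframe w.proj
  refine (Q'.mem_admissible_iff hu).trans ?_
  refine Iff.trans ?_ (and_iff_right hy).symm
  refine exists_congr fun q => and_congr_right fun _ => and_congr_right fun _ => ?_
  simp only [huh]
  constructor
  · intro hJ
    ext f : 1
    have := hJ (hi (extChartAt 𝓘(ℝ, F) p₀ w.proj) f)
    rw [H.frame_inv _ hy] at this
    exact this
  · intro hJ v
    refine (DFunLike.congr_fun hJ _).trans ?_
    change h _ (q • hi _ (h _ v)) = _
    rw [H.inv_frame _ hy]

lemma mem_verticalTangent_iff_of_chartAt_eq (hN : ∀ p q : N, chartAt F p = chartAt F q)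
    (H : IsQuaternionicFrame (extChartAt 𝓘(ℝ, F) p₀).target Γ h hi)
    (hframe : ∀ p, ∃ u ∈ Q'.frames p, ∀ v, u v = h (extChartAt 𝓘(ℝ, F) p₀ p) v)
    (w₀ w : EndTotal F (fun p : N => TangentSpace 𝓘(ℝ, F) p))
    (A : TangentSpace 𝓘(ℝ, F) w.proj →L[ℝ] TangentSpace 𝓘(ℝ, F) w.proj) :
    A ∈ Q'.verticalTangent w.proj w.2 ↔
      modelEnd A ∈ frameIm (h (extChartAt (endModel F F) w₀ w).1)
        (hi (extChartAt (endModel F F) w₀ w).1) ∧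
      ∀ v, modelEnd A ((extChartAt (endModel F F) w₀ w).2 v)
        = -(extChartAt (endModel F F) w₀ w).2 (modelEnd A v) := by
  rw [extChartAt_endTotal_apply hN p₀]
  have hy : extChartAt 𝓘(ℝ, F) p₀ w.proj ∈ (extChartAt 𝓘(ℝ, F) p₀).target :=
    (extChartAt 𝓘(ℝ, F) p₀).map_source (extChartAt_source_eq_univ (I := 𝓘(ℝ, F)) hN p₀ ▸ mem_univ _)
  obtain ⟨u, hu, huh⟩ := hframe w.proj
  refine and_congr ((Q'.mem_span_admissible_iff hu).trans ?_) ?_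
  · rw [mem_frameIm_iff (H.inv_frame _ hy) (H.frame_inv _ hy)]
    simp only [huh]
    rfl
  · exact ⟨fun hA v => DFunLike.congr_fun hA v, fun hA => ContinuousLinearMap.ext hA⟩

/-- The auxiliary endomorphisms and vectors of `distribution` are determined by the tangent vectors:
they are the vertical parts and the projections. The second half of each type condition follows from
the first by `J² = -1`. -/
lemma distribution_iff_of_chartAt_eq (hN : ∀ p q : N, chartAt F p = chartAt F q)
    (H : IsQuaternionicFrame (extChartAt 𝓘(ℝ, F) p₀).target Γ h hi)
    (hframe : ∀ p, ∃ u ∈ Q'.frames p, ∀ v, u v = h (extChartAt 𝓘(ℝ, F) p₀ p) v)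
    (w₀ : EndTotal F (fun p : N => TangentSpace 𝓘(ℝ, F) p))
    {w : EndTotal F (fun p : N => TangentSpace 𝓘(ℝ, F) p)} (hw : w ∈ Q'.twistorBundle)
    (ξ η : TangentSpace (endModel F F) w) :
    Q'.distribution (idTangent F N) (chartConnection hN Γ) w ξ η ↔
      frameDistribution Γ h hi (extChartAt (endModel F F) w₀ w) ξ η := by
  have hK := connectionMap_chartConnection hN Γ w₀ w
  have hJJ := H.sq_apply ((mem_twistorBundle_iff_of_chartAt_eq hN H hframe w₀ w).1 hw)
  have hV := mem_verticalTangent_iff_of_chartAt_eq hN H hframe w₀ w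
  have hJ : ∀ v, (extChartAt (endModel F F) w₀ w).2 v = w.2 v := fun v => by
    rw [extChartAt_endTotal_apply hN p₀]
    rfl
  constructor
  · rintro ⟨⟨A₁, A₂, ⟨hA₁, hA₂, h12, _⟩, hξ, hη⟩, e₁, e₂, he, _, hpξ, hpη⟩
    have h1 : vertPart Γ (extChartAt (endModel F F) w₀ w) ξ = modelEnd A₁ :=
      ContinuousLinearMap.ext fun v => (hK ξ v).symm.trans (hξ v)
    have h2 : vertPart Γ (extChartAt (endModel F F) w₀ w) η = modelEnd A₂ :=
      ContinuousLinearMap.ext fun v => (hK η v).symm.trans (hη v)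
    refine ⟨?_, ?_, fun v => ?_, ?_⟩
    · change _ ∧ _
      rw [h1]
      exact (hV A₁).1 hA₁
    · change _ ∧ _
      rw [h2]
      exact (hV A₂).1 hA₂
    · rw [h1, h2, hJ]
      exact (DFunLike.congr_fun h12 v).symm
    · rw [hJ]
      have h3 := (dproj_tangent hN w ξ).symm.trans hpξ
      have h4 := (dproj_tangent hN w η).symm.trans hpη
      refine h4.trans (he.symm.trans ?_)
      exact congrArg w.2 h3.symm
  · rintro ⟨h1, h2, h3, h4⟩
    refine ⟨⟨tangentEnd w.proj (vertPart Γ (extChartAt (endModel F F) w₀ w) ξ),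
      tangentEnd w.proj (vertPart Γ (extChartAt (endModel F F) w₀ w) η), ⟨(hV _).2 h1, (hV _).2 h2, ?_, ?_⟩,
      hK ξ, hK η⟩, (show F × (F →L[ℝ] F) from ξ).1, (show F × (F →L[ℝ] F) from η).1, ?_, ?_,
      dproj_tangent hN w ξ, dproj_tangent hN w η⟩
    · exact ContinuousLinearMap.ext fun v => (hJ _).symm.trans (h3 v).symm
    · refine ContinuousLinearMap.ext fun v => (hJ _).symm.trans ?_
      refine (congrArg (extChartAt (endModel F F) w₀ w).2 (h3 v)).trans ?_
      exact hJJ _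
    · exact (hJ _).symm.trans h4.symm
    · refine (hJ _).symm.trans ((congrArg (extChartAt (endModel F F) w₀ w).2 h4).trans ?_)
      exact hJJ _

theorem isIntegrable_chartConnection (hN : ∀ p q : N, chartAt F p = chartAt F q) (hk : 2 ≤ k)
    (H : IsQuaternionicFrame (extChartAt 𝓘(ℝ, F) p₀).target Γ h hi)
    (hframe : ∀ p, ∃ u ∈ Q'.frames p, ∀ v, u v = h (extChartAt 𝓘(ℝ, F) p₀ p) v) :
    Q'.IsIntegrable (idTangent F N) (chartConnection hN Γ) := by
  intro O hO X₁ X₂ Y₁ Y₂ hsm hX hY w hw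
  have hE := chartAt_endTotal_eq hN
  set Ψ := extChartAt (endModel F F) w with hΨ
  have hsrc : ∀ w, w ∈ Ψ.source := fun w' => by
    rw [hΨ, extChartAt_source_eq_univ hE]
    trivial
  have hsm' : ∀ V ∈ ({X₁, X₂, Y₁, Y₂} : Set (∀ w : EndTotal F (fun p : N => TangentSpace 𝓘(ℝ, F) p),
      TangentSpace (endModel F F) w)), ContDiffOn ℝ ∞ (fun z => (V (Ψ.symm z) : F × (F →L[ℝ] F)))
        (Ψ.target ∩ Ψ.symm ⁻¹' O) := fun V hV =>
    (contMDiffOn_iff_of_chartAt_eq hE w).1 ((contMDiffOn_tangent_iff_of_chartAt_eq hE).1 (hsm V hV))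
  have hdist : ∀ {X Y : ∀ w : EndTotal F (fun p : N => TangentSpace 𝓘(ℝ, F) p),
      TangentSpace (endModel F F) w},
      (∀ w ∈ O ∩ Q'.twistorBundle, Q'.distribution (idTangent F N) (chartConnection hN Γ) w (X w) (Y w)) →
      ∀ z ∈ (Ψ.target ∩ Ψ.symm ⁻¹' O) ∩ frameTwistor (extChartAt 𝓘(ℝ, F) p₀).target h hi,
        frameDistribution Γ h hi z (X (Ψ.symm z)) (Y (Ψ.symm z)) := by
    intro X Y hXY z hz
    have h1 : Ψ.symm z ∈ Q'.twistorBundle := by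
      rw [mem_twistorBundle_iff_of_chartAt_eq hN H hframe w, ← hΨ, Ψ.right_inv hz.1.1]
      exact hz.2
    have h2 := (distribution_iff_of_chartAt_eq hN H hframe w h1 _ _).1 (hXY _ ⟨hz.1.2, h1⟩)
    rw [← hΨ, Ψ.right_inv hz.1.1] at h2
    exact h2
  have hinv : Ψ.symm (Ψ w) = w := Ψ.left_inv (hsrc w)
  have key := H.frameDistribution_lieBracket (isOpen_extChartAt_target p₀) hk
    (isOpen_target_inter_preimage w hO)
    (hsm' X₁ (by simp)) (hsm' X₂ (by simp)) (hsm' Y₁ (by simp)) (hsm' Y₂ (by simp))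
    (hdist hX) (hdist hY) (w := Ψ w)
    ⟨Ψ.map_source (hsrc w), by rw [mem_preimage, hinv]; exact hw.1⟩
    ((mem_twistorBundle_iff_of_chartAt_eq hN H hframe w w).1 hw.2)
  rw [distribution_iff_of_chartAt_eq hN H hframe w hw.2]
  rw [mlieBracket_of_chartAt_eq hE w, mlieBracket_of_chartAt_eq hE w,
    mlieBracket_of_chartAt_eq hE w, mlieBracket_of_chartAt_eq hE w]
  exact key

theorem isQuaternionic_chartConnection (hN : ∀ p q : N, chartAt F p = chartAt F q) (hk : 2 ≤ k)
    (H : IsQuaternionicFrame (extChartAt 𝓘(ℝ, F) p₀).target Γ h hi)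
    (hframe : ∀ p, ∃ u ∈ Q'.frames p, ∀ v, u v = h (extChartAt 𝓘(ℝ, F) p₀ p) v) :
    IsQuaternionic Q' (chartConnection hN Γ) where
  smooth := contMDiff_chartConnection hN p₀ H.contDiffOn_conn
  compatible := isCompatible_chartConnection hN p₀ (by omega) H hframe
  torsionFree := isTorsionFree_chartConnection hN p₀ H.symm
  integrable := isIntegrable_chartConnection hN hk H hframe

end SingleChart

end CoCR

end

noncomputable section

set_option synthInstance.maxHeartbeats 200000
set_option linter.unusedSectionVars false

namespace CoCR
/-! ### Vector bundles in coordinates -/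

section LocalRepresentation

open Topology Filter VectorField

variable {B : Type*} [NormedAddCommGroup B] [NormedSpace ℝ B] [FiniteDimensional ℝ B]
  {M : Type*} [TopologicalSpace M] [T2Space M] [ChartedSpace B M] [IsManifold 𝓘(ℝ, B) ∞ M]
  {F : Type*} [NormedAddCommGroup F] [NormedSpace ℝ F] [FiniteDimensional ℝ F]
  {E : M → Type*} [TopologicalSpace (TotalSpace F E)]
  [∀ x, AddCommGroup (E x)] [∀ x, Module ℝ (E x)] [∀ x, TopologicalSpace (E x)]
  [∀ x, IsTopologicalAddGroup (E x)] [∀ x, ContinuousSMul ℝ (E x)]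
  [FiberBundle F E] [VectorBundle ℝ F E] [ContMDiffVectorBundle ∞ F E 𝓘(ℝ, B)]

variable (F E) in
/-- The coordinates of the vectors in the fibre over `x`, with respect to the preferred
trivialization around `x₀`. -/
abbrev coordAt (x₀ x : M) : E x →L[ℝ] F := (trivializationAt F E x₀).continuousLinearMapAt ℝ x

variable (F E) in
/-- The vector in the fibre over `x` with given coordinates, with respect to the preferred
trivialization around `x₀`. -/
abbrev vecAt (x₀ x : M) : F →L[ℝ] E x := (trivializationAt F E x₀).symmL ℝ x

variable (B F E) in
/-- The domain of the preferred coordinates around `x₀`. -/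
def coordDomain (x₀ : M) : Set M :=
  (extChartAt 𝓘(ℝ, B) x₀).source ∩ (trivializationAt F E x₀).baseSet

lemma isOpen_coordDomain (x₀ : M) : IsOpen (coordDomain B F E x₀) :=
  (isOpen_extChartAt_source x₀).inter (trivializationAt F E x₀).open_baseSet

lemma mem_coordDomain (x₀ : M) : x₀ ∈ coordDomain B F E x₀ :=
  ⟨mem_extChartAt_source x₀, FiberBundle.mem_baseSet_trivializationAt' x₀⟩

lemma coordAt_vecAt {x₀ x : M} (hx : x ∈ (trivializationAt F E x₀).baseSet) (f : F) :
    coordAt F E x₀ x (vecAt F E x₀ x f) = f :=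
  (trivializationAt F E x₀).continuousLinearMapAt_symmL hx f

lemma vecAt_coordAt {x₀ x : M} (hx : x ∈ (trivializationAt F E x₀).baseSet) (v : E x) :
    vecAt F E x₀ x (coordAt F E x₀ x v) = v :=
  (trivializationAt F E x₀).symmL_continuousLinearMapAt hx v

lemma mem_baseSet_tangent {x₀ x : M} (hx : x ∈ (extChartAt 𝓘(ℝ, B) x₀).source) :
    x ∈ (trivializationAt B (TangentSpace 𝓘(ℝ, B) : M → Type _) x₀).baseSet := by
  rw [TangentBundle.trivializationAt_baseSet]
  simpa using hx

lemma coordAt_tangent {x₀ x : M} (hx : x ∈ (extChartAt 𝓘(ℝ, B) x₀).source) :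
    (coordAt B (TangentSpace 𝓘(ℝ, B) : M → Type _) x₀ x) =
      (mfderiv 𝓘(ℝ, B) 𝓘(ℝ, B) (extChartAt 𝓘(ℝ, B) x₀) x : TangentSpace 𝓘(ℝ, B) x →L[ℝ] B) :=
  TangentBundle.continuousLinearMapAt_trivializationAt (by simpa using hx)

lemma vecAt_tangent {x₀ x : M} (hx : x ∈ (extChartAt 𝓘(ℝ, B) x₀).source) :
    (vecAt B (TangentSpace 𝓘(ℝ, B) : M → Type _) x₀ x) =
      (mfderiv 𝓘(ℝ, B) 𝓘(ℝ, B) (extChartAt 𝓘(ℝ, B) x₀).symm (extChartAt 𝓘(ℝ, B) x₀ x) :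
        B →L[ℝ] TangentSpace 𝓘(ℝ, B) ((extChartAt 𝓘(ℝ, B) x₀).symm (extChartAt 𝓘(ℝ, B) x₀ x))) := by
  have h := TangentBundle.symmL_trivializationAt (I := 𝓘(ℝ, B)) (x₀ := x₀) (x := x)
    (by simpa using hx)
  rw [ModelWithCorners.range_eq_univ, mfderivWithin_univ] at h
  exact h

/-- The local representative of a section. -/
def localRep (x₀ : M) (s : ∀ x, E x) (b : B) : F :=
  coordAt F E x₀ ((extChartAt 𝓘(ℝ, B) x₀).symm b) (s ((extChartAt 𝓘(ℝ, B) x₀).symm b))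

/-- The part of the coordinate domain, in the model space, corresponding to `U`. -/
def chartImage (x₀ : M) (U : Set M) : Set B :=
  (extChartAt 𝓘(ℝ, B) x₀).target ∩ (extChartAt 𝓘(ℝ, B) x₀).symm ⁻¹' U

lemma isOpen_chartImage (x₀ : M) {U : Set M} (hU : IsOpen U) :
    IsOpen (chartImage (B := B) x₀ U) := isOpen_target_inter_preimage x₀ hU

lemma extChartAt_mem_chartImage {x₀ x : M} {U : Set M} (hx : x ∈ (extChartAt 𝓘(ℝ, B) x₀).source)
    (hxU : x ∈ U) : extChartAt 𝓘(ℝ, B) x₀ x ∈ chartImage (B := B) x₀ U :=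
  ⟨(extChartAt 𝓘(ℝ, B) x₀).map_source hx, by
    rw [mem_preimage, (extChartAt 𝓘(ℝ, B) x₀).left_inv hx]; exact hxU⟩

lemma contMDiffOn_iff_chartImage {G : Type*} [NormedAddCommGroup G] [NormedSpace ℝ G] (x₀ : M)
    {U : Set M} (hU : U ⊆ (extChartAt 𝓘(ℝ, B) x₀).source) {f : M → G} :
    ContMDiffOn 𝓘(ℝ, B) 𝓘(ℝ, G) ∞ f U ↔
      ContDiffOn ℝ ∞ (fun b => f ((extChartAt 𝓘(ℝ, B) x₀).symm b)) (chartImage x₀ U) := by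
  rw [← contMDiffOn_iff_contDiffOn]
  constructor
  · intro h
    exact h.comp ((contMDiffOn_extChartAt_symm x₀).mono inter_subset_left) fun y hy => hy.2
  · intro h
    have h1 : ContMDiffOn 𝓘(ℝ, B) 𝓘(ℝ, B) ∞ (extChartAt 𝓘(ℝ, B) x₀) U :=
      contMDiffOn_extChartAt.mono (by simpa using hU)
    refine (h.comp h1 fun q hq => extChartAt_mem_chartImage (hU hq) hq).congr fun q hq => ?_
    simp only [Function.comp_apply, (extChartAt 𝓘(ℝ, B) x₀).left_inv (hU hq)]

lemma mdifferentiableAt_iff_extChartAt {G : Type*} [NormedAddCommGroup G] [NormedSpace ℝ G]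
    {x₀ x : M} (hx : x ∈ (extChartAt 𝓘(ℝ, B) x₀).source) {f : M → G} :
    MDifferentiableAt 𝓘(ℝ, B) 𝓘(ℝ, G) f x ↔
      DifferentiableAt ℝ (fun b => f ((extChartAt 𝓘(ℝ, B) x₀).symm b)) (extChartAt 𝓘(ℝ, B) x₀ x) := by
  rw [← mdifferentiableAt_iff_differentiableAt]
  have hy := (extChartAt 𝓘(ℝ, B) x₀).map_source hx
  have h1 : MDifferentiableAt 𝓘(ℝ, B) 𝓘(ℝ, B) (extChartAt 𝓘(ℝ, B) x₀) x :=
    mdifferentiableAt_extChartAt (by simpa using hx)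
  have h2 : MDifferentiableAt 𝓘(ℝ, B) 𝓘(ℝ, B) (extChartAt 𝓘(ℝ, B) x₀).symm
      (extChartAt 𝓘(ℝ, B) x₀ x) :=
    (mdifferentiableOn_extChartAt_symm _ hy).mdifferentiableAt
      ((isOpen_extChartAt_target x₀).mem_nhds hy)
  constructor
  · intro h
    rw [← (extChartAt 𝓘(ℝ, B) x₀).left_inv hx] at h
    exact h.comp _ h2
  · intro h
    refine (h.comp _ h1).congr_of_eventuallyEq ?_
    filter_upwards [(isOpen_extChartAt_source x₀).mem_nhds hx] with z hz
    simp only [Function.comp_apply, (extChartAt 𝓘(ℝ, B) x₀).left_inv hz]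

lemma mfderiv_eq_fderiv_coordAt {G : Type*} [NormedAddCommGroup G] [NormedSpace ℝ G]
    {x₀ x : M} (hx : x ∈ (extChartAt 𝓘(ℝ, B) x₀).source) {f : M → G}
    (hf : MDifferentiableAt 𝓘(ℝ, B) 𝓘(ℝ, G) f x) (X : TangentSpace 𝓘(ℝ, B) x) :
    (mfderiv 𝓘(ℝ, B) 𝓘(ℝ, G) f x X : G) =
      fderiv ℝ (fun b => f ((extChartAt 𝓘(ℝ, B) x₀).symm b)) (extChartAt 𝓘(ℝ, B) x₀ x)
        (coordAt B (TangentSpace 𝓘(ℝ, B) : M → Type _) x₀ x X) := by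
  have h1 : HasMFDerivAt 𝓘(ℝ, B) 𝓘(ℝ, G) f x _ :=
    (((mdifferentiableAt_iff_extChartAt hx).1 hf).hasFDerivAt.hasMFDerivAt.comp x
      (mdifferentiableAt_extChartAt (I := 𝓘(ℝ, B)) (x := x₀)
        (by simpa using hx)).hasMFDerivAt).congr_of_eventuallyEq (f₁ := f) (by
        filter_upwards [(isOpen_extChartAt_source x₀).mem_nhds hx] with z hz
        simp only [Function.comp_apply, (extChartAt 𝓘(ℝ, B) x₀).left_inv hz])
  rw [coordAt_tangent hx]
  exact DFunLike.congr_fun h1.mfderiv X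

lemma coordAt_apply_eq {x₀ x : M} (hx : x ∈ (trivializationAt F E x₀).baseSet) (v : E x) :
    coordAt F E x₀ x v = (trivializationAt F E x₀ ⟨x, v⟩).2 := by
  rw [Trivialization.continuousLinearMapAt_apply, Trivialization.coe_linearMapAt_of_mem _ hx]

lemma isSmoothSectionOn_iff_localRep {x₀ : M} {U : Set M} (hU : IsOpen U)
    (hUd : U ⊆ coordDomain B F E x₀) {s : ∀ x, E x} :
    IsSmoothSectionOn B F s U ↔ ContDiffOn ℝ ∞ (localRep (B := B) (F := F) x₀ s) (chartImage x₀ U) := by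
  refine ((trivializationAt F E x₀).contMDiffOn_section_iff hU fun x hx => (hUd hx).2).trans ?_
  rw [contMDiffOn_iff_chartImage x₀ fun x hx => (hUd hx).1]
  refine contDiffOn_congr fun b hb => ?_
  exact (coordAt_apply_eq (hUd hb.2).2 _).symm

lemma mdifferentiableAt_section_iff_localRep {x₀ x : M} (hx : x ∈ coordDomain B F E x₀)
    {s : ∀ x, E x} :
    MDifferentiableAt 𝓘(ℝ, B) (𝓘(ℝ, B).prod 𝓘(ℝ, F)) (fun x => (⟨x, s x⟩ : TotalSpace F E)) x ↔
      DifferentiableAt ℝ (localRep (B := B) (F := F) x₀ s) (extChartAt 𝓘(ℝ, B) x₀ x) := by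
  have hop := isOpen_chartImage (B := B) x₀ (isOpen_coordDomain (B := B) (F := F) (E := E) x₀)
  refine ((trivializationAt F E x₀).mdifferentiableAt_section_iff 𝓘(ℝ, B) s hx.2).trans ?_
  rw [mdifferentiableAt_iff_extChartAt hx.1]
  refine Filter.EventuallyEq.differentiableAt_iff ?_
  filter_upwards [hop.mem_nhds (extChartAt_mem_chartImage hx.1 hx)] with b hb
  exact (coordAt_apply_eq hb.2.2 _).symm

lemma localRep_constSection {x₀ : M} {b : B} (hb : b ∈ chartImage x₀ (coordDomain B F E x₀)) (f : F) :
    localRep (E := E) x₀ (constSection x₀ f) b = f := coordAt_vecAt hb.2.2 f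

lemma isSmoothSectionOn_constSection (x₀ : M) (f : F) :
    IsSmoothSectionOn B F (constSection (E := E) x₀ f) (coordDomain B F E x₀) := by
  rw [isSmoothSectionOn_iff_localRep (isOpen_coordDomain x₀) subset_rfl]
  exact contDiffOn_const.congr fun b hb => localRep_constSection hb f

lemma IsSmoothSectionOn.mdifferentiableAt {s : ∀ x, E x} {U : Set M} (hs : IsSmoothSectionOn B F s U)
    (hU : IsOpen U) {x : M} (hx : x ∈ U) : MDifferentiableAt 𝓘(ℝ, B) (𝓘(ℝ, B).prod 𝓘(ℝ, F))
      (fun x => (⟨x, s x⟩ : TotalSpace F E)) x :=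
  (hs.contMDiffAt (hU.mem_nhds hx)).mdifferentiableAt (by simp)

end LocalRepresentation

end CoCR

end

noncomputable section

set_option synthInstance.maxHeartbeats 200000
set_option linter.unusedSectionVars false

namespace CoCR
-- Local connection forms and brackets.
section LocalConnection

open Topology Filter VectorField

variable {B : Type*} [NormedAddCommGroup B] [NormedSpace ℝ B] [FiniteDimensional ℝ B]
  {M : Type*} [TopologicalSpace M] [T2Space M] [ChartedSpace B M] [IsManifold 𝓘(ℝ, B) ∞ M]
  {F : Type*} [NormedAddCommGroup F] [NormedSpace ℝ F] [FiniteDimensional ℝ F]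
  {E : M → Type*} [TopologicalSpace (TotalSpace F E)]
  [∀ x, AddCommGroup (E x)] [∀ x, Module ℝ (E x)] [∀ x, TopologicalSpace (E x)]
  [∀ x, IsTopologicalAddGroup (E x)] [∀ x, ContinuousSMul ℝ (E x)]
  [FiberBundle F E] [VectorBundle ℝ F E] [ContMDiffVectorBundle ∞ F E 𝓘(ℝ, B)]

/-- Smoothness of `∇` is a statement about global sections. A bump function equal to one near the
point extends the local section by zero, and locality of `∇` leaves the derivative near the point
unchanged. -/
lemma contDiffOn_coordAt_nabla {nabla : CovariantDerivative 𝓘(ℝ, B) F E}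
    (hsmooth : CovariantDerivative.ContMDiffCovariantDerivative nabla ∞) {x₀ : M} {U : Set M}
    (hU : IsOpen U) (hUd : U ⊆ coordDomain B F E x₀) {s : ∀ x, E x} (hs : IsSmoothSectionOn B F s U) :
    ContDiffOn ℝ ∞ (fun b => (coordAt F E x₀ ((extChartAt 𝓘(ℝ, B) x₀).symm b)).comp
      ((nabla s ((extChartAt 𝓘(ℝ, B) x₀).symm b)).comp
        (vecAt B (TangentSpace 𝓘(ℝ, B) : M → Type _) x₀ ((extChartAt 𝓘(ℝ, B) x₀).symm b))))
      (chartImage x₀ U) := by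
  rw [← contMDiffOn_iff_chartImage (f := fun x => (coordAt F E x₀ x).comp ((nabla s x).comp
    (vecAt B (TangentSpace 𝓘(ℝ, B) : M → Type _) x₀ x))) x₀ fun x hx => (hUd hx).1]
  intro x hx
  refine ContMDiffAt.contMDiffWithinAt ?_
  obtain ⟨χ, hχ, _⟩ := (SmoothBumpFunction.nhds_basis_support (I := 𝓘(ℝ, B))
    (hU.mem_nhds hx)).mem_iff.1 (hU.mem_nhds hx)
  have h1 : ContMDiff 𝓘(ℝ, B) (𝓘(ℝ, B).prod 𝓘(ℝ, F)) ∞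
      (fun x => (⟨x, ((χ : M → ℝ) • s) x⟩ : TotalSpace F E)) :=
    ContMDiffOn.smul_section_of_tsupport χ.contMDiff.contMDiffOn hU hχ hs
  have h2 := (hsmooth.contMDiff.contMDiff (σ := (χ : M → ℝ) • s) (by
    rw [contMDiffOn_univ]
    exact h1)).contMDiffAt (x := x) univ_mem
  have hx' := hUd hx
  have hmem : x ∈ (trivializationAt (B →L[ℝ] F)
      (fun x : M => TangentSpace 𝓘(ℝ, B) x →L[ℝ] E x) x₀).baseSet := by
    rw [hom_trivializationAt_baseSet]
    exact ⟨mem_baseSet_tangent hx'.1, hx'.2⟩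
  rw [Trivialization.contMDiffAt_section_iff _ hmem] at h2
  refine h2.congr_of_eventuallyEq ?_
  have h3 : ∀ᶠ y in 𝓝 x, ∀ᶠ z in 𝓝 y, χ z = 1 := eventually_eventually_nhds.2 χ.eventuallyEq_one
  filter_upwards [h3, hU.mem_nhds hx] with y hy hyU
  have h4 : nabla s y = nabla ((χ : M → ℝ) • s) y := by
    refine nabla.isCovariantDerivativeOn.congr_of_eventuallyEq (s := univ)
      (hs.mdifferentiableAt hU hyU)
      (h1.mdifferentiable (by simp) y) univ_mem ?_
    filter_upwards [hy] with z hz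
    simp [hz]
  rw [h4]
  rfl

/-- The local connection form of a connection. -/
def localConn (nabla : CovariantDerivative 𝓘(ℝ, B) F E) (x₀ : M) (b : B) : B →L[ℝ] F →L[ℝ] F :=
  ∑ i, (ContinuousLinearMap.smulRightL ℝ F F
    (LinearMap.toContinuousLinearMap ((Module.finBasis ℝ F).coord i))).comp
      ((coordAt F E x₀ ((extChartAt 𝓘(ℝ, B) x₀).symm b)).comp
      ((nabla (constSection x₀ (Module.finBasis ℝ F i)) ((extChartAt 𝓘(ℝ, B) x₀).symm b)).comp
        (vecAt B (TangentSpace 𝓘(ℝ, B) : M → Type _) x₀ ((extChartAt 𝓘(ℝ, B) x₀).symm b))))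

lemma contDiffOn_localConn {nabla : CovariantDerivative 𝓘(ℝ, B) F E}
    (hsmooth : CovariantDerivative.ContMDiffCovariantDerivative nabla ∞) (x₀ : M) :
    ContDiffOn ℝ ∞ (localConn nabla x₀) (chartImage x₀ (coordDomain B F E x₀)) := by
  refine ContDiffOn.sum fun i _ => ?_
  exact contDiffOn_const.clm_comp (contDiffOn_coordAt_nabla hsmooth (isOpen_coordDomain x₀)
    subset_rfl (isSmoothSectionOn_constSection x₀ _))

lemma localConn_apply (nabla : CovariantDerivative 𝓘(ℝ, B) F E) {x₀ x : M}
    (hx : x ∈ coordDomain B F E x₀) (X : TangentSpace 𝓘(ℝ, B) x) (f : F) :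
    localConn nabla x₀ (extChartAt 𝓘(ℝ, B) x₀ x)
      (coordAt B (TangentSpace 𝓘(ℝ, B) : M → Type _) x₀ x X) f =
    ∑ i, (Module.finBasis ℝ F).coord i f •
      coordAt F E x₀ x (nabla (constSection x₀ (Module.finBasis ℝ F i)) x X) := by
  rw [localConn, sum_apply, sum_apply]
  refine Finset.sum_congr rfl fun i _ => ?_
  refine congrArg (fun z : F => (Module.finBasis ℝ F).coord i f • z) ?_
  change (coordAt F E x₀ ((extChartAt 𝓘(ℝ, B) x₀).symm (extChartAt 𝓘(ℝ, B) x₀ x)))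
    ((nabla (constSection x₀ (Module.finBasis ℝ F i))
      ((extChartAt 𝓘(ℝ, B) x₀).symm (extChartAt 𝓘(ℝ, B) x₀ x)))
      (vecAt B (TangentSpace 𝓘(ℝ, B) : M → Type _) x₀
        ((extChartAt 𝓘(ℝ, B) x₀).symm (extChartAt 𝓘(ℝ, B) x₀ x))
        (coordAt B (TangentSpace 𝓘(ℝ, B) : M → Type _) x₀ x X))) = _
  rw [(extChartAt 𝓘(ℝ, B) x₀).left_inv hx.1, vecAt_coordAt (mem_baseSet_tangent hx.1)]

lemma nabla_sum_smul {ι : Type*} (nabla : CovariantDerivative 𝓘(ℝ, B) F E) (S : Finset ι) {x : M}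
    {g : ι → M → ℝ} {s : ι → ∀ x, E x} (hg : ∀ i, MDifferentiableAt 𝓘(ℝ, B) 𝓘(ℝ, ℝ) (g i) x)
    (hs : ∀ i, MDifferentiableAt 𝓘(ℝ, B) (𝓘(ℝ, B).prod 𝓘(ℝ, F))
      (fun x => (⟨x, s i x⟩ : TotalSpace F E)) x) (X : TangentSpace 𝓘(ℝ, B) x) :
    MDifferentiableAt 𝓘(ℝ, B) (𝓘(ℝ, B).prod 𝓘(ℝ, F))
      (fun x => (⟨x, (∑ i ∈ S, g i • s i) x⟩ : TotalSpace F E)) x ∧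
    nabla (∑ i ∈ S, g i • s i) x X = ∑ i ∈ S, (g i x • nabla (s i) x X
      + mvfderiv 𝓘(ℝ, B) (g i) x X • s i x) := by
  classical
  induction S using Finset.induction_on with
  | empty =>
    refine ⟨?_, ?_⟩
    · simp only [Finset.sum_empty]
      exact (mdifferentiable_zeroSection ℝ E) x
    · simp only [Finset.sum_empty, nabla.zero]
      rfl
  | insert i S hi ih =>
    have h1 : MDifferentiableAt 𝓘(ℝ, B) (𝓘(ℝ, B).prod 𝓘(ℝ, F))
      (fun x => (⟨x, (g i • s i) x⟩ : TotalSpace F E)) x := (hg i).smul_section (hs i)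
    rw [Finset.sum_insert hi, Finset.sum_insert hi]
    refine ⟨mdifferentiableAt_add_section h1 ih.1, ?_⟩
    rw [nabla.isCovariantDerivativeOnUniv.add h1 ih.1,
      nabla.isCovariantDerivativeOnUniv.leibniz (hs i) (hg i), add_apply, ih.2]
    rfl

/-- Near `x` the section is a combination of the constant sections of a basis, with its coordinates
as coefficients. By the Leibniz rule, derivatives of the coefficients give the derivative of the
local representative, and those of the constant sections give the connection form. -/
lemma coordAt_nabla (nabla : CovariantDerivative 𝓘(ℝ, B) F E) {x₀ x : M}
    (hx : x ∈ coordDomain B F E x₀) {s : ∀ x, E x}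
    (hs : MDifferentiableAt 𝓘(ℝ, B) (𝓘(ℝ, B).prod 𝓘(ℝ, F))
      (fun x => (⟨x, s x⟩ : TotalSpace F E)) x) (X : TangentSpace 𝓘(ℝ, B) x) :
    coordAt F E x₀ x (nabla s x X) =
      fderiv ℝ (localRep x₀ s) (extChartAt 𝓘(ℝ, B) x₀ x)
        (coordAt B (TangentSpace 𝓘(ℝ, B) : M → Type _) x₀ x X)
      + localConn nabla x₀ (extChartAt 𝓘(ℝ, B) x₀ x)
        (coordAt B (TangentSpace 𝓘(ℝ, B) : M → Type _) x₀ x X) (coordAt F E x₀ x (s x)) := by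
  set bas := Module.finBasis ℝ F with hbas
  set φ := extChartAt 𝓘(ℝ, B) x₀ with hφ
  have hd := (mdifferentiableAt_section_iff_localRep hx).1 hs
  have hinv : φ.symm (φ x) = x := φ.left_inv hx.1
  let c : Fin (Module.finrank ℝ F) → F →L[ℝ] ℝ := fun i => LinearMap.toContinuousLinearMap (bas.coord i)
  let g : Fin (Module.finrank ℝ F) → M → ℝ := fun i y => c i (localRep x₀ s (φ y))
  have hgφ : ∀ i, (fun b => g i (φ.symm b)) =ᶠ[𝓝 (φ x)] fun b => c i (localRep x₀ s b) := by
    intro i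
    filter_upwards [(isOpen_extChartAt_target x₀).mem_nhds (φ.map_source hx.1)] with b hb
    simp only [g, φ.right_inv hb]
  have hgd : ∀ i, HasFDerivAt (fun b => g i (φ.symm b))
      ((c i).comp (fderiv ℝ (localRep x₀ s) (φ x))) (φ x) := fun i =>
    ((c i).hasFDerivAt.comp _ hd.hasFDerivAt).congr_of_eventuallyEq (hgφ i)
  have hg : ∀ i, MDifferentiableAt 𝓘(ℝ, B) 𝓘(ℝ, ℝ) (g i) x := fun i =>
    (mdifferentiableAt_iff_extChartAt hx.1).2 (hgd i).differentiableAt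
  have hcs : ∀ i, MDifferentiableAt 𝓘(ℝ, B) (𝓘(ℝ, B).prod 𝓘(ℝ, F))
      (fun x => (⟨x, constSection x₀ (bas i) x⟩ : TotalSpace F E)) x := fun i =>
    (isSmoothSectionOn_constSection x₀ (bas i)).mdifferentiableAt (isOpen_coordDomain x₀) hx
  obtain ⟨h1, h2⟩ := nabla_sum_smul nabla Finset.univ hg hcs X
  have h3 : ∀ᶠ y in 𝓝 x, s y = (∑ i, g i • constSection x₀ (bas i)) y := by
    filter_upwards [(isOpen_coordDomain x₀).mem_nhds hx] with y hy
    have h4 : localRep x₀ s (φ y) = coordAt F E x₀ y (s y) := by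
      rw [localRep, ← hφ, φ.left_inv hy.1]
    rw [← vecAt_coordAt hy.2 (s y), ← h4, ← bas.sum_repr (localRep x₀ s (φ y)), map_sum,
      Finset.sum_apply]
    refine Finset.sum_congr rfl fun i _ => ?_
    rw [map_smul]
    rfl
  have h5 : localRep x₀ s (φ x) = coordAt F E x₀ x (s x) := by
    rw [localRep, ← hφ, hinv]
  rw [nabla.isCovariantDerivativeOn.congr_of_eventuallyEq (s := univ) hs h1 univ_mem h3, h2, map_sum,
    localConn_apply nabla hx]
  simp only [map_add, map_smul, Finset.sum_add_distrib]
  rw [add_comm]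
  congr 1
  · rw [← bas.sum_repr (fderiv ℝ (localRep x₀ s) (φ x) _)]
    refine Finset.sum_congr rfl fun i _ => ?_
    have h6 : mvfderiv 𝓘(ℝ, B) (g i) x X = _ := mfderiv_eq_fderiv_coordAt hx.1 (hg i) X
    rw [h6, (hgd i).fderiv]
    congr 1
    exact coordAt_vecAt hx.2 _
  · refine Finset.sum_congr rfl fun i _ => ?_
    rw [← h5]
    rfl

/-- The bracket is natural under pull-back by the inverse chart, and the pull-back of a vector field
is its local representative. -/
lemma coordAt_mlieBracket {x₀ x : M} (hx : x ∈ (extChartAt 𝓘(ℝ, B) x₀).source)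
    {X Y : ∀ x : M, TangentSpace 𝓘(ℝ, B) x}
    (hX : MDifferentiableAt 𝓘(ℝ, B) (𝓘(ℝ, B).prod 𝓘(ℝ, B))
      (fun x => (⟨x, X x⟩ : TangentBundle 𝓘(ℝ, B) M)) x)
    (hY : MDifferentiableAt 𝓘(ℝ, B) (𝓘(ℝ, B).prod 𝓘(ℝ, B))
      (fun x => (⟨x, Y x⟩ : TangentBundle 𝓘(ℝ, B) M)) x) :
    coordAt B (TangentSpace 𝓘(ℝ, B) : M → Type _) x₀ x (mlieBracket 𝓘(ℝ, B) X Y x) =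
      lieBracket ℝ (localRep (F := B) x₀ X) (localRep (F := B) x₀ Y) (extChartAt 𝓘(ℝ, B) x₀ x) := by
  set φ := extChartAt 𝓘(ℝ, B) x₀ with hφ
  have hinv : φ.symm (φ x) = x := φ.left_inv hx
  have hop := isOpen_extChartAt_target (I := 𝓘(ℝ, B)) x₀
  have hpull : ∀ Z : ∀ x : M, TangentSpace 𝓘(ℝ, B) x, ∀ b ∈ φ.target,
      (mpullback 𝓘(ℝ, B) 𝓘(ℝ, B) φ.symm Z b : B) = localRep (F := B) x₀ Z b := by
    intro Z b hb
    have hs := φ.map_target hb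
    have h1 := vecAt_tangent hs
    rw [mpullback_apply, localRep]
    have h2 : ∀ e : B ≃L[ℝ] TangentSpace 𝓘(ℝ, B) (φ.symm b),
        (e : B →L[ℝ] TangentSpace 𝓘(ℝ, B) (φ.symm b)) = mfderiv 𝓘(ℝ, B) 𝓘(ℝ, B) φ.symm b →
        ∀ v, ContinuousLinearMap.inverse (mfderiv 𝓘(ℝ, B) 𝓘(ℝ, B) φ.symm b) v = e.symm v := by
      intro e he v
      rw [← he]
      exact DFunLike.congr_fun (ContinuousLinearMap.inverse_equiv e) v
    have hmem := mem_baseSet_tangent hs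
    refine (h2 (ContinuousLinearEquiv.equivOfInverse
      (vecAt B (TangentSpace 𝓘(ℝ, B) : M → Type _) x₀ (φ.symm b))
      (coordAt B (TangentSpace 𝓘(ℝ, B) : M → Type _) x₀ (φ.symm b)) (coordAt_vecAt hmem)
      (vecAt_coordAt hmem)) ?_ _).trans rfl
    have h3 : ∀ b', b' = b → ∀ v : B, (mfderiv 𝓘(ℝ, B) 𝓘(ℝ, B) φ.symm b' v : B)
        = (mfderiv 𝓘(ℝ, B) 𝓘(ℝ, B) φ.symm b v : B) := by
      rintro _ rfl v
      rfl
    ext v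
    exact (DFunLike.congr_fun h1 v).trans (h3 _ (φ.right_inv hb) v)
  have hsm : ContMDiffAt 𝓘(ℝ, B) 𝓘(ℝ, B) ∞ φ.symm (φ x) :=
    (contMDiffOn_extChartAt_symm x₀).contMDiffAt (hop.mem_nhds (φ.map_source hx))
  have hmin : minSmoothness ℝ 2 = 2 := minSmoothness_of_isRCLikeNormedField
  have h2le : (2 : ℕ∞ω) ≤ ∞ := WithTop.coe_le_coe.2 (le_top : (2 : ℕ∞) ≤ ⊤)
  have : IsManifold 𝓘(ℝ, B) (minSmoothness ℝ 2) M := by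
    rw [hmin]
    exact IsManifold.of_le (n := ∞) h2le
  have h1 := mpullback_mlieBracket (I := 𝓘(ℝ, B)) (I' := 𝓘(ℝ, B)) (f := φ.symm) (V := X) (W := Y)
    (x₀ := φ x) (n := ∞) (by rw [hinv]; exact hX) (by rw [hinv]; exact hY) hsm (by rw [hmin]; exact h2le)
  have h2 := (hpull (mlieBracket 𝓘(ℝ, B) X Y) _ (φ.map_source hx)).symm.trans h1
  rw [localRep, ← hφ, hinv] at h2
  rw [h2, ← mlieBracketWithin_univ, mlieBracketWithin_eq_lieBracketWithin]
  have hev : ∀ Z : ∀ x : M, TangentSpace 𝓘(ℝ, B) x,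
      (mpullback 𝓘(ℝ, B) 𝓘(ℝ, B) φ.symm Z : B → B) =ᶠ[𝓝 (φ x)] localRep (F := B) x₀ Z := by
    intro Z
    filter_upwards [hop.mem_nhds (φ.map_source hx)] with b hb using hpull Z b hb
  exact ((hev X).lieBracketWithin_vectorField_eq_nhds (𝕜 := ℝ) (s := univ) (hev Y)).trans
    (congrFun lieBracketWithin_univ _)

end LocalConnection

end CoCR

end

noncomputable section

set_option synthInstance.maxHeartbeats 200000
set_option linter.unusedSectionVars false

namespace CoCR
-- Curvature and the Bianchi identity in coordinates.
section LocalBianchi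

open Topology Filter VectorField

variable {B : Type*} [NormedAddCommGroup B] [NormedSpace ℝ B] [FiniteDimensional ℝ B]
  {M : Type*} [TopologicalSpace M] [T2Space M] [ChartedSpace B M] [IsManifold 𝓘(ℝ, B) ∞ M]
  {F : Type*} [NormedAddCommGroup F] [NormedSpace ℝ F] [FiniteDimensional ℝ F]
  {E : M → Type*} [TopologicalSpace (TotalSpace F E)]
  [∀ x, AddCommGroup (E x)] [∀ x, Module ℝ (E x)] [∀ x, TopologicalSpace (E x)]
  [∀ x, IsTopologicalAddGroup (E x)] [∀ x, ContinuousSMul ℝ (E x)]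
  [FiberBundle F E] [VectorBundle ℝ F E] [ContMDiffVectorBundle ∞ F E 𝓘(ℝ, B)]

/-- The local representative of a morphism `E → TM`. -/
def localMap (ρ : ∀ x : M, E x →L[ℝ] TangentSpace 𝓘(ℝ, B) x) (x₀ : M) (b : B) : F →L[ℝ] B :=
  (coordAt B (TangentSpace 𝓘(ℝ, B) : M → Type _) x₀ ((extChartAt 𝓘(ℝ, B) x₀).symm b)).comp
    ((ρ ((extChartAt 𝓘(ℝ, B) x₀).symm b)).comp (vecAt F E x₀ ((extChartAt 𝓘(ℝ, B) x₀).symm b)))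

lemma localMap_coordAt (ρ : ∀ x : M, E x →L[ℝ] TangentSpace 𝓘(ℝ, B) x) {x₀ x : M}
    (hx : x ∈ coordDomain B F E x₀) (v : E x) :
    localMap ρ x₀ (extChartAt 𝓘(ℝ, B) x₀ x) (coordAt F E x₀ x v) =
      coordAt B (TangentSpace 𝓘(ℝ, B) : M → Type _) x₀ x (ρ x v) := by
  change coordAt B (TangentSpace 𝓘(ℝ, B) : M → Type _) x₀
    ((extChartAt 𝓘(ℝ, B) x₀).symm (extChartAt 𝓘(ℝ, B) x₀ x))
    (ρ _ (vecAt F E x₀ ((extChartAt 𝓘(ℝ, B) x₀).symm (extChartAt 𝓘(ℝ, B) x₀ x)) _)) = _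
  rw [(extChartAt 𝓘(ℝ, B) x₀).left_inv hx.1, vecAt_coordAt hx.2]

lemma exists_eq_extChartAt {x₀ : M} {U : Set M} {b : B} (hb : b ∈ chartImage x₀ U) :
    ∃ x ∈ U, x ∈ (extChartAt 𝓘(ℝ, B) x₀).source ∧ b = extChartAt 𝓘(ℝ, B) x₀ x :=
  ⟨_, hb.2, (extChartAt 𝓘(ℝ, B) x₀).map_target hb.1,
    ((extChartAt 𝓘(ℝ, B) x₀).right_inv hb.1).symm⟩

lemma coordDomain_subset_tangent (x₀ : M) :
    coordDomain B F E x₀ ⊆ coordDomain B B (TangentSpace 𝓘(ℝ, B) : M → Type _) x₀ :=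
  fun _ hx => ⟨hx.1, mem_baseSet_tangent hx.1⟩

variable {Q : QuaternionicStructure B F E k} {k : ℕ}
  {ρ : ∀ x : M, E x →L[ℝ] TangentSpace 𝓘(ℝ, B) x} {nabla : CovariantDerivative 𝓘(ℝ, B) F E}

lemma isSmoothSectionOn_comp_map (hρ : ContMDiff (𝓘(ℝ, B).prod 𝓘(ℝ, F)) (𝓘(ℝ, B).prod 𝓘(ℝ, B)) ∞
    (fun p : TotalSpace F E => (⟨p.1, ρ p.1 p.2⟩ : TangentBundle 𝓘(ℝ, B) M))) {s : ∀ x, E x}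
    {U : Set M} (hs : IsSmoothSectionOn B F s U) :
    IsSmoothSectionOn B B (fun x => ρ x (s x)) U :=
  hρ.comp_contMDiffOn hs

lemma contDiffOn_localMap (hρ : ContMDiff (𝓘(ℝ, B).prod 𝓘(ℝ, F)) (𝓘(ℝ, B).prod 𝓘(ℝ, B)) ∞
    (fun p : TotalSpace F E => (⟨p.1, ρ p.1 p.2⟩ : TangentBundle 𝓘(ℝ, B) M))) (x₀ : M) :
    ContDiffOn ℝ ∞ (localMap (F := F) ρ x₀) (chartImage x₀ (coordDomain B F E x₀)) :=
  contDiffOn_clm_apply.2 fun f =>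
    (isSmoothSectionOn_iff_localRep (F := B) (isOpen_coordDomain (F := F) (E := E) x₀) (coordDomain_subset_tangent (B := B) (F := F) (E := E) x₀)).1
      (isSmoothSectionOn_comp_map hρ (isSmoothSectionOn_constSection x₀ f))

lemma coordAt_nabla_constSection (nabla : CovariantDerivative 𝓘(ℝ, B) F E) {x₀ x : M}
    (hx : x ∈ coordDomain B F E x₀) (f : F) (X : TangentSpace 𝓘(ℝ, B) x) :
    coordAt F E x₀ x (nabla (constSection x₀ f) x X) =
      localConn nabla x₀ (extChartAt 𝓘(ℝ, B) x₀ x)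
        (coordAt B (TangentSpace 𝓘(ℝ, B) : M → Type _) x₀ x X) f := by
  rw [coordAt_nabla nabla hx
    ((isSmoothSectionOn_constSection x₀ f).mdifferentiableAt (isOpen_coordDomain x₀) hx)]
  have h1 : localRep (E := E) x₀ (constSection x₀ f) =ᶠ[𝓝 (extChartAt 𝓘(ℝ, B) x₀ x)] fun _ => f := by
    filter_upwards [(isOpen_chartImage (B := B) x₀ (isOpen_coordDomain (B := B) (E := E) x₀)).mem_nhds
      (extChartAt_mem_chartImage hx.1 hx)] with b hb using localRep_constSection hb f
  rw [h1.fderiv_eq, fderiv_fun_const]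
  have h2 : coordAt F E x₀ x (constSection x₀ f x) = f := coordAt_vecAt hx.2 f
  rw [h2]
  exact zero_add _

lemma hasFDerivAt_localRep_nabla
    (hsmooth : CovariantDerivative.ContMDiffCovariantDerivative nabla ∞) {x₀ x : M}
    (hx : x ∈ coordDomain B F E x₀) (f : F) {Y : ∀ x : M, TangentSpace 𝓘(ℝ, B) x}
    (hY : MDifferentiableAt 𝓘(ℝ, B) (𝓘(ℝ, B).prod 𝓘(ℝ, B))
      (fun x => (⟨x, Y x⟩ : TangentBundle 𝓘(ℝ, B) M)) x) :
    HasFDerivAt (localRep x₀ (fun y => nabla (constSection x₀ f) y (Y y)))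
      (((localConn nabla x₀ (extChartAt 𝓘(ℝ, B) x₀ x)).comp
        (fderiv ℝ (localRep (F := B) x₀ Y) (extChartAt 𝓘(ℝ, B) x₀ x)) +
        (fderiv ℝ (localConn nabla x₀) (extChartAt 𝓘(ℝ, B) x₀ x)).flip
          (localRep (F := B) x₀ Y (extChartAt 𝓘(ℝ, B) x₀ x))).flip f)
      (extChartAt 𝓘(ℝ, B) x₀ x) := by
  have hop := isOpen_chartImage (B := B) x₀ (isOpen_coordDomain (B := B) (F := F) (E := E) x₀)
  have hmem := extChartAt_mem_chartImage (B := B) hx.1 hx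
  have hYd := ((mdifferentiableAt_section_iff_localRep (B := B) (F := B)
    (coordDomain_subset_tangent (B := B) (F := F) (E := E) x₀ hx)).1 hY).hasFDerivAt
  have h1 := ((contDiffOn_localConn hsmooth x₀).hasFDerivAt_of_isOpen hop hmem).clm_apply hYd
  refine (hasFDerivAt_clm_apply_const h1 f).congr_of_eventuallyEq ?_
  filter_upwards [hop.mem_nhds hmem] with b hb
  obtain ⟨z, hz, -, rfl⟩ := exists_eq_extChartAt hb
  have h2 : ∀ z', z' = z → coordAt F E x₀ z' (nabla (constSection x₀ f) z' (Y z')) =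
      localConn nabla x₀ (extChartAt 𝓘(ℝ, B) x₀ z)
        (coordAt B (TangentSpace 𝓘(ℝ, B) : M → Type _) x₀ z' (Y z')) f := by
    rintro _ rfl
    exact coordAt_nabla_constSection nabla hz f _
  exact h2 _ ((extChartAt 𝓘(ℝ, B) x₀).left_inv hz.1)

lemma localRep_extChartAt {x₀ x : M} (hx : x ∈ (extChartAt 𝓘(ℝ, B) x₀).source) (s : ∀ x, E x) :
    localRep (B := B) x₀ s (extChartAt 𝓘(ℝ, B) x₀ x) = coordAt F E x₀ x (s x) := by
  rw [localRep, (extChartAt 𝓘(ℝ, B) x₀).left_inv hx]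

/-- On a constant section, the terms with derivatives of `X` and `Y` in the two iterated covariant
derivatives combine to the connection form on the bracket `[X, Y]`, and cancel the last term of the
curvature. -/
lemma coordAt_curvature (hsmooth : CovariantDerivative.ContMDiffCovariantDerivative nabla ∞)
    {x₀ x : M} (hx : x ∈ coordDomain B F E x₀) (f : F) {X Y : ∀ x : M, TangentSpace 𝓘(ℝ, B) x}
    (hX : MDifferentiableAt 𝓘(ℝ, B) (𝓘(ℝ, B).prod 𝓘(ℝ, B))
      (fun x => (⟨x, X x⟩ : TangentBundle 𝓘(ℝ, B) M)) x)
    (hY : MDifferentiableAt 𝓘(ℝ, B) (𝓘(ℝ, B).prod 𝓘(ℝ, B))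
      (fun x => (⟨x, Y x⟩ : TangentBundle 𝓘(ℝ, B) M)) x) :
    coordAt F E x₀ x (curvature nabla X Y (constSection x₀ f) x) =
      localCurvature (localConn nabla x₀) (extChartAt 𝓘(ℝ, B) x₀ x)
        (coordAt B (TangentSpace 𝓘(ℝ, B) : M → Type _) x₀ x (X x))
        (coordAt B (TangentSpace 𝓘(ℝ, B) : M → Type _) x₀ x (Y x)) f := by
  have h1 : ∀ {X Y : ∀ x : M, TangentSpace 𝓘(ℝ, B) x}, MDifferentiableAt 𝓘(ℝ, B)
      (𝓘(ℝ, B).prod 𝓘(ℝ, B)) (fun x => (⟨x, Y x⟩ : TangentBundle 𝓘(ℝ, B) M)) x →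
      coordAt F E x₀ x (nabla (fun y => nabla (constSection x₀ f) y (Y y)) x (X x)) =
      localConn nabla x₀ (extChartAt 𝓘(ℝ, B) x₀ x)
        (fderiv ℝ (localRep (F := B) x₀ Y) (extChartAt 𝓘(ℝ, B) x₀ x)
          (coordAt B (TangentSpace 𝓘(ℝ, B) : M → Type _) x₀ x (X x))) f
      + fderiv ℝ (localConn nabla x₀) (extChartAt 𝓘(ℝ, B) x₀ x)
        (coordAt B (TangentSpace 𝓘(ℝ, B) : M → Type _) x₀ x (X x))
        (coordAt B (TangentSpace 𝓘(ℝ, B) : M → Type _) x₀ x (Y x)) f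
      + localConn nabla x₀ (extChartAt 𝓘(ℝ, B) x₀ x)
        (coordAt B (TangentSpace 𝓘(ℝ, B) : M → Type _) x₀ x (X x))
        (localConn nabla x₀ (extChartAt 𝓘(ℝ, B) x₀ x)
          (coordAt B (TangentSpace 𝓘(ℝ, B) : M → Type _) x₀ x (Y x)) f) := by
    intro X Y hY
    have h2 := hasFDerivAt_localRep_nabla hsmooth hx f hY
    rw [coordAt_nabla nabla hx ((mdifferentiableAt_section_iff_localRep hx).2 h2.differentiableAt),
      h2.fderiv, coordAt_nabla_constSection nabla hx, localRep_extChartAt hx.1]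
    rfl
  rw [curvature, map_sub, map_sub, h1 hX, h1 hY, coordAt_nabla_constSection nabla hx,
    coordAt_mlieBracket hx.1 hX hY, lieBracket_eq]
  beta_reduce
  rw [localRep_extChartAt hx.1, localRep_extChartAt hx.1]
  simp only [localCurvature, add_apply, sub_apply, ContinuousLinearMap.comp_apply, map_sub]
  abel

/-- The constant sections have arbitrary values at each point, so the intrinsic identities applied
to them give the coordinate ones. -/
theorem isLocalBianchi_localConn (hρ : ContMDiff (𝓘(ℝ, B).prod 𝓘(ℝ, F)) (𝓘(ℝ, B).prod 𝓘(ℝ, B)) ∞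
    (fun p : TotalSpace F E => (⟨p.1, ρ p.1 p.2⟩ : TangentBundle 𝓘(ℝ, B) M)))
    (hsurj : ∀ x, Function.Surjective (ρ x))
    (hsmooth : CovariantDerivative.ContMDiffCovariantDerivative nabla ∞)
    (hb : SatisfiesFirstBianchi ρ nabla) (x₀ : M) :
    IsLocalBianchi (chartImage x₀ (coordDomain B F E x₀)) (localConn nabla x₀) (localMap ρ x₀) where
  contDiffOn_conn := contDiffOn_localConn hsmooth x₀
  contDiffOn_map := contDiffOn_localMap hρ x₀
  surjective := by
    intro b hb X
    obtain ⟨x, hx, -, rfl⟩ := exists_eq_extChartAt hb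
    obtain ⟨v, hv⟩ := hsurj x (vecAt B (TangentSpace 𝓘(ℝ, B) : M → Type _) x₀ x X)
    refine ⟨coordAt F E x₀ x v, ?_⟩
    rw [localMap_coordAt ρ hx, hv, coordAt_vecAt (mem_baseSet_tangent hx.1)]
  torsion := by
    intro b hbm f₁ f₂
    have hop := isOpen_chartImage (B := B) x₀ (isOpen_coordDomain (B := B) (F := F) (E := E) x₀)
    have hd := (contDiffOn_localMap hρ x₀).hasFDerivAt_of_isOpen hop hbm
    obtain ⟨x, hx, -, rfl⟩ := exists_eq_extChartAt hbm
    have hU := isOpen_coordDomain (B := B) (F := F) (E := E) x₀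
    have hs := fun f : F => isSmoothSectionOn_constSection (B := B) (E := E) x₀ f
    have h1 := hb.torsionFree _ hU _ _ (hs f₁) (hs f₂) x hx
    have h2 := congrArg (coordAt B (TangentSpace 𝓘(ℝ, B) : M → Type _) x₀ x) (sub_eq_zero.1 h1)
    have hρs := fun f => (isSmoothSectionOn_comp_map hρ (hs f)).mdifferentiableAt hU hx
    have h3 : ∀ f : F, coordAt B (TangentSpace 𝓘(ℝ, B) : M → Type _) x₀ x (ρ x (constSection x₀ f x))
        = localMap (F := F) ρ x₀ (extChartAt 𝓘(ℝ, B) x₀ x) f := by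
      intro f
      rw [← localMap_coordAt ρ hx]
      exact congrArg _ (coordAt_vecAt hx.2 f)
    have h4 : ∀ f : F, fderiv ℝ (localRep (F := B) x₀ fun y => ρ y (constSection x₀ f y))
        (extChartAt 𝓘(ℝ, B) x₀ x) = (fderiv ℝ (localMap (F := F) ρ x₀) (extChartAt 𝓘(ℝ, B) x₀ x)).flip f :=
      fun f => (hasFDerivAt_clm_apply_const hd f).fderiv
    rw [coordAt_mlieBracket hx.1 (hρs f₁) (hρs f₂), ← localMap_coordAt ρ hx, map_sub,
      coordAt_nabla_constSection nabla hx, coordAt_nabla_constSection nabla hx, h3, h3,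
      lieBracket_eq] at h2
    beta_reduce at h2
    rw [h4, h4, localRep_extChartAt hx.1, localRep_extChartAt hx.1, h3, h3] at h2
    exact h2
  bianchi := by
    intro b hbm f₁ f₂ f₃
    obtain ⟨x, hx, -, rfl⟩ := exists_eq_extChartAt hbm
    have hU := isOpen_coordDomain (B := B) (F := F) (E := E) x₀
    have hs := fun f : F => isSmoothSectionOn_constSection (B := B) (E := E) x₀ f
    have hρs := fun f => (isSmoothSectionOn_comp_map hρ (hs f)).mdifferentiableAt hU hx
    have h3 : ∀ f : F, coordAt B (TangentSpace 𝓘(ℝ, B) : M → Type _) x₀ x (ρ x (constSection x₀ f x))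
        = localMap (F := F) ρ x₀ (extChartAt 𝓘(ℝ, B) x₀ x) f := by
      intro f
      rw [← localMap_coordAt ρ hx]
      exact congrArg _ (coordAt_vecAt hx.2 f)
    have h1 := congrArg (coordAt F E x₀ x) (hb.bianchi _ hU _ _ _ (hs f₁) (hs f₂) (hs f₃) x hx)
    rw [map_add, map_add, map_zero, coordAt_curvature hsmooth hx f₃ (hρs f₁) (hρs f₂),
      coordAt_curvature hsmooth hx f₁ (hρs f₂) (hρs f₃),
      coordAt_curvature hsmooth hx f₂ (hρs f₃) (hρs f₁), h3, h3, h3] at h1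
    exact h1

end LocalBianchi

end CoCR

end

noncomputable section

set_option synthInstance.maxHeartbeats 200000
set_option linter.unusedSectionVars false

namespace CoCR
-- Local admissible frames in coordinates.
section LocalFrame

open Topology Filter VectorField

variable {B : Type*} [NormedAddCommGroup B] [NormedSpace ℝ B] [FiniteDimensional ℝ B]
  {M : Type*} [TopologicalSpace M] [T2Space M] [ChartedSpace B M] [IsManifold 𝓘(ℝ, B) ∞ M]
  {F : Type*} [NormedAddCommGroup F] [NormedSpace ℝ F] [FiniteDimensional ℝ F]
  {E : M → Type*} [TopologicalSpace (TotalSpace F E)]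
  [∀ x, AddCommGroup (E x)] [∀ x, Module ℝ (E x)] [∀ x, TopologicalSpace (E x)]
  [∀ x, IsTopologicalAddGroup (E x)] [∀ x, ContinuousSMul ℝ (E x)]
  [FiberBundle F E] [VectorBundle ℝ F E] [ContMDiffVectorBundle ∞ F E 𝓘(ℝ, B)]

variable {k : ℕ} {Q : QuaternionicStructure B F E k} {nabla : CovariantDerivative 𝓘(ℝ, B) F E}

/-- The local representative of a local frame. -/
def localFrame (u : ∀ x : M, HVec k ≃L[ℝ] E x) (x₀ : M) (b : B) : HVec k →L[ℝ] F :=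
  (coordAt F E x₀ ((extChartAt 𝓘(ℝ, B) x₀).symm b)).comp
    (u ((extChartAt 𝓘(ℝ, B) x₀).symm b) : HVec k →L[ℝ] E _)

/-- The inverse of the local representative of a local frame. -/
def localFrameInv (u : ∀ x : M, HVec k ≃L[ℝ] E x) (x₀ : M) (b : B) : F →L[ℝ] HVec k :=
  ((u ((extChartAt 𝓘(ℝ, B) x₀).symm b)).symm : E _ →L[ℝ] HVec k).comp
    (vecAt F E x₀ ((extChartAt 𝓘(ℝ, B) x₀).symm b))

lemma localFrameInv_localFrame (u : ∀ x : M, HVec k ≃L[ℝ] E x) {x₀ : M} {b : B}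
    (hb : b ∈ chartImage x₀ (coordDomain B F E x₀)) (v : HVec k) :
    localFrameInv (F := F) u x₀ b (localFrame u x₀ b v) = v := by
  change (u _).symm (vecAt F E x₀ ((extChartAt 𝓘(ℝ, B) x₀).symm b)
    (coordAt F E x₀ ((extChartAt 𝓘(ℝ, B) x₀).symm b) (u _ v))) = v
  rw [vecAt_coordAt hb.2.2, (u _).symm_apply_apply]

lemma localFrame_localFrameInv (u : ∀ x : M, HVec k ≃L[ℝ] E x) {x₀ : M} {b : B}
    (hb : b ∈ chartImage x₀ (coordDomain B F E x₀)) (f : F) :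
    localFrame u x₀ b (localFrameInv u x₀ b f) = f := by
  change coordAt F E x₀ ((extChartAt 𝓘(ℝ, B) x₀).symm b) (u _ ((u _).symm
    (vecAt F E x₀ ((extChartAt 𝓘(ℝ, B) x₀).symm b) f))) = f
  rw [(u _).apply_symm_apply, coordAt_vecAt hb.2.2]

lemma contDiffOn_localFrame {u : ∀ x : M, HVec k ≃L[ℝ] E x} {x₀ : M} {U : Set M} (hU : IsOpen U)
    (hUd : U ⊆ coordDomain B F E x₀) (hu : ∀ q, IsSmoothSectionOn B F (fun x => u x q) U) :
    ContDiffOn ℝ ∞ (localFrame (B := B) (F := F) u x₀) (chartImage x₀ U) :=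
  contDiffOn_clm_apply.2 fun q => (isSmoothSectionOn_iff_localRep hU hUd).1 (hu q)

lemma localConnForm_mem (hcompatible : Q.IsCompatible nabla) {u : ∀ x : M, HVec k ≃L[ℝ] E x}
    {x₀ : M} {U : Set M} (hU : IsOpen U) (hUd : U ⊆ coordDomain B F E x₀)
    (hu : ∀ q, IsSmoothSectionOn B F (fun x => u x q) U) (huQ : ∀ x ∈ U, u x ∈ Q.frames x)
    {b : B} (hb : b ∈ chartImage x₀ U) (X : B) :
    (localFrameInv u x₀ b).comp (fderiv ℝ (localFrame (F := F) u x₀) b X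
      + (localConn nabla x₀ b X).comp (localFrame u x₀ b)) ∈ imNormalizer k := by
  have hd := (contDiffOn_localFrame hU hUd hu).hasFDerivAt_of_isOpen (isOpen_chartImage x₀ hU) hb
  have hbd : b ∈ chartImage x₀ (coordDomain B F E x₀) := ⟨hb.1, hUd hb.2⟩
  have hl := localFrameInv_localFrame u hbd
  obtain ⟨x, hx, hxs, rfl⟩ := exists_eq_extChartAt hb
  obtain ⟨a, C, -, h⟩ := hcompatible U hU u hu huQ x hx
    (vecAt B (TangentSpace 𝓘(ℝ, B) : M → Type _) x₀ x X)
  refine mem_imNormalizer_of_form (a := a) (C := C) fun q => ?_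
  have h1 := congrArg (coordAt F E x₀ x) (h q)
  rw [coordAt_nabla nabla (hUd hx) ((hu q).mdifferentiableAt hU hx),
    coordAt_vecAt (mem_baseSet_tangent hxs)] at h1
  have h2 : ∀ q, localFrame u x₀ (extChartAt 𝓘(ℝ, B) x₀ x) q = coordAt F E x₀ x (u x q) :=
    fun q => localRep_extChartAt hxs (fun x => u x q)
  rw [← h2, ← h2] at h1
  have h3 : fderiv ℝ (localRep (F := F) x₀ fun x => u x q) (extChartAt 𝓘(ℝ, B) x₀ x) =
      (fderiv ℝ (localFrame (F := F) u x₀) (extChartAt 𝓘(ℝ, B) x₀ x)).flip q :=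
    (hasFDerivAt_clm_apply_const hd q).fderiv
  rw [h3] at h1
  exact (congrArg _ h1).trans (hl _)

end LocalFrame

/-! ### The torsion free connection induced by a closed frame. -/

section ClosedFrame

open Topology Filter

variable {B : Type*} [NormedAddCommGroup B] [NormedSpace ℝ B] [FiniteDimensional ℝ B]
  {F : Type*} [NormedAddCommGroup F] [NormedSpace ℝ F] [FiniteDimensional ℝ F] {k : ℕ}

lemma fderiv_inverse_apply {X G G' : Type*} [NormedAddCommGroup X] [NormedSpace ℝ X]
    [NormedAddCommGroup G] [NormedSpace ℝ G] [NormedAddCommGroup G'] [NormedSpace ℝ G']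
    {V : Set X} (hV : IsOpen V) {g : X → G →L[ℝ] G'} {gi : X → G' →L[ℝ] G}
    (hl : ∀ y ∈ V, ∀ v, gi y (g y v) = v) {y : X} (hy : y ∈ V) {g' : X →L[ℝ] G →L[ℝ] G'}
    {gi' : X →L[ℝ] G' →L[ℝ] G} (hg : HasFDerivAt g g' y) (hgi : HasFDerivAt gi gi' y) (x : X) (v : G) :
    gi' x (g y v) = -gi y (g' x v) := by
  have h1 := hgi.clm_apply (by simpa using hg.clm_apply (hasFDerivAt_const v y) :
    HasFDerivAt (fun y => g y v) (g'.flip v) y)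
  have h2 : (fun y => gi y (g y v)) =ᶠ[𝓝 y] fun _ => v := by
    filter_upwards [hV.mem_nhds hy] with z hz using hl z hz v
  have h3 := DFunLike.congr_fun
    (h1.unique ((hasFDerivAt_const v y).congr_of_eventuallyEq h2)) x
  exact eq_neg_of_add_eq_zero_right h3

/-- The connection induced on the total space of the kernel by a closed frame `g`. -/
def inducedConn (Γ : B → B →L[ℝ] F →L[ℝ] F) (g : B → F →L[ℝ] F) (τ : F →L[ℝ] B) (y : F) :
    F →L[ℝ] F →L[ℝ] F :=
  (ContinuousLinearMap.compL ℝ F F F (Ring.inverse (g (τ y)))).comp ((fderiv ℝ g (τ y)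
    + ((ContinuousLinearMap.compL ℝ F F F).flip (g (τ y))).comp (Γ (τ y))).comp τ)

lemma inducedConn_apply (Γ : B → B →L[ℝ] F →L[ℝ] F) (g : B → F →L[ℝ] F) (τ : F →L[ℝ] B) (y X Y : F) :
    inducedConn Γ g τ y X Y = Ring.inverse (g (τ y)) (fderiv ℝ g (τ y) (τ X) Y
      + Γ (τ y) (τ X) (g (τ y) Y)) := rfl

lemma ringInverse_apply_apply {g : F →L[ℝ] F} (hg : IsUnit g) (v : F) : Ring.inverse g (g v) = v :=
  DFunLike.congr_fun (Ring.inverse_mul_cancel g hg) v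

lemma apply_ringInverse_apply {g : F →L[ℝ] F} (hg : IsUnit g) (v : F) : g (Ring.inverse g v) = v :=
  DFunLike.congr_fun (Ring.mul_inverse_cancel g hg) v

lemma contDiffOn_ringInverse {O : Set B} {g : B → F →L[ℝ] F} (hg : ContDiffOn ℝ ∞ g O)
    (hu : ∀ b ∈ O, IsUnit (g b)) : ContDiffOn ℝ ∞ (fun b => Ring.inverse (g b)) O := by
  intro b hb
  obtain ⟨e, he⟩ := hu b hb
  have h1 : ContDiffAt ℝ ∞ Ring.inverse (g b) := by
    rw [← he]
    exact contDiffAt_ringInverse ℝ e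
  exact h1.comp_contDiffWithinAt b (hg b hb)

/-- The induced connection is the pull-back by `τ` of `d + Γ`, in the gauge `g`. Its symmetry is the
closedness of `g`, and a change of gauge does not affect the connection form in a frame, so the
structural Lie algebra is preserved. -/
theorem isQuaternionicFrame_inducedConn {O : Set B} (hO : IsOpen O) {Γ : B → B →L[ℝ] F →L[ℝ] F}
    (hΓ : ContDiffOn ℝ ∞ Γ O) {g : B → F →L[ℝ] F} (hg : ContDiffOn ℝ ∞ g O)
    (hu : ∀ b ∈ O, IsUnit (g b)) {τ : F →L[ℝ] B}
    (hclosed : ∀ b ∈ O, ∀ X Y, fderiv ℝ g b (τ X) Y + Γ b (τ X) (g b Y)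
      = fderiv ℝ g b (τ Y) X + Γ b (τ Y) (g b X))
    {h : B → HVec k →L[ℝ] F} {hi : B → F →L[ℝ] HVec k} (hh : ContDiffOn ℝ ∞ h O)
    (hhi : ContDiffOn ℝ ∞ hi O) (hl : ∀ b ∈ O, ∀ v, hi b (h b v) = v)
    (hr : ∀ b ∈ O, ∀ f, h b (hi b f) = f)
    (hform : ∀ b ∈ O, ∀ X, (hi b).comp (fderiv ℝ h b X + (Γ b X).comp (h b)) ∈ imNormalizer k) :
    IsQuaternionicFrame (τ ⁻¹' O) (inducedConn Γ g τ)
      (fun y => (Ring.inverse (g (τ y))).comp (h (τ y))) (fun y => (hi (τ y)).comp (g (τ y))) := by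
  have hgi := contDiffOn_ringInverse hg hu
  have hτ : ContDiffOn ℝ ∞ τ (τ ⁻¹' O) := τ.contDiff.contDiffOn
  have hm : MapsTo τ (τ ⁻¹' O) O := fun y hy => hy
  refine ⟨?_, ?_, ?_, ?_, ?_, ?_, ?_⟩
  · refine contDiffOn_clm_apply.2 fun X => contDiffOn_clm_apply.2 fun Y => ?_
    simp only [inducedConn_apply]
    refine (hgi.comp hτ hm).clm_apply (ContDiffOn.add ?_ ?_)
    · exact (((hg.fderiv_of_isOpen hO (by simp)).comp hτ hm).clm_apply contDiffOn_const).clm_apply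
        contDiffOn_const
    · exact ((hΓ.comp hτ hm).clm_apply contDiffOn_const).clm_apply
        ((hg.comp hτ hm).clm_apply contDiffOn_const)
  · intro y hy X Y
    rw [inducedConn_apply, inducedConn_apply, hclosed _ hy]
  · exact (hgi.comp hτ hm).clm_comp (hh.comp hτ hm)
  · exact (hhi.comp hτ hm).clm_comp (hg.comp hτ hm)
  · intro y hy v
    simp [apply_ringInverse_apply (hu _ hy), hl _ hy]
  · intro y hy f
    simp [hr _ hy, ringInverse_apply_apply (hu _ hy)]
  · intro y hy X
    -- The derivative of `g⁻¹` cancels the inhomogeneous term of the induced connection, and the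
    -- connection form of `g⁻¹ ∘ h` in the direction `X` is that of `h` in the direction `τ X`.
    have hb : τ y ∈ O := hy
    convert hform (τ y) hb (τ X) using 1
    have dg := hg.hasFDerivAt_of_isOpen hO hb
    have dgi := hgi.hasFDerivAt_of_isOpen hO hb
    have dh := hh.hasFDerivAt_of_isOpen hO hb
    have d1 := (dgi.clm_comp dh).comp y τ.hasFDerivAt
    have d2 : fderiv ℝ (fun y => (Ring.inverse (g (τ y))).comp (h (τ y))) y = _ := d1.fderiv
    ext q : 1
    rw [d2]
    have h3 := fderiv_inverse_apply hO (fun b hb v => ringInverse_apply_apply (hu b hb) v) hb dg dgi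
      (τ X) (Ring.inverse (g (τ y)) (h (τ y) q))
    rw [apply_ringInverse_apply (hu _ hb)] at h3
    simp only [ContinuousLinearMap.comp_apply, add_apply, inducedConn_apply,
      ContinuousLinearMap.flip_apply, ContinuousLinearMap.compL_apply, h3,
      apply_ringInverse_apply (hu _ hb), map_add, map_neg]
    abel

end ClosedFrame

end CoCR

end

noncomputable section

set_option synthInstance.maxHeartbeats 200000
set_option linter.unusedSectionVars false

namespace CoCR
-- The connection map in an arbitrary trivialization.
section ConnectionMap

open Topology Filter VectorField

variable {B : Type*} [NormedAddCommGroup B] [NormedSpace ℝ B] [FiniteDimensional ℝ B]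
  {M : Type*} [TopologicalSpace M] [T2Space M] [ChartedSpace B M] [IsManifold 𝓘(ℝ, B) ∞ M]
  {F : Type*} [NormedAddCommGroup F] [NormedSpace ℝ F] [FiniteDimensional ℝ F]
  {E : M → Type*} [TopologicalSpace (TotalSpace F E)]
  [∀ x, AddCommGroup (E x)] [∀ x, Module ℝ (E x)] [∀ x, TopologicalSpace (E x)]
  [∀ x, IsTopologicalAddGroup (E x)] [∀ x, ContinuousSMul ℝ (E x)]
  [FiberBundle F E] [VectorBundle ℝ F E] [ContMDiffVectorBundle ∞ F E 𝓘(ℝ, B)]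

/-- The matrix of an element of `End E`, with respect to the preferred trivialization around
`x₀`. -/
def endCoord (x₀ : M) (w : EndTotal F E) : F →L[ℝ] F :=
  ContinuousLinearMap.inCoordinates F E F E x₀ w.proj x₀ w.proj w.2

lemma endCoord_apply (x₀ : M) (w : EndTotal F E) (f : F) :
    endCoord x₀ w f = coordAt F E x₀ w.proj (w.2 (vecAt F E x₀ w.proj f)) := rfl

lemma contMDiffAt_endCoord {x₀ : M} {w : EndTotal F E}
    (hw : w.proj ∈ (trivializationAt F E x₀).baseSet) :
    ContMDiffAt (endModel B F) 𝓘(ℝ, F →L[ℝ] F) ∞ (endCoord x₀) w := by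
  have hs : w ∈ (trivializationAt (F →L[ℝ] F) (fun x : M => E x →L[ℝ] E x) x₀).source := by
    rw [Trivialization.mem_source, hom_trivializationAt_baseSet]
    exact ⟨hw, hw⟩
  have h1 := (Trivialization.contMDiffOn (IB := 𝓘(ℝ, B)) (n := ∞)
    (trivializationAt (F →L[ℝ] F) (fun x : M => E x →L[ℝ] E x) x₀)).contMDiffAt
      ((trivializationAt (F →L[ℝ] F) (fun x : M => E x →L[ℝ] E x) x₀).open_source.mem_nhds hs)
  exact contMDiffAt_snd.comp w h1

/-- The change of coordinates between the preferred trivializations around `x₁` and `x₀`. -/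
def coordTransition (x₀ x₁ : M) (b : B) : F →L[ℝ] F :=
  (coordAt F E x₀ ((extChartAt 𝓘(ℝ, B) x₀).symm b)).comp
    (vecAt F E x₁ ((extChartAt 𝓘(ℝ, B) x₀).symm b))

/-- The inverse change of coordinates. -/
def coordTransitionInv (x₀ x₁ : M) (b : B) : F →L[ℝ] F :=
  (coordAt F E x₁ ((extChartAt 𝓘(ℝ, B) x₀).symm b)).comp
    (vecAt F E x₀ ((extChartAt 𝓘(ℝ, B) x₀).symm b))

lemma contDiffOn_coordTransition (x₀ x₁ : M) :
    ContDiffOn ℝ ∞ (coordTransition (B := B) (F := F) (E := E) x₀ x₁)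
      (chartImage x₀ (coordDomain B F E x₀ ∩ coordDomain B F E x₁)) :=
  contDiffOn_clm_apply.2 fun f => (isSmoothSectionOn_iff_localRep
    ((isOpen_coordDomain x₀).inter (isOpen_coordDomain x₁)) inter_subset_left).1
    ((isSmoothSectionOn_constSection x₁ f).mono inter_subset_right)

lemma contDiffOn_coordTransitionInv (x₀ x₁ : M) :
    ContDiffOn ℝ ∞ (coordTransitionInv (B := B) (F := F) (E := E) x₀ x₁)
      (chartImage x₀ (coordDomain B F E x₀ ∩ coordDomain B F E x₁)) := by
  refine contDiffOn_clm_apply.2 fun f => ?_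
  refine (contMDiffOn_iff_chartImage (f := fun x => coordAt F E x₁ x (vecAt F E x₀ x f)) x₀
    fun x hx => hx.1.1).1 ?_
  have h1 := (isSmoothSectionOn_constSection (B := B) (E := E) x₀ f).mono
    (inter_subset_left (t := coordDomain B F E x₁))
  refine (((trivializationAt F E x₁).contMDiffOn_section_iff
    ((isOpen_coordDomain x₀).inter (isOpen_coordDomain x₁)) fun x hx => hx.2.2).1 h1).congr
    fun x hx => ?_
  exact coordAt_apply_eq hx.2.2 _

lemma coordTransitionInv_coordTransition {x₀ x₁ : M} {b : B}
    (hb : b ∈ chartImage x₀ (coordDomain B F E x₀ ∩ coordDomain B F E x₁)) (f : F) :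
    coordTransitionInv (E := E) x₀ x₁ b (coordTransition (E := E) x₀ x₁ b f) = f := by
  change coordAt F E x₁ _ (vecAt F E x₀ _ (coordAt F E x₀ _ (vecAt F E x₁ _ f))) = f
  rw [vecAt_coordAt hb.2.1.2, coordAt_vecAt hb.2.2.2]

/-- The product rule for a conjugated matrix; it serves both for changes of trivialization and for
conjugation by the closed frame. -/
lemma hasMFDerivAt_conj {X : Type*} [TopologicalSpace X] {H : Type*} [TopologicalSpace H]
    {G : Type*} [NormedAddCommGroup G] [NormedSpace ℝ G] {I : ModelWithCorners ℝ G H}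
    [ChartedSpace H X] {V W : Type*} [NormedAddCommGroup V] [NormedSpace ℝ V]
    [NormedAddCommGroup W] [NormedSpace ℝ W] {a : X → V} {m : X → W →L[ℝ] W}
    {C D : V → W →L[ℝ] W} {w : X} {a' : TangentSpace I w →L[ℝ] V}
    {m' : TangentSpace I w →L[ℝ] W →L[ℝ] W} {C' D' : V →L[ℝ] W →L[ℝ] W}
    (ha : HasMFDerivAt I 𝓘(ℝ, V) a w a') (hm : HasMFDerivAt I 𝓘(ℝ, W →L[ℝ] W) m w m')
    (hC : HasFDerivAt C C' (a w)) (hD : HasFDerivAt D D' (a w)) :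
    ∃ T : TangentSpace I w →L[ℝ] W →L[ℝ] W,
      HasMFDerivAt I 𝓘(ℝ, W →L[ℝ] W) (fun z => (C (a z)).comp ((m z).comp (D (a z)))) w T ∧
      ∀ ζ v, T ζ v = C' (a' ζ) (m w (D (a w) v)) + C (a w) (m' ζ (D (a w) v))
        + C (a w) (m w (D' (a' ζ) v)) := by
  have h1 : HasFDerivAt (fun p : V × (W →L[ℝ] W) => (C p.1).comp (p.2.comp (D p.1))) _ (a w, m w) :=
    (hC.comp (a w, m w) hasFDerivAt_fst).clm_comp
      (hasFDerivAt_snd.clm_comp (hD.comp (a w, m w) hasFDerivAt_fst))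
  have h2 : HasMFDerivAt I 𝓘(ℝ, V × (W →L[ℝ] W)) (fun z => (a z, m z)) w (a'.prod m') :=
    ⟨ha.1.prodMk hm.1, ha.2.prodMk hm.2⟩
  refine ⟨_, h1.hasMFDerivAt.comp w h2, fun ζ v => ?_⟩
  have h4 : ∀ x y z : W, x + y + z = z + y + x := fun x y z => by abel
  exact (congrArg (fun z => z + C' (a' ζ) (m w (D (a w) v))) (map_add (C (a w))
    (m w (D' (a' ζ) v)) (m' ζ (D (a w) v)))).trans (h4 _ _ _)

lemma hasMFDerivAt_extChartAt_proj {x₀ : M} {w : EndTotal F E}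
    (hw : w.proj ∈ (extChartAt 𝓘(ℝ, B) x₀).source) :
    ∃ a' : TangentSpace (endModel B F) w →L[ℝ] B,
      HasMFDerivAt (endModel B F) 𝓘(ℝ, B) (fun w' : EndTotal F E => extChartAt 𝓘(ℝ, B) x₀ w'.proj) w a' ∧
      ∀ ζ, a' ζ = coordAt B (TangentSpace 𝓘(ℝ, B) : M → Type _) x₀ w.proj (dproj w ζ) := by
  have h1 : MDifferentiableAt (endModel B F) 𝓘(ℝ, B) (fun w' : EndTotal F E => w'.proj) w :=
    mdifferentiableAt_proj _
  have h2 : MDifferentiableAt 𝓘(ℝ, B) 𝓘(ℝ, B) (extChartAt 𝓘(ℝ, B) x₀) w.proj :=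
    mdifferentiableAt_extChartAt (by simpa using hw)
  refine ⟨_, h2.hasMFDerivAt.comp w h1.hasMFDerivAt, fun ζ => ?_⟩
  rw [coordAt_tangent hw]
  rfl

/-- The connection map in coordinates. -/
theorem coordAt_connectionMap (nabla : CovariantDerivative 𝓘(ℝ, B) F E) {x₀ : M} {w : EndTotal F E}
    (hw : w.proj ∈ coordDomain B F E x₀) (ζ : TangentSpace (endModel B F) w) (v : E w.proj)
    {P : TangentSpace (endModel B F) w →L[ℝ] F →L[ℝ] F}
    (hP : HasMFDerivAt (endModel B F) 𝓘(ℝ, F →L[ℝ] F) (endCoord x₀) w P) :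
    coordAt F E x₀ w.proj (connectionMap nabla w ζ v) = P ζ (coordAt F E x₀ w.proj v)
      + localConn nabla x₀ (extChartAt 𝓘(ℝ, B) x₀ w.proj)
        (coordAt B (TangentSpace 𝓘(ℝ, B) : M → Type _) x₀ w.proj (dproj w ζ))
        (endCoord x₀ w (coordAt F E x₀ w.proj v))
      - endCoord x₀ w (localConn nabla x₀ (extChartAt 𝓘(ℝ, B) x₀ w.proj)
        (coordAt B (TangentSpace 𝓘(ℝ, B) : M → Type _) x₀ w.proj (dproj w ζ))
          (coordAt F E x₀ w.proj v)) := by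
  set W := coordDomain B F E x₀ ∩ coordDomain B F E w.proj with hW
  have hWo : IsOpen W := (isOpen_coordDomain x₀).inter (isOpen_coordDomain w.proj)
  have hxW : w.proj ∈ W := ⟨hw, mem_coordDomain w.proj⟩
  have hxb := (mem_coordDomain (B := B) (F := F) (E := E) w.proj).2
  have hop := isOpen_chartImage (B := B) x₀ hWo
  have hb : extChartAt 𝓘(ℝ, B) x₀ w.proj ∈ chartImage x₀ W := extChartAt_mem_chartImage hw.1 hxW
  have hinv : (extChartAt 𝓘(ℝ, B) x₀).symm (extChartAt 𝓘(ℝ, B) x₀ w.proj) = w.proj := (extChartAt 𝓘(ℝ, B) x₀).left_inv hw.1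
  -- The definition of `connectionMap` uses the trivialization around `w.proj` itself. Its
  -- transition to the one around `x₀` conjugates the matrix, and the derivatives of the transition
  -- cancel those in the coordinates of the covariant derivatives of the constant sections.
  have hC := (contDiffOn_coordTransition (B := B) (F := F) (E := E) x₀ w.proj).hasFDerivAt_of_isOpen hop hb
  have hD := (contDiffOn_coordTransitionInv (B := B) (F := F) (E := E) x₀ w.proj).hasFDerivAt_of_isOpen hop hb
  obtain ⟨a', ha, ha'⟩ := hasMFDerivAt_extChartAt_proj (w := w) hw.1
  obtain ⟨P₁, hm⟩ : ∃ P₁ : TangentSpace (endModel B F) w →L[ℝ] F →L[ℝ] F,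
      HasMFDerivAt (endModel B F) 𝓘(ℝ, F →L[ℝ] F) (endCoord w.proj) w P₁ :=
    ⟨_, ((contMDiffAt_endCoord (B := B) (w := w) hxb).mdifferentiableAt (by simp)).hasMFDerivAt⟩
  have hdm : dmatrix w ζ = P₁ ζ := congrArg (fun L => L ζ) hm.mfderiv
  obtain ⟨T, hT, hT'⟩ := hasMFDerivAt_conj ha hm hC hD
  have hC0 : ∀ f, coordTransition (B := B) (F := F) (E := E) x₀ w.proj (extChartAt 𝓘(ℝ, B) x₀ w.proj) f
      = coordAt F E x₀ w.proj (vecAt F E w.proj w.proj f) := by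
    intro f
    change coordAt F E x₀ ((extChartAt 𝓘(ℝ, B) x₀).symm (extChartAt 𝓘(ℝ, B) x₀ w.proj)) (vecAt F E w.proj ((extChartAt 𝓘(ℝ, B) x₀).symm (extChartAt 𝓘(ℝ, B) x₀ w.proj)) f) = _
    rw [hinv]
  have hD0 : ∀ f, coordTransitionInv (B := B) (F := F) (E := E) x₀ w.proj (extChartAt 𝓘(ℝ, B) x₀ w.proj) f
      = coordAt F E w.proj w.proj (vecAt F E x₀ w.proj f) := by
    intro f
    change coordAt F E w.proj ((extChartAt 𝓘(ℝ, B) x₀).symm (extChartAt 𝓘(ℝ, B) x₀ w.proj)) (vecAt F E x₀ ((extChartAt 𝓘(ℝ, B) x₀).symm (extChartAt 𝓘(ℝ, B) x₀ w.proj)) f) = _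
    rw [hinv]
  have hPT : P = T := by
    refine hasMFDerivAt_unique hP (hT.congr_of_eventuallyEq ?_)
    have h1 : ∀ᶠ w' : EndTotal F E in 𝓝 w, w'.proj ∈ W :=
      (FiberBundle.continuous_proj (F →L[ℝ] F) (fun x : M => E x →L[ℝ] E x)).continuousAt.eventually_mem
        (hWo.mem_nhds hxW)
    filter_upwards [h1] with w' hw'
    have h2 : (extChartAt 𝓘(ℝ, B) x₀).symm (extChartAt 𝓘(ℝ, B) x₀ w'.proj) = w'.proj := (extChartAt 𝓘(ℝ, B) x₀).left_inv hw'.1.1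
    ext f
    change coordAt F E x₀ w'.proj (w'.2 (vecAt F E x₀ w'.proj f)) =
      coordAt F E x₀ ((extChartAt 𝓘(ℝ, B) x₀).symm (extChartAt 𝓘(ℝ, B) x₀ w'.proj)) (vecAt F E w.proj ((extChartAt 𝓘(ℝ, B) x₀).symm (extChartAt 𝓘(ℝ, B) x₀ w'.proj))
        (coordAt F E w.proj w'.proj (w'.2 (vecAt F E w.proj w'.proj
          (coordAt F E w.proj ((extChartAt 𝓘(ℝ, B) x₀).symm (extChartAt 𝓘(ℝ, B) x₀ w'.proj)) (vecAt F E x₀ ((extChartAt 𝓘(ℝ, B) x₀).symm (extChartAt 𝓘(ℝ, B) x₀ w'.proj)) f))))))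
    rw [h2, vecAt_coordAt hw'.2.2, vecAt_coordAt hw'.2.2]
  have hnab : ∀ f, coordAt F E x₀ w.proj (nabla (constSection w.proj f) w.proj (dproj w ζ)) =
      fderiv ℝ (coordTransition (B := B) (F := F) (E := E) x₀ w.proj) (extChartAt 𝓘(ℝ, B) x₀ w.proj)
        (coordAt B (TangentSpace 𝓘(ℝ, B) : M → Type _) x₀ w.proj (dproj w ζ)) f
      + localConn nabla x₀ (extChartAt 𝓘(ℝ, B) x₀ w.proj) (coordAt B (TangentSpace 𝓘(ℝ, B) : M → Type _) x₀ w.proj (dproj w ζ))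
        (coordAt F E x₀ w.proj (vecAt F E w.proj w.proj f)) := by
    intro f
    rw [coordAt_nabla nabla hw ((isSmoothSectionOn_constSection w.proj f).mdifferentiableAt
      (isOpen_coordDomain w.proj) (mem_coordDomain w.proj))]
    have h1 : fderiv ℝ (localRep (E := E) x₀ (constSection w.proj f)) (extChartAt 𝓘(ℝ, B) x₀ w.proj) =
      (fderiv ℝ (coordTransition (B := B) (F := F) (E := E) x₀ w.proj) (extChartAt 𝓘(ℝ, B) x₀ w.proj)).flip f :=
        (hasFDerivAt_clm_apply_const hC f).fderiv
    rw [h1]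
    rfl
  have hDC := fderiv_inverse_apply hop (fun b hb f => coordTransitionInv_coordTransition hb f) hb hC hD
    (coordAt B (TangentSpace 𝓘(ℝ, B) : M → Type _) x₀ w.proj (dproj w ζ)) (coordAt F E w.proj w.proj v)
  rw [hC0, hD0, vecAt_coordAt hxb] at hDC
  have hJ : ∀ u : E w.proj, endCoord x₀ w (coordAt F E x₀ w.proj u) = coordAt F E x₀ w.proj (w.2 u) := fun u => by
    rw [endCoord_apply]
    exact congrArg (fun z => coordAt F E x₀ w.proj (w.2 z)) (vecAt_coordAt hw.2 u)
  have hJ' : ∀ u : E w.proj, endCoord w.proj w (coordAt F E w.proj w.proj u) = coordAt F E w.proj w.proj (w.2 u) := fun u => by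
    rw [endCoord_apply]
    exact congrArg (fun z => coordAt F E w.proj w.proj (w.2 z)) (vecAt_coordAt hxb u)
  rw [hPT, hT', ha', hD0, vecAt_coordAt hw.2, hJ', hDC, map_neg, map_neg]
  have hnab' : ∀ u : E w.proj, coordAt F E x₀ w.proj
      (nabla (constSection w.proj (coordAt F E w.proj w.proj u)) w.proj (dproj w ζ)) =
      fderiv ℝ (coordTransition (B := B) (F := F) (E := E) x₀ w.proj) (extChartAt 𝓘(ℝ, B) x₀ w.proj)
        (coordAt B (TangentSpace 𝓘(ℝ, B) : M → Type _) x₀ w.proj (dproj w ζ))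
        (coordAt F E w.proj w.proj u)
      + localConn nabla x₀ (extChartAt 𝓘(ℝ, B) x₀ w.proj)
        (coordAt B (TangentSpace 𝓘(ℝ, B) : M → Type _) x₀ w.proj (dproj w ζ))
        (coordAt F E x₀ w.proj u) := fun u => by
    rw [hnab, vecAt_coordAt hxb]
  have hlhs : coordAt F E x₀ w.proj (connectionMap nabla w ζ v) =
      coordAt F E x₀ w.proj (vecAt F E w.proj w.proj (P₁ ζ (coordAt F E w.proj w.proj v)))
      + coordAt F E x₀ w.proj
        (nabla (constSection w.proj (coordAt F E w.proj w.proj (w.2 v))) w.proj (dproj w ζ))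
      - coordAt F E x₀ w.proj (w.2
        (nabla (constSection w.proj (coordAt F E w.proj w.proj v)) w.proj (dproj w ζ))) := by
    rw [← map_add, ← map_sub, ← hdm]
    rfl
  have hlast : ∀ f, coordTransition (B := B) (F := F) (E := E) x₀ w.proj
      (extChartAt 𝓘(ℝ, B) x₀ w.proj) (endCoord w.proj w (coordAt F E w.proj w.proj
        (vecAt F E x₀ w.proj f))) = endCoord x₀ w f := fun f => by
    rw [hC0, hJ', vecAt_coordAt hxb]
    rfl
  rw [hlhs, hnab', ← hJ (nabla _ _ _), hnab', hlast, hC0, map_add, ← hJ]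
  abel

end ConnectionMap

end CoCR

end

noncomputable section

set_option synthInstance.maxHeartbeats 200000
set_option linter.unusedSectionVars false

namespace CoCR
-- A single chart for the total space of the kernel.
section KernelChart

open Topology Filter Manifold

variable {B : Type*} [NormedAddCommGroup B] [NormedSpace ℝ B]
  {F : Type*} [NormedAddCommGroup F] [NormedSpace ℝ F]
  {X : Type*} [TopologicalSpace X]

/-- The product of the source and of the kernel of a split surjection, straightened. -/
def splitEquiv {τ : F →L[ℝ] B} {s : B →L[ℝ] F} (hs : ∀ b, τ (s b) = b) : (F × B) ≃L[ℝ] B × F :=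
  ContinuousLinearEquiv.equivOfInverse
    ((τ.comp (.fst ℝ F B)).prod (.fst ℝ F B - s.comp (τ.comp (.fst ℝ F B)) + s.comp (.snd ℝ F B)))
    ((s.comp (.fst ℝ B F) + (.snd ℝ B F - s.comp (τ.comp (.snd ℝ B F)))).prod (τ.comp (.snd ℝ B F)))
    (fun p => by ext <;> simp [hs]) (fun p => by ext <;> simp [hs])

lemma splitEquiv_apply_zero {τ : F →L[ℝ] B} {s : B →L[ℝ] F} (hs : ∀ b, τ (s b) = b) (y : F) :
    splitEquiv hs (y, 0) = (τ y, y - s (τ y)) := by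
  simp [splitEquiv]

open Classical in
/-- The chart of the total space `K` of the kernel of a split surjection `τ`, given by a chart `Ξ`
of the ambient space in which `K` is cut out by `τ`. -/
def kernelChart (Ξ : OpenPartialHomeomorph X (B × F)) {O : Set B} (hO : IsOpen O)
    (hΞ : Ξ.target = O ×ˢ univ) {τ : F →L[ℝ] B} {s : B →L[ℝ] F} (hs : ∀ b, τ (s b) = b) {K : Set X}
    (hK : ∀ p, p ∈ K ↔ p ∈ Ξ.source ∧ τ (Ξ p).2 = 0) (p₀ : K) : OpenPartialHomeomorph K F where
  -- The splitting of `F` into the image of `s` and `ker τ` encodes a base point and a kernel vector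
  -- in one element of `F`; then `τ` recovers the base point.
  toFun p := s (Ξ p).1 + (Ξ p).2
  -- The point `p₀` is a default value, taken only outside the target.
  invFun y := if h : Ξ.symm (τ y, y - s (τ y)) ∈ K then ⟨_, h⟩ else p₀
  source := univ
  target := τ ⁻¹' O
  map_source' p _ := by
    have h1 := (hK p).1 p.2
    have h2 := Ξ.map_source h1.1
    rw [hΞ] at h2
    simpa [hs, h1.2] using h2.1
  map_target' _ _ := mem_univ _
  left_inv' p _ := by
    have h1 := (hK p).1 p.2
    have h2 : Ξ.symm (τ (s (Ξ p).1 + (Ξ p).2),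
        s (Ξ p).1 + (Ξ p).2 - s (τ (s (Ξ p).1 + (Ξ p).2))) = p := by
      simp [hs, h1.2, Ξ.left_inv h1.1]
    simp only [h2]
    simp
  right_inv' y hy := by
    have h1 : (τ y, y - s (τ y)) ∈ Ξ.target := by rw [hΞ]; exact ⟨hy, mem_univ _⟩
    have h2 : Ξ.symm (τ y, y - s (τ y)) ∈ K := by
      rw [hK, Ξ.right_inv h1]
      exact ⟨Ξ.map_target h1, by simp [hs]⟩
    simp [h2, Ξ.right_inv h1]
  open_source := isOpen_univ
  open_target := hO.preimage τ.continuous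
  continuousOn_toFun := by
    have h1 : ContinuousOn (fun p : K => Ξ p) univ :=
      Ξ.continuousOn.comp continuous_subtype_val.continuousOn fun p _ => ((hK p).1 p.2).1
    exact (s.continuous.comp_continuousOn h1.fst).add h1.snd
  continuousOn_invFun := by
    rw [IsInducing.subtypeVal.continuousOn_iff]
    have h1 : ContinuousOn (fun y => Ξ.symm (τ y, y - s (τ y))) (τ ⁻¹' O) :=
      Ξ.continuousOn_symm.comp (by fun_prop) fun y hy => by rw [hΞ]; exact ⟨hy, mem_univ _⟩
    refine h1.congr fun y hy => ?_
    have h1 : (τ y, y - s (τ y)) ∈ Ξ.target := by rw [hΞ]; exact ⟨hy, mem_univ _⟩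
    have h2 : Ξ.symm (τ y, y - s (τ y)) ∈ K := by
      rw [hK, Ξ.right_inv h1]
      exact ⟨Ξ.map_target h1, by simp [hs]⟩
    simp [h2]

lemma kernelChart_symm_apply (Ξ : OpenPartialHomeomorph X (B × F)) {O : Set B} (hO : IsOpen O)
    (hΞ : Ξ.target = O ×ˢ univ) {τ : F →L[ℝ] B} {s : B →L[ℝ] F} (hs : ∀ b, τ (s b) = b) {K : Set X}
    (hK : ∀ p, p ∈ K ↔ p ∈ Ξ.source ∧ τ (Ξ p).2 = 0) (p₀ : K) {y : F} (hy : τ y ∈ O) :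
    ((kernelChart Ξ hO hΞ hs hK p₀).symm y : X) = Ξ.symm (τ y, y - s (τ y)) := by
  have h1 : (τ y, y - s (τ y)) ∈ Ξ.target := by rw [hΞ]; exact ⟨hy, mem_univ _⟩
  have h2 : Ξ.symm (τ y, y - s (τ y)) ∈ K := by
    rw [hK, Ξ.right_inv h1]
    exact ⟨Ξ.map_target h1, by simp [hs]⟩
  exact congrArg Subtype.val (dif_pos h2)

/-- Read in the charts, the inclusion is `y ↦ (τ y, y - s (τ y))`, the restriction of the linear
isomorphism `splitEquiv` to `F × 0`; hence it is an immersion with complement `B`. -/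
theorem exists_isSmoothEmbedding_of_kernel [ChartedSpace (ModelProd B F) X]
    [IsManifold (𝓘(ℝ, B).prod 𝓘(ℝ, F)) ∞ X]
    (Ξ : OpenPartialHomeomorph X (ModelProd B F))
    (hΞX : Ξ ∈ IsManifold.maximalAtlas (𝓘(ℝ, B).prod 𝓘(ℝ, F)) ∞ X) {O : Set B} (hO : IsOpen O)
    (hΞ : Ξ.target = O ×ˢ univ) {τ : F →L[ℝ] B} {s : B →L[ℝ] F} (hs : ∀ b, τ (s b) = b) {K : Set X}
    (hK : ∀ p, p ∈ K ↔ p ∈ Ξ.source ∧ τ (Ξ p).2 = 0) (p₀ : K) :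
    ∃ (_ : ChartedSpace F K) (_ : IsManifold 𝓘(ℝ, F) ∞ K),
      IsSmoothEmbedding 𝓘(ℝ, F) (𝓘(ℝ, B).prod 𝓘(ℝ, F)) ∞ (Subtype.val : K → X) ∧
      (∀ p q : K, chartAt F p = chartAt F q) ∧
      (∀ p q : K, extChartAt 𝓘(ℝ, F) p q = s (Ξ q).1 + (Ξ q).2) ∧
      ∀ p : K, (extChartAt 𝓘(ℝ, F) p).target = τ ⁻¹' O := by
  set e := kernelChart Ξ hO hΞ hs hK p₀ with he
  let _ : ChartedSpace F K := e.singletonChartedSpace rfl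
  have _ : IsManifold 𝓘(ℝ, F) ∞ K := { e.singleton_hasGroupoid rfl (contDiffGroupoid ∞ 𝓘(ℝ, F)) with }
  have hT : ∀ p : K, (extChartAt 𝓘(ℝ, F) p).target = τ ⁻¹' O := fun p => by
    simp
    rfl
  refine ⟨inferInstance, inferInstance, ⟨?_, IsEmbedding.subtypeVal⟩, fun p q => rfl, fun p q => rfl, hT⟩
  · refine IsImmersionOfComplement.isImmersion (F := B) fun p => ?_
    refine IsImmersionAtOfComplement.mk_of_continuousAt continuousAt_subtype_val (splitEquiv hs)
      (chartAt F p) Ξ (mem_chart_source F p) ((hK p).1 p.2).1 (IsManifold.chart_mem_maximalAtlas p)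
      hΞX fun y hy => ?_
    have hy' : τ y ∈ O := (Set.ext_iff.1 (hT p) y).1 hy
    have h1 : (τ y, y - s (τ y)) ∈ Ξ.target := by rw [hΞ]; exact ⟨hy', mem_univ _⟩
    have h2 := kernelChart_symm_apply Ξ hO hΞ hs hK p₀ hy'
    refine Eq.trans ?_ (splitEquiv_apply_zero hs y).symm
    change Ξ (e.symm y : X) = _
    rw [h2]
    exact Ξ.right_inv h1

end KernelChart

end CoCR

end

noncomputable section

set_option synthInstance.maxHeartbeats 200000
set_option linter.unusedSectionVars false

namespace CoCR
-- Changes of fibre coordinates.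
section FibreChange

open Topology Filter

variable {B : Type*} [NormedAddCommGroup B] [NormedSpace ℝ B] [FiniteDimensional ℝ B]
  {F : Type*} [NormedAddCommGroup F] [NormedSpace ℝ F] [FiniteDimensional ℝ F]

/-- The change of coordinates on the fibres given by a field `g` of isomorphisms. -/
def fibreChange {O : Set B} (hO : IsOpen O) {g : B → F →L[ℝ] F} (hg : ContDiffOn ℝ ∞ g O)
    (hu : ∀ b ∈ O, IsUnit (g b)) : OpenPartialHomeomorph (B × F) (B × F) where
  toFun p := (p.1, Ring.inverse (g p.1) p.2)
  invFun p := (p.1, g p.1 p.2)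
  source := O ×ˢ univ
  target := O ×ˢ univ
  map_source' _ hp := ⟨hp.1, mem_univ _⟩
  map_target' _ hp := ⟨hp.1, mem_univ _⟩
  left_inv' p hp := by simp [apply_ringInverse_apply (hu _ hp.1)]
  right_inv' p hp := by simp [ringInverse_apply_apply (hu _ hp.1)]
  open_source := hO.prod isOpen_univ
  open_target := hO.prod isOpen_univ
  continuousOn_toFun := continuousOn_fst.prodMk
    (((contDiffOn_ringInverse hg hu).continuousOn.comp continuousOn_fst fun _ hp => hp.1).clm_apply
      continuousOn_snd)
  continuousOn_invFun := continuousOn_fst.prodMk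
    ((hg.continuousOn.comp continuousOn_fst fun _ hp => hp.1).clm_apply continuousOn_snd)

lemma fibreChange_mem_groupoid {O : Set B} (hO : IsOpen O) {g : B → F →L[ℝ] F}
    (hg : ContDiffOn ℝ ∞ g O) (hu : ∀ b ∈ O, IsUnit (g b)) :
    (fibreChange hO hg hu : OpenPartialHomeomorph (ModelProd B F) (ModelProd B F)) ∈
      contDiffGroupoid ∞ (𝓘(ℝ, B).prod 𝓘(ℝ, F)) := by
  have h1 : ContDiffOn ℝ ∞ (fibreChange hO hg hu) (O ×ˢ univ) :=
    contDiffOn_fst.prodMk (((contDiffOn_ringInverse hg hu).comp contDiffOn_fst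
      fun _ hp => hp.1).clm_apply contDiffOn_snd)
  have h2 : ContDiffOn ℝ ∞ (fibreChange hO hg hu).symm (O ×ˢ univ) :=
    contDiffOn_fst.prodMk ((hg.comp contDiffOn_fst fun _ hp => hp.1).clm_apply contDiffOn_snd)
  rw [contDiffGroupoid, mem_groupoid_of_pregroupoid]
  simp only [contDiffPregroupoid]
  refine ⟨h1.mono ?_, h2.mono ?_⟩ <;> exact fun p hp => hp.1

lemma trans_mem_maximalAtlas {H G X : Type*} [NormedAddCommGroup G] [NormedSpace ℝ G]
    [TopologicalSpace H] [TopologicalSpace X] [ChartedSpace H X] {I : ModelWithCorners ℝ G H}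
    [IsManifold I ∞ X] {e : OpenPartialHomeomorph X H} (he : e ∈ IsManifold.maximalAtlas I ∞ X)
    {e' : OpenPartialHomeomorph H H} (he' : e' ∈ contDiffGroupoid ∞ I) :
    e ≫ₕ e' ∈ IsManifold.maximalAtlas I ∞ X := by
  rw [IsManifold.mem_maximalAtlas_iff] at he ⊢
  rw [mem_maximalAtlas_iff] at he ⊢
  intro e₁ h₁
  obtain ⟨h2, h3⟩ := he e₁ h₁
  refine ⟨?_, ?_⟩
  · rw [OpenPartialHomeomorph.trans_symm_eq_symm_trans_symm, OpenPartialHomeomorph.trans_assoc]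
    exact (contDiffGroupoid ∞ I).trans ((contDiffGroupoid ∞ I).symm he') h2
  · rw [← OpenPartialHomeomorph.trans_assoc]
    exact (contDiffGroupoid ∞ I).trans h3 he'

end FibreChange

/-! ### Charts of the total space of `E` adapted to a closed frame. -/

section TotalChart

open Topology Filter

variable {B : Type*} [NormedAddCommGroup B] [NormedSpace ℝ B] [FiniteDimensional ℝ B]
  {M : Type*} [TopologicalSpace M] [T2Space M] [ChartedSpace B M] [IsManifold 𝓘(ℝ, B) ∞ M]
  {F : Type*} [NormedAddCommGroup F] [NormedSpace ℝ F] [FiniteDimensional ℝ F]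
  {E : M → Type*} [TopologicalSpace (TotalSpace F E)]
  [∀ x, AddCommGroup (E x)] [∀ x, Module ℝ (E x)] [∀ x, TopologicalSpace (E x)]
  [∀ x, IsTopologicalAddGroup (E x)] [∀ x, ContinuousSMul ℝ (E x)]
  [FiberBundle F E] [VectorBundle ℝ F E] [ContMDiffVectorBundle ∞ F E 𝓘(ℝ, B)]

/-- The chart of the total space of `E` which corresponds to a field `g` of isomorphisms of the
typical fibre. -/
def totalChart (x₀ : M) {O : Set B} (hO : IsOpen O) {g : B → F →L[ℝ] F} (hg : ContDiffOn ℝ ∞ g O)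
    (hu : ∀ b ∈ O, IsUnit (g b)) : OpenPartialHomeomorph (TotalSpace F E) (ModelProd B F) :=
  chartAt (ModelProd B F) (⟨x₀, 0⟩ : TotalSpace F E) ≫ₕ
    (fibreChange hO hg hu : OpenPartialHomeomorph (ModelProd B F) (ModelProd B F))

lemma totalChart_mem_maximalAtlas (x₀ : M) {O : Set B} (hO : IsOpen O) {g : B → F →L[ℝ] F}
    (hg : ContDiffOn ℝ ∞ g O) (hu : ∀ b ∈ O, IsUnit (g b)) :
    totalChart x₀ hO hg hu ∈
      IsManifold.maximalAtlas (𝓘(ℝ, B).prod 𝓘(ℝ, F)) ∞ (TotalSpace F E) :=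
  trans_mem_maximalAtlas (IsManifold.chart_mem_maximalAtlas _) (fibreChange_mem_groupoid hO hg hu)

lemma chartAt_total_apply {x₀ : M} {p : TotalSpace F E} (hp : p.proj ∈ coordDomain B F E x₀) :
    chartAt (ModelProd B F) (⟨x₀, 0⟩ : TotalSpace F E) p =
      (extChartAt 𝓘(ℝ, B) x₀ p.proj, coordAt F E x₀ p.proj p.2) := by
  rw [FiberBundle.chartedSpace_chartAt, coordAt_apply_eq hp.2]
  have h1 : (trivializationAt F E x₀ p).1 = p.proj :=
    (trivializationAt F E x₀).coe_fst' hp.2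
  change (chartAt B x₀ (trivializationAt F E x₀ p).1, (trivializationAt F E x₀ p).2) = _
  rw [h1]
  rfl

lemma mem_chartAt_total_source {x₀ : M} {p : TotalSpace F E} :
    p ∈ (chartAt (ModelProd B F) (⟨x₀, 0⟩ : TotalSpace F E)).source ↔
      p.proj ∈ coordDomain B F E x₀ := by
  rw [FiberBundle.chartedSpace_chartAt, OpenPartialHomeomorph.trans_source]
  refine ⟨fun h => ?_, fun h => ?_⟩
  · have h1 : p.proj ∈ (trivializationAt F E x₀).baseSet :=
      (trivializationAt F E x₀).mem_source.1 h.1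
    have h2 : (trivializationAt F E x₀ p).1 ∈ (chartAt B x₀).source := h.2.1
    rw [(trivializationAt F E x₀).coe_fst' h1] at h2
    exact ⟨by simpa using h2, h1⟩
  · refine ⟨(trivializationAt F E x₀).mem_source.2 h.2, ?_, mem_univ _⟩
    change (trivializationAt F E x₀ p).1 ∈ (chartAt B x₀).source
    rw [(trivializationAt F E x₀).coe_fst' h.2]
    simpa using h.1

lemma chartAt_total_target {x₀ : M} :
    (chartAt (ModelProd B F) (⟨x₀, 0⟩ : TotalSpace F E)).target =
      chartImage x₀ (coordDomain B F E x₀) ×ˢ univ := by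
  rw [FiberBundle.chartedSpace_chartAt, OpenPartialHomeomorph.trans_target]
  ext p
  refine ⟨fun h => ?_, fun h => ?_⟩
  · have h1 : p.1 ∈ (chartAt B x₀).target := h.1.1
    have h2 : ((chartAt B x₀).symm p.1, p.2) ∈ (trivializationAt F E x₀).target := h.2
    rw [Trivialization.mem_target] at h2
    have h3 : p.1 ∈ (extChartAt 𝓘(ℝ, B) x₀).target := by simpa using h1
    exact ⟨⟨h3, (extChartAt 𝓘(ℝ, B) x₀).map_target h3, h2⟩, mem_univ _⟩
  · have h1 : p.1 ∈ (chartAt B x₀).target := by simpa using h.1.1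
    exact ⟨⟨h1, mem_univ _⟩, (trivializationAt F E x₀).mem_target.2 h.1.2.2⟩

lemma totalChart_apply (x₀ : M) {O : Set B} (hO : IsOpen O) {g : B → F →L[ℝ] F}
    (hg : ContDiffOn ℝ ∞ g O) (hu : ∀ b ∈ O, IsUnit (g b)) {p : TotalSpace F E}
    (hp : p.proj ∈ coordDomain B F E x₀) :
    totalChart x₀ hO hg hu p = (extChartAt 𝓘(ℝ, B) x₀ p.proj,
      Ring.inverse (g (extChartAt 𝓘(ℝ, B) x₀ p.proj)) (coordAt F E x₀ p.proj p.2)) := by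
  change fibreChange hO hg hu (chartAt (ModelProd B F) (⟨x₀, 0⟩ : TotalSpace F E) p) = _
  rw [chartAt_total_apply hp]
  rfl

lemma mem_totalChart_source (x₀ : M) {O : Set B} (hO : IsOpen O) {g : B → F →L[ℝ] F}
    (hg : ContDiffOn ℝ ∞ g O) (hu : ∀ b ∈ O, IsUnit (g b)) {p : TotalSpace F E} :
    p ∈ (totalChart x₀ hO hg hu).source ↔ p.proj ∈ coordDomain B F E x₀ ∧
      extChartAt 𝓘(ℝ, B) x₀ p.proj ∈ O := by
  rw [totalChart, OpenPartialHomeomorph.trans_source, mem_inter_iff, mem_chartAt_total_source]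
  refine and_congr_right fun h => ?_
  rw [mem_preimage, chartAt_total_apply h]
  exact and_iff_left (mem_univ _)

lemma totalChart_target (x₀ : M) {O : Set B} (hO : IsOpen O)
    (hOd : O ⊆ chartImage x₀ (coordDomain B F E x₀)) {g : B → F →L[ℝ] F}
    (hg : ContDiffOn ℝ ∞ g O) (hu : ∀ b ∈ O, IsUnit (g b)) :
    (totalChart (E := E) x₀ hO hg hu).target = O ×ˢ univ := by
  rw [totalChart, OpenPartialHomeomorph.trans_target, chartAt_total_target]
  exact inter_eq_left.2 fun p hp => ⟨hOd hp.1, mem_univ _⟩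

end TotalChart

end CoCR

end

noncomputable section

set_option synthInstance.maxHeartbeats 200000
set_option linter.unusedSectionVars false

namespace CoCR
-- The quaternionic structure on the total space of the kernel.
section KernelFrames

open Topology Filter

variable {B : Type*} [NormedAddCommGroup B] [NormedSpace ℝ B] [FiniteDimensional ℝ B]
  {M : Type*} [TopologicalSpace M] [T2Space M] [ChartedSpace B M] [IsManifold 𝓘(ℝ, B) ∞ M]
  {F : Type*} [NormedAddCommGroup F] [NormedSpace ℝ F] [FiniteDimensional ℝ F]
  {E : M → Type*} [TopologicalSpace (TotalSpace F E)]
  [∀ x, AddCommGroup (E x)] [∀ x, Module ℝ (E x)] [∀ x, TopologicalSpace (E x)]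
  [∀ x, IsTopologicalAddGroup (E x)] [∀ x, ContinuousSMul ℝ (E x)]
  [FiberBundle F E] [VectorBundle ℝ F E] [ContMDiffVectorBundle ∞ F E 𝓘(ℝ, B)]

/-- The field `g` of isomorphisms of the typical fibre is a closed frame for `∇` in the preferred
trivialization around `x₀`; it straightens `ρ` to the constant map `τ`. -/
structure IsClosedFrame (nabla : CovariantDerivative 𝓘(ℝ, B) F E)
    (ρ : ∀ x : M, E x →L[ℝ] TangentSpace 𝓘(ℝ, B) x) (x₀ : M) (O : Set B) (g : B → F →L[ℝ] F)
    (τ : F →L[ℝ] B) : Prop where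
  isOpen : IsOpen O
  contDiffOn : ContDiffOn ℝ ∞ g O
  isUnit : ∀ b ∈ O, IsUnit (g b)
  map_eq : ∀ b ∈ O, ∀ f, localMap ρ x₀ b (g b f) = τ f
  closed : ∀ b ∈ O, ∀ X Y, fderiv ℝ g b (τ X) Y + localConn nabla x₀ b (τ X) (g b Y)
    = fderiv ℝ g b (τ Y) X + localConn nabla x₀ b (τ Y) (g b X)

variable {N : Type*} [TopologicalSpace N] [ChartedSpace F N] [IsManifold 𝓘(ℝ, F) ∞ N]

variable (B E) in
/-- The map `ϖ`, defined on a manifold `N` covered by one chart, is written as `τ` in charts. -/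
structure IsKernelProjection (x₀ : M) (O : Set B) (τ : F →L[ℝ] B) (ϖ : N → M) : Prop where
  chartAt_eq : ∀ p q : N, chartAt F p = chartAt F q
  target : ∀ p : N, (extChartAt 𝓘(ℝ, F) p).target = τ ⁻¹' O
  mem_coordDomain : ∀ p, ϖ p ∈ coordDomain B F E x₀
  mem : ∀ p, extChartAt 𝓘(ℝ, B) x₀ (ϖ p) ∈ O
  map : ∀ p q : N, τ (extChartAt 𝓘(ℝ, F) p q) = extChartAt 𝓘(ℝ, B) x₀ (ϖ q)

variable {k : ℕ} {Q : QuaternionicStructure B F E k} {nabla : CovariantDerivative 𝓘(ℝ, B) F E}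
  {ρ : ∀ x : M, E x →L[ℝ] TangentSpace 𝓘(ℝ, B) x} {x₀ : M} {O : Set B} {g : B → F →L[ℝ] F}
  {τ : F →L[ℝ] B} {ϖ : N → M}

/-- The isomorphism from the typical fibre to the fibre given by a closed frame. -/
def IsClosedFrame.fibreEquiv (hg : IsClosedFrame nabla ρ x₀ O g τ) {x : M}
    (hx : x ∈ coordDomain B F E x₀) (hxO : extChartAt 𝓘(ℝ, B) x₀ x ∈ O) : F ≃L[ℝ] E x :=
  ContinuousLinearEquiv.equivOfInverse
    ((vecAt F E x₀ x).comp (g (extChartAt 𝓘(ℝ, B) x₀ x)))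
    ((Ring.inverse (g (extChartAt 𝓘(ℝ, B) x₀ x))).comp (coordAt F E x₀ x))
    (fun f => by
      rw [ContinuousLinearMap.comp_apply, ContinuousLinearMap.comp_apply, coordAt_vecAt hx.2,
        ringInverse_apply_apply (hg.isUnit _ hxO)])
    (fun v => by
      rw [ContinuousLinearMap.comp_apply, ContinuousLinearMap.comp_apply,
        apply_ringInverse_apply (hg.isUnit _ hxO), vecAt_coordAt hx.2])

/-- The isomorphism from the tangent space of `N` to the fibre of `E` given by a closed frame. -/
def tangentFibreEquiv (hg : IsClosedFrame nabla ρ x₀ O g τ)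
    (hϖ : IsKernelProjection B E x₀ O τ ϖ) (p : N) : TangentSpace 𝓘(ℝ, F) p ≃L[ℝ] E (ϖ p) :=
  hg.fibreEquiv (hϖ.mem_coordDomain p) (hϖ.mem p)

lemma coordAt_tangentFibreEquiv (hg : IsClosedFrame nabla ρ x₀ O g τ)
    (hϖ : IsKernelProjection B E x₀ O τ ϖ) (p : N) (f : F) :
    coordAt F E x₀ (ϖ p) (tangentFibreEquiv hg hϖ p f) = g (extChartAt 𝓘(ℝ, B) x₀ (ϖ p)) f :=
  coordAt_vecAt (hϖ.mem_coordDomain p).2 _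

lemma tangentFibreEquiv_symm_vecAt (hg : IsClosedFrame nabla ρ x₀ O g τ)
    (hϖ : IsKernelProjection B E x₀ O τ ϖ) (p : N) (v : E (ϖ p)) :
    ((tangentFibreEquiv hg hϖ p).symm v : F) =
      Ring.inverse (g (extChartAt 𝓘(ℝ, B) x₀ (ϖ p))) (coordAt F E x₀ (ϖ p) v) := rfl

lemma IsKernelProjection.eq_symm (hϖ : IsKernelProjection B E x₀ O τ ϖ) (p q : N) :
    ϖ q = (extChartAt 𝓘(ℝ, B) x₀).symm (τ (extChartAt 𝓘(ℝ, F) p q)) := by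
  rw [hϖ.map, (extChartAt 𝓘(ℝ, B) x₀).left_inv (hϖ.mem_coordDomain q).1]

lemma IsKernelProjection.contMDiff (hϖ : IsKernelProjection B E x₀ O τ ϖ) :
    ContMDiff 𝓘(ℝ, F) 𝓘(ℝ, B) ∞ ϖ := by
  intro p
  have h1 : ContMDiffAt 𝓘(ℝ, F) 𝓘(ℝ, B) ∞ (fun q => τ (extChartAt 𝓘(ℝ, F) p q)) p :=
    (τ.contDiff.contMDiff.contMDiffAt).comp p contMDiffAt_extChartAt
  have h2 : ContMDiffAt 𝓘(ℝ, B) 𝓘(ℝ, B) ∞ (extChartAt 𝓘(ℝ, B) x₀).symm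
      (τ (extChartAt 𝓘(ℝ, F) p p)) := by
    refine (contMDiffOn_extChartAt_symm x₀).contMDiffAt ((isOpen_extChartAt_target x₀).mem_nhds ?_)
    rw [hϖ.map]
    exact (extChartAt 𝓘(ℝ, B) x₀).map_source (hϖ.mem_coordDomain p).1
  exact (h2.comp p h1).congr_of_eventuallyEq (Eventually.of_forall fun q => hϖ.eq_symm p q)

/-- The frame of `TN` which corresponds to a local frame of `E`. -/
def kernelFrame (g : B → F →L[ℝ] F) (τ : F →L[ℝ] B) (u : ∀ x : M, HVec k ≃L[ℝ] E x) (x₀ : M)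
    (y : F) : HVec k →L[ℝ] F :=
  (Ring.inverse (g (τ y))).comp (localFrame u x₀ (τ y))

lemma trans_tangentFibreEquiv_symm (hg : IsClosedFrame nabla ρ x₀ O g τ)
    (hϖ : IsKernelProjection B E x₀ O τ ϖ) (u : ∀ x : M, HVec k ≃L[ℝ] E x) (p₀ p : N) (v : HVec k) :
    ((u (ϖ p)).trans (tangentFibreEquiv hg hϖ p).symm v : F) =
      kernelFrame g τ u x₀ (extChartAt 𝓘(ℝ, F) p₀ p) v := by
  have h1 : localFrame u x₀ (extChartAt 𝓘(ℝ, B) x₀ (ϖ p)) v = coordAt F E x₀ (ϖ p) (u (ϖ p) v) :=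
    localRep_extChartAt (hϖ.mem_coordDomain p).1 (fun x => u x v)
  refine (tangentFibreEquiv_symm_vecAt hg hϖ p _).trans ?_
  refine (congrArg (fun f => Ring.inverse (g (extChartAt 𝓘(ℝ, B) x₀ (ϖ p))) f) h1.symm).trans ?_
  exact congrArg (fun b => Ring.inverse (g b) (localFrame u x₀ b v)) (hϖ.map p₀ p).symm

lemma contDiffOn_kernelFrame (hg : IsClosedFrame nabla ρ x₀ O g τ) {u : ∀ x : M, HVec k ≃L[ℝ] E x}
    {U : Set M} (hU : IsOpen U) (hUd : U ⊆ coordDomain B F E x₀)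
    (hu : ∀ q, IsSmoothSectionOn B F (fun x => u x q) U) :
    ContDiffOn ℝ ∞ (kernelFrame (B := B) (F := F) g τ u x₀) (τ ⁻¹' (O ∩ chartImage x₀ U)) :=
  ((contDiffOn_ringInverse hg.contDiffOn hg.isUnit).comp τ.contDiff.contDiffOn
    fun _ hy => hy.1).clm_comp ((contDiffOn_localFrame hU hUd hu).comp τ.contDiff.contDiffOn
      fun _ hy => hy.2)

/-- The almost quaternionic structure induced on `N`. -/
def kernelStructure (Q : QuaternionicStructure B F E k) (hg : IsClosedFrame nabla ρ x₀ O g τ)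
    (hϖ : IsKernelProjection B E x₀ O τ ϖ) : AlmostQuaternionicStructure F N k where
  frames p := {v | v.trans (tangentFibreEquiv hg hϖ p) ∈ Q.frames (ϖ p)}
  mem_frames_iff p u hu v := by
    refine (Q.mem_frames_iff (ϖ p) _ hu _).trans (exists_congr fun a => and_congr_right fun _ => ?_)
    refine ⟨fun h => ?_, fun h => by rw [h]; rfl⟩
    exact ContinuousLinearEquiv.ext (funext fun q =>
      (tangentFibreEquiv hg hϖ p).injective (DFunLike.congr_fun h q))
  exists_local p₀ := by
    obtain ⟨U₁, hU₁, hp₁, u, hu, huQ⟩ := Q.exists_local (ϖ p₀)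
    set U := U₁ ∩ coordDomain B F E x₀ with hU
    have hUo : IsOpen U := hU₁.inter (isOpen_coordDomain x₀)
    refine ⟨ϖ ⁻¹' U, hUo.preimage hϖ.contMDiff.continuous, ⟨hp₁, hϖ.mem_coordDomain p₀⟩,
      fun p => (u (ϖ p)).trans (tangentFibreEquiv hg hϖ p).symm, fun q => ?_, fun p hp => ?_⟩
    · rw [isSmoothSectionOn_tangent_iff hϖ.chartAt_eq p₀]
      have h1 := (contDiffOn_kernelFrame (τ := τ) hg hUo inter_subset_right
        fun q => (hu q).mono inter_subset_left).clm_apply (contDiffOn_const (c := q))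
      have hr : ∀ y ∈ (extChartAt 𝓘(ℝ, F) p₀).target,
        extChartAt 𝓘(ℝ, F) p₀ ((extChartAt 𝓘(ℝ, F) p₀).symm y) = y := fun y hy =>
          (extChartAt 𝓘(ℝ, F) p₀).right_inv hy
      refine (h1.mono fun y hy => ?_).congr fun y hy => ?_
      · have h2 := hϖ.mem ((extChartAt 𝓘(ℝ, F) p₀).symm y)
        have h3 := extChartAt_mem_chartImage (B := B) (U := U)
          (hϖ.mem_coordDomain ((extChartAt 𝓘(ℝ, F) p₀).symm y)).1 hy.2
        rw [← hϖ.map p₀, hr y hy.1] at h2 h3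
        exact ⟨h2, h3⟩
      · refine (trans_tangentFibreEquiv_symm hg hϖ u p₀ _ q).trans ?_
        rw [hr y hy.1]
    · have h1 : ((u (ϖ p)).trans (tangentFibreEquiv hg hϖ p).symm).trans
          (tangentFibreEquiv hg hϖ p) = u (ϖ p) := 
        ContinuousLinearEquiv.ext (funext fun q => (tangentFibreEquiv hg hϖ p).apply_symm_apply _)
      rw [mem_ofPred_eq, h1]
      exact huQ _ hp.1

/-- A single admissible frame of `E` over the domain, transported by `g⁻¹`, is a global admissible
frame of `TN`, so the results on quaternionic frames in one chart apply. -/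
theorem isQuaternionic_kernelStructure (hsmooth : CovariantDerivative.ContMDiffCovariantDerivative nabla ∞)
    (hcompatible : Q.IsCompatible nabla) (hk : 2 ≤ k) (hg : IsClosedFrame nabla ρ x₀ O g τ)
    (hϖ : IsKernelProjection B E x₀ O τ ϖ) {U : Set M} (hU : IsOpen U)
    (hUd : U ⊆ coordDomain B F E x₀) (hO : O ⊆ chartImage x₀ U) {u : ∀ x : M, HVec k ≃L[ℝ] E x}
    (hu : ∀ q, IsSmoothSectionOn B F (fun x => u x q) U) (huQ : ∀ x ∈ U, u x ∈ Q.frames x) (p₀ : N) :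
    IsQuaternionic (kernelStructure Q hg hϖ)
      (chartConnection hϖ.chartAt_eq (inducedConn (localConn nabla x₀) g τ)) := by
  have hd : ∀ b ∈ O, b ∈ chartImage x₀ (coordDomain B F E x₀) := fun b hb =>
    ⟨(hO hb).1, hUd (hO hb).2⟩
  have hh := (contDiffOn_localFrame hU hUd hu).mono hO
  have hl : ∀ b ∈ O, ∀ v, localFrameInv (F := F) u x₀ b (localFrame u x₀ b v) = v := fun b hb v =>
    localFrameInv_localFrame u (hd b hb) v
  have hr : ∀ b ∈ O, ∀ f, localFrame (F := F) u x₀ b (localFrameInv u x₀ b f) = f := fun b hb v =>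
    localFrame_localFrameInv u (hd b hb) v
  have H := isQuaternionicFrame_inducedConn hg.isOpen ((contDiffOn_localConn hsmooth x₀).mono hd)
    hg.contDiffOn hg.isUnit hg.closed hh (contDiffOn_inverse hg.isOpen hh hl hr) hl hr
    fun b hb X => localConnForm_mem hcompatible hU hUd hu huQ (hO hb) X
  rw [← hϖ.target p₀] at H
  refine isQuaternionic_chartConnection (p₀ := p₀) hϖ.chartAt_eq hk H fun p =>
    ⟨(u (ϖ p)).trans (tangentFibreEquiv hg hϖ p).symm, ?_,
      fun v => trans_tangentFibreEquiv_symm hg hϖ u p₀ p v⟩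
  have h1 : ((u (ϖ p)).trans (tangentFibreEquiv hg hϖ p).symm).trans
      (tangentFibreEquiv hg hϖ p) = u (ϖ p) := 
    ContinuousLinearEquiv.ext (funext fun q => (tangentFibreEquiv hg hϖ p).apply_symm_apply _)
  change _ ∈ Q.frames (ϖ p)
  rw [h1]
  have h2 := (hO (hϖ.mem p)).2
  rw [mem_preimage, (extChartAt 𝓘(ℝ, B) x₀).left_inv (hϖ.mem_coordDomain p).1] at h2
  exact huQ _ h2

end KernelFrames

end CoCR

end

noncomputable section

set_option synthInstance.maxHeartbeats 200000
set_option linter.unusedSectionVars false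

namespace CoCR
-- The projection is twistorial.
section TwistorMap

open Topology Filter

variable {B : Type*} [NormedAddCommGroup B] [NormedSpace ℝ B] [FiniteDimensional ℝ B]
  {M : Type*} [TopologicalSpace M] [T2Space M] [ChartedSpace B M] [IsManifold 𝓘(ℝ, B) ∞ M]
  {F : Type*} [NormedAddCommGroup F] [NormedSpace ℝ F] [FiniteDimensional ℝ F]
  {E : M → Type*} [TopologicalSpace (TotalSpace F E)]
  [∀ x, AddCommGroup (E x)] [∀ x, Module ℝ (E x)] [∀ x, TopologicalSpace (E x)]
  [∀ x, IsTopologicalAddGroup (E x)] [∀ x, ContinuousSMul ℝ (E x)]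
  [FiberBundle F E] [VectorBundle ℝ F E] [ContMDiffVectorBundle ∞ F E 𝓘(ℝ, B)]

variable {N : Type*} [TopologicalSpace N] [ChartedSpace F N] [IsManifold 𝓘(ℝ, F) ∞ N]
  {k : ℕ} {Q : QuaternionicStructure B F E k} {nabla : CovariantDerivative 𝓘(ℝ, B) F E}
  {ρ : ∀ x : M, E x →L[ℝ] TangentSpace 𝓘(ℝ, B) x} {x₀ : M} {O : Set B} {g : B → F →L[ℝ] F}
  {τ : F →L[ℝ] B} {ϖ : N → M}

/-- The map between the bundles of endomorphisms given by a closed frame. -/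
def kernelEndMap (hg : IsClosedFrame nabla ρ x₀ O g τ) (hϖ : IsKernelProjection B E x₀ O τ ϖ)
    (w : EndTotal F (fun p : N => TangentSpace 𝓘(ℝ, F) p)) : EndTotal F E :=
  ⟨ϖ w.proj, (tangentFibreEquiv hg hϖ w.proj : TangentSpace 𝓘(ℝ, F) w.proj →L[ℝ] E (ϖ w.proj)).comp
    (w.2.comp ((tangentFibreEquiv hg hϖ w.proj).symm :
      E (ϖ w.proj) →L[ℝ] TangentSpace 𝓘(ℝ, F) w.proj))⟩

lemma kernelEndMap_apply (hg : IsClosedFrame nabla ρ x₀ O g τ)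
    (hϖ : IsKernelProjection B E x₀ O τ ϖ)
    (w : EndTotal F (fun p : N => TangentSpace 𝓘(ℝ, F) p)) (v : TangentSpace 𝓘(ℝ, F) w.proj) :
    (kernelEndMap hg hϖ w).2 (tangentFibreEquiv hg hϖ w.proj v) =
      tangentFibreEquiv hg hϖ w.proj (w.2 v) :=
  congrArg (fun z => tangentFibreEquiv hg hϖ w.proj (w.2 z))
    ((tangentFibreEquiv hg hϖ w.proj).symm_apply_apply v)

lemma endCoord_kernelEndMap (hg : IsClosedFrame nabla ρ x₀ O g τ)
    (hϖ : IsKernelProjection B E x₀ O τ ϖ)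
    (w₀ w : EndTotal F (fun p : N => TangentSpace 𝓘(ℝ, F) p)) :
    endCoord x₀ (kernelEndMap hg hϖ w) = (g (τ (extChartAt (endModel F F) w₀ w).1)).comp
      ((extChartAt (endModel F F) w₀ w).2.comp
        (Ring.inverse (g (τ (extChartAt (endModel F F) w₀ w).1)))) := by
  rw [extChartAt_endTotal_apply hϖ.chartAt_eq w.proj, hϖ.map]
  ext f
  refine (coordAt_tangentFibreEquiv hg hϖ w.proj _).trans ?_
  have h1 : coordAt F E x₀ (ϖ w.proj) (vecAt F E x₀ (ϖ w.proj) f) = f :=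
    coordAt_vecAt (hϖ.mem_coordDomain w.proj).2 f
  exact congrArg (fun z => g (extChartAt 𝓘(ℝ, B) x₀ (ϖ w.proj)) (modelEnd w.2
    (Ring.inverse (g (extChartAt 𝓘(ℝ, B) x₀ (ϖ w.proj))) z))) h1

/-- The derivative of `g J g⁻¹` is evaluated on a vector `g v`, so that the derivative of `g⁻¹` can
be expressed through that of `g`. -/
lemma hasMFDerivAt_endCoord_kernelEndMap (hg : IsClosedFrame nabla ρ x₀ O g τ)
    (hϖ : IsKernelProjection B E x₀ O τ ϖ)
    (w₀ w : EndTotal F (fun p : N => TangentSpace 𝓘(ℝ, F) p)) :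
    ∃ T : TangentSpace (endModel F F) w →L[ℝ] F →L[ℝ] F,
      HasMFDerivAt (endModel F F) 𝓘(ℝ, F →L[ℝ] F)
        (fun w' => endCoord x₀ (kernelEndMap hg hϖ w')) w T ∧
      ∀ (ξ : F × (F →L[ℝ] F)) (v : F), T ξ (g (τ (extChartAt (endModel F F) w₀ w).1) v) =
        fderiv ℝ g (τ (extChartAt (endModel F F) w₀ w).1) (τ ξ.1)
          ((extChartAt (endModel F F) w₀ w).2 v)
        + g (τ (extChartAt (endModel F F) w₀ w).1) (ξ.2 v)
        - g (τ (extChartAt (endModel F F) w₀ w).1) ((extChartAt (endModel F F) w₀ w).2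
          (Ring.inverse (g (τ (extChartAt (endModel F F) w₀ w).1))
            (fderiv ℝ g (τ (extChartAt (endModel F F) w₀ w).1) (τ ξ.1) v))) := by
  have h0 := hasMFDerivAt_extChartAt_of_chartAt_eq (endModel F F)
    (chartAt_endTotal_eq hϖ.chartAt_eq) w₀ w
  have ha : HasMFDerivAt (endModel F F) 𝓘(ℝ, B) (fun w' => τ (extChartAt (endModel F F) w₀ w').1) w
      (τ.comp (ContinuousLinearMap.fst ℝ F (F →L[ℝ] F))) :=
    ((τ.comp (ContinuousLinearMap.fst ℝ F (F →L[ℝ] F))).hasMFDerivAt).comp w h0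
  have hm : HasMFDerivAt (endModel F F) 𝓘(ℝ, F →L[ℝ] F)
      (fun w' => (extChartAt (endModel F F) w₀ w').2) w (ContinuousLinearMap.snd ℝ F (F →L[ℝ] F)) :=
    ((ContinuousLinearMap.snd ℝ F (F →L[ℝ] F)).hasMFDerivAt).comp w h0
  have hb : τ (extChartAt (endModel F F) w₀ w).1 ∈ O := by
    rw [extChartAt_endTotal_apply hϖ.chartAt_eq w.proj, hϖ.map]
    exact hϖ.mem _
  have hgd := hg.contDiffOn.hasFDerivAt_of_isOpen hg.isOpen hb
  have hgi := (contDiffOn_ringInverse hg.contDiffOn hg.isUnit).hasFDerivAt_of_isOpen hg.isOpen hb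
  obtain ⟨T, hT, hT'⟩ := hasMFDerivAt_conj ha hm hgd hgi
  refine ⟨T, hT.congr_of_eventuallyEq
    (Eventually.of_forall fun w' => endCoord_kernelEndMap hg hϖ w₀ w'), fun ξ v => ?_⟩
  have h3 := fderiv_inverse_apply hg.isOpen
    (fun b hb v => ringInverse_apply_apply (hg.isUnit b hb) v) hb hgd hgi (τ ξ.1) v
  refine (hT' ξ _).trans ?_
  rw [ringInverse_apply_apply (hg.isUnit _ hb)]
  refine (congrArg (fun z => fderiv ℝ g (τ (extChartAt (endModel F F) w₀ w).1) (τ ξ.1)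
    ((extChartAt (endModel F F) w₀ w).2 v) + g (τ (extChartAt (endModel F F) w₀ w).1) (ξ.2 v)
    + g (τ (extChartAt (endModel F F) w₀ w).1) ((extChartAt (endModel F F) w₀ w).2 z)) h3).trans ?_
  rw [map_neg, map_neg, sub_eq_add_neg]

lemma contMDiffAt_kernelEndMap (hg : IsClosedFrame nabla ρ x₀ O g τ)
    (hϖ : IsKernelProjection B E x₀ O τ ϖ)
    (w : EndTotal F (fun p : N => TangentSpace 𝓘(ℝ, F) p)) :
    ContMDiffAt (endModel F F) (endModel B F) ∞ (kernelEndMap hg hϖ) w := by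
  have hs : kernelEndMap hg hϖ w ∈
      (trivializationAt (F →L[ℝ] F) (fun x : M => E x →L[ℝ] E x) x₀).source := by
    rw [Trivialization.mem_source, hom_trivializationAt_baseSet]
    exact ⟨(hϖ.mem_coordDomain w.proj).2, (hϖ.mem_coordDomain w.proj).2⟩
  refine (Trivialization.contMDiffAt_iff (IB := 𝓘(ℝ, B)) (n := ∞) hs).2 ⟨?_, ?_⟩
  · exact (hϖ.contMDiff w.proj).comp w (contMDiffAt_proj _)
  · change ContMDiffAt (endModel F F) 𝓘(ℝ, F →L[ℝ] F) ∞
      (fun w' => endCoord x₀ (kernelEndMap hg hϖ w')) w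
    have h0 := contMDiffAt_extChartAt_of_chartAt_eq (I := endModel F F)
      (chartAt_endTotal_eq hϖ.chartAt_eq) w w
    have hb : τ (extChartAt (endModel F F) w w).1 ∈ O := by
      rw [extChartAt_endTotal_apply hϖ.chartAt_eq w.proj, hϖ.map]
      exact hϖ.mem _
    have hV : IsOpen ((fun y : F × (F →L[ℝ] F) => τ y.1) ⁻¹' O) :=
      hg.isOpen.preimage (τ.continuous.comp continuous_fst)
    have hτ : ContDiffOn ℝ ∞ (fun y : F × (F →L[ℝ] F) => τ y.1)
      ((fun y : F × (F →L[ℝ] F) => τ y.1) ⁻¹' O) := (τ.contDiff.comp contDiff_fst).contDiffOn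
    have h1 : ContDiffOn ℝ ∞ (fun y : F × (F →L[ℝ] F) =>
        (g (τ y.1)).comp (y.2.comp (Ring.inverse (g (τ y.1)))))
        ((fun y : F × (F →L[ℝ] F) => τ y.1) ⁻¹' O) :=
      (hg.contDiffOn.comp hτ fun _ hy => hy).clm_comp (contDiffOn_snd.clm_comp
        ((contDiffOn_ringInverse hg.contDiffOn hg.isUnit).comp hτ fun _ hy => hy))
    refine (((h1.contDiffAt (hV.mem_nhds hb)).contMDiffAt).comp w h0).congr_of_eventuallyEq
      (Eventually.of_forall fun w' => endCoord_kernelEndMap hg hϖ w w')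

lemma coordAt_dproj_kernelEndMap (hg : IsClosedFrame nabla ρ x₀ O g τ)
    (hϖ : IsKernelProjection B E x₀ O τ ϖ)
    (w : EndTotal F (fun p : N => TangentSpace 𝓘(ℝ, F) p)) (ξ : TangentSpace (endModel F F) w) :
    coordAt B (TangentSpace 𝓘(ℝ, B) : M → Type _) x₀ (ϖ w.proj) (dproj (kernelEndMap hg hϖ w)
      (mfderiv (endModel F F) (endModel B F) (kernelEndMap hg hϖ) w ξ)) =
        τ (show F × (F →L[ℝ] F) from ξ).1 := by
  have hΦ := ((contMDiffAt_kernelEndMap hg hϖ w).mdifferentiableAt (by simp)).hasMFDerivAt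
  obtain ⟨a', ha, ha'⟩ := hasMFDerivAt_extChartAt_proj (w := kernelEndMap hg hϖ w)
    (hϖ.mem_coordDomain w.proj).1
  have h0 := hasMFDerivAt_extChartAt_of_chartAt_eq (endModel F F)
    (chartAt_endTotal_eq hϖ.chartAt_eq) w w
  have h1 : HasMFDerivAt (endModel F F) 𝓘(ℝ, B) (fun w' => τ (extChartAt (endModel F F) w w').1) w
      (τ.comp (ContinuousLinearMap.fst ℝ F (F →L[ℝ] F))) :=
    ((τ.comp (ContinuousLinearMap.fst ℝ F (F →L[ℝ] F))).hasMFDerivAt).comp w h0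
  have h2 : (fun w' : EndTotal F (fun p : N => TangentSpace 𝓘(ℝ, F) p) =>
      τ (extChartAt (endModel F F) w w').1) =
      fun w' => extChartAt 𝓘(ℝ, B) x₀ (kernelEndMap hg hϖ w').proj := funext fun w' => by
    rw [extChartAt_endTotal_apply hϖ.chartAt_eq w.proj, hϖ.map]
    rfl
  rw [h2] at h1
  exact (ha' _).symm.trans (DFunLike.congr_fun (hasMFDerivAt_unique (ha.comp w hΦ) h1) ξ)

/-- In charts the projection is `τ`, and `τ` is the local form of `ρ` composed with `g`: under the
identification of `TN` with the pull-back of `E`, the differential of the projection is `ρ`. -/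
lemma dproj_kernelEndMap (hg : IsClosedFrame nabla ρ x₀ O g τ)
    (hϖ : IsKernelProjection B E x₀ O τ ϖ)
    (w : EndTotal F (fun p : N => TangentSpace 𝓘(ℝ, F) p)) (ξ : TangentSpace (endModel F F) w) :
    dproj (kernelEndMap hg hϖ w)
      (mfderiv (endModel F F) (endModel B F) (kernelEndMap hg hϖ) w ξ) =
        ρ (ϖ w.proj) (tangentFibreEquiv hg hϖ w.proj (dproj w ξ)) := by
  have hx := hϖ.mem_coordDomain w.proj
  have hb := mem_baseSet_tangent hx.1
  have h1 := coordAt_dproj_kernelEndMap hg hϖ w ξ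
  have h2 : coordAt B (TangentSpace 𝓘(ℝ, B) : M → Type _) x₀ (ϖ w.proj)
      (ρ (ϖ w.proj) (tangentFibreEquiv hg hϖ w.proj (dproj w ξ))) =
        τ (show F × (F →L[ℝ] F) from ξ).1 := by
    rw [← localMap_coordAt ρ hx]
    refine (congrArg _ (coordAt_tangentFibreEquiv hg hϖ w.proj _)).trans ?_
    refine (hg.map_eq _ (hϖ.mem w.proj) _).trans ?_
    exact congrArg τ (dproj_tangent hϖ.chartAt_eq w ξ)
  have h3 := congrArg (vecAt B (TangentSpace 𝓘(ℝ, B) : M → Type _) x₀ (ϖ w.proj)) (h1.trans h2.symm)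
  exact (vecAt_coordAt hb _).symm.trans (h3.trans (vecAt_coordAt hb _))

/-- The connection on `N` is the pull-back of `∇`, so conjugation by the fibre isomorphism
intertwines the covariant derivatives of endomorphisms. -/
lemma connectionMap_kernelEndMap (hg : IsClosedFrame nabla ρ x₀ O g τ)
    (hϖ : IsKernelProjection B E x₀ O τ ϖ)
    (w : EndTotal F (fun p : N => TangentSpace 𝓘(ℝ, F) p)) (ξ : TangentSpace (endModel F F) w)
    (v : TangentSpace 𝓘(ℝ, F) w.proj) :
    connectionMap nabla (kernelEndMap hg hϖ w)
      (mfderiv (endModel F F) (endModel B F) (kernelEndMap hg hϖ) w ξ)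
        (tangentFibreEquiv hg hϖ w.proj v) = tangentFibreEquiv hg hϖ w.proj
          (connectionMap (chartConnection hϖ.chartAt_eq (inducedConn (localConn nabla x₀) g τ))
            w ξ v) := by
  have hx := hϖ.mem_coordDomain w.proj
  have hbO := hϖ.mem w.proj
  have hΦ := ((contMDiffAt_kernelEndMap hg hϖ w).mdifferentiableAt (by simp)).hasMFDerivAt
  obtain ⟨P, hP⟩ : ∃ P : TangentSpace (endModel B F) (kernelEndMap hg hϖ w) →L[ℝ] F →L[ℝ] F,
      HasMFDerivAt (endModel B F) 𝓘(ℝ, F →L[ℝ] F) (endCoord x₀) (kernelEndMap hg hϖ w) P :=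
    ⟨_, ((contMDiffAt_endCoord (B := B) (w := kernelEndMap hg hϖ w) hx.2).mdifferentiableAt
      (by simp)).hasMFDerivAt⟩
  obtain ⟨T, hT, hT'⟩ := hasMFDerivAt_endCoord_kernelEndMap hg hϖ w w
  have hPT : ∀ f : F, P (mfderiv (endModel F F) (endModel B F) (kernelEndMap hg hϖ) w ξ) f = T ξ f :=
    fun f => congrArg (fun L : F →L[ℝ] F => L f)
      (DFunLike.congr_fun (hasMFDerivAt_unique (hP.comp w hΦ) hT) ξ)
  have h1 := coordAt_connectionMap nabla (w := kernelEndMap hg hϖ w) hx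
    (mfderiv (endModel F F) (endModel B F) (kernelEndMap hg hϖ) w ξ)
    (tangentFibreEquiv hg hϖ w.proj v) hP
  have h2 := coordAt_tangentFibreEquiv hg hϖ w.proj v
  have h3 := coordAt_dproj_kernelEndMap hg hϖ w ξ
  have h4 := connectionMap_chartConnection hϖ.chartAt_eq
    (inducedConn (localConn nabla x₀) g τ) w w ξ v
  have h5 := coordAt_tangentFibreEquiv hg hϖ w.proj
    (connectionMap (chartConnection hϖ.chartAt_eq (inducedConn (localConn nabla x₀) g τ)) w ξ v)
  have h6 := endCoord_kernelEndMap hg hϖ w w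
  have hy : τ (extChartAt (endModel F F) w w).1 = extChartAt 𝓘(ℝ, B) x₀ (ϖ w.proj) := by
    rw [extChartAt_endTotal_apply hϖ.chartAt_eq w.proj, hϖ.map]
  have h7 : ∀ (f f' : F) (X X' : B) (L L' : F →L[ℝ] F), f = f' → X = X' → L = L' →
      P (mfderiv (endModel F F) (endModel B F) (kernelEndMap hg hϖ) w ξ) f
        + localConn nabla x₀ (extChartAt 𝓘(ℝ, B) x₀ (ϖ w.proj)) X (L f)
        - L (localConn nabla x₀ (extChartAt 𝓘(ℝ, B) x₀ (ϖ w.proj)) X f) =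
      T ξ f' + localConn nabla x₀ (extChartAt 𝓘(ℝ, B) x₀ (ϖ w.proj)) X' (L' f')
        - L' (localConn nabla x₀ (extChartAt 𝓘(ℝ, B) x₀ (ϖ w.proj)) X' f') := by
    rintro f _ X _ L _ rfl rfl rfl
    rw [hPT]
  have h8 := h1.trans (h7 _ _ _ _ _ _ h2 h3 h6)
  -- The gauge identity behind the statement: the derivatives of `g` in `d(g J g⁻¹)` are the
  -- inhomogeneous terms of the induced connection.
  have h9 : ∀ (ξ : F × (F →L[ℝ] F)) (v : F), T ξ (g (extChartAt 𝓘(ℝ, B) x₀ (ϖ w.proj)) v)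
      + localConn nabla x₀ (extChartAt 𝓘(ℝ, B) x₀ (ϖ w.proj)) (τ ξ.1)
        (((g (τ (extChartAt (endModel F F) w w).1)).comp
          ((extChartAt (endModel F F) w w).2.comp
          (Ring.inverse (g (τ (extChartAt (endModel F F) w w).1)))))
          (g (extChartAt 𝓘(ℝ, B) x₀ (ϖ w.proj)) v))
      - ((g (τ (extChartAt (endModel F F) w w).1)).comp
          ((extChartAt (endModel F F) w w).2.comp
          (Ring.inverse (g (τ (extChartAt (endModel F F) w w).1)))))
        (localConn nabla x₀ (extChartAt 𝓘(ℝ, B) x₀ (ϖ w.proj)) (τ ξ.1)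
          (g (extChartAt 𝓘(ℝ, B) x₀ (ϖ w.proj)) v)) =
      g (extChartAt 𝓘(ℝ, B) x₀ (ϖ w.proj)) (vertPart (inducedConn (localConn nabla x₀) g τ)
        (extChartAt (endModel F F) w w) ξ v) := by
    intro ξ v
    have hT2 := hT' ξ v
    have hu := hg.isUnit _ hbO
    rw [← hy] at hu ⊢
    rw [hT2, vertPart_apply, inducedConn_apply, inducedConn_apply]
    simp only [ContinuousLinearMap.comp_apply, ringInverse_apply_apply hu, map_add, map_sub,
      apply_ringInverse_apply hu]
    abel
  have h10 := (h8.trans (h9 ξ v)).trans ((congrArg (fun f => g (extChartAt 𝓘(ℝ, B) x₀ (ϖ w.proj)) f)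
    h4.symm).trans h5.symm)
  have h11 := congrArg (vecAt F E x₀ (ϖ w.proj)) h10
  exact (vecAt_coordAt hx.2 _).symm.trans (h11.trans (vecAt_coordAt hx.2 _))

lemma conj_mem_span_admissible (hg : IsClosedFrame nabla ρ x₀ O g τ)
    (hϖ : IsKernelProjection B E x₀ O τ ϖ) {p : N} (hne : (Q.frames (ϖ p)).Nonempty)
    {A : TangentSpace 𝓘(ℝ, F) p →L[ℝ] TangentSpace 𝓘(ℝ, F) p}
    (hA : A ∈ Submodule.span ℝ ((kernelStructure Q hg hϖ).admissible p)) :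
    (tangentFibreEquiv hg hϖ p : TangentSpace 𝓘(ℝ, F) p →L[ℝ] E (ϖ p)).comp
      (A.comp ((tangentFibreEquiv hg hϖ p).symm : E (ϖ p) →L[ℝ] TangentSpace 𝓘(ℝ, F) p)) ∈
        Submodule.span ℝ (Q.admissible (ϖ p)) := by
  obtain ⟨u, hu⟩ := hne
  have h1 : (u.trans (tangentFibreEquiv hg hϖ p).symm).trans (tangentFibreEquiv hg hϖ p) = u :=
    ContinuousLinearEquiv.ext (funext fun q => (tangentFibreEquiv hg hϖ p).apply_symm_apply _)
  have hu' : u.trans (tangentFibreEquiv hg hϖ p).symm ∈ (kernelStructure Q hg hϖ).frames p := by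
    change _ ∈ Q.frames (ϖ p)
    rwa [h1]
  obtain ⟨i, hi, h⟩ := ((kernelStructure Q hg hϖ).mem_span_admissible_iff hu').1 hA
  refine (Q.mem_span_admissible_iff hu).2 ⟨i, hi, fun q => ?_⟩
  exact (congrArg (tangentFibreEquiv hg hϖ p) (h q)).trans
    ((tangentFibreEquiv hg hϖ p).apply_symm_apply _)

lemma kernelEndMap_mem_twistorBundle (hg : IsClosedFrame nabla ρ x₀ O g τ)
    (hϖ : IsKernelProjection B E x₀ O τ ϖ)
    {w : EndTotal F (fun p : N => TangentSpace 𝓘(ℝ, F) p)}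
    (hw : w ∈ (kernelStructure Q hg hϖ).twistorBundle) : kernelEndMap hg hϖ w ∈ Q.twistorBundle := by
  obtain ⟨u, hu, i, hi, hn, h⟩ := hw
  refine ⟨u.trans (tangentFibreEquiv hg hϖ w.proj), hu, i, hi, hn, fun q => ?_⟩
  exact (kernelEndMap_apply hg hϖ w (u q)).trans (congrArg (tangentFibreEquiv hg hϖ w.proj) (h q))

lemma conj_mem_verticalTangent (hg : IsClosedFrame nabla ρ x₀ O g τ)
    (hϖ : IsKernelProjection B E x₀ O τ ϖ)
    (w : EndTotal F (fun p : N => TangentSpace 𝓘(ℝ, F) p)) (hne : (Q.frames (ϖ w.proj)).Nonempty)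
    {A : TangentSpace 𝓘(ℝ, F) w.proj →L[ℝ] TangentSpace 𝓘(ℝ, F) w.proj}
    (hA : A ∈ (kernelStructure Q hg hϖ).verticalTangent w.proj w.2) :
    (kernelEndMap hg hϖ (⟨w.proj, A⟩ : EndTotal F (fun p : N => TangentSpace 𝓘(ℝ, F) p))).2 ∈
      Q.verticalTangent (ϖ w.proj) (kernelEndMap hg hϖ w).2 := by
  refine ⟨conj_mem_span_admissible hg hϖ hne hA.1, ?_⟩
  ext e
  obtain ⟨v, rfl⟩ := (tangentFibreEquiv hg hϖ w.proj).surjective e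
  have h1 := kernelEndMap_apply hg hϖ ⟨w.proj, A⟩
  have h2 := kernelEndMap_apply hg hϖ w
  have h3 := DFunLike.congr_fun hA.2 v
  refine (congrArg (kernelEndMap hg hϖ (⟨w.proj, A⟩ :
    EndTotal F (fun p : N => TangentSpace 𝓘(ℝ, F) p))).2 (h2 v)).trans ?_
  refine (h1 (w.2 v)).trans ?_
  refine (congrArg (tangentFibreEquiv hg hϖ w.proj) h3).trans ?_
  refine (map_neg (tangentFibreEquiv hg hϖ w.proj) _).trans ?_
  refine congrArg Neg.neg ?_
  exact ((congrArg (kernelEndMap hg hϖ w).2 (h1 v)).trans (h2 (A v))).symm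

/-- The covering map is conjugation by the fibre isomorphisms. These are compatible with the frames
by definition, so vertical vectors of type `(0,1)` are preserved, and they carry the `-i` eigenspace
of `J` to that of its image. -/
theorem isTwistorial_kernelStructure (Q : QuaternionicStructure B F E k)
    (hg : IsClosedFrame nabla ρ x₀ O g τ) (hϖ : IsKernelProjection B E x₀ O τ ϖ) :
    IsTwistorial (kernelStructure Q hg hϖ) (idTangent F N)
      (chartConnection hϖ.chartAt_eq (inducedConn (localConn nabla x₀) g τ)) Q ρ nabla ϖ := by
  refine ⟨hϖ.contMDiff, kernelEndMap hg hϖ, fun w _ => contMDiffAt_kernelEndMap hg hϖ w,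
    fun w hw => ⟨kernelEndMap_mem_twistorBundle hg hϖ hw, rfl⟩, ?_⟩
  rintro w hw ξ η ⟨⟨A₁, A₂, ⟨hA₁, hA₂, hJ₁, hJ₂⟩, hξ, hη⟩, e₁, e₂, he₁, he₂, hξe, hηe⟩
  have hne : (Q.frames (ϖ w.proj)).Nonempty := by
    obtain ⟨U, -, hU, u, -, h⟩ := Q.exists_local (ϖ w.proj)
    exact ⟨_, h _ hU⟩
  have hc : ∀ (A : TangentSpace 𝓘(ℝ, F) w.proj →L[ℝ] TangentSpace 𝓘(ℝ, F) w.proj)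
      (ξ : TangentSpace (endModel F F) w), (∀ v, connectionMap
        (chartConnection hϖ.chartAt_eq (inducedConn (localConn nabla x₀) g τ)) w ξ v = A v) →
      ∀ v, connectionMap nabla (kernelEndMap hg hϖ w)
        (mfderiv (endModel F F) (endModel B F) (kernelEndMap hg hϖ) w ξ) v =
      (kernelEndMap hg hϖ (⟨w.proj, A⟩ : EndTotal F (fun p : N => TangentSpace 𝓘(ℝ, F) p))).2 v := by
    intro A ξ h v
    obtain ⟨v, rfl⟩ := (tangentFibreEquiv hg hϖ w.proj).surjective v
    exact (connectionMap_kernelEndMap hg hϖ w ξ v).trans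
      ((congrArg (tangentFibreEquiv hg hϖ w.proj) (h v)).trans
        (kernelEndMap_apply hg hϖ ⟨w.proj, A⟩ v).symm)
  have hcomp : ∀ A A' : TangentSpace 𝓘(ℝ, F) w.proj →L[ℝ] TangentSpace 𝓘(ℝ, F) w.proj,
      w.2 ∘L A = A' → (kernelEndMap hg hϖ w).2 ∘L
        (kernelEndMap hg hϖ (⟨w.proj, A⟩ : EndTotal F (fun p : N => TangentSpace 𝓘(ℝ, F) p))).2 =
        (kernelEndMap hg hϖ (⟨w.proj, A'⟩ : EndTotal F (fun p : N => TangentSpace 𝓘(ℝ, F) p))).2 := by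
    rintro A _ rfl
    ext v
    exact congrArg (fun z => tangentFibreEquiv hg hϖ w.proj (w.2 z))
      ((tangentFibreEquiv hg hϖ w.proj).symm_apply_apply _)
  have hneg : (kernelEndMap hg hϖ (⟨w.proj, -A₁⟩ :
      EndTotal F (fun p : N => TangentSpace 𝓘(ℝ, F) p))).2 =
      -(kernelEndMap hg hϖ (⟨w.proj, A₁⟩ : EndTotal F (fun p : N => TangentSpace 𝓘(ℝ, F) p))).2 := by
    ext v
    exact map_neg (tangentFibreEquiv hg hϖ w.proj) _
  refine ⟨⟨(kernelEndMap hg hϖ ⟨w.proj, A₁⟩).2, (kernelEndMap hg hϖ ⟨w.proj, A₂⟩).2,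
    ⟨conj_mem_verticalTangent hg hϖ w hne hA₁, conj_mem_verticalTangent hg hϖ w hne hA₂,
      hcomp _ _ hJ₁, (hcomp _ _ hJ₂).trans hneg⟩, hc _ _ hξ, hc _ _ hη⟩,
    tangentFibreEquiv hg hϖ w.proj e₁, tangentFibreEquiv hg hϖ w.proj e₂, ?_, ?_, ?_, ?_⟩
  · exact (kernelEndMap_apply hg hϖ w e₁).trans (congrArg (tangentFibreEquiv hg hϖ w.proj) he₁)
  · exact (kernelEndMap_apply hg hϖ w e₂).trans
      ((congrArg (tangentFibreEquiv hg hϖ w.proj) he₂).trans (map_neg (tangentFibreEquiv hg hϖ w.proj) _))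
  · exact (dproj_kernelEndMap hg hϖ w ξ).trans
      (congrArg (fun e => ρ (ϖ w.proj) (tangentFibreEquiv hg hϖ w.proj e)) hξe)
  · exact (dproj_kernelEndMap hg hϖ w η).trans
      (congrArg (fun e => ρ (ϖ w.proj) (tangentFibreEquiv hg hϖ w.proj e)) hηe)

end TwistorMap

end CoCR

end

noncomputable section

set_option synthInstance.maxHeartbeats 200000
set_option linter.unusedSectionVars false

namespace CoCR
-- The rank of a quaternionic vector bundle.
section Rank

variable {B : Type*} [NormedAddCommGroup B] [NormedSpace ℝ B] [FiniteDimensional ℝ B]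
  {M : Type*} [TopologicalSpace M] [T2Space M] [ChartedSpace B M] [IsManifold 𝓘(ℝ, B) ∞ M]
  {F : Type*} [NormedAddCommGroup F] [NormedSpace ℝ F] [FiniteDimensional ℝ F]
  {E : M → Type*} [TopologicalSpace (TotalSpace F E)]
  [∀ x, AddCommGroup (E x)] [∀ x, Module ℝ (E x)] [∀ x, TopologicalSpace (E x)]
  [∀ x, IsTopologicalAddGroup (E x)] [∀ x, ContinuousSMul ℝ (E x)]
  [FiberBundle F E] [VectorBundle ℝ F E] [ContMDiffVectorBundle ∞ F E 𝓘(ℝ, B)]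

lemma QuaternionicStructure.finrank_eq {k : ℕ} (Q : QuaternionicStructure B F E k) (x₀ : M) :
    Module.finrank ℝ F = 4 * k := by
  obtain ⟨U, -, -, u, -⟩ := Q.exists_local x₀
  have e : HVec k ≃L[ℝ] F := (u x₀).trans ((trivializationAt F E x₀).continuousLinearEquivAt ℝ x₀
    (mem_coordDomain (B := B) (F := F) (E := E) x₀).2)
  rw [← e.toLinearEquiv.finrank_eq, Module.finrank_pi_fintype]
  simp [Quaternion.finrank_eq_four, mul_comm]

end Rank

end CoCR

end

theorem proposition2p4
    {B : Type*} [NormedAddCommGroup B] [NormedSpace ℝ B] [FiniteDimensional ℝ B]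
    {M : Type*} [TopologicalSpace M] [T2Space M] [ChartedSpace B M] [IsManifold 𝓘(ℝ, B) ∞ M]
    {F : Type*} [NormedAddCommGroup F] [NormedSpace ℝ F] [FiniteDimensional ℝ F]
    {E : M → Type*} [TopologicalSpace (TotalSpace F E)]
    [∀ x, AddCommGroup (E x)] [∀ x, Module ℝ (E x)] [∀ x, TopologicalSpace (E x)]
    [∀ x, IsTopologicalAddGroup (E x)] [∀ x, ContinuousSMul ℝ (E x)]
    [FiberBundle F E] [VectorBundle ℝ F E] [ContMDiffVectorBundle ∞ F E 𝓘(ℝ, B)]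
    {k : ℕ} (Q : CoCR.QuaternionicStructure B F E k)
    (ρ : ∀ x : M, E x →L[ℝ] TangentSpace 𝓘(ℝ, B) x)
    (hρ : Q.IsAlmostCoCR ρ)
    (hrank : 4 < Module.finrank ℝ F)
    (nabla : CovariantDerivative 𝓘(ℝ, B) F E)
    (hsmooth : CovariantDerivative.ContMDiffCovariantDerivative nabla ∞)
    (hcompatible : Q.IsCompatible nabla)
    (hbianchi : CoCR.SatisfiesFirstBianchi ρ nabla)
    (x₀ : M) :
    ∃ U : Set M, IsOpen U ∧ x₀ ∈ U ∧
      -- the structure of embedded submanifold on `ker ρ` over `U`, of dimension `dim F = 4k`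
      ∃ (_ : ChartedSpace F (CoCR.kerOver (F := F) ρ U))
        (_ : IsManifold 𝓘(ℝ, F) ∞ (CoCR.kerOver (F := F) ρ U)),
        Manifold.IsSmoothEmbedding 𝓘(ℝ, F) (𝓘(ℝ, B).prod 𝓘(ℝ, F)) ∞
          (Subtype.val : CoCR.kerOver (F := F) ρ U → TotalSpace F E) ∧
        -- the quaternionic structure on `ker ρ` over `U`
        ∃ (Q' : CoCR.AlmostQuaternionicStructure F (CoCR.kerOver (F := F) ρ U) k)
          (D : CovariantDerivative 𝓘(ℝ, F) F
            (fun p : CoCR.kerOver (F := F) ρ U => TangentSpace 𝓘(ℝ, F) p)),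
          CoCR.IsQuaternionic Q' D ∧
          CoCR.IsTwistorial Q' (CoCR.idTangent F (CoCR.kerOver (F := F) ρ U)) D Q ρ nabla
            (fun p : CoCR.kerOver (F := F) ρ U => p.1.proj) := by

  -- The rank is `4k`, so rank greater than four leaves room for a second quaternionic coordinate.
  have hk : 2 ≤ k := by
    have := Q.finrank_eq x₀
    omega
  obtain ⟨U₁, hU₁, hxU₁, u, hu, huQ⟩ := Q.exists_local x₀
  -- Here both the coordinates around `x₀` and a local admissible frame are available; the closed
  -- frame is sought inside its image.
  set U₂ := U₁ ∩ CoCR.coordDomain B F E x₀ with hU₂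
  have hU₂o : IsOpen U₂ := hU₁.inter (CoCR.isOpen_coordDomain x₀)
  have hx₀ := CoCR.mem_coordDomain (B := B) (F := F) (E := E) x₀
  have hb₀ : extChartAt 𝓘(ℝ, B) x₀ x₀ ∈ CoCR.chartImage x₀ U₂ :=
    CoCR.extChartAt_mem_chartImage hx₀.1 ⟨hxU₁, hx₀⟩
  have hU₂d : CoCR.chartImage (B := B) x₀ U₂ ⊆ CoCR.chartImage x₀ (CoCR.coordDomain B F E x₀) :=
    fun b hb => ⟨hb.1, hb.2.2⟩
  obtain ⟨O, s, g, hO, hbO, hOsub, hgs, hs, hall⟩ :=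
    ((CoCR.isLocalBianchi_localConn hρ.smooth hρ.surjective hsmooth hbianchi x₀).mono
      hU₂d).exists_closed_frame (CoCR.isOpen_chartImage x₀ hU₂o) hb₀
  set τ := CoCR.localMap (F := F) ρ x₀ (extChartAt 𝓘(ℝ, B) x₀ x₀) with hτ
  have hg : CoCR.IsClosedFrame nabla ρ x₀ O g τ :=
    ⟨hO, hgs, fun b hb => (hall b hb).1, fun b hb => (hall b hb).2.1, fun b hb => (hall b hb).2.2⟩
  set U := (extChartAt 𝓘(ℝ, B) x₀).source ∩ extChartAt 𝓘(ℝ, B) x₀ ⁻¹' O with hU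
  have hUo : IsOpen U :=
    (continuousOn_extChartAt x₀).isOpen_inter_preimage (isOpen_extChartAt_source x₀) hO
  have hUd : ∀ x ∈ U, x ∈ CoCR.coordDomain B F E x₀ := fun x hx => by
    have h1 := (hOsub hx.2).2
    rw [Set.mem_preimage, (extChartAt 𝓘(ℝ, B) x₀).left_inv hx.1] at h1
    exact h1.2
  -- In the chart adapted to the closed frame, `ρ` is the constant map `τ` on the fibres, so `ker ρ`
  -- over `U` is cut out by `τ`.
  have hK : ∀ p : Bundle.TotalSpace F E, p ∈ CoCR.kerOver ρ U ↔
      p ∈ (CoCR.totalChart x₀ hO hgs hg.isUnit).source ∧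
        τ (CoCR.totalChart x₀ hO hgs hg.isUnit p).2 = 0 := by
    intro p
    have key : ∀ hp : p.proj ∈ CoCR.coordDomain B F E x₀, extChartAt 𝓘(ℝ, B) x₀ p.proj ∈ O →
        (ρ p.proj p.2 = 0 ↔ τ (CoCR.totalChart x₀ hO hgs hg.isUnit p).2 = 0) := by
      intro hp hpO
      rw [CoCR.totalChart_apply x₀ hO hgs hg.isUnit hp, ← hg.map_eq _ hpO,
        CoCR.apply_ringInverse_apply (hg.isUnit _ hpO), CoCR.localMap_coordAt ρ hp]
      refine ⟨fun h => by rw [h, map_zero], fun h => ?_⟩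
      rw [← CoCR.vecAt_coordAt (CoCR.mem_baseSet_tangent hp.1) (ρ p.proj p.2), h, map_zero]
    rw [CoCR.mem_totalChart_source]
    refine ⟨fun h => ?_, fun h => ?_⟩
    · exact ⟨⟨hUd _ h.1, h.1.2⟩, (key (hUd _ h.1) h.1.2).1 h.2⟩
    · exact ⟨⟨h.1.1.1, h.1.2⟩, (key h.1.1 h.1.2).2 h.2⟩
  have hp₀ : (⟨x₀, 0⟩ : Bundle.TotalSpace F E) ∈ CoCR.kerOver ρ U :=
    ⟨⟨hx₀.1, hbO⟩, map_zero _⟩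
  obtain ⟨cs, im, hemb, hchart, hext, htarget⟩ := CoCR.exists_isSmoothEmbedding_of_kernel
    (CoCR.totalChart x₀ hO hgs hg.isUnit) (CoCR.totalChart_mem_maximalAtlas x₀ hO hgs hg.isUnit) hO
    (CoCR.totalChart_target x₀ hO (hOsub.trans hU₂d) hgs hg.isUnit) hs hK ⟨_, hp₀⟩
  refine ⟨U, hUo, ⟨hx₀.1, hbO⟩, cs, im, hemb, ?_⟩
  have hϖ : CoCR.IsKernelProjection B E x₀ O τ (fun p : CoCR.kerOver (F := F) ρ U => p.1.proj) := by
    refine ⟨hchart, htarget, fun p => hUd _ p.2.1, fun p => p.2.1.2, fun p q => ?_⟩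
    rw [hext, map_add, hs, ((hK q).1 q.2).2, add_zero,
      CoCR.totalChart_apply x₀ hO hgs hg.isUnit (hUd _ q.2.1)]
  exact ⟨CoCR.kernelStructure Q hg hϖ, _,
    CoCR.isQuaternionic_kernelStructure hsmooth hcompatible hk hg hϖ hU₂o Set.inter_subset_right
      hOsub (fun q => (hu q).mono Set.inter_subset_left) (fun x hx => huQ x hx.1) ⟨_, hp₀⟩,
    CoCR.isTwistorial_kernelStructure Q hg hϖ⟩
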